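/- Work with $\infty$-categories in the sense of quasicategories. A quasicategory is stable if it has a zero object, all pullbacks and all pushouts, and a square is a pullback if and only if it is a pushout (a "pullout"). A t-structure on a stable $\infty$-category $\mathcal D$ is a pair of classes of objects $(\mathcal D_{\ge 0},\mathcal D_{<0})$, each closed under equivalence, such that every morphism from an object of $\mathcal D_{\ge0}$ to an object of $\mathcal D_{<0}$ is null-homotopic, $\mathcal D_{\ge 0}[1]\subseteq \mathcal D_{\ge 0}$ and $\mathcal D_{<0}[-1]\subseteq\mathcal D_{<0}$, and every object $X$ sits in a fiber sequence $SX\to X\to RX$ with $SX\in\mathcal D_{\ge0}$, $RX\in\mathcal D_{<0}$. A recollement $\mathcal D^0\rightleftarrows\mathcal D\rightleftarrows\mathcal D^1$ of stable $\infty$-categories consists of functors $i:\mathcal D^0\to\mathcal D$, $q:\mathcal D\to\mathcal D^1$, $i_L,i_R:\mathcal D\to\mathcal D^0$, $q_L,q_R:\mathcal D^1\to\mathcal D$ with adjunctions $i_L\dashv i\dashv i_R$ and $q_L\dashv q\dashv q_R$ such that: the counit $i_Li\to 1$, the unit $1\to i_Ri$, the unit $1\to qq_L$ and the counit $qq_R\to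 1$ are natural isomorphisms; the essential image of $i$ consists exactly of the objects $X$ with $qX\simeq 0$; and $q_Lq\to 1_{\mathcal D}\to ii_L$ and $ii_R\to 1_{\mathcal D}\to q_Rq$ (with arrows the counits and units) are fiber sequences in the $\infty$-category of functors $\mathcal D\to\mathcal D$, i.e. complete to pullout squares with a zero functor in the lower left corner. **Theorem (Gluing Theorem).** Consider a recollement $\mathcal D^0\rightleftarrows\mathcal D\rightleftarrows\mathcal D^1$ of stable $\infty$-categories, and let $\mathfrak t_0,\mathfrak t_1$ be t-structures on $\mathcal D^0,\mathcal D^1$. Then there is a t-structure $\mathfrak t_0\circledast\mathfrak t_1$ on $\mathcal D$ whose classes are $$\mathcal D_{\ge0}=\{X : qX\in\mathcal D^1_{\ge0}\text{ and } i_LX\in\mathcal D^0_{\ge0}\},\qquad \mathcal D_{<0}=\{X : qX\in\mathcal D^1_{<0}\text{ and } i_RX\in\mathcal D^0_{<0}\}.$$ Moreover its truncations are obtained as follows. For $X\in\mathcal D$ choose a fiber sequence $S_1\to qX\xrightarrow{\eta}R_1$ with $S_1\in \mathcal D^1_{\ge0}$, $R_1\in\mathcal D^1_{<0}$; let $\hat\eta:X\to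 q_RR_1$ be the mate of $\eta$ under $q\dashv q_R$, and let $w:W\to X$ be the fiber of $\hat\eta$. Choose a fiber sequence $S_0\to i_LW\xrightarrow{\theta}R_0$ with $S_0\in\mathcal D^0_{\ge0}$, $R_0\in\mathcal D^0_{<0}$; let $\hat\theta:W\to iR_0$ be the mate of $\theta$ under $i_L\dashv i$, let $s:S\to W$ be the fiber of $\hat\theta$, and let $\rho:X\to R$ be the pushout of $\hat\theta$ along $w$, so that there is a pushout square $$\begin{array}{ccc}W&\xrightarrow{\ w\ }&X\\ {\scriptstyle\hat\theta}\downarrow&&\downarrow{\scriptstyle\rho}\\ iR_0&\longrightarrow&R.\end{array}$$ Such data exist for every $X$, and for every choice of them $S\in\mathcal D_{\ge0}$, $R\in\mathcal D_{<0}$, and $S\xrightarrow{w\circ s}X\xrightarrow{\rho}R$ is a fiber sequence. -/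

import Mathlib

open CategoryTheory MonoidalCategory CartesianMonoidalCategory Simplicial Opposite SSet

universe u

noncomputable section

/-! Infinity-categories are quasicategories; a functor is a map of simplicial sets `F : C ⟶ D`;
objects are vertices `X : C _⦋0⦌`, morphisms are edges `f : SSet.Edge X Y`. A 2-simplex
`SSet.Edge.CompStruct f g h` exhibits `h` as a composite "`f`, then `g`", and
`SSet.Edge.InvStruct f` exhibits an inverse up to homotopy, so that `f` is an equivalence. -/

namespace InftyCat

/-! ### Terminal, initial and zero objects -/

lemma vertex_mem_boundary (n : ℕ) (i : Fin (n + 2)) :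
    stdSimplex.obj₀Equiv.{u}.symm i ∈ (∂Δ[n + 1] : (Δ[n + 1] : SSet.{u}).Subcomplex).obj (op ⦋0⦌) := by
  intro h
  have h2 := Fintype.card_le_of_surjective _ h
  simp at h2

/-- The vertex `i` of the boundary of the `(n + 1)`-simplex. -/
def bdVertex (n : ℕ) (i : Fin (n + 2)) : (∂Δ[n + 1] : SSet.{u}) _⦋0⦌ :=
  ⟨stdSimplex.obj₀Equiv.symm i, vertex_mem_boundary n i⟩

/-- `x` is terminal: every sphere in `D` whose last vertex is `x` can be filled. -/
def IsTerminal {D : SSet.{u}} (x : D _⦋0⦌) : Prop :=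
  ∀ (n : ℕ) (u : (∂Δ[n + 1] : SSet.{u}) ⟶ D), u.app _ (bdVertex n (Fin.last (n + 1))) = x →
    ∃ v : Δ[n + 1] ⟶ D, (∂Δ[n + 1]).ι ≫ v = u

/-- `x` is initial: every sphere in `D` whose first vertex is `x` can be filled. -/
def IsInitial {D : SSet.{u}} (x : D _⦋0⦌) : Prop :=
  ∀ (n : ℕ) (u : (∂Δ[n + 1] : SSet.{u}) ⟶ D), u.app _ (bdVertex n 0) = x →
    ∃ v : Δ[n + 1] ⟶ D, (∂Δ[n + 1]).ι ≫ v = u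

/-- `x` is a zero object: both initial and terminal. -/
def IsZero {D : SSet.{u}} (x : D _⦋0⦌) : Prop := IsInitial x ∧ IsTerminal x

/-! ### Commutative squares, pullbacks and pushouts -/

/-- The shape of a (homotopy coherent) commutative square. -/
abbrev Sq : SSet.{u} := Δ[1] ⊗ Δ[1]

/-- The sub-shape `(1,0) ⟶ (1,1) ⟵ (0,1)` of the square. -/
def cospan : Sq.{u}.Subcomplex :=
  (stdSimplex.face {1}).unionProd (stdSimplex.face {1})

/-- The sub-shape `(1,0) ⟵ (0,0) ⟶ (0,1)` of the square. -/
def span : Sq.{u}.Subcomplex :=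
  (stdSimplex.face {0}).unionProd (stdSimplex.face {0})

/-- The inclusion `A ≅ A × {x} ⟶ A × K`. -/
def atVertex (A : SSet.{u}) {K : SSet.{u}} (x : K _⦋0⦌) : A ⟶ A ⊗ K :=
  lift (𝟙 A) (SSet.const x)

/-- The square `σ` is a pullback, i.e. it is the right Kan extension of its restriction to the
cospan, i.e. for every square `τ` the restriction map
`Map(τ, σ) ⟶ Map(τ|cospan, σ|cospan)` of mapping spaces in `Fun(Sq, D)` and `Fun(cospan, D)` is a
homotopy equivalence (for `τ` constant at `X` this says `Map(X, σ(0,0)) ≃ Map(X, σ|cospan)`).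
It is spelled out by saying that `σ` is terminal relative to the restriction functor
`Fun(Sq, D) ⟶ Fun(cospan, D)`: a sphere in `Fun(Sq, D)` with last vertex `σ` together
with a filler of its image in `Fun(cospan, D)` has a filler lying over the given one. -/
def IsPullback {D : SSet.{u}} (σ : Sq.{u} ⟶ D) : Prop :=
  ∀ (n : ℕ) (u : Sq.{u} ⊗ (∂Δ[n + 1] : SSet.{u}) ⟶ D) (v : (cospan.{u} : SSet.{u}) ⊗ Δ[n + 1] ⟶ D),
    cospan.ι ▷ (∂Δ[n + 1] : SSet.{u}) ≫ u = (cospan.{u} : SSet.{u}) ◁ (∂Δ[n + 1]).ι ≫ v →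
    atVertex Sq (bdVertex n (Fin.last (n + 1))) ≫ u = σ →
    ∃ w : Sq.{u} ⊗ Δ[n + 1] ⟶ D, Sq ◁ (∂Δ[n + 1]).ι ≫ w = u ∧ cospan.ι ▷ Δ[n + 1] ≫ w = v

/-- The square `σ` is a pushout, i.e. it is the left Kan extension of its restriction to the span;
this is the dual of `IsPullback`. -/
def IsPushout {D : SSet.{u}} (σ : Sq.{u} ⟶ D) : Prop :=
  ∀ (n : ℕ) (u : Sq.{u} ⊗ (∂Δ[n + 1] : SSet.{u}) ⟶ D) (v : (span.{u} : SSet.{u}) ⊗ Δ[n + 1] ⟶ D),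
    span.ι ▷ (∂Δ[n + 1] : SSet.{u}) ≫ u = (span.{u} : SSet.{u}) ◁ (∂Δ[n + 1]).ι ≫ v →
    atVertex Sq (bdVertex n 0) ≫ u = σ →
    ∃ w : Sq.{u} ⊗ Δ[n + 1] ⟶ D, Sq ◁ (∂Δ[n + 1]).ι ≫ w = u ∧ span.ι ▷ Δ[n + 1] ≫ w = v

/-- The object at the corner `(a, b)` of a square. -/
def corner {D : SSet.{u}} (σ : Sq.{u} ⟶ D) (a b : Fin 2) : D _⦋0⦌ :=
  σ.app (op ⦋0⦌) (stdSimplex.obj₀Equiv.symm a, stdSimplex.obj₀Equiv.symm b)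

/-- The edge `(0, b) ⟶ (1, b)` of a square (`b = 0`: top, `b = 1`: bottom). -/
def horizontal {D : SSet.{u}} (σ : Sq.{u} ⟶ D) (b : Fin 2) : D _⦋1⦌ :=
  σ.app (op ⦋1⦌) (stdSimplex.edge 1 0 1 (by decide), stdSimplex.const 1 b _)

/-- The edge `(a, 0) ⟶ (a, 1)` of a square (`a = 0`: left, `a = 1`: right). -/
def vertical {D : SSet.{u}} (σ : Sq.{u} ⟶ D) (a : Fin 2) : D _⦋1⦌ :=
  σ.app (op ⦋1⦌) (stdSimplex.const 1 a _, stdSimplex.edge 1 0 1 (by decide))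

/-- A quasicategory is stable: it has a zero object, all pullbacks and all pushouts, and
pullback squares and pushout squares coincide. -/
structure IsStable (D : SSet.{u}) : Prop where
  exists_zero : ∃ z : D _⦋0⦌, IsZero z
  exists_pullback : ∀ c : (cospan.{u} : SSet.{u}) ⟶ D, ∃ σ : Sq ⟶ D, cospan.ι ≫ σ = c ∧ IsPullback σ
  exists_pushout : ∀ c : (span.{u} : SSet.{u}) ⟶ D, ∃ σ : Sq ⟶ D, span.ι ≫ σ = c ∧ IsPushout σ
  pullback_iff_pushout : ∀ σ : Sq ⟶ D, IsPullback σ ↔ IsPushout σ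

/-- The composable pair `f`, `g` is a fiber sequence: there is a pullback square
with top edge `f`, right edge `g`, and a zero object as lower left corner. -/
def IsFiberSeq {D : SSet.{u}} {A B C : D _⦋0⦌} (f : Edge A B) (g : Edge B C) : Prop :=
  ∃ σ : Sq ⟶ D, IsPullback σ ∧ IsZero (corner σ 0 1) ∧
    horizontal σ 0 = f.edge ∧ vertical σ 1 = g.edge

/-- `Y` is a suspension `X[1]` of `X` (and, in the stable case, `X` is a loop object `Y[-1]` of
`Y`): there is a pushout square with corners `X`, `0`, `0`, `Y`. -/
def IsSuspension {D : SSet.{u}} (X Y : D _⦋0⦌) : Prop :=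
  ∃ σ : Sq ⟶ D, IsPushout σ ∧ IsZero (corner σ 1 0) ∧ IsZero (corner σ 0 1) ∧
    corner σ 0 0 = X ∧ corner σ 1 1 = Y

/-- Two objects are equivalent. -/
def Equivalent {D : SSet.{u}} (X Y : D _⦋0⦌) : Prop :=
  ∃ e : Edge X Y, Nonempty e.InvStruct

/-! ### t-structures -/

/-- A t-structure on a stable quasicategory, given by the classes of objects of the two full
subcategories `D_{≥ 0}` and `D_{< 0}`. -/
structure TStructure (D : SSet.{u}) where
  /-- the aisle `D_{≥ 0}` -/
  ge : D _⦋0⦌ → Prop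
  /-- the coaisle `D_{< 0}` -/
  lt : D _⦋0⦌ → Prop
  ge_of_equivalent : ∀ X Y, Equivalent X Y → ge X → ge Y
  lt_of_equivalent : ∀ X Y, Equivalent X Y → lt X → lt Y
  /-- `π₀ Map(X, Y)` is trivial: any two morphisms from `D_{≥ 0}` to `D_{< 0}` are homotopic
  (hence homotopic to zero) -/
  orthogonal : ∀ X Y, ge X → lt Y → ∀ f g : Edge X Y, Nonempty (Edge.CompStruct f (Edge.id Y) g)
  /-- `D_{≥ 0}[1] ⊆ D_{≥ 0}` -/
  ge_shift : ∀ X Y, IsSuspension X Y → ge X → ge Y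
  /-- `D_{< 0}[-1] ⊆ D_{< 0}` -/
  lt_shift : ∀ X Y, IsSuspension X Y → lt Y → lt X
  /-- every object sits in a fiber sequence `X_{≥ 0} ⟶ X ⟶ X_{< 0}` -/
  exists_fiberSeq : ∀ X, ∃ (A B : D _⦋0⦌) (f : Edge A X) (g : Edge X B),
    ge A ∧ lt B ∧ IsFiberSeq f g

/-! ### Natural transformations and adjunctions -/

variable {A B C : SSet.{u}}

/-- The value of a functor on an object. -/
abbrev obj (F : A ⟶ B) (X : A _⦋0⦌) : B _⦋0⦌ := F.app (op ⦋0⦌) X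

/-- A natural transformation `F ⟶ G`, i.e. an edge of `Fun(A, B)` from `F` to `G`. -/
structure Trans (F G : A ⟶ B) where
  /-- the underlying map `A × Δ[1] ⟶ B` -/
  hom : A ⊗ Δ[1] ⟶ B
  source : ι₀ ≫ hom = F
  target : ι₁ ≫ hom = G

namespace Trans

/-- The identity transformation. -/
def id (F : A ⟶ B) : Trans F F where
  hom := fst A Δ[1] ≫ F
  source := rfl
  target := rfl

/-- The transformation `α` followed by the functor `K`. -/
def whiskerRight {F G : A ⟶ B} (α : Trans F G) (K : B ⟶ C) : Trans (F ≫ K) (G ≫ K) where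
  hom := α.hom ≫ K
  source := by rw [← Category.assoc, α.source]
  target := by rw [← Category.assoc, α.target]

/-- The transformation `α` preceded by the functor `K`. -/
def whiskerLeft (K : A ⟶ B) {F G : B ⟶ C} (α : Trans F G) : Trans (K ≫ F) (K ≫ G) where
  hom := K ▷ Δ[1] ≫ α.hom
  source := by rw [← Category.assoc, ι₀_comp, Category.assoc, α.source]
  target := by rw [← Category.assoc, ι₁_comp, Category.assoc, α.target]

/-- `γ` is a composite "`α`, then `β`": there is a 2-simplex of `Fun(A, B)`
with these faces. -/
def IsComp {F G H : A ⟶ B} (α : Trans F G) (β : Trans G H) (γ : Trans F H) : Prop :=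
  ∃ t : A ⊗ Δ[2] ⟶ B, A ◁ stdSimplex.δ 2 ≫ t = α.hom ∧ A ◁ stdSimplex.δ 0 ≫ t = β.hom ∧
    A ◁ stdSimplex.δ 1 ≫ t = γ.hom

/-- `α` is a natural isomorphism, i.e. an equivalence in `Fun(A, B)`. -/
def IsIso {F G : A ⟶ B} (α : Trans F G) : Prop :=
  ∃ β : Trans G F, IsComp α β (id F) ∧ IsComp β α (id G)

/-- The component at the object `X`. -/
def app {F G : A ⟶ B} (α : Trans F G) (X : A _⦋0⦌) : Edge (obj F X) (obj G X) :=
  Edge.mk (α.hom.app (op ⦋1⦌) (A.σ 0 X, stdSimplex.edge 1 0 1 (by decide)))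
    (by
      obtain ⟨h, rfl, rfl⟩ := α
      refine (SSet.δ_naturality_apply h _ _).symm.trans ?_
      refine congrArg (h.app (op ⦋0⦌)) (Prod.ext ?_ ?_)
      · exact ConcreteCategory.congr_hom (A.δ_comp_σ_succ (i := (0 : Fin 1))) X
      · ext i; fin_cases i; rfl)
    (by
      obtain ⟨h, rfl, rfl⟩ := α
      refine (SSet.δ_naturality_apply h _ _).symm.trans ?_
      refine congrArg (h.app (op ⦋0⦌)) (Prod.ext ?_ ?_)
      · exact ConcreteCategory.congr_hom (A.δ_comp_σ_self (i := (0 : Fin 1))) X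
      · ext i; fin_cases i; rfl)

/-- The transformation `α` regarded as an edge of the simplicial set `Fun(A, B)`. -/
def toEdge {F G : A ⟶ B} (α : Trans F G) : ((ihom A).obj B) _⦋1⦌ :=
  yonedaEquiv (MonoidalClosed.curry α.hom)

end Trans

/-- An adjunction `F ⊣ G`: unit and counit satisfying the two triangle identities
up to homotopy. -/
structure Adj (F : A ⟶ B) (G : B ⟶ A) where
  unit : Trans (𝟙 A) (F ≫ G)
  counit : Trans (G ≫ F) (𝟙 B)
  left_triangle : Trans.IsComp (unit.whiskerRight F) (Trans.whiskerLeft F counit) (Trans.id F)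
  right_triangle : Trans.IsComp (Trans.whiskerLeft G unit) (counit.whiskerRight G) (Trans.id G)

/-- There is a square in `Fun(A, A)` which is both a pullback and a pushout, whose top edge is
`α : F ⟶ 1`, whose right edge is `β : 1 ⟶ G`, and whose lower left corner is a zero functor. -/
def IsPulloutOfFunctors {F G : A ⟶ A} (α : Trans F (𝟙 A)) (β : Trans (𝟙 A) G) : Prop :=
  ∃ σ : Sq ⟶ (ihom A).obj A, IsPullback σ ∧ IsPushout σ ∧ IsZero (corner σ 0 1) ∧
    horizontal σ 0 = α.toEdge ∧ vertical σ 1 = β.toEdge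

/-! ### Recollements and gluing -/

/-- A recollement `D₀ ⇄ D ⇄ D₁`. -/
structure Recollement (D₀ D D₁ : SSet.{u}) where
  i : D₀ ⟶ D
  iL : D ⟶ D₀
  iR : D ⟶ D₀
  q : D ⟶ D₁
  qL : D₁ ⟶ D
  qR : D₁ ⟶ D
  /-- `i_L ⊣ i` -/
  adj_iL : Adj iL i
  /-- `i ⊣ i_R` -/
  adj_iR : Adj i iR
  /-- `q_L ⊣ q` -/
  adj_qL : Adj qL q
  /-- `q ⊣ q_R` -/
  adj_qR : Adj q qR
  /-- `i_L i ⟶ 1` is an isomorphism -/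
  iL_counit : adj_iL.counit.IsIso
  /-- `1 ⟶ i_R i` is an isomorphism -/
  iR_unit : adj_iR.unit.IsIso
  /-- `1 ⟶ q q_L` is an isomorphism -/
  qL_unit : adj_qL.unit.IsIso
  /-- `q q_R ⟶ 1` is an isomorphism -/
  qR_counit : adj_qR.counit.IsIso
  /-- the essential image of `i` is the kernel of `q` -/
  image_eq_kernel : ∀ X : D _⦋0⦌, (∃ Y : D₀ _⦋0⦌, Equivalent (obj i Y) X) ↔ IsZero (obj q X)
  /-- `q_L q ⟶ 1 ⟶ i i_L` is a fiber sequence of functors -/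
  pullout_L : IsPulloutOfFunctors adj_qL.counit adj_iL.unit
  /-- `i i_R ⟶ 1 ⟶ q_R q` is a fiber sequence of functors -/
  pullout_R : IsPulloutOfFunctors adj_iR.counit adj_qR.unit

/-- The diagram of iterated fibers and pushouts that produces the truncations of `X`:
```
  S  →  W  →  X
  ↓     ↓     ↓
  0  → i R₀ → R
```
with top edges `s`, `w`, middle and right vertical edges `θ'`, `ρ`,
where `w` is the fiber of the mate `η' : X ⟶ q_R R₁` of the truncation `η : q X ⟶ R₁`,
`s` is the fiber of the mate `θ' : W ⟶ i R₀` of the truncation `θ : i_L W ⟶ R₀`, and the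
right-hand square is a pushout. -/
structure GluingDiagram {D₀ D D₁ : SSet.{u}} (r : Recollement D₀ D D₁)
    (t₀ : TStructure D₀) (t₁ : TStructure D₁) (X : D _⦋0⦌) where
  (S₁ R₁ : D₁ _⦋0⦌)
  ε : Edge S₁ (obj r.q X)
  η : Edge (obj r.q X) R₁
  ge_S₁ : t₁.ge S₁
  lt_R₁ : t₁.lt R₁
  fiberSeq₁ : IsFiberSeq ε η
  η' : Edge X (obj r.qR R₁)
  η'_mate : Nonempty (Edge.CompStruct (r.adj_qR.unit.app X) (η.map r.qR) η')
  W : D _⦋0⦌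
  w : Edge W X
  fiberSeq_W : IsFiberSeq w η'
  (S₀ R₀ : D₀ _⦋0⦌)
  σ : Edge S₀ (obj r.iL W)
  θ : Edge (obj r.iL W) R₀
  ge_S₀ : t₀.ge S₀
  lt_R₀ : t₀.lt R₀
  fiberSeq₀ : IsFiberSeq σ θ
  θ' : Edge W (obj r.i R₀)
  θ'_mate : Nonempty (Edge.CompStruct (r.adj_iL.unit.app W) (θ.map r.i) θ')
  S : D _⦋0⦌
  s : Edge S W
  fiberSeq_S : IsFiberSeq s θ'
  R : D _⦋0⦌
  ρ : Edge X R
  square : Sq ⟶ D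
  isPushout : IsPushout square
  square_top : horizontal square 0 = w.edge
  square_left : vertical square 0 = θ'.edge
  square_right : vertical square 1 = ρ.edge

end InftyCat

end

set_option linter.unusedSectionVars false

noncomputable section

namespace InftyCat

/-! ### Gluing and relative extension of maps of simplicial sets -/

/-! The theorem itself is the gluing argument for perverse t-structures. Applying `q` to the fiber
sequence W → X → q_R R₁ and using q q_R ≅ 1 gives qW ≅ S₁; applying `i_L` to S → W → i R₀ and using
i_L i ≅ 1 gives i_L S ≅ S₀; and qS ≅ qW because q i = 0. Hence S is in the aisle
(`GluingDiagram.ge_S`). Since i_R q_R = 0, the map i_R W → i_R X is invertible, so its pushout i_R i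
R₀ → i_R R is too, and i_R R ≅ R₀; and qR is the cofiber of qW → qX, which is q q_R R₁ ≅ R₁. Hence R
is in the coaisle (`GluingDiagram.lt_R`). The sequence S → X → R comes from pasting two pullout
squares.

For orthogonality let C be the cofiber of the counit q_L q X → X. It is killed by `q`, so C ≅ i Y',
and i_L q_L = 0 gives Y' ≅ i_L X. If X is in the aisle and Y in the coaisle, maps q_L q X → Y are
maps qX → qY, hence trivial, so every map X → Y factors through C; and maps C → Y are maps Y' → i_R
Y, hence trivial (`Recollement.subsingleton_hom`). Stability under shifts holds because `q`, `i_L`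
and `i_R` preserve pushouts and zero objects.

These arguments take place in homotopy categories, whereas pullbacks and pushouts are defined by
coherent lifting conditions. Three facts connect the two levels. Spheres of dimension 0 and 1 turn
the lifting condition into a bijection on homotopy classes of maps of diagrams (`HInitial`,
`HTerminal`). The lifting condition is invariant under isomorphism of diagrams
(`IsLeftKan.of_isIso`). Therefore, when a pushout exists, a square with the weaker property is
isomorphic to it and is itself a pushout (`IsStable.isPushout_of_hInitial`). The weaker property is
transported by transposition along an adjunction, so left adjoints preserve pushouts; right adjoints
do so through pullbacks and stability.

Invariance under isomorphism rests on Joyal's theorem: an outer horn Λ[n, 0] with n ≥ 2 whose first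
edge is an equivalence has a filler. It is obtained from right fibrations between slices, and gives
homotopy extension along prisms and the fact that a pointwise equivalence of functors is invertible
(`Trans.isIso_ho`). -/

lemma app_congr {X Y : SSet.{u}} {f g : X ⟶ Y} (h : f = g) {U} (x : X.obj U) :
    f.app U x = g.app U x := by rw [h]

theorem exists_glue {ι : Type*} {Y : ι → SSet.{u}} {X E : SSet.{u}} (a : ∀ i, Y i ⟶ X)
    (f : ∀ i, Y i ⟶ E) (hs : ∀ U (x : X.obj U), ∃ i y, (a i).app U y = x)
    (hc : ∀ U i j y y', (a i).app U y = (a j).app U y' → (f i).app U y = (f j).app U y') :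
    ∃ g : X ⟶ E, ∀ i, a i ≫ g = f i := by
  choose I y hy using hs
  have key : ∀ U i (z : (Y i).obj U), (f (I U ((a i).app U z))).app U (y U ((a i).app U z)) =
      (f i).app U z := fun U i z => hc _ _ _ _ _ (hy _ _)
  refine ⟨{ app := fun U => ↾fun x => (f (I U x)).app U (y U x), naturality := ?_ }, ?_⟩
  · intro U V φ
    ext x
    have h1 : E.map φ ((f (I U x)).app U (y U x)) =
        (f (I U x)).app V ((Y (I U x)).map φ (y U x)) := by simp
    change (f (I V (X.map φ x))).app V (y V (X.map φ x)) = E.map φ ((f (I U x)).app U (y U x))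
    rw [h1]
    apply hc
    rw [hy, NatTrans.naturality_apply, hy]
  · intro i
    ext U z
    exact key U i z

/-- The pairs (l, e) that satisfy R and agree with u wherever an operator carries l into K form a
subcomplex of L × E. The filling hypothesis makes its projection to L lift against boundary
inclusions, hence against all monomorphisms, and a lift against ∅ → L is a section. This takes the
place of an induction over skeleta. -/
theorem exists_extension_of_relation {K L E : SSet.{u}} (i : K ⟶ L) [Mono i]
    (R : ∀ U, L.obj U → E.obj U → Prop)
    (hR : ∀ U V (φ : U ⟶ V) l e, R U l e → R V (L.map φ l) (E.map φ e))
    (u : K ⟶ E) (hu : ∀ U k, R U (i.app U k) (u.app U k))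
    (fill : ∀ (n : ℕ) (l : L _⦋n⦌), l ∉ Set.range (i.app (op ⦋n⦌)) → ∀ t : (∂Δ[n] : SSet.{u}) ⟶ E,
      (∀ U (s : (∂Δ[n] : SSet.{u}).obj U), R U ((yonedaEquiv.symm l).app U s.1) (t.app U s)) →
      (∀ U (s : (∂Δ[n] : SSet.{u}).obj U) k, i.app U k = (yonedaEquiv.symm l).app U s.1 →
        t.app U s = u.app U k) →
      ∃ e : E _⦋n⦌, R _ l e ∧ ∂Δ[n].ι ≫ yonedaEquiv.symm e = t) :
    ∃ w : L ⟶ E, i ≫ w = u ∧ ∀ U l, R U l (w.app U l) := by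
  have inj : ∀ U, Function.Injective (i.app U) := fun U =>
    (mono_iff_injective (i.app U)).1 inferInstance
  let Z : (L ⊗ E).Subcomplex :=
    { obj := fun U => {p | R U p.1 p.2 ∧
        ∀ V (φ : U ⟶ V) (k : K.obj V), i.app V k = L.map φ p.1 → E.map φ p.2 = u.app V k}
      map := by
        rintro U V φ ⟨l, e⟩ ⟨h1, h2⟩
        refine ⟨hR _ _ _ _ _ h1, fun W ψ k hk => ?_⟩
        change E.map ψ (E.map φ e) = _
        rw [← Functor.map_comp_apply]
        apply h2
        rw [Functor.map_comp_apply]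
        exact hk }
  let π : (Z : SSet.{u}) ⟶ L := Z.ι ≫ fst L E
  have hπ : modelCategoryQuillen.I.rlp π := by
    rintro _ _ _ ⟨n⟩
    refine ⟨fun {t l'} sq => ?_⟩
    obtain ⟨l, rfl⟩ := yonedaEquiv.symm.surjective l'
    have hw : ∀ U (s : (∂Δ[n] : SSet.{u}).obj U),
        (t.app U s).1.1 = (yonedaEquiv.symm l).app U s.1 := fun U s =>
      app_congr sq.w s
    obtain ⟨e, he, het⟩ : ∃ e : E _⦋n⦌, (show (L ⊗ E).obj (op ⦋n⦌) from (l, e)) ∈ Z.obj (op ⦋n⦌) ∧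
        ∂Δ[n].ι ≫ yonedaEquiv.symm e = t ≫ Z.ι ≫ snd L E := by
      by_cases hl : l ∈ Set.range (i.app (op ⦋n⦌))
      · obtain ⟨k, rfl⟩ := hl
        refine ⟨u.app _ k, ⟨hu _ _, fun V φ k' hk' => ?_⟩, ?_⟩
        · have : K.map φ k = k' := inj _ (by
            rw [NatTrans.naturality_apply]; exact hk'.symm)
          rw [← this, NatTrans.naturality_apply]
        · ext U s
          have h2 := (t.app U s).2.2 U (𝟙 U) (K.map (stdSimplex.objEquiv s.1).op k) (by
            rw [Functor.map_id_apply]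
            exact (NatTrans.naturality_apply _ _ _).trans (hw U s).symm)
          simp only [Functor.map_id_apply] at h2
          refine Eq.trans ?_ h2.symm
          exact (NatTrans.naturality_apply u (stdSimplex.objEquiv s.1).op k).symm
      · obtain ⟨e, he, het⟩ := fill n l hl (t ≫ Z.ι ≫ snd L E) (fun U s => by
            have := (t.app U s).2.1
            rw [hw] at this
            exact this) (fun U s k hk => (by
            have := (t.app U s).2.2 U (𝟙 U) k (by
              rw [Functor.map_id_apply, hw]; exact hk)
            simp only [Functor.map_id_apply] at this
            exact this))
        refine ⟨e, ⟨he, fun V φ k hk => ?_⟩, het⟩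
        -- Either φ lies in the boundary, where t already agrees with u, or φ is surjective; in that
        -- case a section of φ would put l itself in K.
        by_cases hφ : stdSimplex.objEquiv.symm φ.unop ∈ (∂Δ[n] : (Δ[n] : SSet.{u}).Subcomplex).obj V
        · have h1 := app_congr het (U := V) ⟨_, hφ⟩
          have h2 := (t.app V ⟨_, hφ⟩).2.2 V (𝟙 V) k (by
            rw [Functor.map_id_apply]
            exact hk.trans (hw V ⟨_, hφ⟩).symm)
          simp only [Functor.map_id_apply] at h2
          exact h1.trans h2
        · exfalso
          apply hl
          have hsurj : Function.Surjective φ.unop.toOrderHom := by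
            by_contra h
            exact hφ h
          have : Epi φ.unop := SimplexCategory.epi_iff_surjective.2 hsurj
          have := isSplitEpi_of_epi φ.unop
          refine ⟨K.map (section_ φ.unop).op k, ?_⟩
          rw [NatTrans.naturality_apply, hk, ← Functor.map_comp_apply]
          have : φ ≫ (section_ φ.unop).op = 𝟙 _ := Quiver.Hom.unop_inj (by simp)
          rw [this, Functor.map_id_apply]
    refine ⟨⟨⟨Subcomplex.lift (SSet.yonedaEquiv.symm (show (L ⊗ E).obj (op ⦋n⦌) from (l, e))) ?_, ?_, ?_⟩⟩⟩
    · rintro U _ ⟨s, rfl⟩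
      exact Z.map (stdSimplex.objEquiv s).op he
    · rw [← cancel_mono Z.ι]
      ext U s
      · exact (hw U s).symm
      · exact app_congr het s
    · ext U s
      rfl
  have hlp : HasLiftingProperty (⊥ : L.Subcomplex).ι π := by
    rw [← rlp_monomorphisms] at hπ
    exact hπ _ (inferInstanceAs (Mono _))
  have sq : CommSq (Subcomplex.isInitialBot.to (Z : SSet.{u})) (⊥ : L.Subcomplex).ι π (𝟙 L) :=
    ⟨Subcomplex.isInitialBot.hom_ext _ _⟩
  have h1 : sq.lift ≫ π = 𝟙 L := sq.fac_right
  have hl : ∀ U l, ((sq.lift ≫ Z.ι).app U l).1 = l := fun U l =>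
    app_congr h1 l
  refine ⟨sq.lift ≫ Z.ι ≫ snd L E, ?_, fun U l => ?_⟩
  · ext U k
    have h2 := (sq.lift.app U (i.app U k)).2.2 U (𝟙 U) k (by
      simp only [Functor.map_id_apply]
      exact (hl U (i.app U k)).symm)
    simp only [Functor.map_id_apply] at h2
    exact h2
  · have h2 := (sq.lift.app U l).2.1
    have h3 := hl U l
    change ((sq.lift.app U l).1).1 = l at h3
    rw [h3] at h2
    exact h2

/-! ### Relatively initial objects -/

/-- The vertex `x` is initial relative to `p`. -/
def RelInitial {E B : SSet.{u}} (p : E ⟶ B) (x : E _⦋0⦌) : Prop :=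
  ∀ (n : ℕ) (u : (∂Δ[n + 1] : SSet.{u}) ⟶ E) (v : Δ[n + 1] ⟶ B), u ≫ p = ∂Δ[n + 1].ι ≫ v →
    u.app _ (bdVertex n 0) = x → ∃ w : Δ[n + 1] ⟶ E, ∂Δ[n + 1].ι ≫ w = u ∧ w ≫ p = v

/-- The vertex `x` is terminal relative to `p`. -/
def RelTerminal {E B : SSet.{u}} (p : E ⟶ B) (x : E _⦋0⦌) : Prop :=
  ∀ (n : ℕ) (u : (∂Δ[n + 1] : SSet.{u}) ⟶ E) (v : Δ[n + 1] ⟶ B), u ≫ p = ∂Δ[n + 1].ι ≫ v →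
    u.app _ (bdVertex n (Fin.last (n + 1))) = x →
    ∃ w : Δ[n + 1] ⟶ E, ∂Δ[n + 1].ι ≫ w = u ∧ w ≫ p = v

/-- The initial vertex of a simplex. -/
def firstVertex {X : SSet.{u}} {n : ℕ} (x : X _⦋n⦌) : X _⦋0⦌ :=
  (SSet.yonedaEquiv.symm x).app _ (stdSimplex.obj₀Equiv.symm 0)

/-- Each simplex outside K has positive dimension and its first vertex in K, so its lifting problem
is a sphere with relatively initial first vertex. The relation carried along is "e lies over v(l)".
-/
theorem exists_lift_of_relInitial {K L E B : SSet.{u}} (i : K ⟶ L) [Mono i] (p : E ⟶ B)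
    (u : K ⟶ E) (v : L ⟶ B) (huv : u ≫ p = i ≫ v)
    (h : ∀ (n : ℕ) (l : L _⦋n⦌), l ∉ Set.range (i.app (op ⦋n⦌)) →
      n ≠ 0 ∧ ∃ k : K _⦋0⦌, i.app _ k = firstVertex l ∧ RelInitial p (u.app _ k)) :
    ∃ w : L ⟶ E, i ≫ w = u ∧ w ≫ p = v := by
  obtain ⟨w, hw1, hw2⟩ := exists_extension_of_relation i
    (fun U l e => p.app U e = v.app U l) (fun U V φ l e hle => by
      rw [NatTrans.naturality_apply, hle, NatTrans.naturality_apply]) u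
    (fun U k => app_congr huv k) (fun n l hl t ht1 ht2 => by
      obtain ⟨hn, k, hk, hk'⟩ := h n l hl
      obtain _ | n := n
      · exact (hn rfl).elim
      · obtain ⟨w, hw1, hw2⟩ := hk' n t (SSet.yonedaEquiv.symm l ≫ v) (by
          ext U s
          exact ht1 U s) (ht2 _ (bdVertex n 0) k hk)
        refine ⟨SSet.yonedaEquiv w, ?_, by simpa using hw1⟩
        have := congrArg SSet.yonedaEquiv hw2
        rw [SSet.yonedaEquiv_comp] at this
        rw [this, SSet.yonedaEquiv_comp]
        simp)
  exact ⟨w, hw1, by ext U l; exact hw2 U l⟩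

/-! ### Mapping simplicial sets -/

/-- The simplicial set of functors. -/
abbrev Fun (A B : SSet.{u}) : SSet.{u} := (ihom A).obj B

/-- Restriction of functors. -/
abbrev Fun.pre {A A' : SSet.{u}} (i : A' ⟶ A) (B : SSet.{u}) : Fun A B ⟶ Fun A' B :=
  (MonoidalClosed.pre i).app B

/-- A functor, as an object of the simplicial set of functors. -/
def asVertex {A B : SSet.{u}} (F : A ⟶ B) : (Fun A B) _⦋0⦌ :=
  SSet.yonedaEquiv (MonoidalClosed.curry (fst A Δ[0] ≫ F))

/-- The functor corresponding to an object of the simplicial set of functors. -/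
def ofVertex {A B : SSet.{u}} (x : (Fun A B) _⦋0⦌) : A ⟶ B :=
  atVertex A (stdSimplex.obj₀Equiv.symm 0) ≫
    MonoidalClosed.uncurry (SSet.yonedaEquiv.symm x)

@[simp]
lemma ofVertex_asVertex {A B : SSet.{u}} (F : A ⟶ B) : ofVertex (asVertex F) = F := by
  simp [ofVertex, asVertex, atVertex]

lemma whiskerLeft_yonedaEquiv_symm (A : SSet.{u}) {K : SSet.{u}} (k : K _⦋0⦌) :
    A ◁ SSet.yonedaEquiv.symm k = fst A Δ[0] ≫ atVertex A k := by
  apply CartesianMonoidalCategory.hom_ext <;> simp [atVertex]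

lemma app_eq_asVertex {A B K : SSet.{u}} (w : K ⟶ Fun A B) (k : K _⦋0⦌) :
    w.app _ k = asVertex (atVertex A k ≫ MonoidalClosed.uncurry w) := by
  rw [asVertex, ← Category.assoc, ← whiskerLeft_yonedaEquiv_symm, ← MonoidalClosed.uncurry_natural_left,
    MonoidalClosed.curry_uncurry, SSet.yonedaEquiv_comp, Equiv.apply_symm_apply]

lemma asVertex_injective {A B : SSet.{u}} {F G : A ⟶ B} (h : asVertex F = asVertex G) : F = G := by
  rw [← ofVertex_asVertex F, h, ofVertex_asVertex]

lemma comp_pre_eq_iff {A A' B K L : SSet.{u}} (i : A' ⟶ A) (j : K ⟶ L) (u : K ⟶ Fun A B)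
    (v : L ⟶ Fun A' B) :
    u ≫ Fun.pre i B = j ≫ v ↔
      i ▷ K ≫ MonoidalClosed.uncurry u = A' ◁ j ≫ MonoidalClosed.uncurry v := by
  rw [← MonoidalClosed.uncurry_injective.eq_iff, MonoidalClosed.uncurry_pre_app,
    MonoidalClosed.uncurry_natural_left]

/-- Currying turns the spheres of the definition into spheres in `Fun Sq D` over simplices of `Fun
span D`, so pushouts become an instance of relative initiality. -/
lemma isPushout_iff {D : SSet.{u}} (σ : Sq ⟶ D) :
    IsPushout σ ↔ RelInitial (Fun.pre span.ι D) (asVertex σ) := by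
  constructor
  · intro h n u v huv hu
    rw [comp_pre_eq_iff] at huv
    rw [app_eq_asVertex] at hu
    obtain ⟨w, hw1, hw2⟩ := h n _ _ huv (asVertex_injective hu)
    refine ⟨MonoidalClosed.curry w, ?_, ?_⟩
    · rw [← MonoidalClosed.curry_natural_left, hw1, MonoidalClosed.curry_uncurry]
    · apply MonoidalClosed.uncurry_injective
      rw [MonoidalClosed.uncurry_pre_app, MonoidalClosed.uncurry_curry]
      exact hw2
  · intro h n u v huv hu
    obtain ⟨w, hw1, hw2⟩ := h n (MonoidalClosed.curry u) (MonoidalClosed.curry v)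
      ((comp_pre_eq_iff _ _ _ _).2 (by simpa using huv))
      (by rw [app_eq_asVertex, MonoidalClosed.uncurry_curry, hu])
    refine ⟨MonoidalClosed.uncurry w, ?_, ?_⟩
    · rw [← MonoidalClosed.uncurry_natural_left, hw1, MonoidalClosed.uncurry_curry]
    · rw [← MonoidalClosed.uncurry_pre_app, hw2, MonoidalClosed.uncurry_curry]

lemma isPullback_iff {D : SSet.{u}} (σ : Sq ⟶ D) :
    IsPullback σ ↔ RelTerminal (Fun.pre cospan.ι D) (asVertex σ) := by
  constructor
  · intro h n u v huv hu
    rw [comp_pre_eq_iff] at huv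
    rw [app_eq_asVertex] at hu
    obtain ⟨w, hw1, hw2⟩ := h n _ _ huv (asVertex_injective hu)
    refine ⟨MonoidalClosed.curry w, ?_, ?_⟩
    · rw [← MonoidalClosed.curry_natural_left, hw1, MonoidalClosed.curry_uncurry]
    · apply MonoidalClosed.uncurry_injective
      rw [MonoidalClosed.uncurry_pre_app, MonoidalClosed.uncurry_curry]
      exact hw2
  · intro h n u v huv hu
    obtain ⟨w, hw1, hw2⟩ := h n (MonoidalClosed.curry u) (MonoidalClosed.curry v)
      ((comp_pre_eq_iff _ _ _ _).2 (by simpa using huv))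
      (by rw [app_eq_asVertex, MonoidalClosed.uncurry_curry, hu])
    refine ⟨MonoidalClosed.uncurry w, ?_, ?_⟩
    · rw [← MonoidalClosed.uncurry_natural_left, hw1, MonoidalClosed.uncurry_curry]
    · rw [← MonoidalClosed.uncurry_pre_app, hw2, MonoidalClosed.uncurry_curry]

/-! ### Joins of simplices and slices -/

/-- The join of two simplices. -/
abbrev jn (a b : SimplexCategory) : SimplexCategory := ⦋a.len + 1 + b.len⦌

abbrev lft {a b : SimplexCategory} (x : Fin (a.len + 1)) : Fin ((jn a b).len + 1) :=
  Fin.castAdd (b.len + 1) x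

abbrev rgt {a b : SimplexCategory} (x : Fin (b.len + 1)) : Fin ((jn a b).len + 1) :=
  Fin.natAdd (a.len + 1) x

lemma jn_cases {a b : SimplexCategory} (x : Fin ((jn a b).len + 1)) :
    (∃ y : Fin (a.len + 1), x = lft (b := b) y) ∨ ∃ y : Fin (b.len + 1), x = rgt (a := a) y :=
  Fin.addCases (m := a.len + 1) (n := b.len + 1)
    (motive := fun x => (∃ y : Fin (a.len + 1), x = lft (b := b) y) ∨
      ∃ y : Fin (b.len + 1), x = rgt (a := a) y)
    (fun y => Or.inl ⟨y, rfl⟩) (fun y => Or.inr ⟨y, rfl⟩) x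

lemma lft_le {a b : SimplexCategory} {x y : Fin (a.len + 1)} :
    lft (b := b) x ≤ lft y ↔ x ≤ y := Iff.rfl

lemma rgt_le {a b : SimplexCategory} {x y : Fin (b.len + 1)} :
    rgt (a := a) x ≤ rgt y ↔ x ≤ y := by
  simp only [rgt, Fin.le_def, Fin.val_natAdd]; omega

lemma lft_lt_rgt {a b : SimplexCategory} (x : Fin (a.len + 1)) (y : Fin (b.len + 1)) :
    lft x < rgt (a := a) y := by
  simp [lft, rgt, Fin.lt_def]; omega

/-- The underlying function of the join of two maps of simplices. -/
def jfun {a a' b b' : SimplexCategory} (φ : a ⟶ a') (ψ : b ⟶ b') (x : Fin ((jn a b).len + 1)) :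
    Fin ((jn a' b').len + 1) :=
  Fin.addCases (m := a.len + 1) (n := b.len + 1)
    (fun y => lft (φ.toOrderHom y)) (fun y => rgt (ψ.toOrderHom y)) x

lemma jfun_lft {a a' b b' : SimplexCategory} (φ : a ⟶ a') (ψ : b ⟶ b')
    (x : Fin (a.len + 1)) : jfun φ ψ (lft x) = lft (φ.toOrderHom x) :=
  Fin.addCases_left (m := a.len + 1) (n := b.len + 1) x

lemma jfun_rgt {a a' b b' : SimplexCategory} (φ : a ⟶ a') (ψ : b ⟶ b')
    (x : Fin (b.len + 1)) : jfun φ ψ (rgt x) = rgt (ψ.toOrderHom x) :=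
  Fin.addCases_right (m := a.len + 1) (n := b.len + 1) x

/-- The join of two maps of simplices. -/
def jmap {a a' b b' : SimplexCategory} (φ : a ⟶ a') (ψ : b ⟶ b') : jn a b ⟶ jn a' b' :=
  SimplexCategory.Hom.mk ⟨jfun φ ψ, by
    intro x y hxy
    obtain ⟨x, rfl⟩ | ⟨x, rfl⟩ := jn_cases x <;> obtain ⟨y, rfl⟩ | ⟨y, rfl⟩ := jn_cases y
    · rw [jfun_lft, jfun_lft]
      exact φ.toOrderHom.monotone hxy
    · rw [jfun_lft, jfun_rgt]
      exact (lft_lt_rgt _ _).le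
    · exact ((lft_lt_rgt _ _).not_ge hxy).elim
    · rw [jfun_rgt, jfun_rgt]
      exact rgt_le.2 (ψ.toOrderHom.monotone (rgt_le.1 hxy))⟩

@[simp] lemma jmap_lft {a a' b b' : SimplexCategory} (φ : a ⟶ a') (ψ : b ⟶ b')
    (x : Fin (a.len + 1)) : (jmap φ ψ).toOrderHom (lft x) = lft (φ.toOrderHom x) :=
  jfun_lft φ ψ x

@[simp] lemma jmap_rgt {a a' b b' : SimplexCategory} (φ : a ⟶ a') (ψ : b ⟶ b')
    (x : Fin (b.len + 1)) : (jmap φ ψ).toOrderHom (rgt x) = rgt (ψ.toOrderHom x) :=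
  jfun_rgt φ ψ x

def jinl (a b : SimplexCategory) : a ⟶ jn a b :=
  SimplexCategory.Hom.mk ⟨fun x => lft x, fun _ _ h => lft_le.2 h⟩

def jinr (a b : SimplexCategory) : b ⟶ jn a b :=
  SimplexCategory.Hom.mk ⟨fun x => rgt x, fun _ _ h => rgt_le.2 h⟩

lemma jn_hom_ext {a b c : SimplexCategory} {f g : jn a b ⟶ c}
    (hl : jinl a b ≫ f = jinl a b ≫ g) (hr : jinr a b ≫ f = jinr a b ≫ g) : f = g := by
  ext x : 3
  obtain ⟨x, rfl⟩ | ⟨x, rfl⟩ := jn_cases x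
  · exact congrArg (fun h => h.toOrderHom x) hl
  · exact congrArg (fun h => h.toOrderHom x) hr

@[simp] lemma jinl_jmap {a a' b b' : SimplexCategory} (φ : a ⟶ a') (ψ : b ⟶ b') :
    jinl a b ≫ jmap φ ψ = φ ≫ jinl a' b' := by
  ext x : 3
  exact jmap_lft φ ψ x

@[simp] lemma jinr_jmap {a a' b b' : SimplexCategory} (φ : a ⟶ a') (ψ : b ⟶ b') :
    jinr a b ≫ jmap φ ψ = ψ ≫ jinr a' b' := by
  ext x : 3
  exact jmap_rgt φ ψ x

@[simp] lemma jmap_id (a b : SimplexCategory) : jmap (𝟙 a) (𝟙 b) = 𝟙 _ := by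
  apply jn_hom_ext <;> simp

lemma jmap_comp {a a' a'' b b' b'' : SimplexCategory} (φ : a ⟶ a') (φ' : a' ⟶ a'')
    (ψ : b ⟶ b') (ψ' : b' ⟶ b'') : jmap (φ ≫ φ') (ψ ≫ ψ') = jmap φ ψ ≫ jmap φ' ψ' := by
  apply jn_hom_ext
  · rw [jinl_jmap, ← Category.assoc, jinl_jmap, Category.assoc, Category.assoc, jinl_jmap]
  · rw [jinr_jmap, ← Category.assoc, jinr_jmap, Category.assoc, Category.assoc, jinr_jmap]

lemma lft_injective {a b : SimplexCategory} : Function.Injective (lft (a := a) (b := b)) :=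
  Fin.castAdd_injective _ _

lemma rgt_injective {a b : SimplexCategory} : Function.Injective (rgt (a := a) (b := b)) :=
  Fin.natAdd_injective _ _

lemma simplex_hom_ext {a b : SimplexCategory} {f g : a ⟶ b}
    (h : ∀ x, f.toOrderHom x = g.toOrderHom x) : f = g := by
  ext x : 3
  exact h x

lemma exists_jmap {a b p q : SimplexCategory} (f : jn p q ⟶ jn a b)
    (hl : ∀ x, ∃ y, f.toOrderHom (lft x) = lft y) (hr : ∀ x, ∃ y, f.toOrderHom (rgt x) = rgt y) :
    ∃ g h, f = jmap g h := by
  choose g hg using hl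
  choose h hh using hr
  refine ⟨SimplexCategory.Hom.mk ⟨g, fun x y hxy => ?_⟩,
    SimplexCategory.Hom.mk ⟨h, fun x y hxy => ?_⟩, simplex_hom_ext fun x => ?_⟩
  · rw [← lft_le (b := b), ← hg, ← hg]
    exact f.toOrderHom.monotone (lft_le.2 hxy)
  · rw [← rgt_le (a := a), ← hh, ← hh]
    exact f.toOrderHom.monotone (rgt_le.2 hxy)
  · obtain ⟨x, rfl⟩ | ⟨x, rfl⟩ := jn_cases x
    · rw [hg, jmap_lft, SimplexCategory.Hom.toOrderHom_mk]; rfl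
    · rw [hh, jmap_rgt, SimplexCategory.Hom.toOrderHom_mk]; rfl

lemma exists_comp_jinl {a b c : SimplexCategory} (f : c ⟶ jn a b)
    (hl : ∀ x, ∃ y, f.toOrderHom x = lft y) : ∃ g, f = g ≫ jinl a b := by
  choose g hg using hl
  refine ⟨SimplexCategory.Hom.mk ⟨g, fun x y hxy => ?_⟩, simplex_hom_ext hg⟩
  rw [← lft_le (b := b), ← hg, ← hg]
  exact f.toOrderHom.monotone hxy

lemma exists_comp_jinr {a b c : SimplexCategory} (f : c ⟶ jn a b)
    (hr : ∀ x, ∃ y, f.toOrderHom x = rgt y) : ∃ g, f = g ≫ jinr a b := by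
  choose g hg using hr
  refine ⟨SimplexCategory.Hom.mk ⟨g, fun x y hxy => ?_⟩, simplex_hom_ext hg⟩
  rw [← rgt_le (a := a), ← hg, ← hg]
  exact f.toOrderHom.monotone hxy

/-- A map to a join lands on the left, on the right, or is a join of two maps. -/
theorem jn_hom_induction {a b : SimplexCategory} {motive : ∀ n : ℕ, (⦋n⦌ ⟶ jn a b) → Prop}
    (hl : ∀ n g, motive n (g ≫ jinl a b)) (hr : ∀ n g, motive n (g ≫ jinr a b))
    (hj : ∀ (p q : ℕ) (g : ⦋p⦌ ⟶ a) (h : ⦋q⦌ ⟶ b), motive (p + 1 + q) (jmap g h)) (n : ℕ)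
    (f : ⦋n⦌ ⟶ jn a b) : motive n f := by
  by_cases h1 : ∀ x, ∃ y, f.toOrderHom x = lft y
  · obtain ⟨g, rfl⟩ := exists_comp_jinl f h1
    exact hl _ _
  push Not at h1
  have hex : ∃ N, ∃ h : N < n + 1, ∃ y, f.toOrderHom ⟨N, h⟩ = rgt y := by
    obtain ⟨x, hx⟩ := h1
    obtain ⟨y, hy⟩ | ⟨y, hy⟩ := jn_cases (f.toOrderHom x)
    · exact (hx y hy).elim
    · exact ⟨x.1, x.2, y, hy⟩
  classical
  obtain ⟨hN, y₀, hy₀⟩ := Nat.find_spec hex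
  have hmin := fun m => Nat.find_min hex (m := m)
  set N := Nat.find hex
  have hright : ∀ x : Fin (n + 1), N ≤ x.1 → ∃ y, f.toOrderHom x = rgt y := fun x hx => by
    obtain ⟨y, hy⟩ | ⟨y, hy⟩ := jn_cases (f.toOrderHom x)
    · have : f.toOrderHom ⟨N, hN⟩ ≤ f.toOrderHom x := f.toOrderHom.monotone hx
      rw [hy, hy₀] at this
      exact ((lft_lt_rgt _ _).not_ge this).elim
    · exact ⟨y, hy⟩
  have hleft : ∀ x : Fin (n + 1), x.1 < N → ∃ y, f.toOrderHom x = lft y := fun x hx => by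
    obtain ⟨y, hy⟩ | ⟨y, hy⟩ := jn_cases (f.toOrderHom x)
    · exact ⟨y, hy⟩
    · exact (hmin _ hx ⟨x.2, y, hy⟩).elim
  clear_value N
  obtain _ | p := N
  · obtain ⟨g, rfl⟩ := exists_comp_jinr f (fun x => hright x (Nat.zero_le _))
    exact hr _ _
  · obtain ⟨q, rfl⟩ : ∃ q, n = p + 1 + q := ⟨n - (p + 1), by omega⟩
    obtain ⟨g, h, hf⟩ := exists_jmap (p := ⦋p⦌) (q := ⦋q⦌) f
      (fun x => hleft _ x.2) (fun x => hright _ (Nat.le_add_right _ _))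
    have := hj p q g h
    rwa [← hf] at this

/-- This and the two factorization lemmas after it say that a simplex of a join factors through a
subjoin only in the evident way. They make a map out of a horn, prescribed piece by piece along the
join, well defined. -/
lemma comp_jmap_eq_jinl {a b a' b' c : SimplexCategory} {φ : a' ⟶ a} {ψ : b' ⟶ b}
    {y : c ⟶ jn a' b'} {g : c ⟶ a} (h : y ≫ jmap φ ψ = g ≫ jinl a b) :
    ∃ y', y = y' ≫ jinl a' b' ∧ y' ≫ φ = g := by
  have h' : ∀ x, (jmap φ ψ).toOrderHom (y.toOrderHom x) = lft (g.toOrderHom x) := fun x =>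
    congrArg (fun f => f.toOrderHom x) h
  obtain ⟨y', rfl⟩ := exists_comp_jinl y (fun x => by
    obtain ⟨z, hz⟩ | ⟨z, hz⟩ := jn_cases (y.toOrderHom x)
    · exact ⟨z, hz⟩
    · have := h' x
      rw [hz, jmap_rgt] at this
      exact ((lft_lt_rgt _ _).ne' this).elim)
  refine ⟨y', rfl, simplex_hom_ext fun x => ?_⟩
  have := h' x
  exact lft_injective ((jmap_lft φ ψ _).symm.trans this)

lemma comp_jmap_eq_jinr {a b a' b' c : SimplexCategory} {φ : a' ⟶ a} {ψ : b' ⟶ b}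
    {y : c ⟶ jn a' b'} {g : c ⟶ b} (h : y ≫ jmap φ ψ = g ≫ jinr a b) :
    ∃ y', y = y' ≫ jinr a' b' ∧ y' ≫ ψ = g := by
  have h' : ∀ x, (jmap φ ψ).toOrderHom (y.toOrderHom x) = rgt (g.toOrderHom x) := fun x =>
    congrArg (fun f => f.toOrderHom x) h
  obtain ⟨y', rfl⟩ := exists_comp_jinr y (fun x => by
    obtain ⟨z, hz⟩ | ⟨z, hz⟩ := jn_cases (y.toOrderHom x)
    · have := h' x
      rw [hz, jmap_lft] at this
      exact ((lft_lt_rgt _ _).ne this).elim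
    · exact ⟨z, hz⟩)
  refine ⟨y', rfl, simplex_hom_ext fun x => ?_⟩
  have := h' x
  exact rgt_injective ((jmap_rgt φ ψ _).symm.trans this)

lemma comp_jmap_eq_jmap {a b a' b' p q : SimplexCategory} {φ : a' ⟶ a} {ψ : b' ⟶ b}
    {y : jn p q ⟶ jn a' b'} {g : p ⟶ a} {h : q ⟶ b} (H : y ≫ jmap φ ψ = jmap g h) :
    ∃ g' h', y = jmap g' h' ∧ g' ≫ φ = g ∧ h' ≫ ψ = h := by
  have hL : ∀ x, (jmap φ ψ).toOrderHom (y.toOrderHom (lft x)) = lft (g.toOrderHom x) := fun x =>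
    (congrArg (fun f => f.toOrderHom (lft x)) H).trans (jmap_lft g h x)
  have hR : ∀ x, (jmap φ ψ).toOrderHom (y.toOrderHom (rgt x)) = rgt (h.toOrderHom x) := fun x =>
    (congrArg (fun f => f.toOrderHom (rgt x)) H).trans (jmap_rgt g h x)
  obtain ⟨g', h', rfl⟩ := exists_jmap y (fun x => by
      obtain ⟨z, hz⟩ | ⟨z, hz⟩ := jn_cases (y.toOrderHom (lft x))
      · exact ⟨z, hz⟩
      · have := hL x
        rw [hz, jmap_rgt] at this
        exact ((lft_lt_rgt _ _).ne' this).elim) (fun x => by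
      obtain ⟨z, hz⟩ | ⟨z, hz⟩ := jn_cases (y.toOrderHom (rgt x))
      · have := hR x
        rw [hz, jmap_lft] at this
        exact ((lft_lt_rgt _ _).ne this).elim
      · exact ⟨z, hz⟩)
  refine ⟨g', h', rfl, simplex_hom_ext fun x => ?_, simplex_hom_ext fun x => ?_⟩
  · have := hL x
    rw [jmap_lft, jmap_lft] at this
    exact lft_injective this
  · have := hR x
    rw [jmap_rgt, jmap_rgt] at this
    exact rgt_injective this

lemma jinl_ne_jinr {a b c : SimplexCategory} (g : c ⟶ a) (h : c ⟶ b) :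
    g ≫ jinl a b ≠ h ≫ jinr a b := fun H =>
  (lft_lt_rgt (g.toOrderHom 0) (h.toOrderHom 0)).ne (congrArg (fun f => f.toOrderHom 0) H)

lemma jmap_ne_jinl {a b p q : SimplexCategory} (g : p ⟶ a) (h : q ⟶ b) (f : jn p q ⟶ a) :
    jmap g h ≠ f ≫ jinl a b := fun H =>
  (lft_lt_rgt (f.toOrderHom (rgt 0)) (h.toOrderHom 0)).ne'
    ((jmap_rgt g h 0).symm.trans (congrArg (fun f => f.toOrderHom (rgt 0)) H))

lemma jmap_ne_jinr {a b p q : SimplexCategory} (g : p ⟶ a) (h : q ⟶ b) (f : jn p q ⟶ b) :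
    jmap g h ≠ f ≫ jinr a b := fun H =>
  (lft_lt_rgt (g.toOrderHom 0) (f.toOrderHom (lft 0))).ne
    ((jmap_lft g h 0).symm.trans (congrArg (fun f => f.toOrderHom (lft 0)) H))

lemma jinl_cancel {a b c : SimplexCategory} {g g' : c ⟶ a} (h : g ≫ jinl a b = g' ≫ jinl a b) :
    g = g' :=
  simplex_hom_ext fun x => lft_injective (congrArg (fun f => f.toOrderHom x) h)

lemma jinr_cancel {a b c : SimplexCategory} {g g' : c ⟶ b} (h : g ≫ jinr a b = g' ≫ jinr a b) :
    g = g' :=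
  simplex_hom_ext fun x => rgt_injective (congrArg (fun f => f.toOrderHom x) h)

lemma mem_horn_iff {n : ℕ} {i : Fin (n + 1)} {a : SimplexCategory} (φ : a ⟶ ⦋n⦌) :
    stdSimplex.objEquiv.symm φ ∈ (Λ[n, i] : (Δ[n] : SSet.{u}).Subcomplex).obj (op a) ↔
      ∃ j, j ≠ i ∧ ∀ x, φ.toOrderHom x ≠ j := by
  induction a using SimplexCategory.rec with | _ d
  rw [mem_horn_iff_notMem_range]
  simp only [exists_prop, Set.mem_range, not_exists]
  rfl

lemma mem_boundary_iff {n : ℕ} {a : SimplexCategory} (φ : a ⟶ ⦋n⦌) :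
    stdSimplex.objEquiv.symm φ ∈ (∂Δ[n] : (Δ[n] : SSet.{u}).Subcomplex).obj (op a) ↔
      ∃ j, ∀ x, φ.toOrderHom x ≠ j := by
  induction a using SimplexCategory.rec with | _ d
  rw [mem_boundary_iff_notMem_range]
  simp only [Set.mem_range, not_exists]
  rfl

lemma map_map {X : SSet.{u}} {a b c : SimplexCategory} (f : a ⟶ b) (g : b ⟶ c)
    (x : X.obj (op c)) : X.map f.op (X.map g.op x) = X.map (f ≫ g).op x := by
  rw [op_comp, Functor.map_comp_apply]

/-- The simplicial set of joins of a simplex of shape `a` with simplices of `D`. -/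
def Dec (a : SimplexCategory) (D : SSet.{u}) : SSet.{u} where
  obj U := D.obj (op (jn a U.unop))
  map φ := D.map (jmap (𝟙 a) φ.unop).op
  map_id U := by
    rw [unop_id, jmap_id]
    exact D.map_id _
  map_comp φ ψ := by
    rw [← D.map_comp, ← op_comp, ← jmap_comp, Category.comp_id, unop_comp]

/-- A simplex of `Dec a D`, as a simplex of `D`. -/
def Dec.val {a : SimplexCategory} {D : SSet.{u}} {b : SimplexCategory}
    (x : (Dec a D).obj (op b)) : D.obj (op (jn a b)) := x

/-- A simplex of `D`, as a simplex of `Dec a D`. -/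
def Dec.mk {a : SimplexCategory} {D : SSet.{u}} {b : SimplexCategory}
    (x : D.obj (op (jn a b))) : (Dec a D).obj (op b) := x

lemma Dec.val_map {a : SimplexCategory} {D : SSet.{u}} {b c : SimplexCategory} (f : b ⟶ c)
    (x : (Dec a D).obj (op c)) :
    Dec.val ((Dec a D).map f.op x) = D.map (jmap (𝟙 a) f).op (Dec.val x) := rfl

/-- Functoriality of `Dec` in the simplex. -/
def Dec.res {a' a : SimplexCategory} (f : a' ⟶ a) (D : SSet.{u}) : Dec a D ⟶ Dec a' D where
  app U := D.map (jmap f (𝟙 U.unop)).op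
  naturality U V φ := by
    change D.map _ ≫ D.map _ = D.map _ ≫ D.map _
    rw [← D.map_comp, ← D.map_comp, ← op_comp, ← op_comp, ← jmap_comp, ← jmap_comp]
    simp

lemma Dec.val_res {a' a : SimplexCategory} (f : a' ⟶ a) (D : SSet.{u}) {b : SimplexCategory}
    (x : (Dec a D).obj (op b)) :
    Dec.val ((Dec.res f D).app (op b) x) = D.map (jmap f (𝟙 b)).op (Dec.val x) := rfl

/-- The simplices of the slice of `D` over the diagram `p`. -/
structure SliceSimplex {L D : SSet.{u}} (p : L ⟶ D) (a : SimplexCategory) where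
  front : D.obj (op a)
  fam : L ⟶ Dec a D
  jinl_fam : ∀ b (l : L.obj (op b)), D.map (jinl a b).op (Dec.val (fam.app (op b) l)) = front
  jinr_fam : ∀ b (l : L.obj (op b)),
    D.map (jinr a b).op (Dec.val (fam.app (op b) l)) = p.app (op b) l

namespace SliceSimplex

variable {L D : SSet.{u}} {p : L ⟶ D}

/-- The components of a simplex of a slice. -/
def val {a b : SimplexCategory} (x : SliceSimplex p a) (l : L.obj (op b)) :
    D.obj (op (jn a b)) := Dec.val (x.fam.app (op b) l)

lemma ext {a : SimplexCategory} {x y : SliceSimplex p a} (h1 : x.front = y.front)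
    (h2 : ∀ b (l : L.obj (op b)), x.val l = y.val l) : x = y := by
  obtain ⟨s, κ, _, _⟩ := x
  obtain ⟨s', κ', _, _⟩ := y
  obtain rfl : s = s' := h1
  obtain rfl : κ = κ' := by
    ext V l
    exact h2 V.unop l
  rfl

/-- The faces and degeneracies of simplices of a slice. -/
def map {a a' : SimplexCategory} (f : a' ⟶ a) (x : SliceSimplex p a) : SliceSimplex p a' where
  front := D.map f.op x.front
  fam := x.fam ≫ Dec.res f D
  jinl_fam b l := by
    change D.map _ (Dec.val ((Dec.res f D).app (op b) (x.fam.app (op b) l))) = _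
    rw [Dec.val_res, map_map, jinl_jmap, ← map_map, x.jinl_fam]
  jinr_fam b l := by
    change D.map _ (Dec.val ((Dec.res f D).app (op b) (x.fam.app (op b) l))) = _
    rw [Dec.val_res, map_map, jinr_jmap, ← map_map, x.jinr_fam]
    simp

lemma val_map {a a' b : SimplexCategory} (x : SliceSimplex p a) (l : L.obj (op b))
    (f : a' ⟶ a) : (x.map f).val l = D.map (jmap f (𝟙 b)).op (x.val l) := rfl

lemma map_val {a b b' : SimplexCategory} (x : SliceSimplex p a) (l : L.obj (op b))
    (f : b' ⟶ b) : D.map (jmap (𝟙 a) f).op (x.val l) = x.val (L.map f.op l) := by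
  rw [val, val, NatTrans.naturality_apply, Dec.val_map]

lemma jinl_val {a b : SimplexCategory} (x : SliceSimplex p a) (l : L.obj (op b)) :
    D.map (jinl a b).op (x.val l) = x.front := x.jinl_fam b l

lemma jinr_val {a b : SimplexCategory} (x : SliceSimplex p a) (l : L.obj (op b)) :
    D.map (jinr a b).op (x.val l) = p.app (op b) l := x.jinr_fam b l

end SliceSimplex

/-- The slice of `D` over the diagram `p`. -/
def Slice {L D : SSet.{u}} (p : L ⟶ D) : SSet.{u} where
  obj U := SliceSimplex p U.unop
  map φ := ↾fun x => x.map φ.unop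
  map_id U := by
    ext x
    refine SliceSimplex.ext (D.map_id_apply _ _) fun b l => ?_
    change (SliceSimplex.map (𝟙 _) x).val l = _
    rw [SliceSimplex.val_map, jmap_id]
    exact D.map_id_apply _ _
  map_comp φ ψ := by
    ext x
    refine SliceSimplex.ext (D.map_comp_apply _ _ _) fun b l => ?_
    change (SliceSimplex.map (ψ.unop ≫ φ.unop) x).val l = ((x.map φ.unop).map ψ.unop).val l
    rw [SliceSimplex.val_map, SliceSimplex.val_map, SliceSimplex.val_map, map_map, ← jmap_comp,
      Category.comp_id]

namespace Slice

variable {L D : SSet.{u}}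

/-- The front face of a simplex of the slice. -/
def front (p : L ⟶ D) : Slice p ⟶ D where
  app U := ↾fun x => SliceSimplex.front x

/-- Restriction of the diagram. -/
def res {K : SSet.{u}} (i : K ⟶ L) (p : L ⟶ D) : Slice p ⟶ Slice (i ≫ p) where
  app U := ↾fun x => ⟨SliceSimplex.front x, i ≫ SliceSimplex.fam x,
    fun b l => SliceSimplex.jinl_fam x b _, fun b l => SliceSimplex.jinr_fam x b _⟩

/-- A simplex of the slice, as a structure. -/
def get {p : L ⟶ D} {U} (x : (Slice p).obj U) : SliceSimplex p U.unop := x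

end Slice

/-! ### Inner horns in joins and lifting in slices -/

theorem exists_extension_of_innerAnodyne {A B D : SSet.{u}} [Quasicategory D] (i : A ⟶ B)
    (hi : innerAnodyneExtensions i) (f : A ⟶ D) : ∃ g, i ≫ g = f := by
  have := hi (Limits.terminal.from D) (mem_innerFibrations _)
  have sq : CommSq f i (Limits.terminal.from D) (Limits.terminal.from B) := ⟨Subsingleton.elim _ _⟩
  exact ⟨sq.lift, sq.fac_left⟩

lemma map_yonedaEquiv {X : SSet.{u}} {n : ℕ} {a : SimplexCategory} (g : Δ[n] ⟶ X) (χ : a ⟶ ⦋n⦌) :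
    X.map χ.op (SSet.yonedaEquiv g) = g.app (op a) (stdSimplex.objEquiv.symm χ) := by
  conv_rhs => rw [← SSet.yonedaEquiv.symm_apply_apply g]
  rfl

lemma exists_hom_of_forall {X D : SSet.{u}} (G : ∀ a : SimplexCategory, X.obj (op a) →
    D.obj (op a) → Prop) (hG : ∀ a x, ∃! e, G a x e)
    (hm : ∀ a b (f : a ⟶ b) x e, G b x e → G a (X.map f.op x) (D.map f.op e)) :
    ∃ h : X ⟶ D, ∀ a (x : X.obj (op a)), G a x (h.app _ x) := by
  choose h hh huniq using hG
  refine ⟨{ app := fun U => ↾fun x => h U.unop x, naturality := fun U V φ => ?_ }, hh⟩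
  ext x
  exact (huniq _ _ _ (hm _ _ φ.unop x _ (hh _ x))).symm

/-- Filling of an inner horn in a join, decomposed along the join. -/
theorem exists_inner_join_filler {D : SSet.{u}} [Quasicategory D] {m n : ℕ} (k : Fin (m + 2))
    (hk : 0 < k) (s : D _⦋m + 1⦌) (r : D _⦋n⦌)
    (A : ∀ (a : SimplexCategory) (α : a ⟶ ⦋m + 1⦌), (∃ j, j ≠ k ∧ ∀ x, α.toOrderHom x ≠ j) →
      D.obj (op (jn a ⦋n⦌)))
    (B : ∀ (b : SimplexCategory) (β : b ⟶ ⦋n⦌), (∃ j, ∀ x, β.toOrderHom x ≠ j) →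
      D.obj (op (jn ⦋m + 1⦌ b)))
    (A_map : ∀ a α h a' (f : a' ⟶ a) h', D.map (jmap f (𝟙 _)).op (A a α h) = A a' (f ≫ α) h')
    (B_map : ∀ b β h b' (f : b' ⟶ b) h', D.map (jmap (𝟙 _) f).op (B b β h) = B b' (f ≫ β) h')
    (A_jinl : ∀ a α h, D.map (jinl _ _).op (A a α h) = D.map α.op s)
    (A_jinr : ∀ a α h, D.map (jinr _ _).op (A a α h) = r)
    (B_jinl : ∀ b β h, D.map (jinl _ _).op (B b β h) = s)
    (B_jinr : ∀ b β h, D.map (jinr _ _).op (B b β h) = D.map β.op r)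
    (AB : ∀ a α h b β h', D.map (jmap (𝟙 a) β).op (A a α h) =
      D.map (jmap α (𝟙 b)).op (B b β h')) :
    ∃ e : D.obj (op (jn ⦋m + 1⦌ ⦋n⦌)), D.map (jinl _ _).op e = s ∧ D.map (jinr _ _).op e = r ∧
      (∀ a α h, D.map (jmap α (𝟙 _)).op e = A a α h) ∧
      (∀ b β h, D.map (jmap (𝟙 _) β).op e = B b β h) := by
  let N := m + 1 + 1 + n
  let k' : Fin (N + 1) := lft (a := ⦋m + 1⦌) (b := ⦋n⦌) k
  -- F says that e is compatible with every presentation of χ through the data, G that some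
  -- presentation produces e. One e satisfying both is the only solution of G, so G is the graph of
  -- a map from the horn.
  let F : ∀ (c : SimplexCategory) (χ : c ⟶ jn ⦋m + 1⦌ ⦋n⦌) (e : D.obj (op c)), Prop :=
    fun c χ e =>
      (∀ a α h (y : c ⟶ jn a ⦋n⦌), χ = y ≫ jmap α (𝟙 _) → e = D.map y.op (A a α h)) ∧
      (∀ b β h (y : c ⟶ jn ⦋m + 1⦌ b), χ = y ≫ jmap (𝟙 _) β → e = D.map y.op (B b β h)) ∧
      (∀ y : c ⟶ ⦋m + 1⦌, χ = y ≫ jinl _ _ → e = D.map y.op s) ∧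
      (∀ y : c ⟶ ⦋n⦌, χ = y ≫ jinr _ _ → e = D.map y.op r)
  let G : ∀ (c : SimplexCategory) (χ : c ⟶ jn ⦋m + 1⦌ ⦋n⦌) (e : D.obj (op c)), Prop :=
    fun c χ e =>
      (∃ a α h, ∃ y : c ⟶ jn a ⦋n⦌, χ = y ≫ jmap α (𝟙 _) ∧ e = D.map y.op (A a α h)) ∨
      (∃ b β h, ∃ y : c ⟶ jn ⦋m + 1⦌ b, χ = y ≫ jmap (𝟙 _) β ∧ e = D.map y.op (B b β h)) ∨
      (∃ y : c ⟶ ⦋m + 1⦌, χ = y ≫ jinl _ _ ∧ e = D.map y.op s) ∨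
      (∃ y : c ⟶ ⦋n⦌, χ = y ≫ jinr _ _ ∧ e = D.map y.op r)
  have hFG : ∀ c χ e e', F c χ e → G c χ e' → e' = e := by
    rintro c χ e e' ⟨h1, h2, h3, h4⟩ (⟨a, α, h, y, hy, rfl⟩ | ⟨a, α, h, y, hy, rfl⟩ |
      ⟨y, hy, rfl⟩ | ⟨y, hy, rfl⟩)
    · exact (h1 a α h y hy).symm
    · exact (h2 a α h y hy).symm
    · exact (h3 y hy).symm
    · exact (h4 y hy).symm
  have hFe : ∀ (d : ℕ) (χ : ⦋d⦌ ⟶ jn ⦋m + 1⦌ ⦋n⦌), (∃ j, j ≠ k' ∧ ∀ x, χ.toOrderHom x ≠ j) →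
      ∃ e, F _ χ e ∧ G _ χ e := by
    refine jn_hom_induction ?_ ?_ ?_
    · intro d g _
      refine ⟨D.map g.op s, ⟨?_, ?_, ?_, ?_⟩, Or.inr (Or.inr (Or.inl ⟨g, rfl, rfl⟩))⟩
      · intro a α h y hy
        obtain ⟨y, rfl, rfl⟩ := comp_jmap_eq_jinl hy.symm
        rw [← map_map, ← map_map, A_jinl]
      · intro b β h y hy
        obtain ⟨y, rfl, rfl⟩ := comp_jmap_eq_jinl hy.symm
        rw [Category.comp_id, ← map_map, B_jinl]
      · intro y hy
        rw [jinl_cancel hy]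
      · intro y hy
        exact (jinl_ne_jinr _ _ hy).elim
    · intro d g _
      refine ⟨D.map g.op r, ⟨?_, ?_, ?_, ?_⟩, Or.inr (Or.inr (Or.inr ⟨g, rfl, rfl⟩))⟩
      · intro a α h y hy
        obtain ⟨y, rfl, rfl⟩ := comp_jmap_eq_jinr hy.symm
        rw [Category.comp_id, ← map_map, A_jinr]
      · intro b β h y hy
        obtain ⟨y, rfl, rfl⟩ := comp_jmap_eq_jinr hy.symm
        rw [← map_map, ← map_map, B_jinr]
      · intro y hy
        exact (jinl_ne_jinr _ _ hy.symm).elim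
      · intro y hy
        rw [jinr_cancel hy]
    · intro p q g h ⟨j, hj, hj'⟩
      have key : ∀ e : D.obj (op (jn ⦋p⦌ ⦋q⦌)),
          (∀ h1, e = D.map (jmap (𝟙 _) h).op (A _ g h1)) →
          (∀ h1, e = D.map (jmap g (𝟙 _)).op (B _ h h1)) → F _ (jmap g h) e := by
        intro e he1 he2
        refine ⟨?_, ?_, ?_, ?_⟩
        · intro a α hα y hy
          obtain ⟨g', h', rfl, rfl, rfl⟩ := comp_jmap_eq_jmap (p := ⦋p⦌) (q := ⦋q⦌) hy.symm
          have hg : ∃ j, j ≠ k ∧ ∀ x, (g' ≫ α).toOrderHom x ≠ j := by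
            obtain ⟨j, hj, hα⟩ := hα
            exact ⟨j, hj, fun x => hα _⟩
          rw [he1 hg, ← A_map a α hα _ g' hg, map_map, ← jmap_comp]
          simp
        · intro b β hβ y hy
          obtain ⟨g', h', rfl, rfl, rfl⟩ := comp_jmap_eq_jmap (p := ⦋p⦌) (q := ⦋q⦌) hy.symm
          have hg : ∃ j, ∀ x, (h' ≫ β).toOrderHom x ≠ j := by
            obtain ⟨j, hβ⟩ := hβ
            exact ⟨j, fun x => hβ _⟩
          rw [he2 hg, ← B_map b β hβ _ h' hg, map_map, ← jmap_comp]
          simp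
        · intro y hy
          exact (jmap_ne_jinl (p := ⦋p⦌) (q := ⦋q⦌) _ _ _ hy).elim
        · intro y hy
          exact (jmap_ne_jinr (p := ⦋p⦌) (q := ⦋q⦌) _ _ _ hy).elim
      -- The value is read off A or B according to the factor that contains the omitted vertex; the
      -- hypothesis AB reconciles the two when both apply.
      obtain ⟨j, rfl⟩ | ⟨j, rfl⟩ := jn_cases (a := ⦋m + 1⦌) (b := ⦋n⦌) j
      · have hg : ∃ j, j ≠ k ∧ ∀ x, g.toOrderHom x ≠ j :=
          ⟨j, fun h => hj (by rw [h]), fun x hx => hj' (lft (a := ⦋p⦌) (b := ⦋q⦌) x)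
            ((jmap_lft g h x).trans (by rw [hx]))⟩
        refine ⟨D.map (jmap (𝟙 _) h).op (A _ g hg), key _ (fun _ => rfl) (fun h1 => AB _ _ _ _ _ _),
          Or.inl ⟨_, g, hg, jmap (𝟙 _) h, ?_, rfl⟩⟩
        rw [← jmap_comp, Category.id_comp, Category.comp_id]
      · have hg : ∃ j, ∀ x, h.toOrderHom x ≠ j :=
          ⟨j, fun x hx => hj' (rgt (a := ⦋p⦌) (b := ⦋q⦌) x)
            ((jmap_rgt g h x).trans (by rw [hx]))⟩
        refine ⟨D.map (jmap g (𝟙 _)).op (B _ h hg), key _ (fun _ => (AB _ _ _ _ _ _).symm)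
          (fun h1 => rfl), Or.inr (Or.inl ⟨_, h, hg, jmap g (𝟙 _), ?_, rfl⟩)⟩
        rw [← jmap_comp, Category.id_comp, Category.comp_id]
  obtain ⟨f, hf⟩ := exists_hom_of_forall (X := (Λ[N, k'] : (Δ[N] : SSet.{u}).Subcomplex)) (D := D)
    (fun a x e => G a (stdSimplex.objEquiv x.1) e) (fun a x => by
      induction a using SimplexCategory.rec with | _ d
      obtain ⟨e, he1, he2⟩ := hFe d (stdSimplex.objEquiv x.1)
        (by rw [← mem_horn_iff, Equiv.symm_apply_apply]; exact x.2)
      exact ⟨e, he2, fun e' he' => hFG _ _ _ _ he1 he'⟩) (by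
      rintro a b f x e (⟨c, α, h, y, hy, rfl⟩ | ⟨c, α, h, y, hy, rfl⟩ | ⟨y, hy, rfl⟩ | ⟨y, hy, rfl⟩)
      · refine Or.inl ⟨c, α, h, f ≫ y, ?_, map_map _ _ _⟩
        rw [Category.assoc, ← hy]; rfl
      · refine Or.inr (Or.inl ⟨c, α, h, f ≫ y, ?_, map_map _ _ _⟩)
        rw [Category.assoc, ← hy]; rfl
      · refine Or.inr (Or.inr (Or.inl ⟨f ≫ y, ?_, map_map _ _ _⟩))
        rw [Category.assoc, ← hy]; rfl
      · refine Or.inr (Or.inr (Or.inr ⟨f ≫ y, ?_, map_map _ _ _⟩))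
        rw [Category.assoc, ← hy]; rfl)
  -- The horn in the join is inner even when k is the last vertex of the left factor, because the
  -- right factor contributes at least one later vertex.
  obtain ⟨g, hg⟩ := exists_extension_of_innerAnodyne _
    (innerAnodyneExtensions.horn_ι (n := N) (i := k') hk
      (Fin.lt_def.2 (by have := k.2; simp [k', N, lft]; omega))) f
  have hFG' : ∀ (c : SimplexCategory) (χ : c ⟶ jn ⦋m + 1⦌ ⦋n⦌),
      (∃ j, j ≠ k' ∧ ∀ x, χ.toOrderHom x ≠ j) →
      F c χ (D.map χ.op (SSet.yonedaEquiv g)) := fun c χ hχ => by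
    induction c using SimplexCategory.rec with | _ d
    have hmem := (mem_horn_iff.{u} (n := N) (i := k') χ).2 hχ
    obtain ⟨e, he1, he2⟩ := hFe d χ hχ
    have h3 := hf _ ⟨_, hmem⟩
    simp only [Equiv.apply_symm_apply] at h3
    have h4 := hFG _ _ _ _ he1 h3
    have h5 := app_congr hg (U := op ⦋d⦌) ⟨_, hmem⟩
    have h6 : D.map χ.op (SSet.yonedaEquiv g) = e := by
      rw [← h4, ← h5, map_yonedaEquiv]
      rfl
    rw [h6]
    exact he1
  have hone : ∃ j : Fin (m + 2), j ≠ k := ⟨0, hk.ne⟩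
  have hA : ∀ a α, (∃ j, j ≠ k ∧ ∀ x, SimplexCategory.Hom.toOrderHom (a := a) α x ≠ j) →
      ∃ j, j ≠ k' ∧ ∀ x, (jmap α (𝟙 ⦋n⦌)).toOrderHom x ≠ j := by
    rintro a α ⟨j, hj, hj'⟩
    refine ⟨lft (a := ⦋m + 1⦌) (b := ⦋n⦌) j, fun h => hj (lft_injective h), fun x hx => ?_⟩
    obtain ⟨x, rfl⟩ | ⟨x, rfl⟩ := jn_cases x
    · rw [jmap_lft] at hx
      exact hj' x (lft_injective hx)
    · rw [jmap_rgt] at hx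
      exact (lft_lt_rgt _ _).ne' hx
  have hB : ∀ b β, (∃ j, ∀ x, SimplexCategory.Hom.toOrderHom (a := b) β x ≠ j) →
      ∃ j, j ≠ k' ∧ ∀ x, (jmap (𝟙 ⦋m + 1⦌) β).toOrderHom x ≠ j := by
    rintro a α ⟨j, hj'⟩
    refine ⟨rgt (a := ⦋m + 1⦌) (b := ⦋n⦌) j, (lft_lt_rgt _ _).ne', fun x hx => ?_⟩
    obtain ⟨x, rfl⟩ | ⟨x, rfl⟩ := jn_cases x
    · rw [jmap_lft] at hx
      exact (lft_lt_rgt _ _).ne hx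
    · rw [jmap_rgt] at hx
      exact hj' x (rgt_injective hx)
  have hid : ∀ a (x : D.obj (op a)), D.map (𝟙 a).op x = x := fun a x => D.map_id_apply _ x
  refine ⟨SSet.yonedaEquiv g, ?_, ?_, ?_, ?_⟩
  · refine ((hFG' _ (jinl _ _) ⟨rgt (a := ⦋m + 1⦌) (b := ⦋n⦌) 0, (lft_lt_rgt _ _).ne',
      fun x => (lft_lt_rgt _ _).ne⟩).2.2.1 (𝟙 _) (Category.id_comp _).symm).trans (hid _ _)
  · refine ((hFG' _ (jinr _ _) ⟨lft (a := ⦋m + 1⦌) (b := ⦋n⦌) 0,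
      fun h => hk.ne (lft_injective h),
      fun x => (lft_lt_rgt _ _).ne'⟩).2.2.2 (𝟙 _) (Category.id_comp _).symm).trans (hid _ _)
  · intro a α h
    exact ((hFG' _ _ (hA a α h)).1 a α h (𝟙 _) (Category.id_comp _).symm).trans (hid _ _)
  · intro a α h
    exact ((hFG' _ _ (hB a α h)).2.1 a α h (𝟙 _) (Category.id_comp _).symm).trans (hid _ _)

/-- A lift is an extension from K to L of a family of simplices in joins with Δ[m+1], with
prescribed restriction to the horn. For an n-simplex of L outside K, the horn joined with Δ[n]
together with Δ[m+1] joined with ∂Δ[n] is a horn of the join Δ[m+1] ⋆ Δ[n], and it is inner since k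
> 0. -/
theorem slice_hasLiftingProperty {K L D : SSet.{u}} [Quasicategory D] (i : K ⟶ L) [Mono i]
    (p : L ⟶ D) (m : ℕ) (k : Fin (m + 2)) (hk : 0 < k) :
    HasLiftingProperty (Λ[m + 1, k] : (Δ[m + 1] : SSet.{u}).Subcomplex).ι (Slice.res i p) := by
  constructor
  intro u y sq
  let y' : SliceSimplex (i ≫ p) ⦋m + 1⦌ := Slice.get (SSet.yonedaEquiv y)
  have hmem : ∀ {a : SimplexCategory} {α : a ⟶ ⦋m + 1⦌}
    (_ : ∃ j, j ≠ k ∧ ∀ x, α.toOrderHom x ≠ j), stdSimplex.objEquiv.symm α ∈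
      (Λ[m + 1, k] : (Δ[m + 1] : SSet.{u}).Subcomplex).obj (op a) := fun h => (mem_horn_iff _).2 h
  let U : ∀ (a : SimplexCategory) (α : a ⟶ ⦋m + 1⦌),
    (∃ j, j ≠ k ∧ ∀ x, α.toOrderHom x ≠ j) → SliceSimplex p a :=
    fun a α h => Slice.get (u.app (op a) ⟨_, hmem h⟩)
  have U_map : ∀ a α h a' (f : a' ⟶ a) h', (U a α h).map f = U a' (f ≫ α) h' := by
    intro a α h a' f h'
    exact (NatTrans.naturality_apply u f.op ⟨_, hmem h⟩).symm
  have U_res : ∀ a α h, Slice.get ((Slice.res i p).app (op a) (U a α h)) = y'.map α := by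
    intro a α h
    refine (app_congr sq.w (U := op a) ⟨_, hmem h⟩).trans ?_
    exact (map_yonedaEquiv y α).symm
  have U_front : ∀ a α h, (U a α h).front = D.map α.op y'.front := fun a α h =>
    congrArg SliceSimplex.front (U_res a α h)
  have U_val : ∀ a α h b (x : K.obj (op b)), (U a α h).val (i.app _ x) =
      D.map (jmap α (𝟙 b)).op (y'.val x) := fun a α h b x =>
    congrArg (fun z : SliceSimplex (i ≫ p) a => z.val x) (U_res a α h)
  -- The relation records all that is prescribed for the join over l: its front face, its back face
  -- p(l), and its restrictions to the faces in the horn.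
  obtain ⟨w, hw1, hw2⟩ := exists_extension_of_relation i (E := Dec ⦋m + 1⦌ D)
    (fun V l e => D.map (jinl _ V.unop).op (Dec.val e) = y'.front ∧
      D.map (jinr _ V.unop).op (Dec.val e) = p.app _ l ∧
      ∀ a α h, D.map (jmap α (𝟙 V.unop)).op (Dec.val e) = (U a α h).val l) (by
    rintro V W φ l e ⟨h1, h2, h3⟩
    have h0 : Dec.val (b := W.unop) ((Dec ⦋m + 1⦌ D).map φ e) =
      D.map (jmap (𝟙 _) φ.unop).op (Dec.val e) := rfl
    refine ⟨?_, ?_, fun a α h => ?_⟩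
    · rw [h0, map_map, jinl_jmap, Category.id_comp, h1]
    · rw [h0, map_map, jinr_jmap, ← map_map, h2, NatTrans.naturality_apply]
      rfl
    · rw [h0, map_map, ← jmap_comp]
      refine Eq.trans ?_ ((U a α h).map_val l φ.unop)
      rw [← h3 a α h, map_map, ← jmap_comp]
      simp) y'.fam (fun V x => ⟨y'.jinl_fam _ x, y'.jinr_fam _ x, fun a α h =>
        (U_val a α h V.unop x).symm⟩) (by
    intro n l hl t ht1 ht2
    have hmem' : ∀ {b : SimplexCategory} {β : b ⟶ ⦋n⦌}
      (_ : ∃ j, ∀ x, β.toOrderHom x ≠ j), stdSimplex.objEquiv.symm β ∈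
        (∂Δ[n] : (Δ[n] : SSet.{u}).Subcomplex).obj (op b) := fun h => (mem_boundary_iff _).2 h
    have hl' : ∀ (b : SimplexCategory) (β : b ⟶ ⦋n⦌) (h : ∃ j, ∀ x, β.toOrderHom x ≠ j),
      (SSet.yonedaEquiv.symm l).app (op b) (stdSimplex.objEquiv.symm β) = L.map β.op l :=
        fun b β h => rfl
    let T : ∀ (b : SimplexCategory) (β : b ⟶ ⦋n⦌),
      (∃ j, ∀ x, β.toOrderHom x ≠ j) → D.obj (op (jn ⦋m + 1⦌ b)) :=
      fun b β h => Dec.val (t.app (op b) ⟨_, hmem' h⟩)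
    obtain ⟨e, he1, he2, he3, he4⟩ := exists_inner_join_filler k hk y'.front (p.app _ l)
      (fun a α h => (U a α h).val l) T
      (fun a α h a' f h' => by rw [← U_map _ _ h _ _ h', SliceSimplex.val_map])
      (fun b β h b' f h' => by
        have := NatTrans.naturality_apply t f.op ⟨stdSimplex.objEquiv.symm β, hmem' h⟩
        exact (congrArg Dec.val this).symm)
      (fun a α h => by rw [SliceSimplex.jinl_val, U_front a α h])
      (fun a α h => by rw [SliceSimplex.jinr_val])
      (fun b β h => (ht1 (op b) ⟨_, hmem' h⟩).1)
      (fun b β h => ((ht1 (op b) ⟨_, hmem' h⟩).2.1).trans (NatTrans.naturality_apply _ _ _))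
      (fun a α h b β h' => by
        rw [SliceSimplex.map_val]
        exact ((ht1 (op b) ⟨_, hmem' h'⟩).2.2 a α h).symm)
    refine ⟨Dec.mk e, ⟨he1, he2, fun a α h => he3 a α h⟩, ?_⟩
    ext V x
    obtain ⟨β, hβ⟩ := stdSimplex.objEquiv.symm.surjective x.1
    have hβ' : ∃ j, ∀ x, SimplexCategory.Hom.toOrderHom β x ≠ j := by
      rw [← mem_boundary_iff.{u}, hβ]
      exact x.2
    have := he4 V.unop β hβ'
    obtain rfl : x = ⟨_, hmem' hβ'⟩ := Subtype.ext hβ.symm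
    exact this)
  let z : SliceSimplex p ⦋m + 1⦌ := ⟨y'.front, w, fun b l => (hw2 _ l).1, fun b l => (hw2 _ l).2.1⟩
  refine ⟨⟨⟨SSet.yonedaEquiv.symm z, ?_, ?_⟩⟩⟩
  · ext V x
    obtain ⟨α, hα⟩ := stdSimplex.objEquiv.symm.surjective x.1
    have hα' : ∃ j, j ≠ k ∧ ∀ x, SimplexCategory.Hom.toOrderHom α x ≠ j := by
      rw [← mem_horn_iff.{u}, hα]
      exact x.2
    obtain rfl : x = ⟨_, hmem hα'⟩ := Subtype.ext hα.symm
    refine SliceSimplex.ext (U_front _ α hα').symm fun b l => ?_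
    exact (hw2 (op b) l).2.2 _ α hα'
  · apply SSet.yonedaEquiv.injective
    rw [SSet.yonedaEquiv_comp]
    refine (congrArg ((Slice.res i p).app (op ⦋m + 1⦌))
      (SSet.yonedaEquiv.apply_symm_apply (show (Slice p) _⦋m + 1⦌ from z))).trans ?_
    exact SliceSimplex.ext rfl fun b l => app_congr hw1 l

/-! ### Low-dimensional horns and the homotopy category -/

lemma yonedaEquiv_symm_δ {X : SSet.{u}} {n : ℕ} (x : X _⦋n + 1⦌) (j : Fin (n + 2)) :
    stdSimplex.δ j ≫ SSet.yonedaEquiv.symm x = SSet.yonedaEquiv.symm (X.δ j x) := by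
  apply SSet.yonedaEquiv.injective
  rw [Equiv.apply_symm_apply]
  rfl

lemma yonedaEquiv_δ_comp {X : SSet.{u}} {n : ℕ} (g : Δ[n + 1] ⟶ X) (j : Fin (n + 2)) :
    SSet.yonedaEquiv (stdSimplex.δ j ≫ g) = X.δ j (SSet.yonedaEquiv g) := by
  obtain ⟨x, rfl⟩ := SSet.yonedaEquiv.symm.surjective g
  rw [yonedaEquiv_symm_δ, Equiv.apply_symm_apply, Equiv.apply_symm_apply]

lemma δ_eq_of_eq {X : SSet.{u}} {n : ℕ} {g : Δ[n + 1] ⟶ X} {x : X _⦋n⦌} {j : Fin (n + 2)}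
    (h : stdSimplex.δ j ≫ g = SSet.yonedaEquiv.symm x) : X.δ j (SSet.yonedaEquiv g) = x := by
  rw [← yonedaEquiv_δ_comp, h, Equiv.apply_symm_apply]

section

variable {E : SSet.{u}} [Quasicategory E]

lemma exists_filler_horn₂₁ (s₀ s₂ : E _⦋1⦌) (h : E.δ 1 s₀ = E.δ 0 s₂) :
    ∃ t : E _⦋2⦌, E.δ 0 t = s₀ ∧ E.δ 2 t = s₂ := by
  obtain ⟨g, hg⟩ := exists_extension_of_innerAnodyne _
    (innerAnodyneExtensions.horn_ι (n := 2) (i := 1) (by decide) (by decide))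
    (horn₂₁.isPushout.{u}.desc (SSet.yonedaEquiv.symm s₂) (SSet.yonedaEquiv.symm s₀)
      (by rw [yonedaEquiv_symm_δ, yonedaEquiv_symm_δ, h]))
  refine ⟨SSet.yonedaEquiv g, δ_eq_of_eq ?_, δ_eq_of_eq ?_⟩
  · rw [← horn.ι_ι 1 0 (by decide), Category.assoc, hg]
    exact horn₂₁.isPushout.inr_desc _ _ _
  · rw [← horn.ι_ι 1 2 (by decide), Category.assoc, hg]
    exact horn₂₁.isPushout.inl_desc _ _ _

lemma exists_filler_horn₃₁ (s₀ s₂ s₃ : E _⦋2⦌) (h₁₂ : E.δ 2 s₀ = E.δ 0 s₃)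
    (h₁₃ : E.δ 1 s₀ = E.δ 0 s₂) (h₂₃ : E.δ 2 s₂ = E.δ 2 s₃) :
    ∃ t : E _⦋3⦌, E.δ 0 t = s₀ ∧ E.δ 2 t = s₂ ∧ E.δ 3 t = s₃ := by
  obtain ⟨f, h0, h2, h3⟩ := horn₃₁.exists_desc (SSet.yonedaEquiv.symm s₀)
    (SSet.yonedaEquiv.symm s₂) (SSet.yonedaEquiv.symm s₃)
    (by rw [yonedaEquiv_symm_δ, yonedaEquiv_symm_δ, h₁₂])
    (by rw [yonedaEquiv_symm_δ, yonedaEquiv_symm_δ, h₁₃])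
    (by rw [yonedaEquiv_symm_δ, yonedaEquiv_symm_δ, h₂₃])
  obtain ⟨g, hg⟩ := exists_extension_of_innerAnodyne _
    (innerAnodyneExtensions.horn_ι (n := 3) (i := 1) (by decide) (by decide)) f
  refine ⟨SSet.yonedaEquiv g, δ_eq_of_eq ?_, δ_eq_of_eq ?_, δ_eq_of_eq ?_⟩
  · rw [← horn.ι_ι 1 0 (by decide), Category.assoc, hg, h0]
  · rw [← horn.ι_ι 1 2 (by decide), Category.assoc, hg, h2]
  · rw [← horn.ι_ι 1 3 (by decide), Category.assoc, hg, h3]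

lemma exists_filler_horn₃₂ (s₀ s₁ s₃ : E _⦋2⦌) (h₀₂ : E.δ 2 s₁ = E.δ 1 s₃)
    (h₁₂ : E.δ 2 s₀ = E.δ 0 s₃) (h₂₃ : E.δ 0 s₀ = E.δ 0 s₁) :
    ∃ t : E _⦋3⦌, E.δ 0 t = s₀ ∧ E.δ 1 t = s₁ ∧ E.δ 3 t = s₃ := by
  obtain ⟨f, h0, h2, h3⟩ := horn₃₂.exists_desc (SSet.yonedaEquiv.symm s₀)
    (SSet.yonedaEquiv.symm s₁) (SSet.yonedaEquiv.symm s₃)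
    (by rw [yonedaEquiv_symm_δ, yonedaEquiv_symm_δ, h₀₂])
    (by rw [yonedaEquiv_symm_δ, yonedaEquiv_symm_δ, h₁₂])
    (by rw [yonedaEquiv_symm_δ, yonedaEquiv_symm_δ, h₂₃])
  obtain ⟨g, hg⟩ := exists_extension_of_innerAnodyne _
    (innerAnodyneExtensions.horn_ι (n := 3) (i := 2) (by decide) (by decide)) f
  refine ⟨SSet.yonedaEquiv g, δ_eq_of_eq ?_, δ_eq_of_eq ?_, δ_eq_of_eq ?_⟩
  · rw [← horn.ι_ι 2 0 (by decide), Category.assoc, hg, h0]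
  · rw [← horn.ι_ι 2 1 (by decide), Category.assoc, hg, h2]
  · rw [← horn.ι_ι 2 3 (by decide), Category.assoc, hg, h3]

end

lemma δ_δ {X : SSet.{u}} {n : ℕ} (x : X _⦋n + 2⦌) {i j : Fin (n + 2)} (h : i ≤ j) :
    X.δ i (X.δ j.succ x) = X.δ j (X.δ i.castSucc x) :=
  (ConcreteCategory.congr_hom (X.δ_comp_δ h) x)

/-- Filling inner horns of dimension 2 and 3 is all that is needed to compose homotopy classes of
edges, so the homotopy category can be formed from the 2-truncation. -/
instance truncation_quasicategory₂ (E : SSet.{u}) [Quasicategory E] :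
    Truncated.Quasicategory₂ ((truncation 2).obj E) where
  fill21 {x₀ x₁ x₂} f g := by
    obtain ⟨t, h0, h2⟩ := exists_filler_horn₂₁ (E := E) g.edge f.edge
      (g.src_eq.trans f.tgt_eq.symm)
    refine ⟨⟨E.δ 1 t, ?_, ?_⟩, ⟨t, h2, h0, rfl⟩⟩
    · exact (δ_δ t (i := 1) (j := 1) le_rfl).symm.trans ((congrArg _ h2).trans f.src_eq)
    · exact (δ_δ t (i := 0) (j := 0) le_rfl).trans ((congrArg _ h0).trans g.tgt_eq)
  fill31 f₃ f₀ f₂ := by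
    obtain ⟨t, h0, h2, h3⟩ := exists_filler_horn₃₁ (E := E) f₀.simplex f₂.simplex f₃.simplex
      (f₀.d₂.trans f₃.d₀.symm) (f₀.d₁.trans f₂.d₀.symm) (f₂.d₂.trans f₃.d₂.symm)
    refine ⟨⟨E.δ 1 t, ?_, ?_, ?_⟩⟩
    · exact (δ_δ t (i := 1) (j := 2) (by decide)).symm.trans ((congrArg _ h3).trans f₃.d₁)
    · exact (δ_δ t (i := 0) (j := 0) le_rfl).trans ((congrArg _ h0).trans f₀.d₀)
    · exact (δ_δ t (i := 1) (j := 1) le_rfl).symm.trans ((congrArg _ h2).trans f₂.d₁)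
  fill32 f₃ f₀ f₁ := by
    obtain ⟨t, h0, h1, h3⟩ := exists_filler_horn₃₂ (E := E) f₀.simplex f₁.simplex f₃.simplex
      (f₁.d₂.trans f₃.d₁.symm) (f₀.d₂.trans f₃.d₀.symm) (f₀.d₀.trans f₁.d₀.symm)
    refine ⟨⟨E.δ 2 t, ?_, ?_, ?_⟩⟩
    · exact (δ_δ t (i := 2) (j := 2) (by decide)).symm.trans ((congrArg _ h3).trans f₃.d₂)
    · exact (δ_δ t (i := 0) (j := 1) (by decide)).trans ((congrArg _ h0).trans f₀.d₁)
    · exact (δ_δ t (i := 1) (j := 1) le_rfl).trans ((congrArg _ h1).trans f₁.d₁)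

/-- The homotopy category of a quasicategory. -/
def Ho (E : SSet.{u}) [Quasicategory E] : Type u :=
  Truncated.HomotopyCategory₂ ((truncation 2).obj E)

namespace Ho

variable {E E' E'' : SSet.{u}} [Quasicategory E] [Quasicategory E'] [Quasicategory E'']

instance : Category.{u} (Ho E) :=
  inferInstanceAs (Category (Truncated.HomotopyCategory₂ ((truncation 2).obj E)))

/-- A vertex, as an object of the homotopy category. -/
def of (x : E _⦋0⦌) : Ho E := ⟨x⟩

variable {x y z : E _⦋0⦌}

/-- The homotopy class of an edge. -/
def hom (f : Edge x y) : of x ⟶ of y := Truncated.HomotopyCategory₂.homMk f.toTruncated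

lemma hom_surjective : Function.Surjective (hom : Edge x y → _) :=
  Truncated.HomotopyCategory₂.homMk_surjective

@[simp] lemma hom_id (x : E _⦋0⦌) : hom (Edge.id x) = 𝟙 (of x) := rfl

lemma nonempty_compStruct_iff {f : Edge x y} {g : Edge y z} {h : Edge x z} :
    Nonempty (Edge.CompStruct f g h) ↔ hom f ≫ hom g = hom h :=
  Truncated.Edge.CompStruct.nonempty_iff

lemma fac {f : Edge x y} {g : Edge y z} {h : Edge x z} (c : Edge.CompStruct f g h) :
    hom f ≫ hom g = hom h := nonempty_compStruct_iff.1 ⟨c⟩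

lemma hom_eq_iff {f g : Edge x y} :
    hom f = hom g ↔ Nonempty (Edge.CompStruct f (Edge.id y) g) := by
  rw [nonempty_compStruct_iff, hom_id, Category.comp_id]

lemma isIso_hom_iff {f : Edge x y} : IsIso (hom f) ↔ Nonempty f.InvStruct := by
  constructor
  · rintro ⟨g, h1, h2⟩
    obtain ⟨g, rfl⟩ := hom_surjective g
    obtain ⟨c1⟩ := nonempty_compStruct_iff.2 (h1.trans (hom_id x).symm)
    obtain ⟨c2⟩ := nonempty_compStruct_iff.2 (h2.trans (hom_id y).symm)
    exact ⟨⟨g, c1, c2⟩⟩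
  · rintro ⟨g, c1, c2⟩
    exact ⟨hom g, fac c1, fac c2⟩

/-- The action of a map of quasicategories on homotopy classes of edges. -/
def mapHom (F : E ⟶ E') (f : of x ⟶ of y) : of (obj F x) ⟶ of (obj F y) :=
  Quotient.map (sa := Truncated.instSetoidEdge _ _) (sb := Truncated.instSetoidEdge _ _)
    (fun e => Edge.toTruncated (Edge.map (x₀ := x) (x₁ := y) (Edge.ofTruncated e) F))
    (by
      rintro a b ⟨c⟩
      refine ⟨?_⟩
      have := Edge.CompStruct.map (Edge.CompStruct.ofTruncated (e₀₁ := Edge.ofTruncated a)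
        (e₁₂ := Edge.id _) (e₀₂ := Edge.ofTruncated b) c) F
      rw [Edge.map_id] at this
      exact this) f

lemma mapHom_hom (F : E ⟶ E') (f : Edge x y) : mapHom F (hom f) = hom (f.map F) := rfl

lemma mapHom_comp (F : E ⟶ E') (f : of x ⟶ of y) (g : of y ⟶ of z) :
    mapHom F (f ≫ g) = mapHom F f ≫ mapHom F g := by
  obtain ⟨f, rfl⟩ := hom_surjective f
  obtain ⟨g, rfl⟩ := hom_surjective g
  obtain ⟨h, hh⟩ := hom_surjective (hom f ≫ hom g)
  obtain ⟨c⟩ := nonempty_compStruct_iff.2 hh.symm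
  rw [← hh]
  exact (fac (c.map F)).symm

lemma mapHom_id (F : E ⟶ E') (x : E _⦋0⦌) : mapHom F (𝟙 (of x)) = 𝟙 (of (obj F x)) :=
  congrArg Ho.hom (Edge.map_id x F)

end Ho

/-! ### Right fibrations and lifting of equivalences -/

/-- A 1-simplex of a quasicategory is an equivalence. -/
def IsEquiv {E : SSet.{u}} (s : E _⦋1⦌) : Prop := Nonempty (Edge.mk' s).InvStruct

lemma isEquiv_edge_iff {E : SSet.{u}} [Quasicategory E] {x y : E _⦋0⦌} (f : Edge x y) :
    IsEquiv f.edge ↔ IsIso (Ho.hom f) := by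
  rw [Ho.isIso_hom_iff]
  exact ⟨fun ⟨h⟩ => ⟨h.ofEq rfl⟩, fun ⟨h⟩ => ⟨h.ofEq rfl⟩⟩

/-- Maps with the right lifting property with respect to right horns. -/
def IsRightFibration {Q Y : SSet.{u}} (P : Q ⟶ Y) : Prop :=
  ∀ (m : ℕ) (k : Fin (m + 2)), 0 < k →
    HasLiftingProperty (Λ[m + 1, k] : (Δ[m + 1] : SSet.{u}).Subcomplex).ι P

lemma yonedaEquiv_comp_const {X Y : SSet.{u}} {x : Y _⦋0⦌} (f : Δ[0] ⟶ X) :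
    SSet.yonedaEquiv (f ≫ SSet.const x) = x := by
  rw [SSet.yonedaEquiv_comp]
  refine Eq.trans ?_ (Y.map_id_apply _ x)
  exact congrArg (fun f : (⦋0⦌ : SimplexCategory) ⟶ ⦋0⦌ => Y.map f.op x) (Subsingleton.elim _ _)

lemma yonedaEquiv_const_comp {X Y Z : SSet.{u}} {x : Y _⦋0⦌} (f : Δ[0] ⟶ X) (g : Y ⟶ Z) :
    SSet.yonedaEquiv (f ≫ SSet.const x ≫ g) = g.app _ x := by
  rw [← Category.assoc, SSet.yonedaEquiv_comp, yonedaEquiv_comp_const]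

namespace IsRightFibration

variable {Q Y : SSet.{u}} {P : Q ⟶ Y}

lemma quasicategory (hP : IsRightFibration P) [Quasicategory Y] : Quasicategory Q := by
  have : InnerFibration P := by
    rw [innerFibration_iff]
    rintro A B f ⟨i, h0, hn⟩
    exact hP _ i h0
  exact quasicategory_of_innerFibration P

lemma exists_lift_δ₂ (hP : IsRightFibration P) (s₀ s₁ : Q _⦋1⦌) (t : Y _⦋2⦌)
    (h : Q.δ 0 s₁ = Q.δ 0 s₀) (h₀ : Y.δ 0 t = P.app _ s₀) (h₁ : Y.δ 1 t = P.app _ s₁) :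
    ∃ t' : Q _⦋2⦌, P.app _ t' = t ∧ Q.δ 0 t' = s₀ ∧ Q.δ 1 t' = s₁ := by
  have := hP 1 2 (by decide)
  have sq : CommSq (horn₂₂.isPushout.{u}.desc (SSet.yonedaEquiv.symm s₁) (SSet.yonedaEquiv.symm s₀)
      (by rw [yonedaEquiv_symm_δ, yonedaEquiv_symm_δ, h])) Λ[2, 2].ι P
      (SSet.yonedaEquiv.symm t) := ⟨by
    apply horn₂₂.isPushout.hom_ext
    · rw [horn₂₂.isPushout.inl_desc_assoc, horn.ι_ι_assoc, yonedaEquiv_symm_δ, h₁]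
      exact (SSet.yonedaEquiv_symm_comp _ _)
    · rw [horn₂₂.isPushout.inr_desc_assoc, horn.ι_ι_assoc, yonedaEquiv_symm_δ, h₀]
      exact (SSet.yonedaEquiv_symm_comp _ _)⟩
  refine ⟨SSet.yonedaEquiv sq.lift, ?_, δ_eq_of_eq ?_, δ_eq_of_eq ?_⟩
  · rw [← SSet.yonedaEquiv_comp, sq.fac_right, Equiv.apply_symm_apply]
  · rw [← horn.ι_ι 2 0 (by decide), Category.assoc, sq.fac_left]
    exact horn₂₂.isPushout.inr_desc _ _ _
  · rw [← horn.ι_ι 2 1 (by decide), Category.assoc, sq.fac_left]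
    exact horn₂₂.isPushout.inl_desc _ _ _

lemma exists_lift_δ₁ (hP : IsRightFibration P) (s₀ s₂ : Q _⦋1⦌) (t : Y _⦋2⦌)
    (h : Q.δ 0 s₂ = Q.δ 1 s₀) (h₀ : Y.δ 0 t = P.app _ s₀) (h₂ : Y.δ 2 t = P.app _ s₂) :
    ∃ t' : Q _⦋2⦌, P.app _ t' = t ∧ Q.δ 0 t' = s₀ ∧ Q.δ 2 t' = s₂ := by
  have := hP 1 1 (by decide)
  have sq : CommSq (horn₂₁.isPushout.{u}.desc (SSet.yonedaEquiv.symm s₂) (SSet.yonedaEquiv.symm s₀)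
      (by rw [yonedaEquiv_symm_δ, yonedaEquiv_symm_δ, h])) Λ[2, 1].ι P
      (SSet.yonedaEquiv.symm t) := ⟨by
    apply horn₂₁.isPushout.hom_ext
    · rw [horn₂₁.isPushout.inl_desc_assoc, horn.ι_ι_assoc, yonedaEquiv_symm_δ, h₂]
      exact (SSet.yonedaEquiv_symm_comp _ _)
    · rw [horn₂₁.isPushout.inr_desc_assoc, horn.ι_ι_assoc, yonedaEquiv_symm_δ, h₀]
      exact (SSet.yonedaEquiv_symm_comp _ _)⟩
  refine ⟨SSet.yonedaEquiv sq.lift, ?_, δ_eq_of_eq ?_, δ_eq_of_eq ?_⟩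
  · rw [← SSet.yonedaEquiv_comp, sq.fac_right, Equiv.apply_symm_apply]
  · rw [← horn.ι_ι 1 0 (by decide), Category.assoc, sq.fac_left]
    exact horn₂₁.isPushout.inr_desc _ _ _
  · rw [← horn.ι_ι 1 2 (by decide), Category.assoc, sq.fac_left]
    exact horn₂₁.isPushout.inl_desc _ _ _

lemma exists_lift_edge (hP : IsRightFibration P) {x : Y _⦋0⦌} {q : Q _⦋0⦌}
    (g : Edge x (obj P q)) : ∃ (q' : Q _⦋0⦌) (g' : Edge q' q), P.app _ g'.edge = g.edge := by
  have := hP 0 1 (by decide)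
  have sq : CommSq (SSet.const q) Λ[1, 1].ι P (SSet.yonedaEquiv.symm g.edge) := ⟨by
    apply horn.hom_ext'
    intro j hj
    obtain rfl | rfl : j = 0 ∨ j = 1 := by fin_cases j <;> simp
    · rw [horn.ι_ι_assoc, yonedaEquiv_symm_δ, g.tgt_eq]
      apply SSet.yonedaEquiv.injective
      rw [Equiv.apply_symm_apply, yonedaEquiv_const_comp]
    · exact (hj rfl).elim⟩
  refine ⟨Q.δ 1 (SSet.yonedaEquiv sq.lift), Edge.mk (SSet.yonedaEquiv sq.lift) rfl (δ_eq_of_eq ?_), ?_⟩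
  · rw [← horn.ι_ι 1 0 (by decide), Category.assoc, sq.fac_left]
    apply SSet.yonedaEquiv.injective
    rw [Equiv.apply_symm_apply, yonedaEquiv_comp_const]
  · change P.app _ (SSet.yonedaEquiv sq.lift) = _
    rw [← SSet.yonedaEquiv_comp, sq.fac_right, Equiv.apply_symm_apply]

variable [Quasicategory Q] [Quasicategory Y]

/-- The edges f and id_y form a horn Λ[2, 2] lying over the triangle that witnesses the composite of
g and P f. A right fibration lifts this triangle, and the new face is the lift of g. -/
lemma exists_section (hP : IsRightFibration P) {x y : Q _⦋0⦌} (f : Edge x y)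
    (g : Edge (obj P y) (obj P x)) (h : Ho.hom g ≫ Ho.hom (f.map P) = 𝟙 _) :
    ∃ g' : Edge y x, g'.map P = g ∧ Ho.hom g' ≫ Ho.hom f = 𝟙 _ := by
  obtain ⟨c⟩ := Ho.nonempty_compStruct_iff.2 (h.trans (Ho.hom_id _).symm)
  obtain ⟨t, ht, h0, h1⟩ := hP.exists_lift_δ₂ f.edge (Edge.id y).edge c.simplex
    ((Edge.id y).tgt_eq.trans f.tgt_eq.symm) c.d₀ (c.d₁.trans (by
      rw [← Edge.map_id, Edge.map_edge]))
  let g' : Edge y x := Edge.mk (Q.δ 2 t)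
    ((δ_δ t (i := 1) (j := 1) le_rfl).trans ((congrArg _ h1).trans (Edge.id y).src_eq))
    ((δ_δ t (i := 0) (j := 1) (by decide)).trans ((congrArg _ h0).trans f.src_eq))
  refine ⟨g', Edge.ext ?_, ?_⟩
  · change P.app _ (Q.δ 2 t) = _
    rw [SSet.δ_naturality_apply, ht, c.d₂]
  · exact Ho.fac (Edge.CompStruct.mk (e₀₁ := g') (e₁₂ := f) (e₀₂ := Edge.id y) t rfl h0 h1)

/-- Right fibrations between quasicategories are conservative. -/
theorem isIso_hom (hP : IsRightFibration P) {x y : Q _⦋0⦌} (f : Edge x y)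
    (hf : IsIso (Ho.hom (f.map P))) : IsIso (Ho.hom f) := by
  obtain ⟨g, hg⟩ := Ho.hom_surjective (inv (Ho.hom (f.map P)))
  -- Two applications: g' satisfies g' f = 1, and lifting once more gives h' with h' g' = 1. So g'
  -- is invertible and f = h'.
  obtain ⟨g', rfl, h1⟩ := hP.exists_section f g (by rw [hg, IsIso.inv_hom_id])
  obtain ⟨h', -, h2⟩ := hP.exists_section g' (f.map P) (by rw [hg, IsIso.hom_inv_id])
  have h3 : Ho.hom f = Ho.hom h' := by
    rw [← Category.id_comp (Ho.hom f), ← h2, Category.assoc, h1, Category.comp_id]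
  exact ⟨Ho.hom g', by rw [h3, h2], h1⟩

/-- Equivalences can be lifted along right fibrations, with given source. -/
theorem exists_lift_of_isIso (hP : IsRightFibration P) {x : Q _⦋0⦌} {y : Y _⦋0⦌}
    (f : Edge (obj P x) y) (hf : IsIso (Ho.hom f)) :
    ∃ (x' : Q _⦋0⦌) (f' : Edge x x'), P.app _ f'.edge = f.edge := by
  -- A right fibration lifts edges with prescribed target, so the inverse of f is lifted first, with
  -- target x. Conservativity inverts the lift.
  obtain ⟨g, hg⟩ := Ho.hom_surjective (inv (Ho.hom f))
  obtain ⟨x', g', hg'⟩ := hP.exists_lift_edge g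
  obtain rfl : y = obj P x' := by
    rw [← g.src_eq, ← hg', ← SSet.δ_naturality_apply, g'.src_eq]
  obtain rfl : g = g'.map P := Edge.ext hg'.symm
  have : IsIso (Ho.hom g') := hP.isIso_hom g' (by rw [hg]; infer_instance)
  obtain ⟨f'', hf''⟩ := Ho.hom_surjective (inv (Ho.hom g'))
  have h1 : Ho.hom (f''.map P) = Ho.hom f := by
    have h3 : Ho.hom (f''.map P) ≫ Ho.hom (g'.map P) = 𝟙 _ := by
      rw [← Ho.mapHom_hom, ← Ho.mapHom_hom, ← Ho.mapHom_comp, hf'', IsIso.inv_hom_id,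
        Ho.mapHom_id]
    rw [← Category.comp_id (Ho.hom (f''.map P)), ← IsIso.inv_hom_id (Ho.hom f), ← hg,
      ← Category.assoc, h3]
    exact Category.id_comp _
  -- The inverted lift covers f only up to homotopy. Lifting the homotopy, a triangle with one
  -- degenerate edge, along Λ[2, 1] gives an edge lying strictly over f.
  obtain ⟨c⟩ := Ho.hom_eq_iff.1 h1
  obtain ⟨t, ht, h0, h2⟩ := hP.exists_lift_δ₁ (Edge.id x').edge f''.edge c.simplex
    (f''.tgt_eq.trans (Edge.id x').src_eq.symm) (c.d₀.trans (by
      rw [← Edge.map_id, Edge.map_edge])) c.d₂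
  refine ⟨x', Edge.mk (Q.δ 1 t)
    ((δ_δ t (i := 1) (j := 1) le_rfl).symm.trans ((congrArg _ h2).trans f''.src_eq))
    ((δ_δ t (i := 0) (j := 0) le_rfl).trans ((congrArg _ h0).trans (Edge.id x').tgt_eq)), ?_⟩
  change P.app _ (Q.δ 1 t) = _
  rw [SSet.δ_naturality_apply, ht, c.d₁]

end IsRightFibration

/-! ### Slices as right fibrations and special outer horns -/

section

variable {D : SSet.{u}} [Quasicategory D]

/-- This is the restriction of diagrams from L to the empty diagram, whose slice is D itself. -/
lemma slice_front_isRightFibration {L : SSet.{u}} (p : L ⟶ D) :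
    IsRightFibration (Slice.front p) := by
  intro m k hk
  have hi : IsIso (Slice.front ((⊥ : L.Subcomplex).ι ≫ p)) := by
    rw [NatTrans.isIso_iff_isIso_app]
    intro U
    rw [isIso_iff_bijective]
    constructor
    · intro x y hxy
      exact SliceSimplex.ext hxy (fun b l => l.2.elim)
    · intro s
      exact ⟨⟨s, Subcomplex.isInitialBot.to _, fun b l => l.2.elim, fun b l => l.2.elim⟩, rfl⟩
  have := slice_hasLiftingProperty (⊥ : L.Subcomplex).ι p m k hk
  exact inferInstanceAs (HasLiftingProperty _
    (Slice.res (⊥ : L.Subcomplex).ι p ≫ Slice.front ((⊥ : L.Subcomplex).ι ≫ p)))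

instance {L : SSet.{u}} (p : L ⟶ D) : Quasicategory (Slice p) :=
  (slice_front_isRightFibration p).quasicategory

/-- Joyal's special outer horns, in a form adapted to joins. -/
theorem exists_filler_special_join_horn {m : ℕ}
    (u : (Λ[1 + 1 + m, 0] : SSet.{u}) ⟶ D)
    (hu : ∀ h, IsEquiv (u.app (op ⦋1⦌) ⟨stdSimplex.objEquiv.symm (jinl ⦋1⦌ ⦋m⦌), h⟩)) :
    ∃ v : Δ[1 + 1 + m] ⟶ D, Λ[1 + 1 + m, 0].ι ≫ v = u := by
  have hmem {c : SimplexCategory} {χ : c ⟶ jn ⦋1⦌ ⦋m⦌} (h : ∃ j, j ≠ (0 : Fin (1 + 1 + m + 1)) ∧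
      ∀ x, χ.toOrderHom x ≠ j) : stdSimplex.objEquiv.symm χ ∈
        (Λ[1 + 1 + m, 0] : (Δ[1 + 1 + m] : SSet.{u}).Subcomplex).obj (op c) :=
    (mem_horn_iff _).2 h
  have hl1 : lft (a := ⦋1⦌) (b := ⦋m⦌) 1 ≠ (0 : Fin (1 + 1 + m + 1)) := fun h =>
    absurd (congrArg Fin.val h) one_ne_zero
  have hinl : ∃ j, j ≠ (0 : Fin (1 + 1 + m + 1)) ∧ ∀ x, (jinl ⦋1⦌ ⦋m⦌).toOrderHom x ≠ j :=
    ⟨rgt (a := ⦋1⦌) (b := ⦋m⦌) 0, (lft_lt_rgt (a := ⦋1⦌) (b := ⦋m⦌) 0 0).ne', fun x => (lft_lt_rgt _ _).ne⟩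
  have hinr : ∃ j, j ≠ (0 : Fin (1 + 1 + m + 1)) ∧ ∀ x, (jinr ⦋1⦌ ⦋m⦌).toOrderHom x ≠ j :=
    ⟨lft (a := ⦋1⦌) (b := ⦋m⦌) 1, hl1, fun x => (lft_lt_rgt _ _).ne'⟩
  have hA : ∀ (a : SimplexCategory) (α : a ⟶ ⦋1⦌), (∀ x, α.toOrderHom x ≠ 1) →
    ∃ j, j ≠ (0 : Fin (1 + 1 + m + 1)) ∧ ∀ x, (jmap α (𝟙 ⦋m⦌)).toOrderHom x ≠ j := by
    intro a α hα
    refine ⟨lft (a := ⦋1⦌) (b := ⦋m⦌) 1, hl1, fun x hx => ?_⟩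
    obtain ⟨x, rfl⟩ | ⟨x, rfl⟩ := jn_cases x
    · rw [jmap_lft] at hx
      exact hα x (lft_injective hx)
    · rw [jmap_rgt] at hx
      exact (lft_lt_rgt _ _).ne' hx
  have hB : ∀ (b : SimplexCategory) (β : b ⟶ ⦋m⦌), (∃ j, ∀ x, β.toOrderHom x ≠ j) →
    ∃ j, j ≠ (0 : Fin (1 + 1 + m + 1)) ∧ ∀ x, (jmap (𝟙 ⦋1⦌) β).toOrderHom x ≠ j := by
    rintro b β ⟨j, hj⟩
    refine ⟨rgt (a := ⦋1⦌) (b := ⦋m⦌) j, (lft_lt_rgt (a := ⦋1⦌) (b := ⦋m⦌) 0 _).ne', fun x hx => ?_⟩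
    obtain ⟨x, rfl⟩ | ⟨x, rfl⟩ := jn_cases x
    · rw [jmap_lft] at hx
      exact (lft_lt_rgt _ _).ne hx
    · rw [jmap_rgt] at hx
      exact hj x (rgt_injective hx)
  obtain ⟨U, hU⟩ : ∃ U : ∀ (c : SimplexCategory) (χ : c ⟶ jn ⦋1⦌ ⦋m⦌),
      (∃ j, j ≠ (0 : Fin (1 + 1 + m + 1)) ∧ ∀ x, χ.toOrderHom x ≠ j) → D.obj (op c),
      ∀ c χ h, U c χ h = u.app (op c) ⟨_, hmem h⟩ := ⟨_, fun _ _ _ => rfl⟩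
  have U_map : ∀ {c χ h c' χ' h' d} {f : d ⟶ c} {f' : d ⟶ c'}, f ≫ χ = f' ≫ χ' →
      D.map f.op (U c χ h) = D.map f'.op (U c' χ' h') := by
    intro c χ h c' χ' h' d f f' hf
    rw [hU, hU]
    refine (NatTrans.naturality_apply u f.op ⟨_, hmem h⟩).symm.trans
      (Eq.trans ?_ (NatTrans.naturality_apply u f'.op ⟨_, hmem h'⟩))
    exact congrArg _ (Subtype.ext (congrArg stdSimplex.objEquiv.symm hf))
  have U_map' : ∀ {c χ h c' χ' h'} {f : c' ⟶ c}, f ≫ χ = χ' →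
      D.map f.op (U c χ h) = U c' χ' h' := by
    intro c χ h c' χ' h' f hf
    refine Eq.trans ?_ (D.map_id_apply _ (U c' χ' h'))
    exact U_map (f' := 𝟙 c') (by rw [Category.id_comp, hf])
  have hδ : ∀ x, (SimplexCategory.δ (1 : Fin 2)).toOrderHom x ≠ 1 := by decide
  -- View the simplex as Δ[1] ⋆ Δ[m]. The horn at vertex 0 consists of Δ[1] ⋆ ∂Δ[m], an arrow e of
  -- the slice over ∂Δ[m], and {0} ⋆ Δ[m], an object q of the slice over Δ[m] lifting the source of
  -- e. A filler is a lift of e to an arrow out of q.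
  let p : Δ[m] ⟶ D := SSet.yonedaEquiv.symm (U _ (jinr _ _) hinr)
  let i : (∂Δ[m] : SSet.{u}) ⟶ Δ[m] := ∂Δ[m].ι
  have hK : ∀ {b : SimplexCategory} (x : (∂Δ[m] : SSet.{u}).obj (op b)),
      ∃ j, ∀ y, (stdSimplex.objEquiv x.1).toOrderHom y ≠ j := fun x => by
    rw [← mem_boundary_iff.{u}, Equiv.symm_apply_apply]
    exact x.2
  let e : SliceSimplex (i ≫ p) ⦋1⦌ :=
    { front := U _ (jinl _ _) hinl
      fam :=
        { app := fun V => ↾fun x => U _ _ (hB V.unop (stdSimplex.objEquiv x.1) (hK x))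
          naturality := fun V W φ => by
            ext x
            refine (U_map' ?_).symm
            rw [← jmap_comp, Category.comp_id]
            rfl }
      jinl_fam := fun b l => U_map' (by rw [jinl_jmap, Category.id_comp])
      jinr_fam := fun b l => U_map (by rw [jinr_jmap]; rfl) }
  let q : SliceSimplex p ⦋0⦌ :=
    { front := D.map (SimplexCategory.δ 1).op (U _ (jinl _ _) hinl)
      fam := SSet.yonedaEquiv.symm (Dec.mk (U _ _ (hA ⦋0⦌ (SimplexCategory.δ 1) hδ)))
      jinl_fam := fun b l => by
        refine (map_map _ _ _).trans (U_map ?_)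
        change (jinl _ _ ≫ jmap (𝟙 _) (stdSimplex.objEquiv l)) ≫ _ = _
        rw [jinl_jmap, Category.id_comp, jinl_jmap]
      jinr_fam := fun b l => by
        refine (map_map _ _ _).trans (U_map ?_)
        change (jinr _ _ ≫ jmap (𝟙 _) (stdSimplex.objEquiv l)) ≫ _ = _
        rw [jinr_jmap, Category.assoc, jinr_jmap, Category.id_comp]
        rfl }
  have hi := slice_hasLiftingProperty i p
  have hi' : IsRightFibration (Slice.res i p) := hi
  let ē : (Slice (i ≫ p)) _⦋1⦌ := e
  have hē : (Slice (i ≫ p)).δ 1 ē = (Slice.res i p).app _ (show (Slice p) _⦋0⦌ from q) := by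
    refine SliceSimplex.ext rfl fun b l => ?_
    change D.map (jmap (SimplexCategory.δ 1) (𝟙 _)).op (U _ _ _) =
      D.map (jmap (𝟙 _) (stdSimplex.objEquiv l.1)).op (U _ _ _)
    refine U_map ?_
    rw [← jmap_comp, ← jmap_comp]
    simp
  let f : Edge ((Slice.res i p).app _ (show (Slice p) _⦋0⦌ from q)) ((Slice (i ≫ p)).δ 0 ē) :=
    Edge.mk ē hē rfl
  -- The first edge of the horn is the image of e in D. The projection of the slice to D is
  -- conservative, so e is an equivalence, and equivalences can be lifted with prescribed source.
  have hf : IsIso (Ho.hom f) := by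
    apply (slice_front_isRightFibration _).isIso_hom
    rw [← isEquiv_edge_iff]
    exact (congrArg IsEquiv (hU _ (jinl _ _) hinl)).mpr (hu _)
  obtain ⟨q', f', hf'⟩ := hi'.exists_lift_of_isIso f hf
  let w : SliceSimplex p ⦋1⦌ := f'.edge
  have hw1 : w.front = U _ (jinl _ _) hinl := congrArg SliceSimplex.front hf'
  have hw2 : ∀ b (x : (∂Δ[m] : SSet.{u}).obj (op b)), w.val (i.app _ x) =
    U _ _ (hB b (stdSimplex.objEquiv x.1) (hK x)) := fun b x =>
    congrArg (fun z : SliceSimplex (i ≫ p) ⦋1⦌ => z.val x) hf'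
  have hw3 : w.map (SimplexCategory.δ 1) = q := f'.src_eq
  let v : D.obj (op (jn ⦋1⦌ ⦋m⦌)) := w.val (stdSimplex.objEquiv.symm (𝟙 _))
  refine ⟨SSet.yonedaEquiv.symm v, ?_⟩
  have key : ∀ (d : ℕ) (χ : ⦋d⦌ ⟶ jn ⦋1⦌ ⦋m⦌) h, D.map χ.op v = U _ χ h := by
    refine jn_hom_induction ?_ ?_ ?_
    · intro d g h
      rw [← map_map, w.jinl_val, hw1]
      exact U_map' rfl
    · intro d g h
      rw [← map_map, w.jinr_val]
      exact (map_map _ _ _).trans (U_map' rfl)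
    · rintro a b g h ⟨j, hj, hj'⟩
      -- If the omitted vertex is in Δ[1] it must be 1, so g is constant at 0 and the value comes
      -- from q; otherwise h lies in ∂Δ[m] and the value comes from e.
      obtain ⟨j, rfl⟩ | ⟨j, rfl⟩ := jn_cases (a := ⦋1⦌) (b := ⦋m⦌) j
      · have hg : ∀ x, g.toOrderHom x = 0 := by
          intro x
          have h1 : g.toOrderHom x ≠ j := fun hx => hj' (lft (a := ⦋a⦌) (b := ⦋b⦌) x)
            ((jmap_lft g h x).trans (by rw [hx]))
          have h2 : j ≠ 0 := fun h => hj (by rw [h]; rfl)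
          have h3 : ∀ y j : Fin 2, y ≠ j → j ≠ 0 → y = 0 := by decide
          exact h3 _ _ h1 h2
        have hg' : g = SimplexCategory.const ⦋a⦌ ⦋0⦌ 0 ≫ SimplexCategory.δ 1 := by
          ext x
          rw [hg]
          rfl
        have h1 : jmap g h = jmap (SimplexCategory.const ⦋a⦌ ⦋0⦌ 0) h ≫
            jmap (SimplexCategory.δ 1) (𝟙 _) := by
          rw [← jmap_comp, ← hg', Category.comp_id]
        have h2 : D.map (jmap (SimplexCategory.δ 1) (𝟙 _)).op v = q.val (stdSimplex.objEquiv.symm (𝟙 _)) := by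
          rw [← hw3]
          rfl
        have h3 : D.map (jmap g h).op v = D.map (jmap (SimplexCategory.const ⦋a⦌ ⦋0⦌ 0) h).op
            (q.val (stdSimplex.objEquiv.symm (𝟙 _))) := by
          rw [h1, ← map_map, h2]
        refine h3.trans ((map_map _ _ _).trans (U_map' ?_))
        rw [h1, Category.assoc]
        refine congrArg (_ ≫ ·) (Eq.trans ?_ (Category.id_comp _))
        exact congrArg (· ≫ _) (jmap_id _ _)
      · have hh : ∃ j, ∀ x, h.toOrderHom x ≠ j :=
          ⟨j, fun x hx => hj' (rgt (a := ⦋a⦌) (b := ⦋b⦌) x)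
            ((jmap_rgt g h x).trans (by rw [hx]))⟩
        have h1 : jmap g h = jmap g (𝟙 _) ≫ jmap (𝟙 _) h := by
          rw [← jmap_comp, Category.comp_id, Category.id_comp]
        have h2 : D.map (jmap (𝟙 _) h).op v = U _ _ (hB ⦋b⦌ h hh) := by
          rw [w.map_val]
          have h3 : (Δ[m] : SSet.{u}).map h.op (stdSimplex.objEquiv.symm (𝟙 _)) =
            stdSimplex.objEquiv.symm h := congrArg stdSimplex.objEquiv.symm (Category.comp_id h)
          rw [h3]
          exact hw2 _ ⟨stdSimplex.objEquiv.symm h, (mem_boundary_iff _).2 hh⟩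
        have h3 : D.map (jmap g h).op v = D.map (jmap g (𝟙 _)).op (U _ _ (hB ⦋b⦌ h hh)) := by
          rw [← h2, map_map, ← h1]
        exact h3.trans (U_map' h1.symm)
  ext V x
  obtain ⟨c⟩ := V
  induction c using SimplexCategory.rec with | _ d
  obtain ⟨χ, hχ⟩ := stdSimplex.objEquiv.symm.surjective x.1
  have hχ' : ∃ j, j ≠ (0 : Fin (1 + 1 + m + 1)) ∧ ∀ x, SimplexCategory.Hom.toOrderHom χ x ≠ j := by
    rw [← mem_horn_iff.{u}, hχ]
    exact x.2
  obtain rfl : x = ⟨_, hmem hχ'⟩ := Subtype.ext hχ.symm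
  exact (key d χ hχ').trans (hU _ _ _)

end

/-! ### Attaching horn fillers and filtering the prism -/

theorem exists_glue₂ {A B X E : SSet.{u}} (i : A ⟶ X) (j : B ⟶ X) [Mono i] [Mono j] (f : A ⟶ E)
    (g : B ⟶ E) (hs : ∀ U (x : X.obj U), (∃ a, i.app U a = x) ∨ ∃ b, j.app U b = x)
    (hc : ∀ U a b, i.app U a = j.app U b → f.app U a = g.app U b) :
    ∃ h : X ⟶ E, i ≫ h = f ∧ j ≫ h = g := by
  have hi : ∀ U, Function.Injective (i.app U) := fun U =>
    (mono_iff_injective (i.app U)).1 inferInstance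
  have hj : ∀ U, Function.Injective (j.app U) := fun U =>
    (mono_iff_injective (j.app U)).1 inferInstance
  let Y : Bool → SSet.{u} := fun b => match b with
    | true => A
    | false => B
  obtain ⟨h, hh⟩ := exists_glue (Y := Y) (X := X) (E := E)
    (fun b => match b with
      | true => i
      | false => j)
    (fun b => match b with
      | true => f
      | false => g)
    (fun U x => by
      obtain ⟨a, ha⟩ | ⟨b, hb⟩ := hs U x
      · exact ⟨true, a, ha⟩
      · exact ⟨false, b, hb⟩)
    (by
      rintro U (_ | _) (_ | _) y y' hy
      · exact congrArg _ (hj U hy)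
      · exact (hc _ _ _ hy.symm).symm
      · exact hc _ _ _ hy
      · exact congrArg _ (hi U hy))
  exact ⟨h, hh true, hh false⟩

instance {X Y : SSet.{u}} {B : Y.Subcomplex} (f : X ⟶ Y) [Mono f] (hf) :
    Mono (Subcomplex.lift (B := B) f hf) :=
  mono_of_mono_fac (Subcomplex.lift_ι f hf)

instance (X : SSet.{u}) : Mono (ι₀ : X ⟶ X ⊗ Δ[1]) := mono_of_mono_fac (ι₀_fst X)

lemma mono_of_app_injective {X Y : SSet.{u}} (f : X ⟶ Y)
    (h : ∀ U, Function.Injective (f.app U)) : Mono f := by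
  have : ∀ U, Mono (f.app U) := fun U => (mono_iff_injective _).2 (h U)
  exact NatTrans.mono_of_mono_app f

instance {X Y : SSet.{u}} (f : X ⟶ Y) [Mono f] (Z : SSet.{u}) : Mono (f ▷ Z) :=
  mono_of_app_injective _ fun U _ _ h =>
    Prod.ext ((mono_iff_injective (f.app U)).1 inferInstance
      (congrArg (fun z : (Y ⊗ Z).obj U => z.1) h)) (congrArg (fun z : (Y ⊗ Z).obj U => z.2) h)

instance {X Y : SSet.{u}} (f : X ⟶ Y) [Mono f] (Z : SSet.{u}) : Mono (Z ◁ f) :=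
  mono_of_app_injective _ fun U _ _ h =>
    Prod.ext (congrArg (fun z : (Z ⊗ Y).obj U => z.1) h)
      ((mono_iff_injective (f.app U)).1 inferInstance
        (congrArg (fun z : (Z ⊗ Y).obj U => z.2) h))

/-- Extension of a map to a subcomplex obtained by attaching a horn filler. -/
theorem exists_extension_of_attach {X D : SSet.{u}} {A B : X.Subcomplex} (hAB : A ≤ B) {N : ℕ}
    {k : Fin (N + 1)} (σ : Δ[N] ⟶ X) [Mono σ] (hσ : ∀ U s, σ.app U s ∈ B.obj U)
    (hpre : ∀ U s, σ.app U s ∈ A.obj U ↔ s ∈ (Λ[N, k] : (Δ[N] : SSet.{u}).Subcomplex).obj U)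
    (hB : ∀ U x, x ∈ B.obj U → x ∈ A.obj U ∨ ∃ s, σ.app U s = x) (f : (A : SSet.{u}) ⟶ D)
    (fill : ∀ u : (Λ[N, k] : SSet.{u}) ⟶ D,
      (∀ U s h, u.app U s = f.app U ⟨σ.app U s.1, h⟩) → ∃ v, Λ[N, k].ι ≫ v = u) :
    ∃ f' : (B : SSet.{u}) ⟶ D, Subcomplex.homOfLE hAB ≫ f' = f := by
  let σ' : Δ[N] ⟶ (B : SSet.{u}) := Subcomplex.lift σ (by rintro U _ ⟨s, rfl⟩; exact hσ U s)
  have hσ' : σ' ≫ B.ι = σ := rfl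
  have : Mono σ' := mono_of_mono_fac hσ'
  let τ : (Λ[N, k] : SSet.{u}) ⟶ (A : SSet.{u}) :=
    Subcomplex.lift (Λ[N, k].ι ≫ σ) (by rintro U _ ⟨s, rfl⟩; exact (hpre U _).2 s.2)
  obtain ⟨v, hv⟩ := fill (τ ≫ f) (fun U s h => rfl)
  obtain ⟨h, hh, -⟩ := exists_glue₂ (Subcomplex.homOfLE hAB) σ' f v (fun U x => by
    obtain h | ⟨s, hs⟩ := hB U x.1 x.2
    · exact Or.inl ⟨⟨x.1, h⟩, rfl⟩
    · exact Or.inr ⟨s, Subtype.ext hs⟩) (fun U a s has => by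
      have h1 : a.1 = σ.app U s := congrArg Subtype.val has
      have h2 := (hpre U s).1 (h1 ▸ a.2)
      refine Eq.trans ?_ (app_congr hv ⟨s, h2⟩).symm
      exact congrArg (f.app U) (Subtype.ext h1))
  exact ⟨h, hh⟩

/-- The vertices of a simplex of a standard simplex. -/
def vx {n : ℕ} {U} (x : (Δ[n] : SSet.{u}).obj U) : Fin (U.unop.len + 1) →o Fin (n + 1) :=
  (stdSimplex.objEquiv x).toOrderHom

lemma vx_ext {n : ℕ} {U} {x y : (Δ[n] : SSet.{u}).obj U} (h : ∀ t, vx x t = vx y t) : x = y := by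
  apply stdSimplex.objEquiv.injective
  ext t
  exact congrArg Fin.val (h t)

/-- The simplex of a standard simplex with given vertices. -/
def mkx {n : ℕ} {U : SimplexCategoryᵒᵖ} (f : Fin (U.unop.len + 1) →o Fin (n + 1)) :
    (Δ[n] : SSet.{u}).obj U :=
  stdSimplex.objEquiv.symm (SimplexCategory.Hom.mk f)

lemma exists_vx {n : ℕ} {U : SimplexCategoryᵒᵖ} (f : Fin (U.unop.len + 1) → Fin (n + 1))
    (hf : Monotone f) : ∃ x : (Δ[n] : SSet.{u}).obj U, ∀ t, vx x t = f t :=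
  ⟨mkx ⟨f, hf⟩, fun _ => rfl⟩

lemma mem_horn_iff_vx {n : ℕ} {i : Fin (n + 1)} {U} (x : (Δ[n] : SSet.{u}).obj U) :
    x ∈ (Λ[n, i] : (Δ[n] : SSet.{u}).Subcomplex).obj U ↔ ∃ j, j ≠ i ∧ ∀ t, vx x t ≠ j := by
  obtain ⟨c⟩ := U
  obtain ⟨χ, rfl⟩ := stdSimplex.objEquiv.symm.surjective x
  exact mem_horn_iff χ

lemma mem_boundary_iff_vx {n : ℕ} {U} (x : (Δ[n] : SSet.{u}).obj U) :
    x ∈ (∂Δ[n] : (Δ[n] : SSet.{u}).Subcomplex).obj U ↔ ∃ j, ∀ t, vx x t ≠ j := by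
  obtain ⟨c⟩ := U
  obtain ⟨χ, rfl⟩ := stdSimplex.objEquiv.symm.surjective x
  exact mem_boundary_iff χ

/-- The filtration of the prism. -/
def prismFiltration (n k : ℕ) : ((Δ[n] : SSet.{u}) ⊗ Δ[1]).Subcomplex where
  obj U := {x | (∃ j, ∀ t, vx x.1 t ≠ j) ∨ ∀ t, vx x.2 t = 1 → k ≤ (vx x.1 t).val}
  map := by
    rintro U V φ x (⟨j, hj⟩ | h)
    · exact Or.inl ⟨j, fun t => hj _⟩
    · exact Or.inr fun t => h _

/-- The maximal simplices of the prism. -/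
def prismSimplex (n : ℕ) (k : Fin (n + 1)) : (Δ[n + 1] : SSet.{u}) ⟶ Δ[n] ⊗ Δ[1] :=
  lift (SSet.stdSimplex.map (SimplexCategory.σ k)) (SSet.stdSimplex.map (SimplexCategory.Hom.mk
    ⟨fun j => if j ≤ k.castSucc then 0 else 1, fun a b h => by
      dsimp only
      split_ifs with h1 h2
      · exact le_rfl
      · exact Fin.zero_le _
      · exact (h1 (h.trans (by assumption))).elim
      · exact le_rfl⟩))

lemma prismSimplex_fst {n : ℕ} (k : Fin (n + 1)) {U} (s : (Δ[n + 1] : SSet.{u}).obj U) (t) :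
    vx ((prismSimplex n k).app U s).1 t = k.predAbove (vx s t) := rfl

lemma prismSimplex_snd {n : ℕ} (k : Fin (n + 1)) {U} (s : (Δ[n + 1] : SSet.{u}).obj U) (t) :
    vx ((prismSimplex n k).app U s).2 t = if vx s t ≤ k.castSucc then 0 else 1 := rfl

lemma predAbove_val {n : ℕ} (k : Fin (n + 1)) (j : Fin (n + 2)) :
    (k.predAbove j).val = if j ≤ k.castSucc then j.val else j.val - 1 := by
  rw [Fin.predAbove]
  split_ifs with h1 h2 h2
  · exact (h1.not_ge h2).elim
  · rfl
  · rfl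
  · exact (h2 (not_lt.1 h1)).elim

instance (n : ℕ) (k : Fin (n + 1)) : Mono (prismSimplex.{u} n k) := by
  refine mono_of_app_injective _ fun U s s' h => vx_ext fun t => ?_
  have h1 : k.predAbove (vx s t) = k.predAbove (vx s' t) := by
    rw [← prismSimplex_fst, ← prismSimplex_fst, h]
  have h2 : (if vx s t ≤ k.castSucc then (0 : Fin 2) else 1) =
      if vx s' t ≤ k.castSucc then 0 else 1 := by
    rw [← prismSimplex_snd, ← prismSimplex_snd, h]
  have h3 := congrArg Fin.val h1
  rw [predAbove_val, predAbove_val] at h3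
  simp only [Fin.le_def, Fin.val_castSucc] at h2 h3
  ext
  split_ifs at h2 h3 with h4 h5 h5
  · omega
  · simp at h2
  · simp at h2
  · omega

lemma prismSimplex_mem (n : ℕ) (k : Fin (n + 1)) {U} (s : (Δ[n + 1] : SSet.{u}).obj U) :
    (prismSimplex n k).app U s ∈ (prismFiltration n k).obj U := by
  refine Or.inr fun t ht => ?_
  rw [prismSimplex_snd] at ht
  rw [prismSimplex_fst, predAbove_val]
  simp only [Fin.le_def, Fin.val_castSucc] at ht ⊢
  split_ifs at ht ⊢ with h
  · simp at ht
  · omega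

/-- The maximal simplex runs through (0,0), …, (k,0), (k,1), …, (n,1). Dropping (k,1) moves the
upper vertices to indices above k, dropping any vertex other than (k,0) and (k,1) lands over ∂Δ[n],
and dropping (k,0) does neither. So the missing face is the one opposite vertex k. -/
lemma prismSimplex_mem_succ_iff (n : ℕ) (k : Fin (n + 1)) {U} (s : (Δ[n + 1] : SSet.{u}).obj U) :
    (prismSimplex n k).app U s ∈ (prismFiltration n (k + 1)).obj U ↔
      s ∈ (Λ[n + 1, k.castSucc] : (Δ[n + 1] : SSet.{u}).Subcomplex).obj U := by
  rw [mem_horn_iff_vx]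
  have key (t) := predAbove_val k (vx s t)
  simp only [Fin.le_def, Fin.val_castSucc] at key
  constructor
  · rintro (⟨j, hj⟩ | h)
    · refine ⟨if j < k then j.castSucc else j.succ, ?_, fun t ht => ?_⟩
      · split_ifs with h
        · simpa using h.ne
        · rw [Fin.lt_def] at h
          rw [ne_eq, Fin.ext_iff, Fin.val_succ, Fin.val_castSucc]
          omega
      · apply hj t
        ext
        rw [prismSimplex_fst, key]
        have h1 := congrArg Fin.val ht
        simp only [Fin.lt_def] at h1
        split_ifs at h1 ⊢ <;> simp at h1 <;> omega
    · refine ⟨k.succ, by simp [Fin.ext_iff], fun t ht => ?_⟩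
      have h1 := h t (by
        rw [prismSimplex_snd, ht, if_neg]
        simp [Fin.le_def])
      rw [prismSimplex_fst, key, ht] at h1
      simp at h1
  · rintro ⟨j, hj, h⟩
    by_cases hjk : j = k.succ
    · subst hjk
      refine Or.inr fun t ht => ?_
      rw [prismSimplex_snd] at ht
      rw [prismSimplex_fst, key]
      have h1 := h t
      simp only [Fin.le_def, Fin.val_castSucc, ne_eq, Fin.ext_iff, Fin.val_succ] at ht h1
      split_ifs at ht ⊢ with h2
      · simp at ht
      · omega
    · refine Or.inl ⟨k.predAbove j, fun t ht => ?_⟩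
      have h1 := congrArg Fin.val ht
      have h2 := h t
      rw [prismSimplex_fst, key, predAbove_val] at h1
      simp only [Fin.le_def, Fin.val_castSucc, ne_eq, Fin.ext_iff, Fin.val_succ] at h1 h2 hj hjk
      split_ifs at h1 <;> omega

/-- A simplex lost at stage k + 1 has an upper vertex at index exactly k; monotonicity puts its
lower vertices at indices at most k, so it factors through the k-th maximal simplex. -/
lemma mem_prismFiltration_cases (n : ℕ) (k : Fin (n + 1)) {U}
    (x : ((Δ[n] : SSet.{u}) ⊗ Δ[1]).obj U) (hx : x ∈ (prismFiltration n k).obj U) :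
    x ∈ (prismFiltration n (k + 1)).obj U ∨ ∃ s, (prismSimplex n k).app U s = x := by
  by_cases h : x ∈ (prismFiltration n (k + 1)).obj U
  · exact Or.inl h
  refine Or.inr ?_
  have h' := not_or.1 h
  obtain ⟨h1, h2⟩ := h'
  push Not at h2
  obtain ⟨y, hy, hy'⟩ := h2
  obtain hx | hx := hx
  · exact (h1 hx).elim
  have hval : ∀ t, vx x.2 t = 0 ∨ vx x.2 t = 1 := fun t => by
    have : ∀ i : Fin 2, i = 0 ∨ i = 1 := by decide
    exact this _
  have h0 : ∀ t, vx x.2 t = 0 → (vx x.1 t).val ≤ k := by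
    intro t ht
    have hty : t ≤ y := by
      by_contra hlt
      have := (vx x.2).monotone (not_le.1 hlt).le
      rw [hy, ht] at this
      exact absurd this (by decide)
    have := (vx x.1).monotone hty
    rw [Fin.le_def] at this
    omega
  obtain ⟨m, hm⟩ := exists_vx (U := U)
    (fun t => if vx x.2 t = 0 then (vx x.1 t).castSucc else (vx x.1 t).succ) (by
    intro a b hab
    have h3 := (vx x.1).monotone hab
    have h4 := (vx x.2).monotone hab
    dsimp only
    split_ifs with h5 h6 h6
    · exact h3
    · rw [Fin.le_def] at h3 ⊢
      simp
      omega
    · rw [h6, Fin.le_zero_iff] at h4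
      exact (h5 h4).elim
    · simpa using h3)
  refine ⟨m, Prod.ext (vx_ext fun t => ?_) (vx_ext fun t => ?_)⟩
  · rw [prismSimplex_fst]
    ext
    rw [predAbove_val, hm]
    simp only [Fin.le_def, Fin.val_castSucc]
    obtain h3 | h3 := hval t
    · simp [h3, h0 t h3]
    · have := hx t h3
      simp [h3]
      omega
  · rw [prismSimplex_snd, hm]
    simp only [Fin.le_def, Fin.val_castSucc]
    obtain h3 | h3 := hval t
    · simp [h3, h0 t h3]
    · have := hx t h3
      simp [h3]
      omega

theorem exists_filler_special_horn {D : SSet.{u}} [Quasicategory D] {N m : ℕ} (hN : N = 1 + 1 + m)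
    (u : (Λ[N, 0] : SSet.{u}) ⟶ D)
    (hu : ∀ s : (Λ[N, 0] : SSet.{u}).obj (op ⦋1⦌), (vx s.1 0).val = 0 → (vx s.1 1).val = 1 →
      IsEquiv (u.app (op ⦋1⦌) s)) :
    ∃ v : Δ[N] ⟶ D, Λ[N, 0].ι ≫ v = u := by
  subst hN
  exact exists_filler_special_join_horn u fun h => hu _ rfl rfl

lemma prismFiltration_anti (n k : ℕ) : prismFiltration.{u} n (k + 1) ≤ prismFiltration n k := by
  rintro U x (h | h)
  · exact Or.inl h
  · exact Or.inr fun t ht => (Nat.le_succ k).trans (h t ht)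

variable {D : SSet.{u}} [Quasicategory D]

/-- The maximal simplices are attached for decreasing k, along the horn at vertex k. These horns are
inner except for k = 0, where the first edge is (0,0) → (0,1), assumed to be an equivalence, and the
special outer horn theorem applies. -/
lemma exists_extension_prismFiltration (n : ℕ)
    (f : (prismFiltration.{u} (n + 1) (n + 2) : SSet.{u}) ⟶ D)
    (hf : ∀ s : (prismFiltration.{u} (n + 1) (n + 2) : SSet.{u}).obj (op ⦋1⦌),
      (∀ t, vx s.1.1 t = 0) → vx s.1.2 0 = 0 → vx s.1.2 1 = 1 → IsEquiv (f.app _ s)) (k : ℕ)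
    (hk : k ≤ n + 2) :
    ∃ f' : (prismFiltration.{u} (n + 1) k : SSet.{u}) ⟶ D,
      ∀ U x h h', f'.app U ⟨x, h⟩ = f.app U ⟨x, h'⟩ := by
  induction hk using Nat.decreasingInduction with
  | self => exact ⟨f, fun U x h h' => rfl⟩
  | of_succ k hk ih =>
    obtain ⟨f₁, hf₁⟩ := ih
    obtain ⟨f₂, hf₂⟩ := exists_extension_of_attach (prismFiltration_anti (n + 1) k)
      (k := (⟨k, hk⟩ : Fin (n + 2)).castSucc)
      (prismSimplex (n + 1) ⟨k, hk⟩) (fun U s => prismSimplex_mem _ _ s)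
      (fun U s => prismSimplex_mem_succ_iff _ _ s)
      (fun U x hx => mem_prismFiltration_cases (n + 1) ⟨k, hk⟩ x hx) f₁ (fun u hu => by
        obtain _ | k := k
        · refine exists_filler_special_horn (m := n) (by omega) u fun s hs hs' => ?_
          have h0 : ∀ t : Fin 2, t = 0 ∨ t = 1 := by decide
          have h1 : ∀ t, vx ((prismSimplex (n + 1) 0).app _ s.1).1 t = 0 := fun t => by
            ext
            rw [prismSimplex_fst, predAbove_val]
            obtain rfl | rfl := h0 t
            · simp [hs]
            · rw [if_neg (by rw [Fin.le_def, hs']; exact Nat.not_succ_le_zero 0), hs']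
              rfl
          have h2 : vx ((prismSimplex (n + 1) 0).app _ s.1).2 0 = 0 := by
            rw [prismSimplex_snd, if_pos]
            rw [Fin.le_def, hs]
            exact Nat.zero_le _
          have h3 : vx ((prismSimplex (n + 1) 0).app _ s.1).2 1 = 1 := by
            rw [prismSimplex_snd, if_neg]
            rw [Fin.le_def, hs']
            exact Nat.not_succ_le_zero 0
          have h4 (k) : (prismSimplex (n + 1) 0).app _ s.1 ∈
              (prismFiltration (n + 1) k).obj (op ⦋1⦌) :=
            Or.inl ⟨Fin.last _, fun t => by
              rw [h1]
              exact (Fin.last_pos).ne⟩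
          have h5 := (hu _ s (h4 _)).trans (hf₁ _ _ _ (h4 _))
          exact (congrArg IsEquiv h5).mpr (hf _ h1 h2 h3)
        · exact exists_extension_of_innerAnodyne _ (innerAnodyneExtensions.horn_ι
            (Fin.lt_def.2 (by simp)) (Fin.lt_def.2 (by simp; omega))) u)
    refine ⟨f₂, fun U x h h' => ?_⟩
    have h3 : x ∈ (prismFiltration (n + 1) (k + 1)).obj U := by
      obtain h | h := h'
      · exact Or.inl h
      · exact Or.inr fun t ht => (Nat.succ_le_of_lt hk).trans (h t ht)
    exact (app_congr hf₂ ⟨x, h3⟩).trans (hf₁ U x h3 h')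

/-- Homotopy extension along the boundary of a simplex, for homotopies whose value at the first
vertex is an equivalence. -/
theorem exists_prism_filler (n : ℕ) (f : (∂Δ[n + 1] : SSet.{u}) ⊗ Δ[1] ⟶ D) (g : Δ[n + 1] ⟶ D)
    (h : ι₀ ≫ f = ∂Δ[n + 1].ι ≫ g)
    (hf : IsEquiv (f.app (op ⦋1⦌) ((∂Δ[n + 1] : SSet.{u}).σ 0 (bdVertex n 0),
      stdSimplex.edge 1 0 1 (by decide)))) :
    ∃ w : Δ[n + 1] ⊗ Δ[1] ⟶ D, ∂Δ[n + 1].ι ▷ Δ[1] ≫ w = f ∧ ι₀ ≫ w = g := by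
  -- No vertex of Δ[n+1] has index n + 2 or more, so this stage is exactly ∂Δ[n+1] × Δ[1] together
  -- with Δ[n+1] × {0}.
  obtain ⟨f₀, hf₀, hg₀⟩ := exists_glue₂ (X := (prismFiltration.{u} (n + 1) (n + 2) : SSet.{u}))
    (Subcomplex.lift (∂Δ[n + 1].ι ▷ Δ[1]) (by
      rintro U _ ⟨s, rfl⟩
      exact Or.inl ((mem_boundary_iff_vx _).1 s.1.2)))
    (Subcomplex.lift ι₀ (by
      rintro U _ ⟨s, rfl⟩
      exact Or.inr fun t ht => absurd ht (by decide : (0 : Fin 2) ≠ 1))) f g (by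
    rintro U ⟨x, h | h⟩
    · exact Or.inl ⟨(⟨x.1, (mem_boundary_iff_vx _).2 h⟩, x.2), rfl⟩
    · refine Or.inr ⟨x.1, Subtype.ext (Prod.ext rfl (vx_ext fun t => ?_))⟩
      have h2 : ∀ i : Fin 2, i ≠ 1 → 0 = i := by decide
      refine h2 _ fun h3 => ?_
      have := h t h3
      omega) (by
    rintro U a b hab
    have h1 := congrArg Subtype.val hab
    have h2 : a.1.1 = b := congrArg (fun z : (Δ[n + 1] ⊗ Δ[1] : SSet.{u}).obj U => z.1) h1
    have h3 : a.2 = _ := congrArg (fun z : (Δ[n + 1] ⊗ Δ[1] : SSet.{u}).obj U => z.2) h1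
    have h4 : a = (ι₀ : _ ⟶ (∂Δ[n + 1] : SSet.{u}) ⊗ Δ[1]).app U a.1 := Prod.ext rfl h3
    exact (congrArg (f.app U) h4).trans ((app_congr h a.1).trans (congrArg (g.app U) h2)))
  obtain ⟨w, hw⟩ := exists_extension_prismFiltration n f₀ (by
    rintro ⟨⟨s1, s2⟩, hs⟩ h1 h2 h3
    obtain rfl : s1 = ((∂Δ[n + 1] : SSet.{u}).σ 0 (bdVertex n 0)).1 := vx_ext fun t => h1 t
    obtain rfl : s2 = stdSimplex.edge 1 0 1 (by decide) := vx_ext fun t => by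
      have : ∀ t : Fin 2, t = 0 ∨ t = 1 := by decide
      obtain rfl | rfl := this t
      · exact h2
      · exact h3
    have h4 := app_congr hf₀ ((∂Δ[n + 1] : SSet.{u}).σ 0 (bdVertex n 0),
      stdSimplex.edge 1 0 1 (by decide))
    rw [← h4] at hf
    exact hf) 0 (Nat.zero_le _)
  refine ⟨Subcomplex.lift (B := prismFiltration (n + 1) 0) (𝟙 _)
    (by rintro U x -; exact Or.inr fun t _ => Nat.zero_le _) ≫ w, ?_, ?_⟩
  · rw [← hf₀]
    ext U x
    exact hw U _ _ _
  · rw [← hg₀]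
    ext U x
    exact hw U _ _ _

/-! ### Commutative squares in the homotopy category -/

lemma eq_zero_or_one (i : Fin 2) : i = 0 ∨ i = 1 := by
  revert i; decide

/-- The nondegenerate edge of the interval. -/
abbrev e01 : (Δ[1] : SSet.{u}) _⦋1⦌ := stdSimplex.edge 1 0 1 (by decide)

/-- A degenerate edge of the interval. -/
abbrev cst (b : Fin 2) : (Δ[1] : SSet.{u}) _⦋1⦌ := stdSimplex.const 1 b _

/-- A vertex of the interval. -/
abbrev pt1 (b : Fin 2) : (Δ[1] : SSet.{u}) _⦋0⦌ := stdSimplex.obj₀Equiv.symm b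

lemma δ_one_e01 : (Δ[1] : SSet.{u}).δ 1 e01 = pt1 0 := by ext i; fin_cases i; rfl
lemma δ_zero_e01 : (Δ[1] : SSet.{u}).δ 0 e01 = pt1 1 := by ext i; fin_cases i; rfl
lemma δ_cst (j : Fin 2) (b) : (Δ[1] : SSet.{u}).δ j (cst b) = pt1 b := by ext i; rfl

section

variable {E : SSet.{u}} (σ : Sq.{u} ⟶ E)

/-- The horizontal edges of a square. -/
def hEdge (b : Fin 2) : Edge (corner σ 0 b) (corner σ 1 b) :=
  Edge.mk (horizontal σ b)
    ((SSet.δ_naturality_apply σ _ _).symm.trans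
      (congrArg _ (Prod.ext δ_one_e01 (δ_cst _ _))))
    ((SSet.δ_naturality_apply σ _ _).symm.trans
      (congrArg _ (Prod.ext δ_zero_e01 (δ_cst _ _))))

/-- The vertical edges of a square. -/
def vEdge (a : Fin 2) : Edge (corner σ a 0) (corner σ a 1) :=
  Edge.mk (vertical σ a)
    ((SSet.δ_naturality_apply σ _ _).symm.trans
      (congrArg _ (Prod.ext (δ_cst _ _) δ_one_e01)))
    ((SSet.δ_naturality_apply σ _ _).symm.trans
      (congrArg _ (Prod.ext (δ_cst _ _) δ_zero_e01)))

/-- The diagonal of a square. -/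
def dEdge : Edge (corner σ 0 0) (corner σ 1 1) :=
  Edge.mk (σ.app (op ⦋1⦌) (e01, e01))
    ((SSet.δ_naturality_apply σ _ _).symm.trans
      (congrArg _ (Prod.ext δ_one_e01 δ_one_e01)))
    ((SSet.δ_naturality_apply σ _ _).symm.trans
      (congrArg _ (Prod.ext δ_zero_e01 δ_zero_e01)))

/-- The upper triangle of a square. -/
def upperTriangle : Edge.CompStruct (hEdge σ 0) (vEdge σ 1) (dEdge σ) :=
  Edge.CompStruct.mk (σ.app (op ⦋2⦌) ((Δ[1] : SSet.{u}).σ 1 e01, (Δ[1] : SSet.{u}).σ 0 e01))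
    ((SSet.δ_naturality_apply σ _ _).symm.trans
      (congrArg (σ.app (op ⦋1⦌)) (Prod.ext (by ext i; fin_cases i <;> rfl) (by ext i; fin_cases i <;> rfl))))
    ((SSet.δ_naturality_apply σ _ _).symm.trans
      (congrArg (σ.app (op ⦋1⦌)) (Prod.ext (by ext i; fin_cases i <;> rfl) (by ext i; fin_cases i <;> rfl))))
    ((SSet.δ_naturality_apply σ _ _).symm.trans
      (congrArg (σ.app (op ⦋1⦌)) (Prod.ext (by ext i; fin_cases i <;> rfl) (by ext i; fin_cases i <;> rfl))))

/-- The lower triangle of a square. -/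
def lowerTriangle : Edge.CompStruct (vEdge σ 0) (hEdge σ 1) (dEdge σ) :=
  Edge.CompStruct.mk (σ.app (op ⦋2⦌) ((Δ[1] : SSet.{u}).σ 0 e01, (Δ[1] : SSet.{u}).σ 1 e01))
    ((SSet.δ_naturality_apply σ _ _).symm.trans
      (congrArg (σ.app (op ⦋1⦌)) (Prod.ext (by ext i; fin_cases i <;> rfl) (by ext i; fin_cases i <;> rfl))))
    ((SSet.δ_naturality_apply σ _ _).symm.trans
      (congrArg (σ.app (op ⦋1⦌)) (Prod.ext (by ext i; fin_cases i <;> rfl) (by ext i; fin_cases i <;> rfl))))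
    ((SSet.δ_naturality_apply σ _ _).symm.trans
      (congrArg (σ.app (op ⦋1⦌)) (Prod.ext (by ext i; fin_cases i <;> rfl) (by ext i; fin_cases i <;> rfl))))

lemma square_comm [Quasicategory E] : Ho.hom (hEdge σ 0) ≫ Ho.hom (vEdge σ 1) =
    Ho.hom (vEdge σ 0) ≫ Ho.hom (hEdge σ 1) :=
  (Ho.fac (upperTriangle σ)).trans (Ho.fac (lowerTriangle σ)).symm

end

/-! ### Simplices of functor quasicategories -/

section

variable {A A' B B' : SSet.{u}}

/-- The simplices of `Fun A B` in uncurried form. -/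
def tr {n : ℕ} (x : (Fun A B) _⦋n⦌) : A ⊗ Δ[n] ⟶ B :=
  MonoidalClosed.uncurry (SSet.yonedaEquiv.symm x)

/-- The simplices of `Fun A B` from their uncurried form. -/
def untr {n : ℕ} (f : A ⊗ Δ[n] ⟶ B) : (Fun A B) _⦋n⦌ :=
  SSet.yonedaEquiv (MonoidalClosed.curry f)

@[simp] lemma tr_untr {n : ℕ} (f : A ⊗ Δ[n] ⟶ B) : tr (untr f) = f := by
  simp [tr, untr]

@[simp] lemma untr_tr {n : ℕ} (x : (Fun A B) _⦋n⦌) : untr (tr x) = x := by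
  simp [tr, untr]

lemma tr_injective {n : ℕ} {x y : (Fun A B) _⦋n⦌} (h : tr x = tr y) : x = y := by
  rw [← untr_tr x, h, untr_tr]

lemma tr_app {X : SSet.{u}} (w : X ⟶ Fun A B) {n : ℕ} (x : X _⦋n⦌) :
    tr (w.app _ x) = A ◁ SSet.yonedaEquiv.symm x ≫ MonoidalClosed.uncurry w := by
  rw [tr, ← SSet.yonedaEquiv_symm_comp, MonoidalClosed.uncurry_natural_left]

lemma tr_map {n m : ℕ} (φ : ⦋m⦌ ⟶ ⦋n⦌) (x : (Fun A B) _⦋n⦌) :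
    tr ((Fun A B).map φ.op x) = A ◁ SSet.stdSimplex.map φ ≫ tr x := by
  rw [tr, tr, ← MonoidalClosed.uncurry_natural_left]
  congr 1

lemma tr_δ {n : ℕ} (j : Fin (n + 2)) (x : (Fun A B) _⦋n + 1⦌) :
    tr ((Fun A B).δ j x) = A ◁ stdSimplex.δ j ≫ tr x := tr_map _ _

lemma tr_σ {n : ℕ} (j : Fin (n + 1)) (x : (Fun A B) _⦋n⦌) :
    tr ((Fun A B).σ j x) = A ◁ stdSimplex.σ j ≫ tr x := tr_map _ _

lemma tr_pre (i : A' ⟶ A) {n : ℕ} (x : (Fun A B) _⦋n⦌) :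
    tr ((Fun.pre i B).app _ x) = i ▷ _ ≫ tr x := by
  rw [tr, ← SSet.yonedaEquiv_symm_comp, MonoidalClosed.uncurry_pre_app]
  rfl

lemma tr_asVertex (F : A ⟶ B) : tr (asVertex F) = fst A Δ[0] ≫ F := tr_untr _

lemma eq_asVertex_iff (x : (Fun A B) _⦋0⦌) (F : A ⟶ B) :
    x = asVertex F ↔ tr x = fst A Δ[0] ≫ F := by
  rw [← tr_asVertex]
  exact ⟨fun h => by rw [h], tr_injective⟩

lemma whiskerLeft_δ_one : A ◁ stdSimplex.δ (1 : Fin 2) = fst A Δ[0] ≫ ι₀ := by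
  apply CartesianMonoidalCategory.hom_ext
  · simp
  · simp [stdSimplex.δ_one_eq_const]

lemma whiskerLeft_δ_zero : A ◁ stdSimplex.δ (0 : Fin 2) = fst A Δ[0] ≫ ι₁ := by
  apply CartesianMonoidalCategory.hom_ext
  · simp
  · simp [stdSimplex.δ_zero_eq_const]

lemma pre_asVertex (i : A' ⟶ A) (F : A ⟶ B) :
    (Fun.pre i B).app _ (asVertex F) = asVertex (i ≫ F) := by
  rw [eq_asVertex_iff, tr_pre, tr_asVertex, ← Category.assoc, whiskerRight_fst, Category.assoc]

namespace Trans

variable {F G H : A ⟶ B}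

lemma tr_toEdge (α : Trans F G) : tr α.toEdge = α.hom := tr_untr _

/-- A natural transformation, as an edge of the functor quasicategory. -/
def fe (α : Trans F G) : Edge (asVertex F) (asVertex G) :=
  Edge.mk α.toEdge
    (by
      rw [eq_asVertex_iff, tr_δ, tr_toEdge, whiskerLeft_δ_one, Category.assoc, α.source])
    (by
      rw [eq_asVertex_iff, tr_δ, tr_toEdge, whiskerLeft_δ_zero, Category.assoc, α.target])

@[simp] lemma fe_edge (α : Trans F G) : α.fe.edge = α.toEdge := rfl

/-- The natural transformation corresponding to an edge. -/
def ofEdge (e : Edge (asVertex F) (asVertex G)) : Trans F G where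
  hom := tr e.edge
  source := by
    have h := (eq_asVertex_iff _ _).1 e.src_eq
    rw [tr_δ, whiskerLeft_δ_one, Category.assoc] at h
    have h2 := congrArg (fun f => lift (𝟙 A) (SSet.const (stdSimplex.obj₀Equiv.symm 0)) ≫ f) h
    simpa using h2
  target := by
    have h := (eq_asVertex_iff _ _).1 e.tgt_eq
    rw [tr_δ, whiskerLeft_δ_zero, Category.assoc] at h
    have h2 := congrArg (fun f => lift (𝟙 A) (SSet.const (stdSimplex.obj₀Equiv.symm 0)) ≫ f) h
    simpa using h2

@[simp] lemma fe_ofEdge (e : Edge (asVertex F) (asVertex G)) : (ofEdge e).fe = e :=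
  Edge.ext (untr_tr _)

lemma isComp_iff (α : Trans F G) (β : Trans G H) (γ : Trans F H) :
    IsComp α β γ ↔ Nonempty (Edge.CompStruct α.fe β.fe γ.fe) := by
  constructor
  · rintro ⟨t, h2, h0, h1⟩
    refine ⟨Edge.CompStruct.mk (untr t) (tr_injective ?_) (tr_injective ?_) (tr_injective ?_)⟩
    · rw [tr_δ, tr_untr, h2, fe_edge, tr_toEdge]
    · rw [tr_δ, tr_untr, h0, fe_edge, tr_toEdge]
    · rw [tr_δ, tr_untr, h1, fe_edge, tr_toEdge]
  · rintro ⟨c⟩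
    refine ⟨tr c.simplex, ?_, ?_, ?_⟩
    · rw [← tr_δ, c.d₂, fe_edge, tr_toEdge]
    · rw [← tr_δ, c.d₀, fe_edge, tr_toEdge]
    · rw [← tr_δ, c.d₁, fe_edge, tr_toEdge]

lemma fe_id (F : A ⟶ B) : (Trans.id F).fe = Edge.id (asVertex F) := by
  apply Edge.ext
  apply tr_injective
  rw [fe_edge, tr_toEdge, Edge.id_edge, tr_σ, tr_asVertex, ← Category.assoc, whiskerLeft_fst]
  rfl

/-- The homotopy class of a natural transformation. -/
def ho [Quasicategory B] (α : Trans F G) : Ho.of (asVertex F) ⟶ Ho.of (asVertex G) := Ho.hom α.fe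

lemma ho_surjective [Quasicategory B] : Function.Surjective (ho : Trans F G → _) := fun f => by
  obtain ⟨e, rfl⟩ := Ho.hom_surjective f
  exact ⟨ofEdge e, by rw [ho, fe_ofEdge]⟩

lemma ho_id [Quasicategory B] (F : A ⟶ B) : (Trans.id F).ho = 𝟙 (Ho.of (asVertex F)) := by
  rw [ho, fe_id, Ho.hom_id]

lemma isComp_iff_ho [Quasicategory B] (α : Trans F G) (β : Trans G H) (γ : Trans F H) :
    IsComp α β γ ↔ α.ho ≫ β.ho = γ.ho := by
  rw [isComp_iff, Ho.nonempty_compStruct_iff, ho, ho, ho]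

lemma whiskerLeft_toEdge (K : A' ⟶ A) (α : Trans F G) :
    (whiskerLeft K α).toEdge = (Fun.pre K B).app _ α.toEdge := by
  apply tr_injective
  rw [tr_pre, tr_toEdge, tr_toEdge]
  rfl

end Trans

/-- Evaluation of functors at an object. -/
def evalAt (B : SSet.{u}) (a : A _⦋0⦌) : Fun A B ⟶ B :=
  lift (SSet.const a) (𝟙 _) ≫ (ihom.ev A).app B

lemma comp_evalAt {X : SSet.{u}} (a : A _⦋0⦌) (w : X ⟶ Fun A B) :
    w ≫ evalAt B a = lift (SSet.const a) (𝟙 X) ≫ MonoidalClosed.uncurry w := by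
  rw [evalAt, MonoidalClosed.uncurry_eq, ← Category.assoc, ← Category.assoc]
  congr 1

lemma evalAt_app (a : A _⦋0⦌) {n : ℕ} (x : (Fun A B) _⦋n⦌) :
    (evalAt B a).app _ x = (tr x).app (op ⦋n⦌) (A.map (SimplexCategory.const ⦋n⦌ ⦋0⦌ 0).op a,
      stdSimplex.objEquiv.symm (𝟙 _)) := by
  have h := congrArg SSet.yonedaEquiv (comp_evalAt a (SSet.yonedaEquiv.symm x))
  rw [SSet.yonedaEquiv_comp, Equiv.apply_symm_apply] at h
  exact h

lemma evalAt_toEdge (a : A _⦋0⦌) {F G : A ⟶ B} (α : Trans F G) :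
    (evalAt B a).app _ α.toEdge = (α.app a).edge := by
  rw [evalAt_app, Trans.tr_toEdge]
  refine congrArg (α.hom.app _) (Prod.ext ?_ ?_)
  · exact congrArg (fun f : (⦋1⦌ : SimplexCategory) ⟶ ⦋0⦌ => A.map f.op a) (Subsingleton.elim _ _)
  ext i; fin_cases i <;> rfl

end

/-! ### Extension of natural equivalences -/

section

variable {D : SSet.{u}} [Quasicategory D]

/-- Evaluation at the source, on the quasicategory of arrows. -/
abbrev src (D : SSet.{u}) : Fun Δ[1] D ⟶ D := evalAt D (pt1 0)

/-- Maps from a cylinder, as maps to the quasicategory of arrows. -/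
def cyl {K D : SSet.{u}} (u : K ⊗ Δ[1] ⟶ D) : K ⟶ Fun Δ[1] D :=
  MonoidalClosed.curry ((β_ _ _).hom ≫ u)

/-- Maps to the quasicategory of arrows, as maps from a cylinder. -/
def uncyl {K D : SSet.{u}} (u : K ⟶ Fun Δ[1] D) : K ⊗ Δ[1] ⟶ D :=
  (β_ _ _).hom ≫ MonoidalClosed.uncurry u

@[simp] lemma cyl_uncyl {K D : SSet.{u}} (u : K ⟶ Fun Δ[1] D) : cyl (uncyl u) = u := by
  simp [cyl, uncyl]

@[simp] lemma uncyl_cyl {K D : SSet.{u}} (u : K ⊗ Δ[1] ⟶ D) : uncyl (cyl u) = u := by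
  simp [cyl, uncyl]

lemma comp_cyl {K L D : SSet.{u}} (i : K ⟶ L) (u : L ⊗ Δ[1] ⟶ D) :
    i ≫ cyl u = cyl (i ▷ _ ≫ u) := by
  rw [cyl, cyl, ← MonoidalClosed.curry_natural_left]
  rfl

lemma comp_uncyl {K L D : SSet.{u}} (i : K ⟶ L) (u : L ⟶ Fun Δ[1] D) :
    i ▷ _ ≫ uncyl u = uncyl (i ≫ u) := by
  rw [← uncyl_cyl (i ▷ _ ≫ uncyl u), ← comp_cyl, cyl_uncyl]

lemma uncyl_src {K D : SSet.{u}} (u : K ⟶ Fun Δ[1] D) : u ≫ src D = ι₀ ≫ uncyl u := by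
  rw [comp_evalAt]
  rfl

lemma uncyl_app {K D : SSet.{u}} (u : K ⟶ Fun Δ[1] D) (k : K _⦋0⦌) (s) :
    (uncyl u).app (op ⦋1⦌) (K.σ 0 k, s) =
      (((ihom.ev Δ[1]).app D).app _ (s, (Fun Δ[1] D).σ 0 (u.app _ k)) : D _⦋1⦌) := by
  rw [uncyl, MonoidalClosed.uncurry_eq]
  have h : u.app (op ⦋1⦌) (K.σ 0 k) = (Fun Δ[1] D).σ 0 (u.app _ k) :=
    NatTrans.naturality_apply u _ k
  exact congrArg (fun z => (((ihom.ev Δ[1]).app D).app (op ⦋1⦌) (s, z) : D _⦋1⦌)) h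

/-- A sphere of arrows with prescribed filling of the sources is a prism over ∂Δ[n+1] with
prescribed bottom. Only the arrow at the first vertex has to be an equivalence for it to be filled.
-/
lemma relInitial_src (x : (Fun Δ[1] D) _⦋0⦌)
    (hx : IsEquiv (((ihom.ev Δ[1]).app D).app _ (e01, (Fun Δ[1] D).σ 0 x) : D _⦋1⦌)) :
    RelInitial (src D) x := by
  intro n u v huv hu
  obtain ⟨w, hw1, hw2⟩ := exists_prism_filler n (uncyl u) v (by rw [← uncyl_src, huv]) (by
    rw [uncyl_app, hu]
    exact hx)
  refine ⟨cyl w, ?_, ?_⟩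
  · rw [comp_cyl, hw1, cyl_uncyl]
  · rw [uncyl_src, uncyl_cyl, hw2]

/-- Extension of natural transformations whose components are equivalences. -/
theorem exists_extension_of_isEquiv {K L : SSet.{u}} (i : K ⟶ L) [Mono i] (u : K ⊗ Δ[1] ⟶ D)
    (v : L ⟶ D) (h : ι₀ ≫ u = i ≫ v)
    (hcell : ∀ (n : ℕ) (l : L _⦋n⦌), l ∉ Set.range (i.app (op ⦋n⦌)) →
      n ≠ 0 ∧ ∃ k : K _⦋0⦌, i.app _ k = firstVertex l ∧
        IsEquiv (u.app (op ⦋1⦌) (K.σ 0 k, e01))) :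
    ∃ w : L ⊗ Δ[1] ⟶ D, i ▷ _ ≫ w = u ∧ ι₀ ≫ w = v := by
  obtain ⟨w, hw1, hw2⟩ := exists_lift_of_relInitial i (src D) (cyl u) v
    (by rw [uncyl_src, uncyl_cyl, h]) (fun n l hl => by
      obtain ⟨hn, k, hk, hk'⟩ := hcell n l hl
      refine ⟨hn, k, hk, relInitial_src _ ?_⟩
      rw [← uncyl_app, uncyl_cyl]
      exact hk')
  refine ⟨uncyl w, ?_, ?_⟩
  · rw [comp_uncyl, hw1, uncyl_cyl]
  · rw [← uncyl_src, hw2]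

end

/-! ### Pointwise equivalences -/

section

variable {A D : SSet.{u}} [Quasicategory D]

/-- A map of simplicial sets from the boundary of the interval. -/
lemma exists_hom_boundary_one {X E : SSet.{u}} (f g : X ⟶ E) :
    ∃ h : X ⊗ (∂Δ[1] : SSet.{u}) ⟶ E, atVertex X (bdVertex 0 0) ≫ h = f ∧
      atVertex X (bdVertex 0 1) ≫ h = g := by
  have hm : ∀ i : Fin 2, Mono (atVertex X (bdVertex 0 i)) := fun i =>
    mono_of_mono_fac (lift_fst (𝟙 X) _)
  have := hm 0
  have := hm 1
  refine exists_glue₂ _ _ f g (fun U x => ?_) (fun U a b hab => ?_)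
  · obtain ⟨j, hj⟩ := (mem_boundary_iff_vx _).1 x.2.2
    have h2 : ∀ i k : Fin 2, i ≠ k → i = 1 - k := by decide
    have h3 : ∀ t, vx x.2.1 t = 1 - j := fun t => h2 _ _ (hj t)
    obtain rfl | rfl := eq_zero_or_one j
    · exact Or.inr ⟨x.1, Prod.ext rfl (Subtype.ext (vx_ext fun t => (h3 t).symm))⟩
    · exact Or.inl ⟨x.1, Prod.ext rfl (Subtype.ext (vx_ext fun t => (h3 t).symm))⟩
  · have h1 := congrArg (fun z : (X ⊗ (∂Δ[1] : SSet.{u})).obj U => vx z.2.1 0) hab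
    exact absurd h1 (by decide : (0 : Fin 2) ≠ 1)

lemma hom_ext_boundary_one {X E : SSet.{u}} {f g : X ⊗ (∂Δ[1] : SSet.{u}) ⟶ E}
    (h : ∀ i : Fin 2, atVertex X (bdVertex 0 i) ≫ f = atVertex X (bdVertex 0 i) ≫ g) : f = g := by
  ext U x
  obtain ⟨j, hj⟩ := (mem_boundary_iff_vx _).1 x.2.2
  have h2 : ∀ i k : Fin 2, i ≠ k → i = 1 - k := by decide
  have h3 : ∀ t, vx x.2.1 t = 1 - j := fun t => h2 _ _ (hj t)
  have h4 : (atVertex X (bdVertex 0 (1 - j))).app U x.1 = x :=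
    Prod.ext rfl (Subtype.ext (vx_ext fun t => (h3 t).symm))
  rw [← h4]
  exact app_congr (h (1 - j)) x.1

lemma square_comm' (σ : Sq.{u} ⟶ D) {x y z w : D _⦋0⦌} (t : Edge x y) (r : Edge y w)
    (l : Edge x z) (b : Edge z w) (ht : horizontal σ 0 = t.edge) (hr : vertical σ 1 = r.edge)
    (hl : vertical σ 0 = l.edge) (hb : horizontal σ 1 = b.edge) :
    Ho.hom t ≫ Ho.hom r = Ho.hom l ≫ Ho.hom b := by
  obtain rfl : corner σ 0 0 = x := by
    rw [← t.src_eq, ← ht]; exact (hEdge σ 0).src_eq.symm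
  obtain rfl : corner σ 1 0 = y := by
    rw [← t.tgt_eq, ← ht]; exact (hEdge σ 0).tgt_eq.symm
  obtain rfl : corner σ 0 1 = z := by
    rw [← b.src_eq, ← hb]; exact (hEdge σ 1).src_eq.symm
  obtain rfl : corner σ 1 1 = w := by
    rw [← b.tgt_eq, ← hb]; exact (hEdge σ 1).tgt_eq.symm
  obtain rfl : hEdge σ 0 = t := Edge.ext ht
  obtain rfl : hEdge σ 1 = b := Edge.ext hb
  obtain rfl : vEdge σ 0 = l := Edge.ext hl
  obtain rfl : vEdge σ 1 = r := Edge.ext hr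
  exact square_comm σ

lemma yonedaEquiv_symm_e01 : SSet.yonedaEquiv.symm (e01 : (Δ[1] : SSet.{u}) _⦋1⦌) = 𝟙 _ := by
  apply SSet.yonedaEquiv.injective
  rw [Equiv.apply_symm_apply]
  ext i; fin_cases i <;> rfl

lemma yonedaEquiv_symm_prod {X Y : SSet.{u}} {n : ℕ} (x : X _⦋n⦌) (y : Y _⦋n⦌) :
    SSet.yonedaEquiv.symm (show (X ⊗ Y) _⦋n⦌ from (x, y)) =
      lift (SSet.yonedaEquiv.symm x) (SSet.yonedaEquiv.symm y) := rfl

lemma yonedaEquiv_symm_cst (b : Fin 2) :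
    SSet.yonedaEquiv.symm (cst b : (Δ[1] : SSet.{u}) _⦋1⦌) = SSet.const (pt1 b) := rfl

/-- The square of functors associated to a map from a product. -/
def funSquare {A D : SSet.{u}} (w : (A ⊗ Δ[1]) ⊗ Δ[1] ⟶ D) : Sq.{u} ⟶ Fun A D :=
  MonoidalClosed.curry ((α_ _ _ _).inv ≫ w)

lemma tr_funSquare_horizontal (w : (A ⊗ Δ[1]) ⊗ Δ[1] ⟶ D) (b : Fin 2) :
    tr (horizontal (funSquare w) b) = atVertex _ (pt1 b) ≫ w := by
  refine (tr_app (funSquare w) (show Sq _⦋1⦌ from (e01, cst b))).trans ?_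
  rw [funSquare, MonoidalClosed.uncurry_curry, ← Category.assoc, yonedaEquiv_symm_prod,
    yonedaEquiv_symm_e01, yonedaEquiv_symm_cst]
  congr 1

lemma tr_funSquare_vertical (w : (A ⊗ Δ[1]) ⊗ Δ[1] ⟶ D) (a : Fin 2) :
    tr (vertical (funSquare w) a) = atVertex A (pt1 a) ▷ _ ≫ w := by
  refine (tr_app (funSquare w) (show Sq _⦋1⦌ from (cst a, e01))).trans ?_
  rw [funSquare, MonoidalClosed.uncurry_curry, ← Category.assoc, yonedaEquiv_symm_prod,
    yonedaEquiv_symm_e01, yonedaEquiv_symm_cst]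
  congr 1

/-- The exchange of the last two factors. -/
def swapRight (A K L : SSet.{u}) : (A ⊗ K) ⊗ L ⟶ (A ⊗ L) ⊗ K :=
  lift (lift (fst _ _ ≫ fst _ _) (snd _ _)) (fst _ _ ≫ snd _ _)

lemma ι₀_swapRight (A K : SSet.{u}) : ι₀ ≫ swapRight A K Δ[1] = ι₀ ▷ K := by
  apply CartesianMonoidalCategory.hom_ext
  · apply CartesianMonoidalCategory.hom_ext <;> simp [swapRight]
  · simp [swapRight]

lemma whiskerRight_swapRight {A K L : SSet.{u}} (x : K _⦋0⦌) :
    atVertex A x ▷ L ≫ swapRight A K L = atVertex (A ⊗ L) x := by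
  apply CartesianMonoidalCategory.hom_ext
  · apply CartesianMonoidalCategory.hom_ext <;> simp [swapRight, atVertex]
  · simp [swapRight, atVertex]

lemma atVertex_bdVertex {A : SSet.{u}} (i : Fin 2) : atVertex A (bdVertex 0 i) ≫
    A ◁ (∂Δ[1] : (Δ[1] : SSet.{u}).Subcomplex).ι = atVertex A (pt1 i) := by
  have h : (∂Δ[1] : (Δ[1] : SSet.{u}).Subcomplex).ι.app (op ⦋0⦌) (bdVertex 0 i) = pt1 i := rfl
  rw [← h]
  apply CartesianMonoidalCategory.hom_ext <;> simp [atVertex]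

lemma atVertex_whiskerRight {A B K : SSet.{u}} (f : A ⟶ B) (x : K _⦋0⦌) :
    atVertex A x ≫ f ▷ K = f ≫ atVertex B x := by
  apply CartesianMonoidalCategory.hom_ext <;> simp [atVertex]

lemma ι₀_eq_atVertex (A : SSet.{u}) : (ι₀ : A ⟶ _) = atVertex A (pt1 0) := rfl

lemma ι₁_eq_atVertex (A : SSet.{u}) : (ι₁ : A ⟶ _) = atVertex A (pt1 1) := rfl

lemma ι₀_ι₁ {A : SSet.{u}} :
    (ι₀ : A ⟶ _) ≫ (ι₁ : A ⊗ Δ[1] ⟶ _) = ι₁ ≫ atVertex A (pt1 0) ▷ Δ[1] := by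
  rw [ι₀_eq_atVertex, ι₁_eq_atVertex, ι₁_eq_atVertex, atVertex_whiskerRight]

lemma ι₁_ι₁ {A : SSet.{u}} :
    (ι₁ : A ⟶ _) ≫ (ι₁ : A ⊗ Δ[1] ⟶ _) = ι₁ ≫ atVertex A (pt1 1) ▷ Δ[1] := by
  rw [ι₁_eq_atVertex, ι₁_eq_atVertex, atVertex_whiskerRight]

lemma swapRight_app_degenerate {A K L : SSet.{u}} (a : A _⦋0⦌) (k : K _⦋0⦌) (l : L _⦋1⦌) :
    (swapRight A K L).app (op ⦋1⦌) ((A ⊗ K).σ 0 (a, k), l) =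
      (atVertex (A ⊗ L) k).app (op ⦋1⦌) (A.σ 0 a, l) := by
  have h : K.σ 0 k = (SSet.const (X := A ⊗ L) k).app (op ⦋1⦌) (A.σ 0 a, l) :=
    congrArg (fun f : (⦋1⦌ : SimplexCategory) ⟶ ⦋0⦌ => K.map f.op k) (Subsingleton.elim _ _)
  exact Prod.ext rfl h

lemma atVertex_fst {A K : SSet.{u}} (x : K _⦋0⦌) : atVertex A x ≫ fst _ _ = 𝟙 _ :=
  lift_fst _ _

lemma atVertex_whiskerLeft {A K L : SSet.{u}} (f : K ⟶ L) (x : K _⦋0⦌) :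
    atVertex A x ≫ A ◁ f = atVertex A (f.app _ x) := by
  apply CartesianMonoidalCategory.hom_ext <;> simp [atVertex]

lemma firstVertex_of_notMem_boundary {n : ℕ} (s : (Δ[1] : SSet.{u}) _⦋n⦌)
    (h : s ∉ (∂Δ[1] : (Δ[1] : SSet.{u}).Subcomplex).obj (op ⦋n⦌)) :
    n ≠ 0 ∧ firstVertex s = pt1 0 := by
  have hs : ∀ j, ∃ t, vx s t = j := by
    by_contra! hs
    exact h ((mem_boundary_iff_vx _).2 hs)
  have hs0 : vx s 0 = 0 := by
    obtain ⟨t, ht⟩ := hs 0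
    exact Fin.le_zero_iff.1 (ht ▸ (vx s).monotone (Fin.zero_le t))
  refine ⟨?_, vx_ext fun t => hs0⟩
  rintro rfl
  obtain ⟨t, ht⟩ := hs 1
  rw [Subsingleton.elim (α := Fin 1) t 0, hs0] at ht
  exact absurd ht (by decide)

lemma exists_firstVertex_of_notMem_range {A : SSet.{u}} {n : ℕ} (a : A _⦋n⦌)
    (s : (Δ[1] : SSet.{u}) _⦋n⦌) (h : (show (A ⊗ Δ[1]) _⦋n⦌ from (a, s)) ∉
      Set.range ((A ◁ (∂Δ[1] : (Δ[1] : SSet.{u}).Subcomplex).ι).app (op ⦋n⦌))) :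
    n ≠ 0 ∧ (A ◁ (∂Δ[1] : (Δ[1] : SSet.{u}).Subcomplex).ι).app (op ⦋0⦌)
      (firstVertex a, bdVertex 0 0) = firstVertex (show (A ⊗ Δ[1]) _⦋n⦌ from (a, s)) := by
  obtain ⟨hn, hs⟩ := firstVertex_of_notMem_boundary s
    fun h' => h ⟨(a, ⟨s, h'⟩), rfl⟩
  exact ⟨hn, Prod.ext rfl hs.symm⟩

namespace Trans

variable {F G H K : A ⟶ D}

lemma ho_square_comm (w : (A ⊗ Δ[1]) ⊗ Δ[1] ⟶ D) (t : Trans F G) (r : Trans G K)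
    (l : Trans F H) (b : Trans H K) (ht : ι₀ ≫ w = t.hom) (hr : atVertex A (pt1 1) ▷ _ ≫ w = r.hom)
    (hl : atVertex A (pt1 0) ▷ _ ≫ w = l.hom) (hb : ι₁ ≫ w = b.hom) :
    t.ho ≫ r.ho = l.ho ≫ b.ho := by
  refine square_comm' (funSquare w) t.fe r.fe l.fe b.fe ?_ ?_ ?_ ?_ <;>
    refine tr_injective (Eq.trans ?_ (tr_toEdge _).symm)
  · rw [tr_funSquare_horizontal, ← ht]; rfl
  · rw [tr_funSquare_vertical, hr]
  · rw [tr_funSquare_vertical, hl]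
  · rw [tr_funSquare_horizontal, ← hb]; rfl

lemma app_id (a : A _⦋0⦌) : (Trans.id F).app a = Edge.id (obj F a) := by
  apply Edge.ext
  exact (SSet.σ_naturality_apply F _ _)

lemma app_comp (a : A _⦋0⦌) (α : Trans F G) (β : Trans G H) (γ : Trans F H)
    (h : α.ho ≫ β.ho = γ.ho) : Ho.hom (α.app a) ≫ Ho.hom (β.app a) = Ho.hom (γ.app a) := by
  obtain ⟨c⟩ := (isComp_iff _ _ _).1 ((isComp_iff_ho _ _ _).2 h)
  exact Ho.fac ((c.map (evalAt D a)).ofEq (evalAt_toEdge a α) (evalAt_toEdge a β)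
    (evalAt_toEdge a γ))

lemma app_edge (φ : Trans F G) (a : A _⦋0⦌) :
    (φ.app a).edge = φ.hom.app (op ⦋1⦌) (A.σ 0 a, e01) := rfl

lemma isEquiv_swapRight_comp {K : SSet.{u}} (φ : Trans F G) (k : K _⦋0⦌) (a : A _⦋0⦌)
    (hφ : CategoryTheory.IsIso (Ho.hom (φ.app a))) (u : (A ⊗ Δ[1]) ⊗ K ⟶ D)
    (hu : atVertex (A ⊗ Δ[1]) k ≫ u = φ.hom) :
    IsEquiv ((swapRight A K Δ[1] ≫ u).app (op ⦋1⦌) ((A ⊗ K).σ 0 (a, k), e01)) := by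
  have h1 : u.app (op ⦋1⦌) ((atVertex (A ⊗ Δ[1]) k).app (op ⦋1⦌) (A.σ 0 a, e01)) =
    (φ.app a).edge := by
    rw [app_edge, ← hu]
    rfl
  have h2 : (swapRight A K Δ[1] ≫ u).app (op ⦋1⦌) ((A ⊗ K).σ 0 (a, k), e01) =
    u.app (op ⦋1⦌) ((swapRight A K Δ[1]).app (op ⦋1⦌) ((A ⊗ K).σ 0 (a, k), e01)) := rfl
  rw [h2, swapRight_app_degenerate, h1]
  exact (isEquiv_edge_iff _).2 hφ

/-- Consider a square of functors with left side φ, right side the identity of F and top constant at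
F. Since the left components are equivalences, it can be filled relative to its top, and the bottom
side is ψ; commutativity reads φ ψ = 1. -/
lemma exists_right_inverse (φ : Trans F G)
    (hφ : ∀ a, CategoryTheory.IsIso (Ho.hom (φ.app a))) :
    ∃ ψ : Trans G F, φ.ho ≫ ψ.ho = 𝟙 _ := by
  obtain ⟨u, hu0, hu1⟩ := exists_hom_boundary_one (X := A ⊗ Δ[1]) φ.hom (Trans.id F).hom
  obtain ⟨w, hw1, hw2⟩ := exists_extension_of_isEquiv (A ◁ (∂Δ[1] : (Δ[1] : SSet.{u}).Subcomplex).ι)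
    (swapRight A _ _ ≫ u) (fst A Δ[1] ≫ F) (by
      refine hom_ext_boundary_one fun i => ?_
      rw [← Category.assoc ι₀, ι₀_swapRight, ← Category.assoc, atVertex_whiskerRight,
        Category.assoc, whiskerLeft_fst_assoc,
        ← Category.assoc (atVertex _ _) (fst _ _), atVertex_fst, Category.id_comp]
      obtain rfl | rfl := eq_zero_or_one i
      · rw [hu0, φ.source]
      · rw [hu1, (Trans.id F).source])
    (by
      rintro n ⟨a, s⟩ hl
      obtain ⟨hn, hs⟩ := exists_firstVertex_of_notMem_range a s hl
      refine ⟨hn, (firstVertex a, bdVertex 0 0), hs, ?_⟩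
      exact isEquiv_swapRight_comp φ _ _ (hφ _) u hu0)
  have h3 : ∀ i, atVertex A (pt1 i) ▷ _ ≫ w = atVertex (A ⊗ Δ[1]) (bdVertex 0 i) ≫ u := by
    intro i
    rw [← atVertex_bdVertex, comp_whiskerRight, Category.assoc, hw1, ← Category.assoc, whiskerRight_swapRight]
  refine ⟨⟨ι₁ ≫ w, ?_, ?_⟩, ?_⟩
  · have h5 : ι₀ ≫ ι₁ ≫ w = ι₁ ≫ atVertex A (pt1 0) ▷ _ ≫ w := by
      rw [← Category.assoc, ← Category.assoc, ι₀_ι₁]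
    rw [h5, h3, hu0, φ.target]
  · have h5 : ι₁ ≫ ι₁ ≫ w = ι₁ ≫ atVertex A (pt1 1) ▷ _ ≫ w := by
      rw [← Category.assoc, ← Category.assoc, ι₁_ι₁]
    rw [h5, h3, hu1, (Trans.id F).target]
  · rw [← ho_square_comm w (Trans.id F) (Trans.id F) φ _ hw2 ((h3 1).trans hu1)
      ((h3 0).trans hu0) rfl, ho_id, Category.comp_id]

/-- A natural transformation is an isomorphism when its components are. -/
theorem isIso_ho (φ : Trans F G)
    (hφ : ∀ a, CategoryTheory.IsIso (Ho.hom (φ.app a))) : CategoryTheory.IsIso φ.ho := by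
  obtain ⟨ψ, hψ⟩ := φ.exists_right_inverse hφ
  -- The components of ψ are inverse to equivalences, so the construction applies to ψ as well.
  -- Being invertible on both sides, ψ is inverse to φ.
  obtain ⟨χ, hχ⟩ := ψ.exists_right_inverse fun a => by
    have h1 := app_comp a φ ψ (Trans.id F) (by rw [hψ, ho_id])
    rw [app_id, Ho.hom_id] at h1
    have := hφ a
    rw [IsIso.eq_inv_of_hom_inv_id h1]
    infer_instance
  have h3 : φ.ho = χ.ho := by
    rw [← Category.comp_id φ.ho, ← hχ, ← Category.assoc, hψ, Category.id_comp]
  exact ⟨ψ.ho, hψ, by rw [h3, hχ]⟩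

end Trans

end

/-! ### Homotopy categories of functors and of objects -/

namespace Trans

variable {K' K A B C : SSet.{u}}

lemma IsComp.whiskerRight {F G H : A ⟶ B} {α : Trans F G} {β : Trans G H} {γ : Trans F H}
    (h : IsComp α β γ) (L : B ⟶ C) :
    IsComp (α.whiskerRight L) (β.whiskerRight L) (γ.whiskerRight L) := by
  obtain ⟨t, h2, h0, h1⟩ := h
  refine ⟨t ≫ L, ?_, ?_, ?_⟩ <;> rw [← Category.assoc]
  · rw [h2]; rfl
  · rw [h0]; rfl
  · rw [h1]; rfl

lemma IsComp.whiskerLeft {F G H : A ⟶ B} {α : Trans F G} {β : Trans G H} {γ : Trans F H}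
    (h : IsComp α β γ) (k : K ⟶ A) :
    IsComp (Trans.whiskerLeft k α) (Trans.whiskerLeft k β) (Trans.whiskerLeft k γ) := by
  obtain ⟨t, h2, h0, h1⟩ := h
  have key : ∀ d : (Δ[1] : SSet.{u}) ⟶ Δ[2], K ◁ d ≫ k ▷ _ ≫ t = k ▷ _ ≫ A ◁ d ≫ t := fun d => by
    rw [whisker_exchange_assoc]
  refine ⟨k ▷ _ ≫ t, ?_, ?_, ?_⟩
  · exact (key _).trans (congrArg (k ▷ Δ[1] ≫ ·) h2)
  · exact (key _).trans (congrArg (k ▷ Δ[1] ≫ ·) h0)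
  · exact (key _).trans (congrArg (k ▷ Δ[1] ≫ ·) h1)

lemma app_whiskerLeft (k : K ⟶ A) {F G : A ⟶ B} (α : Trans F G) (x : K _⦋0⦌) :
    (Trans.whiskerLeft k α).app x = α.app (obj k x) := by
  apply Edge.ext
  have h : k.app (op ⦋1⦌) (K.σ 0 x) = A.σ 0 (obj k x) := NatTrans.naturality_apply k _ x
  exact congrArg (fun z => α.hom.app (op ⦋1⦌) (z, e01)) h

end Trans

/-- The homotopy category of the quasicategory of functors. -/
structure FunHo (K D : SSet.{u}) where
  /-- the underlying functor -/
  fn : K ⟶ D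

/-- The homotopy category of a quasicategory, with vertices as objects. -/
structure Hc (D : SSet.{u}) where
  /-- the underlying vertex -/
  pt : D _⦋0⦌

instance (K D : SSet.{u}) [Quasicategory D] : Category.{u} (FunHo K D) where
  Hom F G := Ho.of (asVertex F.fn) ⟶ Ho.of (asVertex G.fn)
  id F := 𝟙 (Ho.of (asVertex F.fn))
  comp f g := CategoryStruct.comp (obj := Ho (Fun K D)) f g
  id_comp f := Category.id_comp (obj := Ho (Fun K D)) f
  comp_id f := Category.comp_id (obj := Ho (Fun K D)) f
  assoc f g h := Category.assoc (obj := Ho (Fun K D)) f g h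

instance (D : SSet.{u}) [Quasicategory D] : Category.{u} (Hc D) where
  Hom X Y := Ho.of X.pt ⟶ Ho.of Y.pt
  id X := 𝟙 (Ho.of X.pt)
  comp f g := CategoryStruct.comp (obj := Ho D) f g
  id_comp f := Category.id_comp (obj := Ho D) f
  comp_id f := Category.comp_id (obj := Ho D) f
  assoc f g h := Category.assoc (obj := Ho D) f g h

lemma yonedaEquiv_symm_app_e01 {X : SSet.{u}} (s : X _⦋1⦌) :
    (SSet.yonedaEquiv.symm s).app (op ⦋1⦌) e01 = s := by
  have h := SSet.yonedaEquiv_comp (SSet.yonedaEquiv.symm (e01 : (Δ[1] : SSet.{u}) _⦋1⦌))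
    (SSet.yonedaEquiv.symm s)
  rw [Equiv.apply_symm_apply, yonedaEquiv_symm_e01, Category.id_comp, Equiv.apply_symm_apply] at h
  exact h.symm

lemma yonedaEquiv_symm_app_cst {X : SSet.{u}} (s : X _⦋1⦌) (a : Fin 2) :
    (SSet.yonedaEquiv.symm s).app (op ⦋1⦌) (cst a) = X.σ 0 (X.δ (1 - a) s) := by
  have h1 : (cst a : (Δ[1] : SSet.{u}) _⦋1⦌) =
      (Δ[1] : SSet.{u}).σ 0 ((Δ[1] : SSet.{u}).δ (1 - a) e01) := by
    obtain rfl | rfl := eq_zero_or_one a <;> ext i <;> fin_cases i <;> rfl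
  conv_rhs => rw [← yonedaEquiv_symm_app_e01 s]
  rw [h1]
  exact (NatTrans.naturality_apply _ _ _).trans
    (congrArg (X.σ 0) (NatTrans.naturality_apply _ _ _))

namespace Hc

section

variable {D E : SSet.{u}} [Quasicategory D] [Quasicategory E] {x y z : D _⦋0⦌}

/-- The homotopy class of an edge. -/
def hom (f : Edge x y) : (⟨x⟩ : Hc D) ⟶ ⟨y⟩ := Ho.hom f

lemma hom_surjective : Function.Surjective (hom : Edge x y → _) := Ho.hom_surjective

lemma hom_id (x : D _⦋0⦌) : hom (Edge.id x) = 𝟙 (⟨x⟩ : Hc D) := Ho.hom_id x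

lemma nonempty_compStruct_iff {f : Edge x y} {g : Edge y z} {h : Edge x z} :
    Nonempty (Edge.CompStruct f g h) ↔ hom f ≫ hom g = hom h := Ho.nonempty_compStruct_iff

lemma hom_eq_iff {f g : Edge x y} :
    hom f = hom g ↔ Nonempty (Edge.CompStruct f (Edge.id y) g) := Ho.hom_eq_iff

lemma isIso_iff {F G : Hc D} (f : F ⟶ G) :
    IsIso f ↔ CategoryTheory.IsIso (C := Ho D) (X := Ho.of F.pt) (Y := Ho.of G.pt) f :=
  ⟨fun ⟨g, h1, h2⟩ => ⟨g, h1, h2⟩, fun ⟨g, h1, h2⟩ => ⟨g, h1, h2⟩⟩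

lemma isIso_hom_iff {f : Edge x y} : IsIso (hom f) ↔ Nonempty f.InvStruct :=
  (isIso_iff _).trans Ho.isIso_hom_iff

lemma equivalent_iff : Equivalent x y ↔ Nonempty ((⟨x⟩ : Hc D) ≅ ⟨y⟩) := by
  constructor
  · rintro ⟨e, he⟩
    have := isIso_hom_iff.2 he
    exact ⟨asIso (hom e)⟩
  · rintro ⟨e⟩
    obtain ⟨f, hf⟩ := hom_surjective e.hom
    have : IsIso (hom f) := by rw [hf]; infer_instance
    exact ⟨f, isIso_hom_iff.1 this⟩

/-- The functor between homotopy categories induced by a functor of quasicategories. -/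
def map (F : D ⟶ E) : Hc D ⥤ Hc E where
  obj X := ⟨obj F X.pt⟩
  map f := Ho.mapHom F f
  map_id X := Ho.mapHom_id F X.pt
  map_comp f g := Ho.mapHom_comp F f g

lemma hom_app_id (F : D ⟶ E) (x : D _⦋0⦌) : hom ((Trans.id F).app x) = 𝟙 _ := by
  rw [Trans.app_id]
  exact hom_id _

lemma hom_app_comp {F G H : D ⟶ E} {α : Trans F G} {β : Trans G H} {γ : Trans F H}
    (h : Trans.IsComp α β γ) (x : D _⦋0⦌) : hom (α.app x) ≫ hom (β.app x) = hom (γ.app x) :=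
  Trans.app_comp x α β γ ((Trans.isComp_iff_ho _ _ _).1 h)

end

lemma app_naturality {D E : SSet.{u}} [Quasicategory E] {F G : D ⟶ E} (α : Trans F G)
    {x y : D _⦋0⦌} (f : Edge x y) :
    hom (f.map F) ≫ hom (α.app y) = hom (α.app x) ≫ hom (f.map G) := by
  refine square_comm' (SSet.yonedaEquiv.symm f.edge ▷ Δ[1] ≫ α.hom) (f.map F) (α.app y) (α.app x)
    (f.map G) ?_ ?_ ?_ ?_
  · refine Eq.trans ?_ (app_congr α.source f.edge)
    exact congrArg (α.hom.app _) (Prod.ext (yonedaEquiv_symm_app_e01 _) rfl)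
  · exact congrArg (α.hom.app _) (Prod.ext
      ((yonedaEquiv_symm_app_cst _ _).trans (congrArg (D.σ 0) f.tgt_eq)) rfl)
  · exact congrArg (α.hom.app _) (Prod.ext
      ((yonedaEquiv_symm_app_cst _ _).trans (congrArg (D.σ 0) f.src_eq)) rfl)
  · refine Eq.trans ?_ (app_congr α.target f.edge)
    exact congrArg (α.hom.app _) (Prod.ext (yonedaEquiv_symm_app_e01 _) rfl)

section

variable {D E : SSet.{u}} [Quasicategory D] [Quasicategory E] {x y z : D _⦋0⦌}

/-- The natural transformation of functors on homotopy categories induced by a natural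
transformation of functors of quasicategories. -/
def mapTrans {F G : D ⟶ E} (α : Trans F G) : map F ⟶ map G where
  app X := hom (α.app X.pt)
  naturality X Y f := by
    obtain ⟨f, rfl⟩ := hom_surjective f
    exact app_naturality α f

lemma isIso_mapTrans_app {F G : D ⟶ E} (α : Trans F G) (h : α.IsIso) (X : Hc D) :
    IsIso ((mapTrans α).app X) := by
  obtain ⟨β, h1, h2⟩ := h
  exact ⟨hom (β.app X.pt), (hom_app_comp h1 _).trans (hom_app_id _ _),
    (hom_app_comp h2 _).trans (hom_app_id _ _)⟩

/-- An adjunction of quasicategories induces an adjunction of homotopy categories. -/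
def adj {L : D ⟶ E} {R : E ⟶ D} (a : Adj L R) : map L ⊣ map R where
  unit :=
    { app := (mapTrans a.unit).app
      naturality := fun X Y f => by
        obtain ⟨f, rfl⟩ := hom_surjective f
        exact app_naturality a.unit f }
  counit :=
    { app := (mapTrans a.counit).app
      naturality := fun X Y f => by
        obtain ⟨f, rfl⟩ := hom_surjective f
        exact app_naturality a.counit f }
  left_triangle_components X :=
    (congrArg (hom ((a.unit.app X.pt).map L) ≫ ·)
      (congrArg hom (Trans.app_whiskerLeft L a.counit X.pt)).symm).trans
      ((hom_app_comp a.left_triangle X.pt).trans (hom_app_id _ _))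
  right_triangle_components X :=
    (congrArg (· ≫ hom ((a.counit.app X.pt).map R))
      (congrArg hom (Trans.app_whiskerLeft R a.unit X.pt)).symm).trans
      ((hom_app_comp a.right_triangle X.pt).trans (hom_app_id _ _))

end

end Hc

namespace FunHo

variable {K K' K'' D E : SSet.{u}} [Quasicategory D] [Quasicategory E]

/-- The homotopy class of a natural transformation. -/
def hom {F G : K ⟶ D} (α : Trans F G) : (⟨F⟩ : FunHo K D) ⟶ ⟨G⟩ := α.ho

lemma hom_surjective {F G : K ⟶ D} :
    Function.Surjective (hom : Trans F G → ((⟨F⟩ : FunHo K D) ⟶ ⟨G⟩)) := Trans.ho_surjective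

lemma hom_id (F : K ⟶ D) : hom (Trans.id F) = 𝟙 (⟨F⟩ : FunHo K D) := Trans.ho_id F

lemma isComp_iff {F G H : K ⟶ D} {α : Trans F G} {β : Trans G H} {γ : Trans F H} :
    Trans.IsComp α β γ ↔ hom α ≫ hom β = hom γ := Trans.isComp_iff_ho _ _ _

lemma hom_eq_iff {F G : K ⟶ D} {α β : Trans F G} :
    hom α = hom β ↔ Trans.IsComp α (Trans.id G) β := by
  rw [isComp_iff, hom_id, Category.comp_id]

/-- A representative of a homotopy class of natural transformations. -/
def rep {F G : FunHo K D} (f : F ⟶ G) : Trans F.fn G.fn := (hom_surjective f).choose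

@[simp] lemma hom_rep {F G : FunHo K D} (f : F ⟶ G) : hom (rep f) = f :=
  (hom_surjective f).choose_spec

lemma isComp_rep {F G H : FunHo K D} (f : F ⟶ G) (g : G ⟶ H) :
    Trans.IsComp (rep f) (rep g) (rep (f ≫ g)) := by
  rw [isComp_iff, hom_rep, hom_rep, hom_rep]

lemma isComp_rep_hom {F G : K ⟶ D} (α : Trans F G) :
    Trans.IsComp (rep (hom α)) (Trans.id G) α := by
  rw [← hom_eq_iff, hom_rep]

lemma isComp_rep_id (F : FunHo K D) :
    Trans.IsComp (rep (𝟙 F)) (Trans.id F.fn) (Trans.id F.fn) := by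
  rw [← hom_eq_iff, hom_rep, hom_id]

/-- Restriction along a map. -/
def pre (k : K' ⟶ K) (D : SSet.{u}) [Quasicategory D] : FunHo K D ⥤ FunHo K' D where
  obj F := ⟨k ≫ F.fn⟩
  map f := hom (Trans.whiskerLeft k (rep f))
  map_id F := by
    rw [← hom_id]
    exact hom_eq_iff.2 ((isComp_rep_id F).whiskerLeft k)
  map_comp f g := (isComp_iff.1 ((isComp_rep f g).whiskerLeft k)).symm

/-- The functor was defined through chosen representatives; whiskering respects homotopy, so the
choice does not matter. -/
lemma pre_hom (k : K' ⟶ K) {F G : K ⟶ D} (α : Trans F G) :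
    (pre k D).map (hom α) = hom (Trans.whiskerLeft k α) :=
  hom_eq_iff.2 ((isComp_rep_hom α).whiskerLeft k)

/-- Composition with a functor. -/
def post (K : SSet.{u}) (L : D ⟶ E) : FunHo K D ⥤ FunHo K E where
  obj F := ⟨F.fn ≫ L⟩
  map f := hom ((rep f).whiskerRight L)
  map_id F := by
    rw [← hom_id]
    exact hom_eq_iff.2 ((isComp_rep_id F).whiskerRight L)
  map_comp f g := (isComp_iff.1 ((isComp_rep f g).whiskerRight L)).symm

lemma post_hom (L : D ⟶ E) {F G : K ⟶ D} (α : Trans F G) :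
    (post K L).map (hom α) = hom (α.whiskerRight L) :=
  hom_eq_iff.2 ((isComp_rep_hom α).whiskerRight L)

/-- Evaluation at an object. -/
def ev (k : K _⦋0⦌) (D : SSet.{u}) [Quasicategory D] : FunHo K D ⥤ Hc D where
  obj F := ⟨obj F.fn k⟩
  map f := Hc.hom ((rep f).app k)
  map_id F := by
    have h := Trans.app_comp k _ _ _ ((Trans.isComp_iff_ho _ _ _).1 (isComp_rep_id F))
    rw [Trans.app_id, Ho.hom_id] at h
    exact (Category.comp_id (Hc.hom ((rep (𝟙 F)).app k))).symm.trans h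
  map_comp f g := (Trans.app_comp k _ _ _
    ((Trans.isComp_iff_ho _ _ _).1 (isComp_rep f g))).symm

lemma ev_hom (k : K _⦋0⦌) {F G : K ⟶ D} (α : Trans F G) :
    (ev k D).map (hom α) = Hc.hom (α.app k) := by
  have h := Trans.app_comp k _ _ _ ((Trans.isComp_iff_ho _ _ _).1 (isComp_rep_hom α))
  rw [Trans.app_id, Ho.hom_id] at h
  exact (Category.comp_id (Hc.hom ((rep (hom α)).app k))).symm.trans h

lemma isIso_iff {F G : FunHo K D} (f : F ⟶ G) :
    IsIso f ↔ CategoryTheory.IsIso (C := Ho (Fun K D)) (X := Ho.of (asVertex F.fn))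
      (Y := Ho.of (asVertex G.fn)) f :=
  ⟨fun ⟨g, h1, h2⟩ => ⟨g, h1, h2⟩, fun ⟨g, h1, h2⟩ => ⟨g, h1, h2⟩⟩

/-- Isomorphisms of functors are detected pointwise. -/
lemma isIso_of_ev {F G : FunHo K D} (f : F ⟶ G) (h : ∀ k, IsIso ((ev k D).map f)) : IsIso f := by
  obtain ⟨α, rfl⟩ := hom_surjective f
  refine (isIso_iff _).2 (Trans.isIso_ho α fun a => ?_)
  have := h a
  rw [ev_hom] at this
  exact (Hc.isIso_iff _).1 this

lemma ev_pre (k : K' ⟶ K) (x : K' _⦋0⦌) {F G : FunHo K D} (f : F ⟶ G) :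
    (ev x D).map ((pre k D).map f) = (ev (obj k x) D).map f := by
  obtain ⟨α, rfl⟩ := hom_surjective f
  refine (congrArg (ev x D).map (pre_hom k α)).trans ((ev_hom x _).trans ?_)
  exact (congrArg Hc.hom (Trans.app_whiskerLeft k α x)).trans (ev_hom _ α).symm

lemma pre_pre (j : K'' ⟶ K') (k : K' ⟶ K) {F G : FunHo K D} (f : F ⟶ G) :
    (pre j D).map ((pre k D).map f) = (pre (j ≫ k) D).map f := by
  obtain ⟨α, rfl⟩ := hom_surjective f
  exact (congrArg (pre j D).map (pre_hom k α)).trans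
    ((pre_hom j _).trans (pre_hom (j ≫ k) α).symm)

lemma pre_post (k : K' ⟶ K) (L : D ⟶ E) {F G : FunHo K D} (f : F ⟶ G) :
    (pre k E).map ((post K L).map f) = (post K' L).map ((pre k D).map f) := by
  obtain ⟨α, rfl⟩ := hom_surjective f
  refine (congrArg (pre k E).map (post_hom L α)).trans ((pre_hom k _).trans ?_)
  exact (post_hom L (Trans.whiskerLeft k α)).symm.trans
    (congrArg (post K' L).map (pre_hom k α)).symm

/-- Whiskering of natural transformations satisfies the interchange law. -/
lemma interchange {M : SSet.{u}} {F G : K ⟶ M} (α : Trans F G) {H H' : M ⟶ E} (β : Trans H H') :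
    hom (α.whiskerRight H) ≫ hom (Trans.whiskerLeft G β) =
      hom (Trans.whiskerLeft F β) ≫ hom (α.whiskerRight H') := by
  refine Trans.ho_square_comm (α.hom ▷ Δ[1] ≫ β.hom) (α.whiskerRight H) (Trans.whiskerLeft G β)
    (Trans.whiskerLeft F β) (α.whiskerRight H') ?_ ?_ ?_ ?_
  · rw [← Category.assoc, ι₀_comp, Category.assoc, β.source]; rfl
  · rw [← Category.assoc, ← comp_whiskerRight, ← ι₁_eq_atVertex, α.target]; rfl
  · rw [← Category.assoc, ← comp_whiskerRight, ← ι₀_eq_atVertex, α.source]; rfl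
  · rw [← Category.assoc, ι₁_comp, Category.assoc, β.target]; rfl

/-- The unit of an adjunction on functors. -/
abbrev unit {L : D ⟶ E} {R : E ⟶ D} (a : Adj L R) (F : K ⟶ D) :
    (⟨F⟩ : FunHo K D) ⟶ ⟨(F ≫ L) ≫ R⟩ := hom (Trans.whiskerLeft F a.unit)

/-- The counit of an adjunction on functors. -/
abbrev counit {L : D ⟶ E} {R : E ⟶ D} (a : Adj L R) (F : K ⟶ E) :
    (⟨(F ≫ R) ≫ L⟩ : FunHo K E) ⟶ ⟨F⟩ := hom (Trans.whiskerLeft F a.counit)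

lemma unit_naturality {L : D ⟶ E} {R : E ⟶ D} (a : Adj L R) {F G : FunHo K D} (f : F ⟶ G) :
    f ≫ unit a G.fn = unit a F.fn ≫ (post K R).map ((post K L).map f) := by
  obtain ⟨α, rfl⟩ := hom_surjective f
  have h : (post K R).map ((post K L).map (hom α)) = hom ((α.whiskerRight L).whiskerRight R) :=
    (congrArg (post K R).map (post_hom L α)).trans (post_hom R _)
  exact (interchange α a.unit).trans (congrArg (unit a F.fn ≫ ·) h.symm)

lemma counit_naturality {L : D ⟶ E} {R : E ⟶ D} (a : Adj L R) {F G : FunHo K E} (f : F ⟶ G) :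
    (post K L).map ((post K R).map f) ≫ counit a G.fn = counit a F.fn ≫ f := by
  obtain ⟨α, rfl⟩ := hom_surjective f
  have h : (post K L).map ((post K R).map (hom α)) = hom ((α.whiskerRight R).whiskerRight L) :=
    (congrArg (post K L).map (post_hom R α)).trans (post_hom L _)
  exact (congrArg (· ≫ counit a G.fn) h).trans (interchange α a.counit)

lemma left_triangle {L : D ⟶ E} {R : E ⟶ D} (a : Adj L R) (F : K ⟶ D) :
    (post K L).map (unit a F) ≫ counit a (F ≫ L) = 𝟙 _ := by
  refine (congrArg (· ≫ counit a (F ≫ L)) (post_hom L (Trans.whiskerLeft F a.unit))).trans ?_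
  exact (isComp_iff.1 (a.left_triangle.whiskerLeft F)).trans (hom_id _)

lemma right_triangle {L : D ⟶ E} {R : E ⟶ D} (a : Adj L R) (F : K ⟶ E) :
    unit a (F ≫ R) ≫ (post K R).map (counit a F) = 𝟙 _ := by
  refine (congrArg (unit a (F ≫ R) ≫ ·) (post_hom R (Trans.whiskerLeft F a.counit))).trans ?_
  exact (isComp_iff.1 (a.right_triangle.whiskerLeft F)).trans (hom_id _)

/-- An adjunction of quasicategories induces an adjunction of homotopy categories of functors. -/
def adj {L : D ⟶ E} {R : E ⟶ D} (a : Adj L R) (K : SSet.{u}) : post K L ⊣ post K R where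
  unit :=
    { app := fun F => unit a F.fn
      naturality := fun _ _ f => unit_naturality a f }
  counit :=
    { app := fun F => counit a F.fn
      naturality := fun _ _ f => counit_naturality a f }
  left_triangle_components F := left_triangle a F.fn
  right_triangle_components F := right_triangle a F.fn

end FunHo

/-! ### Spheres of dimension zero and one -/

section

variable {E B : SSet.{u}}

lemma exists_hom_boundary {n : ℕ} (f : Fin (n + 2) → ((Δ[n] : SSet.{u}) ⟶ E))
    (hc : ∀ U i j (y y' : (Δ[n] : SSet.{u}).obj U),
      (∀ t, i.succAbove (vx y t) = j.succAbove (vx y' t)) → (f i).app U y = (f j).app U y') :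
    ∃ u : (∂Δ[n + 1] : SSet.{u}) ⟶ E, ∀ i, boundary.ι i ≫ u = f i := by
  refine exists_glue boundary.ι f (fun U x => ?_) (fun U i j y y' h => hc U i j y y' fun t => ?_)
  · obtain ⟨x, hx⟩ := x
    have hx' := hx
    rw [boundary_eq_iSup] at hx'
    simp only [Subfunctor.iSup_obj, Set.mem_iUnion] at hx'
    obtain ⟨i, hi⟩ := hx'
    rw [stdSimplex.face_singleton_compl] at hi
    obtain ⟨φ, hφ⟩ := hi
    exact ⟨i, stdSimplex.objEquiv.symm φ.unop, Subtype.ext hφ⟩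
  · exact congrArg (fun z : (∂Δ[n + 1] : SSet.{u}).obj U => vx z.1 t) h

lemma exists_hom_boundary_of_vertices (x y : E _⦋0⦌) : ∃ u : (∂Δ[1] : SSet.{u}) ⟶ E,
    boundary.ι 1 ≫ u = SSet.yonedaEquiv.symm x ∧ boundary.ι 0 ≫ u = SSet.yonedaEquiv.symm y := by
  obtain ⟨u, hu⟩ := exists_hom_boundary (n := 0)
    (fun i => SSet.yonedaEquiv.symm (if i = 1 then x else y)) (fun U i j a b h => by
      have h1 : ∀ (i j : Fin 2) (a b : Fin 1), i.succAbove a = j.succAbove b → i = j := by decide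
      obtain rfl := h1 _ _ _ _ (h 0)
      obtain rfl : a = b := vx_ext fun t => Subsingleton.elim (α := Fin 1) _ _
      rfl)
  exact ⟨u, hu 1, hu 0⟩

lemma app_of_vx_eq {n : ℕ} (f : (Δ[n] : SSet.{u}) ⟶ E) {U} (y : (Δ[n] : SSet.{u}).obj U)
    (c : Fin (n + 1)) (h : ∀ t, vx y t = c) :
    f.app U y = E.map (SimplexCategory.const U.unop ⦋0⦌ 0).op
      (f.app (op ⦋0⦌) (stdSimplex.obj₀Equiv.symm c)) := by
  rw [← NatTrans.naturality_apply]
  exact congrArg (f.app U) (vx_ext fun t => h t)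

lemma yonedaEquiv_symm_app_pt1 (w : E _⦋1⦌) (c : Fin 2) :
    (SSet.yonedaEquiv.symm w).app (op ⦋0⦌) (pt1 c) = E.δ (1 - c) w := by
  have h : (pt1 c : (Δ[1] : SSet.{u}) _⦋0⦌) = (Δ[1] : SSet.{u}).δ (1 - c) e01 := by
    obtain rfl | rfl := eq_zero_or_one c
    · exact δ_one_e01.symm
    · exact δ_zero_e01.symm
  exact (congrArg _ h).trans ((NatTrans.naturality_apply (SSet.yonedaEquiv.symm w) _ e01).trans
    (congrArg (E.δ (1 - c)) (yonedaEquiv_symm_app_e01 w)))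

lemma exists_hom_boundary_of_edges {x y z : E _⦋0⦌} (f : Edge x y) (g : Edge y z)
    (h : Edge x z) : ∃ u : (∂Δ[2] : SSet.{u}) ⟶ E,
    boundary.ι 2 ≫ u = SSet.yonedaEquiv.symm f.edge ∧
    boundary.ι 0 ≫ u = SSet.yonedaEquiv.symm g.edge ∧
    boundary.ι 1 ≫ u = SSet.yonedaEquiv.symm h.edge := by
  let e : Fin 3 → E _⦋1⦌ := ![g.edge, h.edge, f.edge]
  have hd : ∀ (i j : Fin 3) (c c' : Fin 2), i.succAbove c = j.succAbove c' →
      E.δ (1 - c) (e i) = E.δ (1 - c') (e j) := by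
    have k0 : E.δ 1 g.edge = E.δ 0 f.edge := g.src_eq.trans f.tgt_eq.symm
    have k1 : E.δ 0 g.edge = E.δ 0 h.edge := g.tgt_eq.trans h.tgt_eq.symm
    have k2 : E.δ 1 f.edge = E.δ 1 h.edge := f.src_eq.trans h.src_eq.symm
    intro i j c c' hij
    fin_cases i <;> fin_cases j <;> fin_cases c <;> fin_cases c' <;>
      first
      | rfl
      | exact k0
      | exact k1
      | exact k2
      | exact k0.symm
      | exact k1.symm
      | exact k2.symm
      | exact absurd hij (by decide)
  obtain ⟨u, hu⟩ := exists_hom_boundary (n := 1) (fun i => SSet.yonedaEquiv.symm (e i))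
    (fun U i j a b hab => by
      by_cases hij : i = j
      · subst hij
        obtain rfl : a = b := vx_ext fun t => Fin.succAbove_right_injective (hab t)
        rfl
      · have h1 : ∀ (i j : Fin 3), i ≠ j → ∃ c c' : Fin 2, i.succAbove c = j.succAbove c' ∧
          ∀ a b, i.succAbove a = j.succAbove b → a = c ∧ b = c' := by decide
        obtain ⟨c, c', hcc, h2⟩ := h1 i j hij
        rw [app_of_vx_eq _ a c fun t => (h2 _ _ (hab t)).1,
          app_of_vx_eq _ b c' fun t => (h2 _ _ (hab t)).2, yonedaEquiv_symm_app_pt1, yonedaEquiv_symm_app_pt1, hd _ _ _ _ hcc])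
  exact ⟨u, hu 2, hu 0, hu 1⟩

/-- A map from ∂Δ[1] is a pair of vertices. Filling it over an edge of B is the surjectivity half of
the bijections on homotopy classes. -/
lemma exists_edge_of_fill (p : E ⟶ B) {x y : E _⦋0⦌}
    (fill : ∀ (u : (∂Δ[0 + 1] : SSet.{u}) ⟶ E) (v : Δ[0 + 1] ⟶ B), u ≫ p = ∂Δ[0 + 1].ι ≫ v →
      u.app _ (bdVertex 0 0) = x → u.app _ (bdVertex 0 (Fin.last (0 + 1))) = y →
      ∃ w, ∂Δ[0 + 1].ι ≫ w = u ∧ w ≫ p = v) (g : Edge (obj p x) (obj p y)) :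
    ∃ f : Edge x y, f.map p = g := by
  obtain ⟨u, hx, hy⟩ := exists_hom_boundary_of_vertices x y
  obtain ⟨w, hw, hw'⟩ := fill u (SSet.yonedaEquiv.symm g.edge) (by
    refine boundary.hom_ext fun i => ?_
    rw [boundary.ι_ι_assoc, ← Category.assoc, yonedaEquiv_symm_δ]
    obtain rfl | rfl := eq_zero_or_one i
    · rw [hy, g.tgt_eq, SSet.yonedaEquiv_symm_comp]
    · rw [hx, g.src_eq, SSet.yonedaEquiv_symm_comp])
    (by
      have h := app_congr hx (U := op ⦋0⦌) (stdSimplex.objEquiv.symm (𝟙 _))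
      refine Eq.trans ?_ (h.trans (SSet.yonedaEquiv.apply_symm_apply x))
      exact congrArg (u.app _) (Subtype.ext (by ext i; fin_cases i; rfl)))
    (by
      have h := app_congr hy (U := op ⦋0⦌) (stdSimplex.objEquiv.symm (𝟙 _))
      refine Eq.trans ?_ (h.trans (SSet.yonedaEquiv.apply_symm_apply y))
      exact congrArg (u.app _) (Subtype.ext (by ext i; fin_cases i; rfl)))
  refine ⟨Edge.mk (SSet.yonedaEquiv w) (δ_eq_of_eq ?_) (δ_eq_of_eq ?_), Edge.ext ?_⟩
  · rw [← hx, ← hw]; rfl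
  · rw [← hy, ← hw]; rfl
  · have h := congrArg SSet.yonedaEquiv hw'
    rw [SSet.yonedaEquiv_comp, Equiv.apply_symm_apply] at h
    exact h

/-- Two parallel edges and a degenerate edge bound a triangle; filling it over a homotopy in B lifts
that homotopy. This is the injectivity half. -/
lemma compStruct_of_fill (p : E ⟶ B) {x y : E _⦋0⦌}
    (fill : ∀ (u : (∂Δ[1 + 1] : SSet.{u}) ⟶ E) (v : Δ[1 + 1] ⟶ B), u ≫ p = ∂Δ[1 + 1].ι ≫ v →
      u.app _ (bdVertex 1 0) = x → u.app _ (bdVertex 1 (Fin.last (1 + 1))) = y →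
      ∃ w, ∂Δ[1 + 1].ι ≫ w = u ∧ w ≫ p = v) (f g : Edge x y)
    (c : Edge.CompStruct (f.map p) (Edge.id _) (g.map p)) :
    Nonempty (Edge.CompStruct f (Edge.id _) g) := by
  obtain ⟨u, h2, h0, h1⟩ := exists_hom_boundary_of_edges f (Edge.id y) g
  obtain ⟨w, hw, hw'⟩ := fill u (SSet.yonedaEquiv.symm c.simplex) (by
    refine boundary.hom_ext fun i => ?_
    rw [boundary.ι_ι_assoc, ← Category.assoc, yonedaEquiv_symm_δ]
    fin_cases i
    · refine (congrArg (· ≫ p) h0).trans ?_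
      refine Eq.trans ?_ (congrArg SSet.yonedaEquiv.symm c.d₀).symm
      rw [SSet.yonedaEquiv_symm_comp, ← Edge.map_id]
      rfl
    · refine (congrArg (· ≫ p) h1).trans ?_
      refine Eq.trans ?_ (congrArg SSet.yonedaEquiv.symm c.d₁).symm
      rw [SSet.yonedaEquiv_symm_comp]
      rfl
    · refine (congrArg (· ≫ p) h2).trans ?_
      refine Eq.trans ?_ (congrArg SSet.yonedaEquiv.symm c.d₂).symm
      rw [SSet.yonedaEquiv_symm_comp]
      rfl)
    (by
      have h := app_congr h2 (U := op ⦋0⦌) (pt1 0)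
      refine Eq.trans ?_ (h.trans ?_)
      · exact congrArg (u.app _) (Subtype.ext (vx_ext fun t => rfl))
      · exact (yonedaEquiv_symm_app_pt1 _ _).trans f.src_eq)
    (by
      have h := app_congr h1 (U := op ⦋0⦌) (pt1 1)
      refine Eq.trans ?_ (h.trans ?_)
      · exact congrArg (u.app _) (Subtype.ext (vx_ext fun t => rfl))
      · exact (yonedaEquiv_symm_app_pt1 _ _).trans g.tgt_eq)
  refine ⟨Edge.CompStruct.mk (SSet.yonedaEquiv w) (δ_eq_of_eq ?_) (δ_eq_of_eq ?_)
    (δ_eq_of_eq ?_)⟩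
  · rw [← h2, ← hw]; rfl
  · rw [← h0, ← hw]; rfl
  · rw [← h1, ← hw]; rfl

end

/-! ### Universal properties at the level of homotopy categories -/

/-- The functor `σ` is a left Kan extension of its restriction to `S`. -/
def IsLeftKan {C D : SSet.{u}} (S : C.Subcomplex) (σ : C ⟶ D) : Prop :=
  RelInitial (Fun.pre S.ι D) (asVertex σ)

/-- The functor `σ` is a right Kan extension of its restriction to `S`. -/
def IsRightKan {C D : SSet.{u}} (S : C.Subcomplex) (σ : C ⟶ D) : Prop :=
  RelTerminal (Fun.pre S.ι D) (asVertex σ)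

/-- The left Kan extension property, at the level of homotopy categories. -/
def HInitial {C₀ C D : SSet.{u}} [Quasicategory D] (k : C₀ ⟶ C) (σ : C ⟶ D) : Prop :=
  ∀ ρ : FunHo C D, Function.Bijective
    fun f : (⟨σ⟩ : FunHo C D) ⟶ ρ => (FunHo.pre k D).map f

/-- The right Kan extension property, at the level of homotopy categories. -/
def HTerminal {C₀ C D : SSet.{u}} [Quasicategory D] (k : C₀ ⟶ C) (σ : C ⟶ D) : Prop :=
  ∀ ρ : FunHo C D, Function.Bijective
    fun f : ρ ⟶ (⟨σ⟩ : FunHo C D) => (FunHo.pre k D).map f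

section

variable {C₀ C D : SSet.{u}} [Quasicategory D]

lemma Trans.ext_of_hom {F G : C ⟶ D} {α β : Trans F G} (h : α.hom = β.hom) : α = β := by
  cases α
  cases β
  cases h
  rfl

/-- Fillers of 0-spheres give surjectivity and fillers of 1-spheres give injectivity. The endpoints
are both constrained so that the same statement serves initial and terminal diagrams. -/
lemma bijective_pre_map_of_fill (k : C₀ ⟶ C) {σ ρ : C ⟶ D}
    (fill : ∀ (n : ℕ) (u : (∂Δ[n + 1] : SSet.{u}) ⟶ Fun C D) (v : Δ[n + 1] ⟶ Fun C₀ D),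
      u ≫ Fun.pre k D = ∂Δ[n + 1].ι ≫ v →
      u.app _ (bdVertex n 0) = asVertex σ → u.app _ (bdVertex n (Fin.last (n + 1))) = asVertex ρ →
      ∃ w, ∂Δ[n + 1].ι ≫ w = u ∧ w ≫ Fun.pre k D = v) :
    Function.Bijective fun f : (⟨σ⟩ : FunHo C D) ⟶ ⟨ρ⟩ => (FunHo.pre k D).map f := by
  constructor
  · intro f g h
    obtain ⟨α, rfl⟩ := FunHo.hom_surjective f
    obtain ⟨β, rfl⟩ := FunHo.hom_surjective g
    have h' : FunHo.hom (Trans.whiskerLeft k α) = FunHo.hom (Trans.whiskerLeft k β) :=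
      (FunHo.pre_hom k α).symm.trans (h.trans (FunHo.pre_hom k β))
    obtain ⟨c⟩ := (Trans.isComp_iff _ _ _).1 (FunHo.hom_eq_iff.1 h')
    have h1 : (Trans.id (k ≫ ρ)).fe.edge = (Edge.id (obj (Fun.pre k D) (asVertex ρ))).edge := by
      rw [Trans.fe_id, Edge.id_edge, Edge.id_edge]
      exact congrArg ((Fun C₀ D).σ 0) (pre_asVertex k ρ).symm
    have c' : Edge.CompStruct (α.fe.map (Fun.pre k D)) (Edge.id _) (β.fe.map (Fun.pre k D)) :=
      c.ofEq (Trans.whiskerLeft_toEdge k α) h1 (Trans.whiskerLeft_toEdge k β)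
    obtain ⟨d⟩ := compStruct_of_fill (Fun.pre k D) (fill 1) α.fe β.fe c'
    refine FunHo.hom_eq_iff.2 ((Trans.isComp_iff _ _ _).2 ?_)
    rw [Trans.fe_id]
    exact ⟨d⟩
  · intro g
    obtain ⟨φ, rfl⟩ := FunHo.hom_surjective (F := k ≫ σ) (G := k ≫ ρ) g
    obtain ⟨f, hf⟩ := exists_edge_of_fill (Fun.pre k D) (fill 0)
      (φ.fe.ofEq (pre_asVertex k σ).symm (pre_asVertex k ρ).symm)
    refine ⟨FunHo.hom (Trans.ofEdge f), (FunHo.pre_hom k _).trans (congrArg FunHo.hom ?_)⟩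
    apply Trans.ext_of_hom
    rw [← Trans.tr_toEdge, ← Trans.tr_toEdge φ, Trans.whiskerLeft_toEdge]
    have h1 : (Trans.ofEdge f).toEdge = f.edge := congrArg Edge.edge (Trans.fe_ofEdge f)
    have h2 : (Fun.pre k D).app _ f.edge = φ.toEdge := congrArg Edge.edge hf
    rw [h1, h2]

lemma IsLeftKan.hInitial {S : C.Subcomplex} {σ : C ⟶ D} (h : IsLeftKan S σ) : HInitial S.ι σ :=
  fun ρ => bijective_pre_map_of_fill S.ι (ρ := ρ.fn) fun n u v huv h0 _ => h n u v huv h0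

lemma IsRightKan.hTerminal {S : C.Subcomplex} {σ : C ⟶ D} (h : IsRightKan S σ) :
    HTerminal S.ι σ :=
  fun ρ => bijective_pre_map_of_fill S.ι (σ := ρ.fn) fun n u v huv _ h1 => h n u v huv h1

end

/-! ### Invariance of Kan extensions under isomorphism -/

lemma FunHo.isIso_of_app {K D : SSet.{u}} [Quasicategory D] {F G : K ⟶ D} (α : Trans F G)
    (h : ∀ k, IsIso (Hc.hom (α.app k))) : IsIso (FunHo.hom α) :=
  FunHo.isIso_of_ev _ fun k => by
    rw [FunHo.ev_hom]
    exact h k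

lemma FunHo.isIso_app {K D : SSet.{u}} [Quasicategory D] {F G : K ⟶ D} (α : Trans F G)
    (h : IsIso (FunHo.hom α)) (k : K _⦋0⦌) : IsIso (Hc.hom (α.app k)) := by
  have h1 := Functor.map_isIso (FunHo.ev k D) (FunHo.hom α)
  rwa [FunHo.ev_hom] at h1

/-- Extensions of functors are invariant under isomorphism. -/
lemma exists_extension_of_isIso {M L D : SSet.{u}} [Quasicategory D] (i : M ⟶ L) [Mono i]
    (hcell : ∀ (n : ℕ) (l : L _⦋n⦌), l ∉ Set.range (i.app (op ⦋n⦌)) →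
      n ≠ 0 ∧ ∃ k : M _⦋0⦌, i.app _ k = firstVertex l)
    {m' m : M ⟶ D} (φ : (⟨m'⟩ : FunHo M D) ⟶ ⟨m⟩) [IsIso φ]
    (h : ∃ w' : L ⟶ D, i ≫ w' = m') : ∃ w : L ⟶ D, i ≫ w = m := by
  obtain ⟨w', hw'⟩ := h
  obtain ⟨φ, rfl⟩ := FunHo.hom_surjective φ
  obtain ⟨W, hW, -⟩ := exists_extension_of_isEquiv i φ.hom w' (φ.source.trans hw'.symm)
    (fun n l hl => by
      obtain ⟨hn, k, hk⟩ := hcell n l hl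
      refine ⟨hn, k, hk, (isEquiv_edge_iff (φ.app k)).2 ?_⟩
      have h1 : IsIso ((FunHo.ev k D).map (FunHo.hom φ)) := inferInstance
      rw [FunHo.ev_hom] at h1
      exact (Hc.isIso_iff _).1 h1)
  exact ⟨ι₁ ≫ W, by rw [← ι₁_comp_assoc, hW, φ.target]⟩

/-- The restriction of a functor to a subcomplex containing the vertices can be changed up to
isomorphism. -/
lemma exists_isIso_of_isIso {N M D : SSet.{u}} [Quasicategory D] (j : N ⟶ M) [Mono j]
    (hj : ∀ x : M _⦋0⦌, ∃ y, j.app _ y = x) (m : M ⟶ D) {n' : N ⟶ D}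
    (φ : (⟨j ≫ m⟩ : FunHo N D) ⟶ ⟨n'⟩) [IsIso φ] :
    ∃ (m' : M ⟶ D) (ψ : (⟨m⟩ : FunHo M D) ⟶ ⟨m'⟩), IsIso ψ ∧ j ≫ m' = n' := by
  obtain ⟨φ, rfl⟩ := FunHo.hom_surjective φ
  have hφ : ∀ y, IsIso (Hc.hom (φ.app y)) := fun y => by
    have h1 : IsIso ((FunHo.ev y D).map (FunHo.hom φ)) := inferInstance
    rwa [FunHo.ev_hom] at h1
  obtain ⟨W, hW, hW'⟩ := exists_extension_of_isEquiv j φ.hom m φ.source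
    (fun n l hl => by
      obtain ⟨y, hy⟩ := hj (firstVertex l)
      refine ⟨?_, y, hy, (isEquiv_edge_iff (φ.app y)).2 ((Hc.isIso_iff _).1 (hφ y))⟩
      rintro rfl
      exact hl (hj l))
  let ψ : Trans m (ι₁ ≫ W) := ⟨W, hW', rfl⟩
  refine ⟨ι₁ ≫ W, FunHo.hom ψ, FunHo.isIso_of_ev _ fun x => ?_, ?_⟩
  · obtain ⟨y, rfl⟩ := hj x
    have h1 : (ψ.app (j.app _ y)).edge = (φ.app y).edge := by
      rw [Trans.app_edge, Trans.app_edge, ← hW]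
      have h2 : M.σ 0 (j.app _ y) = j.app (op ⦋1⦌) (N.σ 0 y) :=
        (NatTrans.naturality_apply j _ y).symm
      exact congrArg (fun z => W.app (op ⦋1⦌) (z, e01)) h2
    have h3 : IsIso (Hc.hom (ψ.app (j.app _ y))) :=
      (Hc.isIso_iff _).2 ((isEquiv_edge_iff (ψ.app (j.app _ y))).1 (by
        rw [h1]
        exact (isEquiv_edge_iff (φ.app y)).2 ((Hc.isIso_iff _).1 (hφ y))))
    rwa [FunHo.ev_hom]
  · rw [← ι₁_comp_assoc, hW, φ.target]

/-- The discrete simplicial set. -/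
def disc (V : Type u) : SSet.{u} := (Functor.const _).obj V

/-- The inclusion of the vertices. -/
def discι (K : SSet.{u}) : disc (K _⦋0⦌) ⟶ K where
  app U := ↾fun x => K.map (SimplexCategory.const U.unop ⦋0⦌ 0).op x
  naturality U V f := by
    ext x
    exact (K.map_comp_apply (SimplexCategory.const U.unop ⦋0⦌ 0).op f x)

lemma discι_app_zero {K : SSet.{u}} (x : K _⦋0⦌) : (discι K).app (op ⦋0⦌) x = x := by
  refine Eq.trans ?_ (K.map_id_apply _ x)
  exact congrArg (fun f : (⦋0⦌ : SimplexCategory) ⟶ ⦋0⦌ => K.map f.op x) (Subsingleton.elim _ _)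

instance (K : SSet.{u}) : Mono (discι K) := by
  refine mono_of_app_injective _ fun U x y h => ?_
  have h1 := congrArg (K.map (SimplexCategory.const ⦋0⦌ U.unop 0).op) h
  have h2 : ∀ z : K _⦋0⦌, K.map (SimplexCategory.const ⦋0⦌ U.unop 0).op
      ((discι K).app U z) = z := fun z =>
    (NatTrans.naturality_apply (discι K) (SimplexCategory.const ⦋0⦌ U.unop 0).op z).symm.trans
      (discι_app_zero z)
  exact (h2 x).symm.trans (h1.trans (h2 y))

/-- A family of maps, as a map from the product with a discrete simplicial set. -/
def discDesc {C D : SSet.{u}} {V : Type u} (f : V → (C ⟶ D)) : C ⊗ disc V ⟶ D where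
  app U := ↾fun x => (f x.2).app U x.1
  naturality U V g := by
    ext x
    exact NatTrans.naturality_apply (f x.2) g x.1

/-- Over a discrete V the copies of C are independent, so one copy can be changed along e and the
others kept. As these copies contain all vertices of M, the pointwise equivalence extends over M. -/
lemma exists_isIso_replace {C M D : SSet.{u}} [Quasicategory D] {V : Type u} (j : C ⊗ disc V ⟶ M)
    [Mono j] (hj : ∀ x : M _⦋0⦌, ∃ y, j.app _ y = x) (m : M ⟶ D) (v₀ : V) {σ τ : C ⟶ D}
    (hσ : atVertex C (K := disc V) v₀ ≫ j ≫ m = σ) (e : (⟨σ⟩ : FunHo C D) ⟶ ⟨τ⟩) [IsIso e] :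
    ∃ (m' : M ⟶ D) (ψ : (⟨m⟩ : FunHo M D) ⟶ ⟨m'⟩), IsIso ψ ∧
      atVertex C (K := disc V) v₀ ≫ j ≫ m' = τ := by
  have key : ∀ v : V, ∃ (F' : C ⟶ D) (φ : Trans (atVertex C (K := disc V) v ≫ j ≫ m) F'),
      IsIso (FunHo.hom φ) ∧ (v = v₀ → F' = τ) := fun v => by
    by_cases hv : v = v₀
    · subst hv
      subst hσ
      obtain ⟨e, rfl⟩ := FunHo.hom_surjective e
      exact ⟨τ, e, inferInstance, fun _ => rfl⟩
    · exact ⟨_, Trans.id _, by rw [FunHo.hom_id]; infer_instance, fun h => (hv h).elim⟩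
  choose F' φ hφ hF' using key
  let Φ : Trans (j ≫ m) (discDesc F') :=
    { hom := swapRight C (disc V) Δ[1] ≫ discDesc fun v => (φ v).hom
      source := by
        ext U x
        exact app_congr (φ x.2).source x.1
      target := by
        ext U x
        exact app_congr (φ x.2).target x.1 }
  have hΦ : IsIso (FunHo.hom Φ) := FunHo.isIso_of_app _ fun ⟨c, v⟩ =>
    FunHo.isIso_app (φ v) (hφ v) c
  obtain ⟨m', ψ, hψ, hm'⟩ := exists_isIso_of_isIso j hj m (FunHo.hom Φ)
  refine ⟨m', ψ, hψ, ?_⟩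
  rw [hm', ← hF' v₀ rfl]
  ext U x
  rfl

section

variable {C D : SSet.{u}} (S : C.Subcomplex) {σ : C ⟶ D}

/-- The lifting problem along restriction is an extension problem along the pushout-product of S ⊆ C
and ∂Δ[n+1] ⊆ Δ[n+1]. In this form only maps into D occur, and they can be changed up to
isomorphism. -/
lemma isLeftKan_iff : IsLeftKan S σ ↔
    ∀ (n : ℕ) (m : (S.unionProd ∂Δ[n + 1] : SSet.{u}) ⟶ D),
      atVertex C (bdVertex n 0) ≫ Subcomplex.unionProd.ι₁ S ∂Δ[n + 1] ≫ m = σ →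
      ∃ w : C ⊗ Δ[n + 1] ⟶ D, (S.unionProd ∂Δ[n + 1]).ι ≫ w = m := by
  constructor
  · intro h n m hm
    obtain ⟨w, hw1, hw2⟩ := h n (MonoidalClosed.curry (Subcomplex.unionProd.ι₁ S ∂Δ[n + 1] ≫ m))
      (MonoidalClosed.curry (Subcomplex.unionProd.ι₂ S ∂Δ[n + 1] ≫ m))
      ((comp_pre_eq_iff _ _ _ _).2 (by
        rw [MonoidalClosed.uncurry_curry, MonoidalClosed.uncurry_curry]
        exact (Subcomplex.unionProd.isPushout S ∂Δ[n + 1]).w_assoc m))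
      (by rw [app_eq_asVertex, MonoidalClosed.uncurry_curry, hm])
    refine ⟨MonoidalClosed.uncurry w, (Subcomplex.unionProd.isPushout S ∂Δ[n + 1]).hom_ext ?_ ?_⟩
    · rw [Subcomplex.unionProd.ι₁_ι_assoc, ← MonoidalClosed.uncurry_natural_left, hw1,
        MonoidalClosed.uncurry_curry]
    · rw [Subcomplex.unionProd.ι₂_ι_assoc, ← MonoidalClosed.uncurry_pre_app, hw2,
        MonoidalClosed.uncurry_curry]
  · intro h n u v huv hu
    rw [comp_pre_eq_iff] at huv
    rw [app_eq_asVertex] at hu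
    let m := (Subcomplex.unionProd.isPushout S ∂Δ[n + 1]).desc _ _ huv
    have h1 : Subcomplex.unionProd.ι₁ S ∂Δ[n + 1] ≫ m = MonoidalClosed.uncurry u :=
      (Subcomplex.unionProd.isPushout S ∂Δ[n + 1]).inl_desc _ _ _
    have h2 : Subcomplex.unionProd.ι₂ S ∂Δ[n + 1] ≫ m = MonoidalClosed.uncurry v :=
      (Subcomplex.unionProd.isPushout S ∂Δ[n + 1]).inr_desc _ _ _
    obtain ⟨w, hw⟩ := h n m (by rw [h1, asVertex_injective hu])
    refine ⟨MonoidalClosed.curry w, ?_, ?_⟩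
    · rw [← MonoidalClosed.curry_natural_left, ← Subcomplex.unionProd.ι₁_ι S, Category.assoc, hw,
        h1, MonoidalClosed.curry_uncurry]
    · apply MonoidalClosed.uncurry_injective
      rw [MonoidalClosed.uncurry_pre_app, MonoidalClosed.uncurry_curry,
        ← Subcomplex.unionProd.ι₂_ι S ∂Δ[n + 1], Category.assoc, hw, h2]

lemma exists_bd_vertex_eq {n : ℕ} (x : (S.unionProd ∂Δ[n + 1] : SSet.{u}) _⦋0⦌) :
    ∃ y, (C ◁ discι (∂Δ[n + 1] : SSet.{u}) ≫
      Subcomplex.unionProd.ι₁ S ∂Δ[n + 1]).app (op ⦋0⦌) y = x := by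
  obtain ⟨⟨c, s⟩, hx⟩ := x
  have hs : s ∈ (∂Δ[n + 1] : (Δ[n + 1] : SSet.{u}).Subcomplex).obj (op ⦋0⦌) := by
    rw [boundary_obj_eq_univ 0 (n + 1) (by omega)]
    trivial
  refine ⟨(c, ⟨s, hs⟩), Subtype.ext (Prod.ext rfl ?_)⟩
  exact congrArg Subtype.val (discι_app_zero (K := (∂Δ[n + 1] : SSet.{u})) ⟨s, hs⟩)

instance {n : ℕ} : Mono (Subcomplex.unionProd.ι₁ S (∂Δ[n + 1] : (Δ[n + 1] : SSet.{u}).Subcomplex)) :=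
  mono_of_mono_fac (Subcomplex.unionProd.ι₁_ι S ∂Δ[n + 1])

/-- Left Kan extensions are invariant under isomorphism. -/
theorem IsLeftKan.of_isIso [Quasicategory D] {τ : C ⟶ D} (hτ : IsLeftKan S τ)
    (e : (⟨σ⟩ : FunHo C D) ⟶ ⟨τ⟩) [IsIso e] : IsLeftKan S σ := by
  rw [isLeftKan_iff] at hτ ⊢
  intro n m hm
  have hv : ∀ f : (S.unionProd ∂Δ[n + 1] : SSet.{u}) ⟶ D,
      atVertex C (K := disc ((∂Δ[n + 1] : SSet.{u}) _⦋0⦌)) (bdVertex n 0) ≫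
        (C ◁ discι (∂Δ[n + 1] : SSet.{u}) ≫ Subcomplex.unionProd.ι₁ S ∂Δ[n + 1]) ≫ f =
      atVertex C (bdVertex n 0) ≫ Subcomplex.unionProd.ι₁ S ∂Δ[n + 1] ≫ f := fun f => by
    have h1 : atVertex C (K := disc ((∂Δ[n + 1] : SSet.{u}) _⦋0⦌)) (bdVertex n 0) ≫
        C ◁ discι (∂Δ[n + 1] : SSet.{u}) = atVertex C (bdVertex n 0) := by
      refine (atVertex_whiskerLeft _ _).trans ?_
      rw [discι_app_zero]
    rw [Category.assoc, ← h1, Category.assoc]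
  -- Replace σ by τ on the copy of C at the first vertex. The Kan property of τ extends the modified
  -- data, and the extension is carried back along the inverse of ψ.
  obtain ⟨m', ψ, hψ, hm'⟩ := exists_isIso_replace
    (C ◁ discι (∂Δ[n + 1] : SSet.{u}) ≫ Subcomplex.unionProd.ι₁ S ∂Δ[n + 1])
    (exists_bd_vertex_eq S) m (bdVertex n 0) ((hv m).trans hm) e
  refine exists_extension_of_isIso (S.unionProd ∂Δ[n + 1]).ι (fun k l hl => ?_) (inv ψ)
    (hτ n m' ((hv m').symm.trans hm'))
  have h0 : ∀ x : (C ⊗ Δ[n + 1]) _⦋0⦌, ∃ y, (S.unionProd ∂Δ[n + 1]).ι.app (op ⦋0⦌) y = x :=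
    fun x => ⟨⟨x, (Subcomplex.mem_unionProd_iff _ _ _).2 (Or.inl (by
      rw [boundary_obj_eq_univ 0 (n + 1) (by omega)]
      trivial))⟩, rfl⟩
  refine ⟨?_, h0 _⟩
  rintro rfl
  exact hl (h0 l)

end

section

variable {D : SSet.{u}} [Quasicategory D]

/-- The same replacement argument with C a point: change the sphere at vertex i along e, fill, and
transport the filler back. -/
lemma exists_sphere_filler_of_isIso {n : ℕ} (i : Fin (n + 2)) {x y : D _⦋0⦌}
    (e : (⟨x⟩ : Hc D) ⟶ ⟨y⟩) [IsIso e]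
    (h : ∀ (u : (∂Δ[n + 1] : SSet.{u}) ⟶ D), u.app _ (bdVertex n i) = y →
      ∃ v : Δ[n + 1] ⟶ D, (∂Δ[n + 1]).ι ≫ v = u)
    (u : (∂Δ[n + 1] : SSet.{u}) ⟶ D) (hu : u.app _ (bdVertex n i) = x) :
    ∃ v : Δ[n + 1] ⟶ D, (∂Δ[n + 1]).ι ≫ v = u := by
  obtain ⟨f, rfl⟩ := Hc.hom_surjective e
  let φ : Trans (SSet.const (X := Δ[0]) x) (SSet.const y) :=
    { hom := snd _ _ ≫ SSet.yonedaEquiv.symm f.edge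
      source := by
        rw [ι₀_snd_assoc, SSet.const_comp]
        congr 1
        exact (yonedaEquiv_symm_app_pt1 f.edge 0).trans f.src_eq
      target := by
        rw [ι₁_snd_assoc, SSet.const_comp]
        congr 1
        exact (yonedaEquiv_symm_app_pt1 f.edge 1).trans f.tgt_eq }
  have hφ : IsIso (FunHo.hom φ) := FunHo.isIso_of_app _ fun k =>
    (Hc.isIso_iff _).2 ((isEquiv_edge_iff (φ.app k)).1 (by
      have h1 : (φ.app k).edge = f.edge := yonedaEquiv_symm_app_e01 f.edge
      rw [h1]
      exact (isEquiv_edge_iff f).2 ((Hc.isIso_iff (Hc.hom f)).1 inferInstance)))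
  let j : Δ[0] ⊗ disc ((∂Δ[n + 1] : SSet.{u}) _⦋0⦌) ⟶ (∂Δ[n + 1] : SSet.{u}) := snd _ _ ≫ discι _
  have : Mono j := by
    refine mono_of_app_injective _ fun U a b hab => ?_
    have h1 := (mono_iff_injective ((discι (∂Δ[n + 1] : SSet.{u})).app U)).1 inferInstance hab
    exact Prod.ext (vx_ext fun t => Subsingleton.elim (α := Fin 1) _ _) h1
  have hj : ∀ g : (∂Δ[n + 1] : SSet.{u}) ⟶ D,
      atVertex Δ[0] (K := disc ((∂Δ[n + 1] : SSet.{u}) _⦋0⦌)) (bdVertex n i) ≫ j ≫ g =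
        SSet.const (g.app _ (bdVertex n i)) := fun g => by
    have h1 : atVertex Δ[0] (K := disc ((∂Δ[n + 1] : SSet.{u}) _⦋0⦌)) (bdVertex n i) ≫ snd _ _ =
      SSet.const (X := Δ[0]) (Y := disc ((∂Δ[n + 1] : SSet.{u}) _⦋0⦌)) (bdVertex n i) :=
      lift_snd _ _
    rw [← Category.assoc, ← Category.assoc, h1]
    refine (congrArg (· ≫ g) (SSet.const_comp _ _)).trans ((SSet.const_comp _ _).trans ?_)
    exact congrArg (fun z => SSet.const (g.app _ z)) (discι_app_zero _)
  obtain ⟨m', ψ, hψ, hm'⟩ := exists_isIso_replace j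
    (fun z => ⟨(stdSimplex.obj₀Equiv.symm 0, z), discι_app_zero z⟩) u (bdVertex n i)
    ((hj u).trans (by rw [hu])) (FunHo.hom φ)
  refine exists_extension_of_isIso (∂Δ[n + 1]).ι (fun k l hl => ?_) (inv ψ) (h m' ?_)
  · have h0 : ∀ x : (Δ[n + 1] : SSet.{u}) _⦋0⦌, ∃ y, (∂Δ[n + 1]).ι.app (op ⦋0⦌) y = x :=
      fun x => ⟨⟨x, by
        rw [boundary_obj_eq_univ 0 (n + 1) (by omega)]
        trivial⟩, rfl⟩
    refine ⟨?_, h0 _⟩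
    rintro rfl
    exact hl (h0 l)
  · rw [hj] at hm'
    have h1 := app_congr hm' (stdSimplex.obj₀Equiv.symm 0 : (Δ[0] : SSet.{u}) _⦋0⦌)
    have h2 : ∀ z : D _⦋0⦌, (SSet.const (X := Δ[0]) z).app (op ⦋0⦌)
        (stdSimplex.obj₀Equiv.symm 0) = z := fun z => by
      refine Eq.trans ?_ (D.map_id_apply _ z)
      exact congrArg (fun f : (⦋0⦌ : SimplexCategory) ⟶ ⦋0⦌ => D.map f.op z) (Subsingleton.elim _ _)
    exact (h2 _).symm.trans (h1.trans (h2 _))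

lemma IsZero.of_isIso {x y : D _⦋0⦌} (hy : IsZero y) (e : (⟨x⟩ : Hc D) ⟶ ⟨y⟩) [IsIso e] :
    IsZero x :=
  ⟨fun n u hu => exists_sphere_filler_of_isIso 0 e (hy.1 n) u hu,
    fun n u hu => exists_sphere_filler_of_isIso (Fin.last _) e (hy.2 n) u hu⟩

end

/-! ### Universal properties in stable quasicategories -/

section

variable {𝒜 ℬ : Type*} [Category 𝒜] [Category ℬ] (P : 𝒜 ⥤ ℬ)

lemma exists_iso_of_bijective_from {s t : 𝒜}
    (hs : ∀ r, Function.Bijective fun f : s ⟶ r => P.map f)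
    (ht : ∀ r, Function.Bijective fun f : t ⟶ r => P.map f) (φ : P.obj s ≅ P.obj t) :
    ∃ e : s ≅ t, P.map e.hom = φ.hom := by
  obtain ⟨f, hf⟩ := (hs t).2 φ.hom
  obtain ⟨g, hg⟩ := (ht s).2 φ.inv
  dsimp only at hf hg
  exact ⟨⟨f, g, (hs s).1 (by simp [hf, hg]), (ht t).1 (by simp [hf, hg])⟩, hf⟩

lemma exists_iso_of_bijective_to {s t : 𝒜}
    (hs : ∀ r, Function.Bijective fun f : r ⟶ s => P.map f)
    (ht : ∀ r, Function.Bijective fun f : r ⟶ t => P.map f) (φ : P.obj s ≅ P.obj t) :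
    ∃ e : s ≅ t, P.map e.hom = φ.hom := by
  obtain ⟨f, hf⟩ := (ht s).2 φ.hom
  obtain ⟨g, hg⟩ := (hs t).2 φ.inv
  dsimp only at hf hg
  exact ⟨⟨f, g, (hs s).1 (by simp [hf, hg]), (ht t).1 (by simp [hf, hg])⟩, hf⟩

end

section

variable {C₀ C D E : SSet.{u}} [Quasicategory D] [Quasicategory E] {k : C₀ ⟶ C}

lemma HInitial.exists_iso {σ τ : C ⟶ D} (hσ : HInitial k σ) (hτ : HInitial k τ)
    (φ : (⟨k ≫ σ⟩ : FunHo C₀ D) ≅ ⟨k ≫ τ⟩) :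
    ∃ e : (⟨σ⟩ : FunHo C D) ≅ ⟨τ⟩, (FunHo.pre k D).map e.hom = φ.hom :=
  exists_iso_of_bijective_from _ hσ hτ φ

lemma HTerminal.exists_iso {σ τ : C ⟶ D} (hσ : HTerminal k σ) (hτ : HTerminal k τ)
    (φ : (⟨k ≫ σ⟩ : FunHo C₀ D) ≅ ⟨k ≫ τ⟩) :
    ∃ e : (⟨σ⟩ : FunHo C D) ≅ ⟨τ⟩, (FunHo.pre k D).map e.hom = φ.hom :=
  exists_iso_of_bijective_to _ hσ hτ φ

/-- Transposition along an adjunction. -/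
def transpose {K : SSet.{u}} {L : D ⟶ E} {R : E ⟶ D} (a : Adj L R) {σ : K ⟶ D} {ρ : K ⟶ E}
    (f : (⟨σ ≫ L⟩ : FunHo K E) ⟶ ⟨ρ⟩) : (⟨σ⟩ : FunHo K D) ⟶ ⟨ρ ≫ R⟩ :=
  FunHo.unit a σ ≫ (FunHo.post K R).map f

lemma bijective_transpose {K : SSet.{u}} {L : D ⟶ E} {R : E ⟶ D} (a : Adj L R) (σ : K ⟶ D)
    (ρ : K ⟶ E) : Function.Bijective (transpose a : ((⟨σ ≫ L⟩ : FunHo K E) ⟶ ⟨ρ⟩) → _) :=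
  ((FunHo.adj a K).homEquiv ⟨σ⟩ ⟨ρ⟩).bijective

lemma pre_unit {L : D ⟶ E} {R : E ⟶ D} (a : Adj L R) (k : C₀ ⟶ C) (σ : C ⟶ D) :
    (FunHo.pre k D).map (FunHo.unit a σ) = FunHo.unit a (k ≫ σ) :=
  FunHo.pre_hom k _

/-- The functorial action of `FunHo.pre`, on bare functors. -/
abbrev preMap (k : C₀ ⟶ C) {F G : C ⟶ D} (f : (⟨F⟩ : FunHo C D) ⟶ ⟨G⟩) :
    (⟨k ≫ F⟩ : FunHo C₀ D) ⟶ ⟨k ≫ G⟩ := (FunHo.pre k D).map f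

lemma pre_transpose {L : D ⟶ E} {R : E ⟶ D} (a : Adj L R) (k : C₀ ⟶ C) {σ : C ⟶ D}
    {ρ : C ⟶ E} (f : (⟨σ ≫ L⟩ : FunHo C E) ⟶ ⟨ρ⟩) :
    (FunHo.pre k D).map (transpose a f) =
      transpose (K := C₀) (σ := k ≫ σ) (ρ := k ≫ ρ) a
        (preMap (F := σ ≫ L) (G := ρ) k f) := by
  have h1 := (FunHo.pre k D).map_comp (FunHo.unit a σ) ((FunHo.post C R).map f)
  have h2 : (FunHo.pre k D).map ((FunHo.post C R).map f) =
    (FunHo.post C₀ R).map ((FunHo.pre k E).map f) := FunHo.pre_post k R f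
  have h3 := pre_unit a k σ
  exact h1.trans (congrArg₂ (· ≫ ·) h3 h2)

/-- Maps σL → ρ correspond by transposition to maps σ → ρR, compatibly with restriction along k, so
bijectivity of restriction passes from one side to the other. -/
lemma HInitial.comp {L : D ⟶ E} {R : E ⟶ D} (a : Adj L R) {σ : C ⟶ D} (h : HInitial k σ) :
    HInitial k (σ ≫ L) := fun ρ => by
  have h1 : Function.Bijective fun f : (⟨σ ≫ L⟩ : FunHo C E) ⟶ ⟨ρ.fn⟩ =>
      (FunHo.pre k D).map (transpose a f) := (h ⟨ρ.fn ≫ R⟩).comp (bijective_transpose a σ ρ.fn)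
  simp only [pre_transpose] at h1
  exact ((bijective_transpose a (k ≫ σ) (k ≫ ρ.fn)).of_comp_iff' _).1 h1

lemma HTerminal.comp {L : D ⟶ E} {R : E ⟶ D} (a : Adj L R) {σ : C ⟶ E} (h : HTerminal k σ) :
    HTerminal k (σ ≫ R) := fun ρ => by
  have h1 : Function.Bijective fun f : (⟨ρ.fn ≫ L⟩ : FunHo C E) ⟶ ⟨σ⟩ =>
      (FunHo.pre k D).map (transpose a f) := by
    simp only [pre_transpose]
    exact (bijective_transpose a (k ≫ ρ.fn) (k ≫ σ)).comp (h ⟨ρ.fn ≫ L⟩)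
  exact (Function.Bijective.of_comp_iff _ (bijective_transpose a ρ.fn σ)).1 h1

lemma IsPushout.hInitial {σ : Sq ⟶ D} (h : IsPushout σ) : HInitial span.ι σ :=
  IsLeftKan.hInitial ((isPushout_iff σ).1 h)

lemma IsPullback.hTerminal {σ : Sq ⟶ D} (h : IsPullback σ) : HTerminal cospan.ι σ :=
  IsRightKan.hTerminal ((isPullback_iff σ).1 h)

lemma IsPushout.of_isIso {σ τ : Sq ⟶ D} (hτ : IsPushout τ) (e : (⟨σ⟩ : FunHo Sq D) ⟶ ⟨τ⟩)
    [IsIso e] : IsPushout σ :=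
  (isPushout_iff σ).2 (IsLeftKan.of_isIso span ((isPushout_iff τ).1 hτ) e)

/-- An actual pushout of the same span has the same universal property up to homotopy, so the two
squares are isomorphic; being a pushout is invariant under isomorphism. -/
lemma IsStable.isPushout_of_hInitial (hD : IsStable D) {σ : Sq ⟶ D} (h : HInitial span.ι σ) :
    IsPushout σ := by
  obtain ⟨τ, h1, h2⟩ := hD.exists_pushout (span.ι ≫ σ)
  obtain ⟨e, -⟩ := h.exists_iso h2.hInitial (eqToIso (by rw [h1]))
  exact h2.of_isIso e.hom

lemma IsStable.isPushout_of_hTerminal (hD : IsStable D) {σ : Sq ⟶ D}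
    (h : HTerminal cospan.ι σ) : IsPushout σ := by
  obtain ⟨τ, h1, h2⟩ := hD.exists_pullback (cospan.ι ≫ σ)
  obtain ⟨e, -⟩ := h.exists_iso h2.hTerminal (eqToIso (by rw [h1]))
  exact ((hD.pullback_iff_pushout τ).1 h2).of_isIso e.hom

lemma IsPushout.comp_leftAdj {L : D ⟶ E} {R : E ⟶ D} (a : Adj L R) (hE : IsStable E)
    {σ : Sq ⟶ D} (h : IsPushout σ) : IsPushout (σ ≫ L) :=
  hE.isPushout_of_hInitial (h.hInitial.comp a)

/-- Stability of E turns the pushout into a pullback, whose universal property right adjoints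
preserve; comparison with an existing pullback in D, which is a pushout by stability, concludes. -/
lemma IsPushout.comp_rightAdj {L : D ⟶ E} {R : E ⟶ D} (a : Adj L R) (hD : IsStable D)
    (hE : IsStable E) {σ : Sq ⟶ E} (h : IsPushout σ) : IsPushout (σ ≫ R) :=
  hD.isPushout_of_hTerminal (((hE.pullback_iff_pushout σ).2 h).hTerminal.comp a)

end

/-! ### Zero objects -/

section

variable {D E : SSet.{u}} [Quasicategory D] [Quasicategory E]

/-- Absolute spheres are spheres relative to D → Δ[0], so the relative results in dimensions 0 and 1
give existence and uniqueness of a homotopy class. -/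
lemma hom_of_fill {x y : D _⦋0⦌}
    (fill : ∀ (n : ℕ) (u : (∂Δ[n + 1] : SSet.{u}) ⟶ D), u.app _ (bdVertex n 0) = x →
      u.app _ (bdVertex n (Fin.last (n + 1))) = y →
      ∃ w : Δ[n + 1] ⟶ D, (∂Δ[n + 1]).ι ≫ w = u) :
    Nonempty (Unique ((⟨x⟩ : Hc D) ⟶ ⟨y⟩)) := by
  let p : D ⟶ Δ[0] := stdSimplex.isTerminalObj₀.from D
  have hs : ∀ {n : ℕ} (a b : (Δ[0] : SSet.{u}) _⦋n⦌), a = b := fun a b =>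
    vx_ext fun t => Subsingleton.elim (α := Fin 1) _ _
  have fill' : ∀ (n : ℕ) (u : (∂Δ[n + 1] : SSet.{u}) ⟶ D) (v : Δ[n + 1] ⟶ Δ[0]),
      u ≫ p = ∂Δ[n + 1].ι ≫ v →
      u.app _ (bdVertex n 0) = x → u.app _ (bdVertex n (Fin.last (n + 1))) = y →
      ∃ w, ∂Δ[n + 1].ι ≫ w = u ∧ w ≫ p = v := fun n u v _ h0 h1 => by
    obtain ⟨w, hw⟩ := fill n u h0 h1
    exact ⟨w, hw, stdSimplex.isTerminalObj₀.hom_ext _ _⟩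
  obtain ⟨f, -⟩ := exists_edge_of_fill p (fill' 0)
    (Edge.mk ((Δ[0] : SSet.{u}).σ 0 (obj p x)) (hs _ _) (hs _ _))
  refine ⟨⟨⟨Hc.hom f⟩, fun g => ?_⟩⟩
  obtain ⟨g, rfl⟩ := Hc.hom_surjective g
  exact Hc.hom_eq_iff.2 (compStruct_of_fill p (fill' 1) g f
    (Edge.CompStruct.mk ((Δ[0] : SSet.{u}).σ 0 ((Δ[0] : SSet.{u}).σ 0 (obj p x)))
      (hs _ _) (hs _ _) (hs _ _)))

lemma IsZero.hc {x : D _⦋0⦌} (hx : IsZero x) : Limits.IsZero (⟨x⟩ : Hc D) :=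
  ⟨fun Y => hom_of_fill (y := Y.pt) fun n u h _ => hx.1 n u h,
    fun Y => hom_of_fill (x := Y.pt) fun n u _ h => hx.2 n u h⟩

/-- Maps to and from a zero object always exist, and with a single endomorphism of x they are
mutually inverse. The lifting definition of zero is invariant under isomorphism. -/
lemma IsStable.isZero_of_subsingleton (hD : IsStable D) {x : D _⦋0⦌}
    (h : Subsingleton ((⟨x⟩ : Hc D) ⟶ ⟨x⟩)) : IsZero x := by
  obtain ⟨z, hz⟩ := hD.exists_zero
  have : IsIso (hz.hc.from_ ⟨x⟩) :=
    ⟨hz.hc.to_ ⟨x⟩, Subsingleton.elim _ _, hz.hc.eq_of_src _ _⟩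
  exact hz.of_isIso (hz.hc.from_ ⟨x⟩)

lemma IsZero.map_leftAdj {L : D ⟶ E} {R : E ⟶ D} (a : Adj L R) (hE : IsStable E) {x : D _⦋0⦌}
    (hx : IsZero x) : IsZero (obj L x) :=
  hE.isZero_of_subsingleton ⟨fun _ _ =>
    ((Hc.adj a).homEquiv ⟨x⟩ ⟨obj L x⟩).injective (hx.hc.eq_of_src _ _)⟩

lemma IsZero.map_rightAdj {L : D ⟶ E} {R : E ⟶ D} (a : Adj L R) (hD : IsStable D) {x : E _⦋0⦌}
    (hx : IsZero x) : IsZero (obj R x) :=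
  hD.isZero_of_subsingleton ⟨fun _ _ =>
    ((Hc.adj a).homEquiv ⟨obj R x⟩ ⟨x⟩).symm.injective (hx.hc.eq_of_tgt _ _)⟩

end

/-! ### Spans, cospans and squares -/

/-- The span (for `j = 0`) or cospan (for `j = 1`) in the square. -/
abbrev corr (j : Fin 2) : Sq.{u}.Subcomplex :=
  (stdSimplex.face {j}).unionProd (stdSimplex.face {j})

lemma mem_corr_iff (j : Fin 2) {U} (x y : (Δ[1] : SSet.{u}).obj U) :
    (show Sq.{u}.obj U from (x, y)) ∈ (corr j).obj U ↔ (∀ t, vx y t = j) ∨ ∀ t, vx x t = j := by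
  have h : ∀ z : (Δ[1] : SSet.{u}).obj U,
      z ∈ (stdSimplex.face {j} : (Δ[1] : SSet.{u}).Subcomplex).obj U ↔ ∀ t, vx z t = j := by
    intro z
    rw [stdSimplex.mem_face_iff]
    simp only [Finset.mem_singleton]
    rfl
  refine (Subcomplex.mem_unionProd_iff _ _ _).trans ?_
  exact or_congr (h y) (h x)

/-- The horizontal leg. -/
def corrH (j : Fin 2) : Δ[1] ⟶ (corr.{u} j : SSet.{u}) :=
  Subcomplex.lift (lift (𝟙 _) (SSet.const (pt1 j))) (by
    rintro U _ ⟨x, rfl⟩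
    exact (mem_corr_iff j _ _).2 (Or.inl fun t => rfl))

/-- The vertical leg. -/
def corrV (j : Fin 2) : Δ[1] ⟶ (corr.{u} j : SSet.{u}) :=
  Subcomplex.lift (lift (SSet.const (pt1 j)) (𝟙 _)) (by
    rintro U _ ⟨x, rfl⟩
    exact (mem_corr_iff j _ _).2 (Or.inr fun t => rfl))

lemma exists_corrH_or_corrV (j : Fin 2) {U} (z : (corr.{u} j : SSet.{u}).obj U) :
    (∃ a, (corrH j).app U a = z) ∨ ∃ b, (corrV j).app U b = z := by
  obtain ⟨⟨x, y⟩, hz⟩ := z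
  obtain h | h := (mem_corr_iff j x y).1 hz
  · exact Or.inl ⟨x, Subtype.ext (Prod.ext rfl (vx_ext fun t => (h t).symm))⟩
  · exact Or.inr ⟨y, Subtype.ext (Prod.ext (vx_ext fun t => (h t).symm) rfl)⟩

lemma corr_hom_ext {E : SSet.{u}} {j : Fin 2} {f g : (corr.{u} j : SSet.{u}) ⟶ E}
    (h1 : corrH j ≫ f = corrH j ≫ g) (h2 : corrV j ≫ f = corrV j ≫ g) : f = g := by
  ext U z
  obtain ⟨a, rfl⟩ | ⟨b, rfl⟩ := exists_corrH_or_corrV j z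
  · exact app_congr h1 a
  · exact app_congr h2 b

instance (j : Fin 2) : Mono (corrH.{u} j) := by
  refine mono_of_app_injective _ fun U a b h => ?_
  exact congrArg (fun z : (corr.{u} j : SSet.{u}).obj U => z.1.1) h

instance (j : Fin 2) : Mono (corrV.{u} j) := by
  refine mono_of_app_injective _ fun U a b h => ?_
  exact congrArg (fun z : (corr.{u} j : SSet.{u}).obj U => z.1.2) h

lemma exists_corr_hom {E : SSet.{u}} (j : Fin 2) (f g : Δ[1] ⟶ E)
    (h : f.app (op ⦋0⦌) (pt1 j) = g.app (op ⦋0⦌) (pt1 j)) :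
    ∃ c : (corr.{u} j : SSet.{u}) ⟶ E, corrH j ≫ c = f ∧ corrV j ≫ c = g := by
  refine exists_glue₂ (corrH j) (corrV j) f g (fun U z => exists_corrH_or_corrV j z)
    (fun U a b hab => ?_)
  have h1 : ∀ t, vx a t = j := fun t =>
    congrArg (fun z : (corr.{u} j : SSet.{u}).obj U => vx z.1.1 t) hab
  have h2 : ∀ t, j = vx b t := fun t =>
    congrArg (fun z : (corr.{u} j : SSet.{u}).obj U => vx z.1.2 t) hab
  rw [app_of_vx_eq f a j h1, app_of_vx_eq g b j fun t => (h2 t).symm, h]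

section

variable {D : SSet.{u}}

lemma horizontal_eq_app (σ : Sq.{u} ⟶ D) (b : Fin 2) :
    lift (𝟙 _) (SSet.const (pt1 b)) ≫ σ = SSet.yonedaEquiv.symm (horizontal σ b) := by
  refine Eq.trans ?_ (SSet.yonedaEquiv_symm_comp (show Sq.{u} _⦋1⦌ from (e01, cst b)) σ)
  refine congrArg (· ≫ σ) ?_
  refine Eq.trans ?_ (yonedaEquiv_symm_prod _ _).symm
  rw [yonedaEquiv_symm_e01, yonedaEquiv_symm_cst]

lemma vertical_eq_app (σ : Sq.{u} ⟶ D) (a : Fin 2) :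
    lift (SSet.const (pt1 a)) (𝟙 _) ≫ σ = SSet.yonedaEquiv.symm (vertical σ a) := by
  refine Eq.trans ?_ (SSet.yonedaEquiv_symm_comp (show Sq.{u} _⦋1⦌ from (cst a, e01)) σ)
  refine congrArg (· ≫ σ) ?_
  refine Eq.trans ?_ (yonedaEquiv_symm_prod _ _).symm
  rw [yonedaEquiv_symm_e01, yonedaEquiv_symm_cst]

lemma corrH_ι_comp (σ : Sq.{u} ⟶ D) (j : Fin 2) :
    corrH j ≫ (corr j).ι ≫ σ = SSet.yonedaEquiv.symm (horizontal σ j) := horizontal_eq_app σ j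

lemma corrV_ι_comp (σ : Sq.{u} ⟶ D) (j : Fin 2) :
    corrV j ≫ (corr j).ι ≫ σ = SSet.yonedaEquiv.symm (vertical σ j) := vertical_eq_app σ j

/-- The upper triangle of the square. -/
def upperTri : Δ[2] ⟶ Sq.{u} := lift (stdSimplex.σ 1) (stdSimplex.σ 0)

/-- The lower triangle of the square. -/
def lowerTri : Δ[2] ⟶ Sq.{u} := lift (stdSimplex.σ 0) (stdSimplex.σ 1)

lemma vx_upperTri {U} (s : (Δ[2] : SSet.{u}).obj U) (t) :
    vx (upperTri.app U s).1 t = Fin.predAbove 1 (vx s t) ∧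
      vx (upperTri.app U s).2 t = Fin.predAbove 0 (vx s t) := ⟨rfl, rfl⟩

lemma vx_lowerTri {U} (s : (Δ[2] : SSet.{u}).obj U) (t) :
    vx (lowerTri.app U s).1 t = Fin.predAbove 0 (vx s t) ∧
      vx (lowerTri.app U s).2 t = Fin.predAbove 1 (vx s t) := ⟨rfl, rfl⟩

lemma predAbove_injective : ∀ a b : Fin 3, Fin.predAbove (1 : Fin 2) a = Fin.predAbove 1 b →
    Fin.predAbove (0 : Fin 2) a = Fin.predAbove 0 b → a = b := by decide

instance : Mono upperTri.{u} := by
  refine mono_of_app_injective _ fun U a b h => vx_ext fun t => predAbove_injective _ _ ?_ ?_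
  · exact congrArg (fun z : Sq.{u}.obj U => vx z.1 t) h
  · exact congrArg (fun z : Sq.{u}.obj U => vx z.2 t) h

instance : Mono lowerTri.{u} := by
  refine mono_of_app_injective _ fun U a b h => vx_ext fun t => predAbove_injective _ _ ?_ ?_
  · exact congrArg (fun z : Sq.{u}.obj U => vx z.2 t) h
  · exact congrArg (fun z : Sq.{u}.obj U => vx z.1 t) h

/-- A chain in the square cannot pass through both (1,0) and (0,1), so it stays on one side of the
diagonal; the sum of the coordinates then gives its vertices in Δ[2]. -/
lemma exists_upperTri_or_lowerTri {U} (z : Sq.{u}.obj U) :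
    (∃ a, upperTri.app U a = z) ∨ ∃ b, lowerTri.app U b = z := by
  obtain ⟨x, y⟩ := z
  have hmono : ∀ p q p' q' : Fin 2, p ≤ p' → q ≤ q' →
      (⟨p.val + q.val, by omega⟩ : Fin 3) ≤ ⟨p'.val + q'.val, by omega⟩ := by decide
  obtain ⟨s, hs⟩ := exists_vx (n := 2) (U := U)
    (fun t => ⟨(vx x t).val + (vx y t).val, by omega⟩)
    (fun t t' h => hmono _ _ _ _ ((vx x).monotone h) ((vx y).monotone h))
  have h1 : ∀ p q : Fin 2, q ≤ p → Fin.predAbove (1 : Fin 2) ⟨p.val + q.val, by omega⟩ = p ∧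
      Fin.predAbove (0 : Fin 2) ⟨p.val + q.val, by omega⟩ = q := by decide
  have h2 : ∀ p q : Fin 2, p ≤ q → Fin.predAbove (0 : Fin 2) ⟨p.val + q.val, by omega⟩ = p ∧
      Fin.predAbove (1 : Fin 2) ⟨p.val + q.val, by omega⟩ = q := by decide
  by_cases h : ∀ t, vx y t ≤ vx x t
  · refine Or.inl ⟨s, Prod.ext (vx_ext fun t => ?_) (vx_ext fun t => ?_)⟩
    · rw [(vx_upperTri s t).1, hs]
      exact (h1 _ _ (h t)).1
    · rw [(vx_upperTri s t).2, hs]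
      exact (h1 _ _ (h t)).2
  · have h' : ∀ t, vx x t ≤ vx y t := by
      obtain ⟨t₀, ht₀⟩ := not_forall.1 h
      intro t
      by_contra ht
      have h3 : ∀ p q p' q' : Fin 2, ¬ q ≤ p → ¬ p' ≤ q' → ¬ (p ≤ p' ∧ q ≤ q') ∧
        ¬ (p' ≤ p ∧ q' ≤ q) := by decide
      obtain h4 | h4 := le_total t₀ t
      · exact (h3 _ _ _ _ ht₀ ht).1 ⟨(vx x).monotone h4, (vx y).monotone h4⟩
      · exact (h3 _ _ _ _ ht₀ ht).2 ⟨(vx x).monotone h4, (vx y).monotone h4⟩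
    refine Or.inr ⟨s, Prod.ext (vx_ext fun t => ?_) (vx_ext fun t => ?_)⟩
    · rw [(vx_lowerTri s t).1, hs]
      exact (h2 _ _ (h' t)).1
    · rw [(vx_lowerTri s t).2, hs]
      exact (h2 _ _ (h' t)).2

lemma exists_square_of_simplices (c c' : D _⦋2⦌) (h : D.δ 1 c = D.δ 1 c') :
    ∃ σ : Sq.{u} ⟶ D, horizontal σ 0 = D.δ 2 c ∧ vertical σ 1 = D.δ 0 c ∧
      vertical σ 0 = D.δ 2 c' ∧ horizontal σ 1 = D.δ 0 c' := by
  obtain ⟨σ, h1, h2⟩ := exists_glue₂ upperTri.{u} lowerTri.{u} (SSet.yonedaEquiv.symm c)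
    (SSet.yonedaEquiv.symm c') (fun U z => exists_upperTri_or_lowerTri z) (fun U a b hab => by
      have key : ∀ p q : Fin 3, Fin.predAbove (1 : Fin 2) p = Fin.predAbove 0 q →
        Fin.predAbove (0 : Fin 2) p = Fin.predAbove 1 q →
        p = Fin.succAbove 1 (Fin.predAbove (1 : Fin 2) p) ∧
        q = Fin.succAbove 1 (Fin.predAbove (1 : Fin 2) p) := by decide
      have h3 : ∀ t, vx a t = Fin.succAbove 1 (Fin.predAbove (1 : Fin 2) (vx a t)) ∧
          vx b t = Fin.succAbove 1 (Fin.predAbove (1 : Fin 2) (vx a t)) := fun t =>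
        key _ _ (congrArg (fun z : Sq.{u}.obj U => vx z.1 t) hab)
          (congrArg (fun z : Sq.{u}.obj U => vx z.2 t) hab)
      have h4 : (stdSimplex.δ 1).app U ((stdSimplex.σ 1).app U a) = a :=
        vx_ext fun t => (h3 t).1.symm
      have h5 : (stdSimplex.δ 1).app U ((stdSimplex.σ 1).app U a) = b :=
        vx_ext fun t => (h3 t).2.symm
      have h6 : stdSimplex.δ 1 ≫ SSet.yonedaEquiv.symm c =
          stdSimplex.δ 1 ≫ SSet.yonedaEquiv.symm c' := by
        rw [yonedaEquiv_symm_δ, yonedaEquiv_symm_δ, h]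
      have h7 := app_congr h6 ((stdSimplex.σ 1).app U a)
      refine Eq.trans ?_ (h7.trans ?_)
      · exact congrArg ((SSet.yonedaEquiv.symm c).app U) h4.symm
      · exact congrArg ((SSet.yonedaEquiv.symm c').app U) h5)
  have h3 : ∀ (d : D _⦋2⦌) (i : Fin 3), (SSet.yonedaEquiv.symm d).app (op ⦋1⦌)
      ((stdSimplex.δ i).app (op ⦋1⦌) e01) = D.δ i d := fun d i =>
    (app_congr (yonedaEquiv_symm_δ d i) e01).trans (yonedaEquiv_symm_app_e01 _)
  refine ⟨σ, ?_, ?_, ?_, ?_⟩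
  · rw [← h3, ← h1]
    exact congrArg (σ.app (op ⦋1⦌)) (Prod.ext (by ext i; fin_cases i <;> rfl)
      (by ext i; fin_cases i <;> rfl))
  · rw [← h3, ← h1]
    exact congrArg (σ.app (op ⦋1⦌)) (Prod.ext (by ext i; fin_cases i <;> rfl)
      (by ext i; fin_cases i <;> rfl))
  · rw [← h3, ← h2]
    exact congrArg (σ.app (op ⦋1⦌)) (Prod.ext (by ext i; fin_cases i <;> rfl)
      (by ext i; fin_cases i <;> rfl))
  · rw [← h3, ← h2]
    exact congrArg (σ.app (op ⦋1⦌)) (Prod.ext (by ext i; fin_cases i <;> rfl)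
      (by ext i; fin_cases i <;> rfl))

variable [Quasicategory D]

/-- Both composites can be witnessed by triangles with one and the same third edge, since they have
the same homotopy class; the triangles are glued along it. -/
lemma exists_square {x y z w : D _⦋0⦌} (t : Edge x y) (r : Edge y w) (l : Edge x z)
    (b : Edge z w) (h : Hc.hom t ≫ Hc.hom r = Hc.hom l ≫ Hc.hom b) :
    ∃ σ : Sq.{u} ⟶ D, horizontal σ 0 = t.edge ∧ vertical σ 1 = r.edge ∧
      vertical σ 0 = l.edge ∧ horizontal σ 1 = b.edge := by
  obtain ⟨d, hd⟩ := Hc.hom_surjective (Hc.hom t ≫ Hc.hom r)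
  obtain ⟨c⟩ := Hc.nonempty_compStruct_iff.2 hd.symm
  obtain ⟨c'⟩ := Hc.nonempty_compStruct_iff.2 (h.symm.trans hd.symm)
  obtain ⟨σ, h1, h2, h3, h4⟩ := exists_square_of_simplices c.simplex c'.simplex
    (c.d₁.trans c'.d₁.symm)
  exact ⟨σ, h1.trans c.d₂, h2.trans c.d₀, h3.trans c'.d₂, h4.trans c'.d₀⟩

end

/-! ### Maps between squares -/

section

variable {D : SSet.{u}}

lemma yonedaEquiv_symm_whiskerRight (Q : Sq.{u} ⟶ D) (a : Fin 2) :
    SSet.yonedaEquiv.symm (pt1 a) ▷ _ ≫ Q =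
      snd _ _ ≫ SSet.yonedaEquiv.symm (vertical Q a) := by
  rw [← vertical_eq_app]
  rfl

lemma cyl_vertex_eq {Q Q' : Sq.{u} ⟶ D} {a : Fin 2} (h : vertical Q a = vertical Q' a) :
    (cyl Q).app (op ⦋0⦌) (pt1 a) = (cyl Q').app (op ⦋0⦌) (pt1 a) := by
  have h1 : SSet.yonedaEquiv.symm (pt1 a) ≫ cyl Q = SSet.yonedaEquiv.symm (pt1 a) ≫ cyl Q' := by
    rw [comp_cyl, comp_cyl, yonedaEquiv_symm_whiskerRight, yonedaEquiv_symm_whiskerRight, h]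
  have h2 : ∀ R : Sq.{u} ⟶ D, SSet.yonedaEquiv (SSet.yonedaEquiv.symm (pt1 a) ≫ cyl R) =
      (cyl R).app (op ⦋0⦌) (pt1 a) := fun R => by
    rw [SSet.yonedaEquiv_comp, Equiv.apply_symm_apply]
  rw [← h2, ← h2, h1]

/-- A (co)span is two intervals sharing a vertex, so a transformation is a square over each leg,
agreeing strictly on the edge over the shared vertex. -/
lemma exists_trans_corr (j : Fin 2) (σ ρ Q Q' : Sq.{u} ⟶ D)
    (h0 : horizontal Q 0 = horizontal σ j) (h1 : horizontal Q 1 = horizontal ρ j)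
    (h0' : horizontal Q' 0 = vertical σ j) (h1' : horizontal Q' 1 = vertical ρ j)
    (h : vertical Q j = vertical Q' j) :
    ∃ φ : Trans ((corr j).ι ≫ σ) ((corr j).ι ≫ ρ),
      (∀ p, (φ.app (obj (corrH j) (pt1 p))).edge = vertical Q p) ∧
      ∀ p, (φ.app (obj (corrV j) (pt1 p))).edge = vertical Q' p := by
  obtain ⟨c, hc, hc'⟩ := exists_corr_hom j (cyl Q) (cyl Q') (cyl_vertex_eq h)
  have k1 : corrH j ▷ _ ≫ uncyl c = Q := by rw [comp_uncyl, hc, uncyl_cyl]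
  have k2 : corrV j ▷ _ ≫ uncyl c = Q' := by rw [comp_uncyl, hc', uncyl_cyl]
  have e : ∀ (b : Fin 2) (τ : Sq.{u} ⟶ D), horizontal Q b = horizontal τ j →
      horizontal Q' b = vertical τ j →
      atVertex (corr.{u} j : SSet.{u}) (pt1 b) ≫ uncyl c = (corr j).ι ≫ τ := by
    intro b τ hb hb'
    refine corr_hom_ext ?_ ?_
    · refine Eq.trans ?_ (corrH_ι_comp τ j).symm
      refine Eq.trans ?_ ((horizontal_eq_app Q b).trans (congrArg SSet.yonedaEquiv.symm hb))
      rw [← k1]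
      rfl
    · refine Eq.trans ?_ (corrV_ι_comp τ j).symm
      refine Eq.trans ?_ ((horizontal_eq_app Q' b).trans (congrArg SSet.yonedaEquiv.symm hb'))
      rw [← k2]
      rfl
  refine ⟨⟨uncyl c, ?_, ?_⟩, fun p => ?_, fun p => ?_⟩
  · rw [ι₀_eq_atVertex]
    exact e 0 σ h0 h0'
  · rw [ι₁_eq_atVertex]
    exact e 1 ρ h1 h1'
  · rw [← k1]
    exact congrArg ((uncyl c).app (op ⦋1⦌)) (Prod.ext
      (NatTrans.naturality_apply (corrH j) _ (pt1 p)).symm rfl)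
  · rw [← k2]
    exact congrArg ((uncyl c).app (op ⦋1⦌)) (Prod.ext
      (NatTrans.naturality_apply (corrV j) _ (pt1 p)).symm rfl)

variable [Quasicategory D]

/-- The corners of a square, as objects of the homotopy category. -/
abbrev cn (σ : Sq.{u} ⟶ D) (a b : Fin 2) : Hc D := ⟨corner σ a b⟩

/-- The horizontal morphisms of a square in the homotopy category. -/
def hz (σ : Sq.{u} ⟶ D) (b : Fin 2) : cn σ 0 b ⟶ cn σ 1 b := Hc.hom (hEdge σ b)

/-- The vertical morphisms of a square in the homotopy category. -/
def vt (σ : Sq.{u} ⟶ D) (a : Fin 2) : cn σ a 0 ⟶ cn σ a 1 := Hc.hom (vEdge σ a)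

/-- The components of a map of squares. -/
def evSq {σ ρ : Sq.{u} ⟶ D} (f : (⟨σ⟩ : FunHo Sq D) ⟶ ⟨ρ⟩) (a b : Fin 2) :
    cn σ a b ⟶ cn ρ a b :=
  (FunHo.ev (show Sq.{u} _⦋0⦌ from (pt1 a, pt1 b)) D).map f

lemma hz_evSq {σ ρ : Sq.{u} ⟶ D} (f : (⟨σ⟩ : FunHo Sq D) ⟶ ⟨ρ⟩) (b : Fin 2) :
    hz σ b ≫ evSq f 1 b = evSq f 0 b ≫ hz ρ b := by
  obtain ⟨α, rfl⟩ := FunHo.hom_surjective f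
  have h : ∀ a, evSq (FunHo.hom α) a b = Hc.hom (α.app (corner (𝟙 Sq) a b)) := fun a =>
    FunHo.ev_hom _ α
  rw [h, h]
  exact Hc.app_naturality α (hEdge (𝟙 Sq) b)

lemma vt_evSq {σ ρ : Sq.{u} ⟶ D} (f : (⟨σ⟩ : FunHo Sq D) ⟶ ⟨ρ⟩) (a : Fin 2) :
    vt σ a ≫ evSq f a 1 = evSq f a 0 ≫ vt ρ a := by
  obtain ⟨α, rfl⟩ := FunHo.hom_surjective f
  have h : ∀ b, evSq (FunHo.hom α) a b = Hc.hom (α.app (corner (𝟙 Sq) a b)) := fun b =>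
    FunHo.ev_hom _ α
  rw [h, h]
  exact Hc.app_naturality α (vEdge (𝟙 Sq) a)

lemma isIso_evSq {σ ρ : Sq.{u} ⟶ D} (f : (⟨σ⟩ : FunHo Sq D) ⟶ ⟨ρ⟩) [IsIso f] (a b : Fin 2) :
    IsIso (evSq f a b) :=
   Functor.map_isIso (FunHo.ev (show Sq.{u} _⦋0⦌ from (pt1 a, pt1 b)) D) f

/-- A map of spans or cospans. -/
lemma exists_corr_map (j : Fin 2) (σ ρ : Sq.{u} ⟶ D)
    (f : ∀ p : Fin 2, cn σ p j ⟶ cn ρ p j) (g : ∀ p : Fin 2, cn σ j p ⟶ cn ρ j p)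
    (hfg : f j = g j) (hf : hz σ j ≫ f 1 = f 0 ≫ hz ρ j) (hg : vt σ j ≫ g 1 = g 0 ≫ vt ρ j) :
    ∃ φ : (⟨(corr j).ι ≫ σ⟩ : FunHo (corr.{u} j : SSet.{u}) D) ⟶ ⟨(corr j).ι ≫ ρ⟩,
      (∀ p, (FunHo.ev (obj (corrH j) (pt1 p)) D).map φ = f p) ∧
      ∀ p, (FunHo.ev (obj (corrV j) (pt1 p)) D).map φ = g p := by
  choose f' hf' using fun p => Hc.hom_surjective (f p)
  choose g₀ hg₀ using fun p => Hc.hom_surjective (g p)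
  -- Equality f j = g j of homotopy classes does not suffice for gluing; the representative chosen
  -- for f j is therefore reused for g j.
  obtain ⟨g', hg', hfg'⟩ : ∃ g' : ∀ p, Edge (corner σ j p) (corner ρ j p),
      (∀ p, Hc.hom (g' p) = g p) ∧ f' j = g' j := by
    refine ⟨Function.update g₀ j (f' j), fun p => ?_, by rw [Function.update_self]⟩
    by_cases hp : p = j
    · subst hp
      rw [Function.update_self, hf', hfg]
    · rw [Function.update_of_ne hp, hg₀]
  obtain ⟨Q, q1, q2, q3, q4⟩ := exists_square (hEdge σ j) (f' 1) (f' 0) (hEdge ρ j) (by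
    rw [hf', hf']; exact hf)
  obtain ⟨Q', q1', q2', q3', q4'⟩ := exists_square (vEdge σ j) (g' 1) (g' 0) (vEdge ρ j) (by
    rw [hg', hg']; exact hg)
  have hQ : ∀ p, vertical Q p = (f' p).edge := fun p => by
    obtain rfl | rfl := eq_zero_or_one p
    · exact q3
    · exact q2
  have hQ' : ∀ p, vertical Q' p = (g' p).edge := fun p => by
    obtain rfl | rfl := eq_zero_or_one p
    · exact q3'
    · exact q2'
  obtain ⟨φ, h1, h2⟩ := exists_trans_corr j σ ρ Q Q' q1 q4 q1' q4' (by rw [hQ, hQ', hfg'])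
  refine ⟨FunHo.hom φ, fun p => ?_, fun p => ?_⟩
  · refine (FunHo.ev_hom _ φ).trans (Eq.trans ?_ (hf' p))
    exact congrArg Hc.hom (Edge.ext ((h1 p).trans (hQ p)))
  · refine (FunHo.ev_hom _ φ).trans (Eq.trans ?_ (hg' p))
    exact congrArg Hc.hom (Edge.ext ((h2 p).trans (hQ' p)))

lemma isIso_corr_map {j : Fin 2} {σ ρ : Sq.{u} ⟶ D}
    (φ : (⟨(corr j).ι ≫ σ⟩ : FunHo (corr.{u} j : SSet.{u}) D) ⟶ ⟨(corr j).ι ≫ ρ⟩)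
    (h1 : ∀ p, IsIso ((FunHo.ev (obj (corrH j) (pt1 p)) D).map φ))
    (h2 : ∀ p, IsIso ((FunHo.ev (obj (corrV j) (pt1 p)) D).map φ)) : IsIso φ := by
  have hp : ∀ x : (Δ[1] : SSet.{u}) _⦋0⦌, ∃ p, pt1 p = x := fun x =>
    ⟨stdSimplex.obj₀Equiv x, stdSimplex.obj₀Equiv.symm_apply_apply x⟩
  refine FunHo.isIso_of_ev φ fun k => ?_
  obtain ⟨a, rfl⟩ | ⟨a, rfl⟩ := exists_corrH_or_corrV j k
  · obtain ⟨p, rfl⟩ := hp a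
    exact h1 p
  · obtain ⟨p, rfl⟩ := hp a
    exact h2 p

lemma ev_corrH {j : Fin 2} {σ ρ : Sq.{u} ⟶ D} (f : (⟨σ⟩ : FunHo Sq D) ⟶ ⟨ρ⟩) (p : Fin 2) :
    (FunHo.ev (obj (corrH j) (pt1 p)) D).map ((FunHo.pre (corr j).ι D).map f) = evSq f p j :=
  FunHo.ev_pre (corr j).ι _ f

lemma ev_corrV {j : Fin 2} {σ ρ : Sq.{u} ⟶ D} (f : (⟨σ⟩ : FunHo Sq D) ⟶ ⟨ρ⟩) (p : Fin 2) :
    (FunHo.ev (obj (corrV j) (pt1 p)) D).map ((FunHo.pre (corr j).ι D).map f) = evSq f j p :=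
  FunHo.ev_pre (corr j).ι _ f

/-- A map from a square with the left Kan extension property is determined by a map on the span. -/
lemma HInitial.exists_map {σ : Sq.{u} ⟶ D} (hσ : HInitial span.ι σ) (ρ : Sq.{u} ⟶ D)
    (a : cn σ 0 0 ⟶ cn ρ 0 0) (b : cn σ 1 0 ⟶ cn ρ 1 0) (c : cn σ 0 1 ⟶ cn ρ 0 1)
    (hb : hz σ 0 ≫ b = a ≫ hz ρ 0) (hc : vt σ 0 ≫ c = a ≫ vt ρ 0) :
    ∃ f : (⟨σ⟩ : FunHo Sq D) ⟶ ⟨ρ⟩, evSq f 0 0 = a ∧ evSq f 1 0 = b ∧ evSq f 0 1 = c := by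
  obtain ⟨φ, h1, h2⟩ := exists_corr_map 0 σ ρ (Fin.cons a (Fin.cons b finZeroElim))
    (Fin.cons a (Fin.cons c finZeroElim)) rfl hb hc
  obtain ⟨f, hf⟩ := (hσ ⟨ρ⟩).2 φ
  subst hf
  exact ⟨f, (ev_corrH f 0).symm.trans (h1 0), (ev_corrH f 1).symm.trans (h1 1),
    (ev_corrV f 1).symm.trans (h2 1)⟩

lemma HInitial.exists_square_iso {σ ρ : Sq.{u} ⟶ D} (hσ : HInitial span.ι σ)
    (hρ : HInitial span.ι ρ)
    (a : cn σ 0 0 ≅ cn ρ 0 0) (b : cn σ 1 0 ≅ cn ρ 1 0) (c : cn σ 0 1 ≅ cn ρ 0 1)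
    (hb : hz σ 0 ≫ b.hom = a.hom ≫ hz ρ 0) (hc : vt σ 0 ≫ c.hom = a.hom ≫ vt ρ 0) :
    ∃ f : (⟨σ⟩ : FunHo Sq D) ⟶ ⟨ρ⟩, IsIso f ∧ evSq f 0 0 = a.hom ∧ evSq f 1 0 = b.hom ∧
      evSq f 0 1 = c.hom := by
  obtain ⟨φ, h1, h2⟩ := exists_corr_map 0 σ ρ (Fin.cons a.hom (Fin.cons b.hom finZeroElim))
    (Fin.cons a.hom (Fin.cons c.hom finZeroElim)) rfl hb hc
  have : IsIso φ := by
    refine isIso_corr_map φ (fun p => ?_) fun p => ?_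
    · rw [h1]
      obtain rfl | rfl := eq_zero_or_one p
      · exact inferInstanceAs (IsIso a.hom)
      · exact inferInstanceAs (IsIso b.hom)
    · rw [h2]
      obtain rfl | rfl := eq_zero_or_one p
      · exact inferInstanceAs (IsIso a.hom)
      · exact inferInstanceAs (IsIso c.hom)
  obtain ⟨f, hf⟩ := hσ.exists_iso hρ (@asIso _ _ _ _ φ this)
  have hf' : (FunHo.pre (corr 0).ι D).map f.hom = φ := hf
  subst hf'
  exact ⟨f.hom, inferInstance, (ev_corrH f.hom 0).symm.trans (h1 0),
    (ev_corrH f.hom 1).symm.trans (h1 1), (ev_corrV f.hom 1).symm.trans (h2 1)⟩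

lemma HTerminal.exists_square_iso {σ ρ : Sq.{u} ⟶ D} (hσ : HTerminal cospan.ι σ)
    (hρ : HTerminal cospan.ι ρ)
    (a : cn ρ 1 1 ≅ cn σ 1 1) (b : cn ρ 0 1 ≅ cn σ 0 1) (c : cn ρ 1 0 ≅ cn σ 1 0)
    (hb : hz ρ 1 ≫ a.hom = b.hom ≫ hz σ 1) (hc : vt ρ 1 ≫ a.hom = c.hom ≫ vt σ 1) :
    ∃ f : (⟨ρ⟩ : FunHo Sq D) ⟶ ⟨σ⟩, IsIso f ∧ evSq f 1 1 = a.hom ∧ evSq f 0 1 = b.hom ∧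
      evSq f 1 0 = c.hom := by
  obtain ⟨φ, h1, h2⟩ := exists_corr_map 1 ρ σ (Fin.cons b.hom (Fin.cons a.hom finZeroElim))
    (Fin.cons c.hom (Fin.cons a.hom finZeroElim)) rfl hb hc
  have : IsIso φ := by
    refine isIso_corr_map φ (fun p => ?_) fun p => ?_
    · rw [h1]
      obtain rfl | rfl := eq_zero_or_one p
      · exact inferInstanceAs (IsIso b.hom)
      · exact inferInstanceAs (IsIso a.hom)
    · rw [h2]
      obtain rfl | rfl := eq_zero_or_one p
      · exact inferInstanceAs (IsIso c.hom)
      · exact inferInstanceAs (IsIso a.hom)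
  obtain ⟨f, hf⟩ := hρ.exists_iso hσ (@asIso _ _ _ _ φ this)
  have hf' : (FunHo.pre (corr 1).ι D).map f.hom = φ := hf
  subst hf'
  exact ⟨f.hom, inferInstance, (ev_corrH f.hom 1).symm.trans (h1 1),
    (ev_corrH f.hom 0).symm.trans (h1 0), (ev_corrV f.hom 0).symm.trans (h2 0)⟩

end

/-! ### Restriction along adjoint maps of shapes -/

section

variable {𝒜 ℬ : Type*} [Category 𝒜] [Category ℬ] (U : 𝒜 ⥤ ℬ) (V : ℬ ⥤ 𝒜) (θ : V ⋙ U ≅ 𝟭 ℬ)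

/-- The inverse sends g to the composite of ε_π⁻¹, V g and ε_ρ. In the application U restricts along
a section of shapes and V along its retraction. -/
lemma bijective_map_of_isIso_counit (ε : U ⋙ V ⟶ 𝟭 𝒜)
    (hθ : ∀ X, U.map (ε.app X) = θ.hom.app (U.obj X)) (π ρ : 𝒜) [IsIso (ε.app π)] :
    Function.Bijective fun f : π ⟶ ρ => U.map f := by
  constructor
  · intro f g h
    rw [← cancel_epi (ε.app π)]
    have h1 := ε.naturality f
    have h2 := ε.naturality g
    dsimp at h h1 h2
    rw [← h1, ← h2, h]
  · intro g
    refine ⟨inv (ε.app π) ≫ V.map g ≫ ε.app ρ, ?_⟩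
    have h := θ.hom.naturality g
    dsimp at h
    have h2 : U.map (ε.app π) ≫ U.map (inv (ε.app π) ≫ V.map g ≫ ε.app ρ) =
        U.map (ε.app π) ≫ g := by
      rw [← U.map_comp, IsIso.hom_inv_id_assoc, U.map_comp, hθ, hθ]
      exact h
    exact (cancel_epi (U.map (ε.app π))).1 h2

lemma bijective_map_of_isIso_unit (η : 𝟭 𝒜 ⟶ U ⋙ V)
    (hθ : ∀ X, U.map (η.app X) = θ.inv.app (U.obj X)) (π ρ : 𝒜) [IsIso (η.app ρ)] :
    Function.Bijective fun f : π ⟶ ρ => U.map f := by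
  constructor
  · intro f g h
    rw [← cancel_mono (η.app ρ)]
    have h1 := η.naturality f
    have h2 := η.naturality g
    dsimp at h h1 h2
    rw [h1, h2, h]
  · intro g
    refine ⟨η.app π ≫ V.map g ≫ inv (η.app ρ), ?_⟩
    have h := θ.inv.naturality g
    dsimp at h
    have h2 : U.map (η.app π ≫ V.map g ≫ inv (η.app ρ)) ≫ U.map (η.app ρ) =
        g ≫ U.map (η.app ρ) := by
      rw [← U.map_comp, Category.assoc, Category.assoc, IsIso.inv_hom_id, Category.comp_id,
        U.map_comp, hθ, hθ]
      exact h.symm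
    exact (cancel_mono (U.map (η.app ρ))).1 h2

end

namespace FunHo

variable {A P D : SSet.{u}} [Quasicategory D] {k : A ⟶ P} {p : P ⟶ A}

lemma eqToHom_conj_comp {𝒜 : Type*} [Category 𝒜] {X Y X' Y' : 𝒜} (f : X ⟶ Y) (a : X' = X)
    (b : Y = Y') (c : Y' = Y) : (eqToHom a ≫ f ≫ eqToHom b) ≫ eqToHom c = eqToHom a ≫ f := by
  simp

lemma pre_map_of_eq_id {m : A ⟶ A} (hm : m = 𝟙 A) {F G : FunHo A D} (f : F ⟶ G) :
    (pre m D).map f = eqToHom (by subst hm; rfl) ≫ f ≫ eqToHom (by subst hm; rfl) := by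
  subst hm
  obtain ⟨α, rfl⟩ := hom_surjective f
  refine (pre_hom (𝟙 A) α).trans ?_
  refine Eq.trans ?_ (Eq.trans (Category.id_comp _) (Category.comp_id _)).symm
  rfl

lemma hom_eq_eqToHom {F G : A ⟶ D} (α : Trans F G) (h : α.hom = fst _ _ ≫ F) :
    ∃ e : F = G, hom α = eqToHom (by rw [e]) := by
  have e : F = G := by
    rw [← α.target, h]
    rfl
  subst e
  refine ⟨rfl, Eq.trans ?_ (hom_id F)⟩
  exact congrArg hom (Trans.ext_of_hom h)

lemma pre_pre_obj (h : k ≫ p = 𝟙 A) (F : FunHo A D) :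
    (pre k D).obj ((pre p D).obj F) = F := by
  change (⟨(k ≫ p) ≫ F.fn⟩ : FunHo A D) = F
  rw [h]
  rfl

/-- The restriction functors along a section-retraction pair. -/
def preIso (h : k ≫ p = 𝟙 A) : pre p D ⋙ pre k D ≅ 𝟭 (FunHo A D) :=
  NatIso.ofComponents (fun F => eqToIso (pre_pre_obj h F)) (fun {F G} f => by
    have h1 : (pre k D).map ((pre p D).map f) = _ :=
      (pre_pre k p f).trans (pre_map_of_eq_id h f)
    have e := pre_pre_obj h G
    exact (congrArg (· ≫ eqToHom e) h1).trans (eqToHom_conj_comp f _ _ e))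

/-- The homotopy ε contracts P onto A while keeping A fixed. A diagram π sending ε to an isomorphism
is recovered from its restriction to A, and so are the maps out of it. -/
lemma bijective_pre_of_counit (h : k ≫ p = 𝟙 A) (ε : Trans (p ≫ k) (𝟙 P))
    (hε : k ▷ _ ≫ ε.hom = fst _ _ ≫ k) {π : P ⟶ D} (ρ : P ⟶ D)
    (hπ : IsIso (hom (ε.whiskerRight π))) :
    Function.Bijective fun f : (⟨π⟩ : FunHo P D) ⟶ ⟨ρ⟩ => (pre k D).map f := by
  let ε' : pre k D ⋙ pre p D ⟶ 𝟭 (FunHo P D) :=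
    { app := fun F => hom (ε.whiskerRight F.fn)
      naturality := fun F G f => by
        obtain ⟨α, rfl⟩ := hom_surjective f
        have h1 : (pre p D).map ((pre k D).map (hom α)) = hom (Trans.whiskerLeft (p ≫ k) α) :=
          (pre_pre p k _).trans (pre_hom _ _)
        exact (congrArg (· ≫ hom (ε.whiskerRight G.fn)) h1).trans (interchange ε α).symm }
  have : IsIso (ε'.app ⟨π⟩) := hπ
  refine bijective_map_of_isIso_counit (pre k D) (pre p D) (preIso h) ε' (fun X => ?_) ⟨π⟩ ⟨ρ⟩
  have h2 : (Trans.whiskerLeft k (ε.whiskerRight X.fn)).hom = fst _ _ ≫ k ≫ p ≫ k ≫ X.fn := by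
    have h3 : k ▷ _ ≫ ε.hom ≫ X.fn = fst _ _ ≫ (k ≫ p) ≫ k ≫ X.fn := by
      rw [h, Category.id_comp, ← Category.assoc, hε, Category.assoc]
    exact h3
  obtain ⟨e, he⟩ := hom_eq_eqToHom _ h2
  exact (pre_hom k _).trans he

lemma bijective_pre_of_unit (h : k ≫ p = 𝟙 A) (η : Trans (𝟙 P) (p ≫ k))
    (hη : k ▷ _ ≫ η.hom = fst _ _ ≫ k) (π : P ⟶ D) {ρ : P ⟶ D}
    (hρ : IsIso (hom (η.whiskerRight ρ))) :
    Function.Bijective fun f : (⟨π⟩ : FunHo P D) ⟶ ⟨ρ⟩ => (pre k D).map f := by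
  let η' : 𝟭 (FunHo P D) ⟶ pre k D ⋙ pre p D :=
    { app := fun F => hom (η.whiskerRight F.fn)
      naturality := fun F G f => by
        obtain ⟨α, rfl⟩ := hom_surjective f
        have h1 : (pre p D).map ((pre k D).map (hom α)) = hom (Trans.whiskerLeft (p ≫ k) α) :=
          (pre_pre p k _).trans (pre_hom _ _)
        exact (interchange η α).symm.trans (congrArg (hom (η.whiskerRight F.fn) ≫ ·) h1.symm) }
  have : IsIso (η'.app ⟨ρ⟩) := hρ
  refine bijective_map_of_isIso_unit (pre k D) (pre p D) (preIso h) η' (fun X => ?_) ⟨π⟩ ⟨ρ⟩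
  have h2 : (Trans.whiskerLeft k (η.whiskerRight X.fn)).hom = fst _ _ ≫ k ≫ X.fn := by
    have h3 : k ▷ _ ≫ η.hom ≫ X.fn = fst _ _ ≫ k ≫ X.fn := by
      rw [← Category.assoc, hη, Category.assoc]
    exact h3
  obtain ⟨e, he⟩ := hom_eq_eqToHom _ h2
  exact (pre_hom k _).trans he

end FunHo

/-! ### Maps of simplices given on vertices -/

/-- The map from a product of simplices to a simplex given by a monotone map on vertices. -/
def vmap {m n l : ℕ} (φ : Fin (m + 1) → Fin (n + 1) → Fin (l + 1))
    (hφ : ∀ a a' b b', a ≤ a' → b ≤ b' → φ a b ≤ φ a' b') :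
    (Δ[m] : SSet.{u}) ⊗ Δ[n] ⟶ Δ[l] where
  app U := ↾fun z => mkx ⟨fun t => φ (vx z.1 t) (vx z.2 t), fun _ _ h =>
    hφ _ _ _ _ ((vx z.1).monotone h) ((vx z.2).monotone h)⟩
  naturality U V f := by
    ext z
    rfl

/-- The minimum map. -/
def minMap : Sq.{u} ⟶ Δ[1] := vmap (fun a b => min a b) (by decide)

/-- The column of the square. -/
def col (a : Fin 2) : Δ[1] ⟶ Sq.{u} := lift (SSet.const (pt1 a)) (𝟙 _)

/-- The contraction of the square to its left column. -/
def colHom : Trans (snd Δ[1] Δ[1] ≫ col.{u} 0) (𝟙 Sq.{u}) where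
  hom := lift (lift (fst _ _ ≫ fst _ _) (snd _ _) ≫ minMap) (fst _ _ ≫ snd _ _)
  source := by
    ext U z
    · refine vx_ext fun t => ?_
      have h : ∀ a : Fin 2, min a 0 = 0 := by decide
      exact h _
    · rfl
  target := by
    ext U z
    · refine vx_ext fun t => ?_
      have h : ∀ a : Fin 2, min a 1 = a := by decide
      exact h _
    · rfl

lemma colHom_col : col.{u} 0 ▷ _ ≫ colHom.hom = fst _ _ ≫ col.{u} 0 := by
  ext U z
  · refine vx_ext fun t => ?_
    have h : ∀ a : Fin 2, min 0 a = 0 := by decide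
    exact h _
  · rfl

/-- The contraction of the span to its left column. -/
def spanColHom : Trans ((span.ι ≫ snd Δ[1] Δ[1]) ≫ corrV.{u} 0) (𝟙 (span.{u} : SSet.{u})) where
  hom := Subcomplex.lift (span.ι ▷ _ ≫ colHom.hom) (by
    rintro U _ ⟨⟨⟨⟨x, y⟩, h⟩, s⟩, rfl⟩
    have h' : ∀ a b : Fin 2, a = 0 → min a b = 0 := by decide
    refine (mem_corr_iff 0 _ _).2 (((mem_corr_iff 0 x y).1 h).imp id fun hx t => h' _ _ (hx t)))
  source := by
    refine (cancel_mono (corr 0).ι).1 ?_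
    refine Eq.trans ?_ (congrArg (span.ι ≫ ·) colHom.source)
    rfl
  target := by
    refine (cancel_mono (corr 0).ι).1 ?_
    exact (congrArg (span.ι ≫ ·) colHom.target)

lemma spanColHom_col : corrV.{u} 0 ▷ _ ≫ spanColHom.hom = fst _ _ ≫ corrV.{u} 0 := by
  refine (cancel_mono (corr 0).ι).1 ?_
  exact colHom_col

section

variable {D : SSet.{u}} [Quasicategory D]

lemma isIso_hom_of_eq {A : SSet.{u}} {F G : A ⟶ D} (α : Trans F G) (h : α.hom = fst _ _ ≫ F) :
    IsIso (FunHo.hom α) := by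
  obtain ⟨e, he⟩ := FunHo.hom_eq_eqToHom α h
  rw [he]
  infer_instance

/-- Squares that are constant in the horizontal direction are pushouts. -/
lemma hInitial_snd (g : Δ[1] ⟶ D) : HInitial span.ι (snd Δ[1] Δ[1] ≫ g) := by
  rintro ⟨ρ⟩
  have h1 := FunHo.bijective_pre_of_counit (k := col 0) (p := snd _ _) rfl colHom colHom_col
    (π := snd _ _ ≫ g) ρ (isIso_hom_of_eq _ rfl)
  have h2 := FunHo.bijective_pre_of_counit (k := corrV 0) (p := span.ι ≫ snd _ _) rfl spanColHom
    spanColHom_col (π := span.ι ≫ snd _ _ ≫ g) (span.ι ≫ ρ) (isIso_hom_of_eq _ rfl)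
  -- Both the square and the span contract onto the left column, so restriction from the square to
  -- the span is bijective by cancellation.
  refine (h2.of_comp_iff' _).1 ?_
  have h3 : (fun f : (⟨snd _ _ ≫ g⟩ : FunHo Sq D) ⟶ ⟨ρ⟩ =>
      (FunHo.pre (corrV 0) D).map ((FunHo.pre span.ι D).map f)) =
      fun f => (FunHo.pre (col 0) D).map f := by
    funext f
    exact FunHo.pre_pre _ _ f
  rw [← h3] at h1
  exact h1

end

/-! ### Transposition of squares -/

/-- The exchange of the two directions of a square. -/
abbrev flip : Sq.{u} ⟶ Sq.{u} := lift (snd _ _) (fst _ _)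

/-- The exchange of the two directions of a span. -/
def spanFlip : (span.{u} : SSet.{u}) ⟶ span.{u} := Subcomplex.lift (span.ι ≫ flip) (by
  rintro U _ ⟨⟨⟨x, y⟩, h⟩, rfl⟩
  exact (mem_corr_iff 0 _ _).2 ((mem_corr_iff 0 x y).1 h).symm)

lemma IsPushout.flip {D : SSet.{u}} {σ : Sq.{u} ⟶ D} (h : IsPushout σ) :
    IsPushout (flip ≫ σ) := by
  intro n u v huv hu
  obtain ⟨w, h1, h2⟩ := h n (InftyCat.flip ▷ _ ≫ u) (spanFlip ▷ _ ≫ v) (by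
    have e1 := congrArg (spanFlip ▷ (∂Δ[n + 1] : SSet.{u}) ≫ ·) huv
    exact e1) (by
    have e1 := congrArg (InftyCat.flip ≫ ·) hu
    exact e1)
  refine ⟨InftyCat.flip ▷ _ ≫ w, ?_, ?_⟩
  · have e1 := congrArg (InftyCat.flip ▷ (∂Δ[n + 1] : SSet.{u}) ≫ ·) h1
    exact e1
  · have e1 := congrArg (spanFlip ▷ Δ[n + 1] ≫ ·) h2
    exact e1

/-! ### Bicartesian squares in the homotopy category -/

section

variable {D E : SSet.{u}} [Quasicategory D] [Quasicategory E]

/-- A commutative square in the homotopy category that lifts to a pushout square. -/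
def Bicart {A B C T : Hc D} (f : A ⟶ B) (g : A ⟶ C) (h : B ⟶ T) (k : C ⟶ T) : Prop :=
  ∃ σ : Sq.{u} ⟶ D, IsPushout σ ∧
    ∃ (a : A ≅ cn σ 0 0) (b : B ≅ cn σ 1 0) (c : C ≅ cn σ 0 1) (t : T ≅ cn σ 1 1),
      f ≫ b.hom = a.hom ≫ hz σ 0 ∧ g ≫ c.hom = a.hom ≫ vt σ 0 ∧
      h ≫ t.hom = b.hom ≫ vt σ 1 ∧ k ≫ t.hom = c.hom ≫ hz σ 1

lemma IsPushout.bicart {σ : Sq.{u} ⟶ D} (h : IsPushout σ) :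
    Bicart (hz σ 0) (vt σ 0) (vt σ 1) (hz σ 1) :=
  ⟨σ, h, Iso.refl _, Iso.refl _, Iso.refl _, Iso.refl _, by simp, by simp, by simp, by simp⟩

lemma IsPushout.bicart_of_edges {σ : Sq.{u} ⟶ D} (h : IsPushout σ) {x y z w : D _⦋0⦌}
    {t : Edge x y} {r : Edge y w} {l : Edge x z} {b : Edge z w} (ht : horizontal σ 0 = t.edge)
    (hr : vertical σ 1 = r.edge) (hl : vertical σ 0 = l.edge) (hb : horizontal σ 1 = b.edge) :
    Bicart (Hc.hom t) (Hc.hom l) (Hc.hom r) (Hc.hom b) := by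
  obtain rfl : corner σ 0 0 = x := by
    rw [← t.src_eq, ← ht]; exact (hEdge σ 0).src_eq.symm
  obtain rfl : corner σ 1 0 = y := by
    rw [← t.tgt_eq, ← ht]; exact (hEdge σ 0).tgt_eq.symm
  obtain rfl : corner σ 0 1 = z := by
    rw [← b.src_eq, ← hb]; exact (hEdge σ 1).src_eq.symm
  obtain rfl : corner σ 1 1 = w := by
    rw [← b.tgt_eq, ← hb]; exact (hEdge σ 1).tgt_eq.symm
  obtain rfl : hEdge σ 0 = t := Edge.ext ht
  obtain rfl : hEdge σ 1 = b := Edge.ext hb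
  obtain rfl : vEdge σ 0 = l := Edge.ext hl
  obtain rfl : vEdge σ 1 = r := Edge.ext hr
  exact h.bicart

lemma conj_comm {𝒜 : Type*} [Category 𝒜] {X Y X' Y' X₁ Y₁ X₂ Y₂ : 𝒜} {f : X ⟶ Y} {f' : X' ⟶ Y'}
    {f₁ : X₁ ⟶ Y₁} {f₂ : X₂ ⟶ Y₂} {a : X ≅ X'} {b : Y ≅ Y'} {a₁ : X ≅ X₁} {b₁ : Y ≅ Y₁}
    {a₂ : X' ≅ X₂} {b₂ : Y' ≅ Y₂} (h : f ≫ b.hom = a.hom ≫ f') (h₁ : f ≫ b₁.hom = a₁.hom ≫ f₁)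
    (h₂ : f' ≫ b₂.hom = a₂.hom ≫ f₂) :
    f₁ ≫ (b₁.symm ≪≫ b ≪≫ b₂).hom = (a₁.symm ≪≫ a ≪≫ a₂).hom ≫ f₂ := by
  rw [← Iso.inv_comp_eq] at h₁
  simp [← h₁, reassoc_of% h, h₂]

namespace Bicart

variable {A B C T A' B' C' T' : Hc D} {f : A ⟶ B} {g : A ⟶ C} {h : B ⟶ T} {k : C ⟶ T}
  {f' : A' ⟶ B'} {g' : A' ⟶ C'} {h' : B' ⟶ T'} {k' : C' ⟶ T'}

lemma flip (s : Bicart f g h k) : Bicart g f k h := by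
  obtain ⟨σ, hσ, a, b, c, t, h1, h2, h3, h4⟩ := s
  exact ⟨_, hσ.flip, a, c, b, t, h2, h1, h4, h3⟩

lemma map_of_isPushout {L : D ⟶ E} (hL : ∀ σ : Sq.{u} ⟶ D, IsPushout σ → IsPushout (σ ≫ L))
    (s : Bicart f g h k) : Bicart ((Hc.map L).map f) ((Hc.map L).map g) ((Hc.map L).map h)
      ((Hc.map L).map k) := by
  obtain ⟨σ, hσ, a, b, c, t, h1, h2, h3, h4⟩ := s
  have key : ∀ {X Y X' Y' : Hc D} (p : X ⟶ Y) (y : Y ≅ Y') (x : X ≅ X') (p' : X' ⟶ Y'),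
      p ≫ y.hom = x.hom ≫ p' → (Hc.map L).map p ≫ ((Hc.map L).mapIso y).hom =
        ((Hc.map L).mapIso x).hom ≫ (Hc.map L).map p' := fun p y x p' hp => by
    rw [Functor.mapIso_hom, Functor.mapIso_hom, ← Functor.map_comp, hp, Functor.map_comp]
  exact ⟨σ ≫ L, hL σ hσ, (Hc.map L).mapIso a, (Hc.map L).mapIso b, (Hc.map L).mapIso c,
    (Hc.map L).mapIso t, key _ _ _ _ h1, key _ _ _ _ h2, key _ _ _ _ h3, key _ _ _ _ h4⟩

lemma map_leftAdj {L : D ⟶ E} {R : E ⟶ D} (a : Adj L R) (hE : IsStable E)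
    (s : Bicart f g h k) : Bicart ((Hc.map L).map f) ((Hc.map L).map g) ((Hc.map L).map h)
      ((Hc.map L).map k) :=
  s.map_of_isPushout fun _ hσ => hσ.comp_leftAdj a hE

lemma map_rightAdj {L : E ⟶ D} {R : D ⟶ E} (a : Adj L R) (hE : IsStable E) (hD : IsStable D)
    (s : Bicart f g h k) : Bicart ((Hc.map R).map f) ((Hc.map R).map g) ((Hc.map R).map h)
      ((Hc.map R).map k) :=
  s.map_of_isPushout fun _ hσ => hσ.comp_rightAdj a hE hD

/-- Isomorphisms at three corners, commuting up to homotopy, lift to an isomorphism of coherent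
spans. The universal property extends it to the squares, and t is its value at the last corner. -/
lemma exists_iso_last (s : Bicart f g h k) (s' : Bicart f' g' h' k') (a : A ≅ A') (b : B ≅ B')
    (c : C ≅ C') (hb : f ≫ b.hom = a.hom ≫ f') (hc : g ≫ c.hom = a.hom ≫ g') :
    ∃ t : T ≅ T', h ≫ t.hom = b.hom ≫ h' ∧ k ≫ t.hom = c.hom ≫ k' := by
  obtain ⟨σ, hσ, a₁, b₁, c₁, t₁, h1, h2, h3, h4⟩ := s
  obtain ⟨ρ, hρ, a₂, b₂, c₂, t₂, k1, k2, k3, k4⟩ := s'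
  obtain ⟨F, hF, F0, F1, F2⟩ := hσ.hInitial.exists_square_iso hρ.hInitial
    (a₁.symm ≪≫ a ≪≫ a₂) (b₁.symm ≪≫ b ≪≫ b₂) (c₁.symm ≪≫ c ≪≫ c₂)
    (conj_comm hb h1 k1) (conj_comm hc h2 k2)
  have := isIso_evSq F 1 1
  have e1 := hz_evSq F 1
  have e2 := vt_evSq F 1
  rw [F2] at e1
  rw [F1] at e2
  rw [← Iso.eq_comp_inv] at h3 h4 k3 k4
  refine ⟨t₁ ≪≫ asIso (evSq F 1 1) ≪≫ t₂.symm, ?_, ?_⟩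
  · rw [h3, k3]
    simp [reassoc_of% e2]
  · rw [h4, k4]
    simp [reassoc_of% e1]

/-- By stability the lifted squares are also pullbacks, so an isomorphism of cospans determines one
of squares; only here does the dual universal property enter. -/
lemma exists_iso_first (hD : IsStable D) (s : Bicart f g h k) (s' : Bicart f' g' h' k')
    (t : T ≅ T') (b : B ≅ B') (c : C ≅ C') (hb : h ≫ t.hom = b.hom ≫ h')
    (hc : k ≫ t.hom = c.hom ≫ k') :
    ∃ a : A ≅ A', f ≫ b.hom = a.hom ≫ f' ∧ g ≫ c.hom = a.hom ≫ g' := by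
  obtain ⟨σ, hσ, a₁, b₁, c₁, t₁, h1, h2, h3, h4⟩ := s
  obtain ⟨ρ, hρ, a₂, b₂, c₂, t₂, k1, k2, k3, k4⟩ := s'
  obtain ⟨F, hF, F0, F1, F2⟩ :=
    ((hD.pullback_iff_pushout ρ).2 hρ).hTerminal.exists_square_iso
      ((hD.pullback_iff_pushout σ).2 hσ).hTerminal
    (t₁.symm ≪≫ t ≪≫ t₂) (c₁.symm ≪≫ c ≪≫ c₂) (b₁.symm ≪≫ b ≪≫ b₂)
    (conj_comm hc h4 k4) (conj_comm hb h3 k3)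
  have := isIso_evSq F 0 0
  have e1 := hz_evSq F 0
  have e2 := vt_evSq F 0
  rw [F2] at e1
  rw [F1] at e2
  rw [← Iso.eq_comp_inv] at h1 h2 k1 k2
  refine ⟨a₁ ≪≫ asIso (evSq F 0 0) ≪≫ a₂.symm, ?_, ?_⟩
  · rw [h1, k1]
    simp [← reassoc_of% e1]
  · rw [h2, k2]
    simp [← reassoc_of% e2]

/-- The constant square in one direction. -/
lemma constant (hD : IsStable D) (g : A ⟶ C) : Bicart (𝟙 A) g g (𝟙 C) := by
  obtain ⟨g, rfl⟩ := Hc.hom_surjective g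
  rw [← Hc.hom_id, ← Hc.hom_id]
  have hσ := hD.isPushout_of_hInitial (hInitial_snd (SSet.yonedaEquiv.symm g.edge))
  refine hσ.bicart_of_edges (yonedaEquiv_symm_app_cst g.edge 0 |>.trans ?_)
    (yonedaEquiv_symm_app_e01 g.edge) (yonedaEquiv_symm_app_e01 g.edge)
    (yonedaEquiv_symm_app_cst g.edge 1 |>.trans ?_)
  · exact congrArg (D.σ 0) g.src_eq
  · exact congrArg (D.σ 0) g.tgt_eq

/-- The square has the same span, up to isomorphism, as the constant square on g, whose bottom edge
is an identity. -/
lemma isIso_bottom (hD : IsStable D) (s : Bicart f g h k) [IsIso f] : IsIso k := by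
  obtain ⟨t, -, h2⟩ := (constant hD g).exists_iso_last s (Iso.refl A) (asIso f) (Iso.refl C)
    (by simp) (by simp)
  rw [Category.id_comp, Iso.refl_hom, Category.id_comp] at h2
  rw [← h2]
  infer_instance

lemma isIso_top (hD : IsStable D) (s : Bicart f g h k) [IsIso k] : IsIso f := by
  obtain ⟨a, h1, -⟩ := s.exists_iso_first hD (constant hD h) (Iso.refl T) (Iso.refl B)
    (asIso k) (by simp) (by simp)
  rw [Category.comp_id, Iso.refl_hom, Category.comp_id] at h1
  rw [h1]
  infer_instance

lemma exists_map (s : Bicart f g h k) (s' : Bicart f' g' h' k') (a : A ⟶ A') (b : B ⟶ B')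
    (c : C ⟶ C') (hb : f ≫ b = a ≫ f') (hc : g ≫ c = a ≫ g') :
    ∃ t : T ⟶ T', h ≫ t = b ≫ h' ∧ k ≫ t = c ≫ k' := by
  obtain ⟨σ, hσ, a₁, b₁, c₁, t₁, h1, h2, h3, h4⟩ := s
  obtain ⟨ρ, hρ, a₂, b₂, c₂, t₂, k1, k2, k3, k4⟩ := s'
  rw [← Iso.eq_comp_inv] at h1 h2 h3 h4 k1 k2 k3 k4
  subst h1 h2 h3 h4 k1 k2 k3 k4
  simp only [Category.assoc] at hb hc
  rw [← Iso.eq_inv_comp] at hb hc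
  obtain ⟨F, F0, F1, F2⟩ := hσ.hInitial.exists_map ρ
    (a₁.inv ≫ a ≫ a₂.hom) (b₁.inv ≫ b ≫ b₂.hom) (c₁.inv ≫ c ≫ c₂.hom)
    (by rw [reassoc_of% hb]; simp) (by rw [reassoc_of% hc]; simp)
  have e1 := hz_evSq F 1
  have e2 := vt_evSq F 1
  rw [F2] at e1
  rw [F1] at e2
  refine ⟨t₁.hom ≫ evSq F 1 1 ≫ t₂.inv, ?_, ?_⟩
  · simp [reassoc_of% e2]
  · simp [reassoc_of% e1]

/-- Bicartesian squares are weak pushouts. -/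
lemma exists_desc (hD : IsStable D) (s : Bicart f g h k) {Y : Hc D} (p : B ⟶ Y) (r : C ⟶ Y)
    (hpr : f ≫ p = g ≫ r) : ∃ d : T ⟶ Y, h ≫ d = p ∧ k ≫ d = r := by
  -- A cocone to Y is a map to the constant square at Y. Only existence follows, because lifting a
  -- commuting diagram to a coherent one involves choices.
  obtain ⟨d, h1, h2⟩ := s.exists_map (constant hD (𝟙 Y)) (f ≫ p) p r (by simp) (by simpa using hpr.symm)
  exact ⟨d, by simpa using h1, by simpa using h2⟩

end Bicart

end

lemma isIso_of_isZero {𝒜 : Type*} [Category 𝒜] {X Y : 𝒜} (hX : Limits.IsZero X)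
    (hY : Limits.IsZero Y) (f : X ⟶ Y) : IsIso f :=
  ⟨hY.to_ X, hX.eq_of_src _ _, hY.eq_of_src _ _⟩

/-! ### Existence of bicartesian squares -/

section

variable {D E : SSet.{u}} [Quasicategory D] [Quasicategory E]

lemma IsStable.exists_pushout_of_edges (hD : IsStable D) {x y z : D _⦋0⦌} (t : Edge x y)
    (l : Edge x z) : ∃ (w : D _⦋0⦌) (r : Edge y w) (b : Edge z w) (σ : Sq ⟶ D), IsPushout σ ∧
      horizontal σ 0 = t.edge ∧ vertical σ 0 = l.edge ∧ vertical σ 1 = r.edge ∧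
      horizontal σ 1 = b.edge := by
  obtain ⟨c, h1, h2⟩ := exists_corr_hom 0 (SSet.yonedaEquiv.symm t.edge)
    (SSet.yonedaEquiv.symm l.edge) ((yonedaEquiv_symm_app_pt1 t.edge 0).trans
      ((t.src_eq.trans l.src_eq.symm).trans (yonedaEquiv_symm_app_pt1 l.edge 0).symm))
  obtain ⟨σ, rfl, hσ⟩ := hD.exists_pushout c
  have ht : horizontal σ 0 = t.edge :=
    SSet.yonedaEquiv.symm.injective ((corrH_ι_comp σ 0).symm.trans h1)
  have hl : vertical σ 0 = l.edge :=
    SSet.yonedaEquiv.symm.injective ((corrV_ι_comp σ 0).symm.trans h2)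
  have hy : corner σ 1 0 = y := by
    rw [← t.tgt_eq, ← ht]; exact (hEdge σ 0).tgt_eq.symm
  have hz : corner σ 0 1 = z := by
    rw [← l.tgt_eq, ← hl]; exact (vEdge σ 0).tgt_eq.symm
  exact ⟨corner σ 1 1, Edge.mk (vertical σ 1) ((vEdge σ 1).src_eq.trans hy) (vEdge σ 1).tgt_eq,
    Edge.mk (horizontal σ 1) ((hEdge σ 1).src_eq.trans hz) (hEdge σ 1).tgt_eq, σ, hσ, ht, hl,
    rfl, rfl⟩

lemma IsStable.exists_pullback_of_edges (hD : IsStable D) {y z w : D _⦋0⦌} (r : Edge y w)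
    (b : Edge z w) : ∃ (x : D _⦋0⦌) (t : Edge x y) (l : Edge x z) (σ : Sq ⟶ D), IsPullback σ ∧
      horizontal σ 0 = t.edge ∧ vertical σ 0 = l.edge ∧ vertical σ 1 = r.edge ∧
      horizontal σ 1 = b.edge := by
  obtain ⟨c, h1, h2⟩ := exists_corr_hom 1 (SSet.yonedaEquiv.symm b.edge)
    (SSet.yonedaEquiv.symm r.edge) ((yonedaEquiv_symm_app_pt1 b.edge 1).trans
      ((b.tgt_eq.trans r.tgt_eq.symm).trans (yonedaEquiv_symm_app_pt1 r.edge 1).symm))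
  obtain ⟨σ, rfl, hσ⟩ := hD.exists_pullback c
  have hb : horizontal σ 1 = b.edge :=
    SSet.yonedaEquiv.symm.injective ((corrH_ι_comp σ 1).symm.trans h1)
  have hr : vertical σ 1 = r.edge :=
    SSet.yonedaEquiv.symm.injective ((corrV_ι_comp σ 1).symm.trans h2)
  have hy : corner σ 1 0 = y := by
    rw [← r.src_eq, ← hr]; exact (vEdge σ 1).src_eq.symm
  have hz : corner σ 0 1 = z := by
    rw [← b.src_eq, ← hb]; exact (hEdge σ 1).src_eq.symm
  exact ⟨corner σ 0 0, Edge.mk (horizontal σ 0) (hEdge σ 0).src_eq ((hEdge σ 0).tgt_eq.trans hy),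
    Edge.mk (vertical σ 0) (vEdge σ 0).src_eq ((vEdge σ 0).tgt_eq.trans hz), σ, hσ, rfl, rfl, hr,
    hb⟩

lemma IsStable.exists_fiberSeq (hD : IsStable D) {X Y : D _⦋0⦌} (g : Edge X Y) :
    ∃ (W : D _⦋0⦌) (f : Edge W X), IsFiberSeq f g := by
  obtain ⟨Z, hZ⟩ := hD.exists_zero
  obtain ⟨b, -⟩ := Hc.hom_surjective (hZ.hc.to_ ⟨Y⟩)
  obtain ⟨W, f, l, σ, hσ, h1, h2, h3, h4⟩ := hD.exists_pullback_of_edges g b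
  refine ⟨W, f, σ, hσ, ?_, h1, h3⟩
  obtain rfl : corner σ 0 1 = Z := by
    rw [← b.src_eq, ← h4]; exact (hEdge σ 1).src_eq.symm
  exact hZ

lemma IsStable.exists_cofiber (hD : IsStable D) {A B : Hc D} (f : A ⟶ B) :
    ∃ (C Z : Hc D) (l : A ⟶ Z) (p : B ⟶ C) (z : Z ⟶ C), IsZero Z.pt ∧ Bicart f l p z := by
  obtain ⟨Z, hZ⟩ := hD.exists_zero
  obtain ⟨l, -⟩ := Hc.hom_surjective (hZ.hc.from_ A)
  obtain ⟨f, rfl⟩ := Hc.hom_surjective f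
  obtain ⟨C, r, b, σ, hσ, h1, h2, h3, h4⟩ := hD.exists_pushout_of_edges f l
  exact ⟨⟨C⟩, ⟨Z⟩, Hc.hom l, Hc.hom r, Hc.hom b, hZ, hσ.bicart_of_edges h1 h3 h2 h4⟩

lemma IsFiberSeq.bicart (hD : IsStable D) {A B C : D _⦋0⦌} {f : Edge A B} {g : Edge B C}
    (h : IsFiberSeq f g) : ∃ (Z : Hc D) (l : ⟨A⟩ ⟶ Z) (z : Z ⟶ ⟨C⟩), IsZero Z.pt ∧
      Bicart (Hc.hom f) l (Hc.hom g) z := by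
  obtain ⟨σ, hσ, hZ, h1, h2⟩ := h
  obtain rfl : corner σ 0 0 = A := by
    rw [← f.src_eq, ← h1]; exact (hEdge σ 0).src_eq.symm
  obtain rfl : corner σ 1 1 = C := by
    rw [← g.tgt_eq, ← h2]; exact (vEdge σ 1).tgt_eq.symm
  exact ⟨_, _, _, hZ, ((hD.pullback_iff_pushout σ).1 hσ).bicart_of_edges (l := vEdge σ 0)
    (b := hEdge σ 1) h1 h2 rfl rfl⟩

lemma IsZero.of_iso {x y : D _⦋0⦌} (hy : IsZero y) (e : (⟨x⟩ : Hc D) ≅ ⟨y⟩) : IsZero x :=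
  hy.of_isIso e.hom

lemma exists_comp {x y z : D _⦋0⦌} (f : Edge x y) (g : Edge y z) :
    ∃ h, Nonempty (Edge.CompStruct f g h) := by
  obtain ⟨h, hh⟩ := Hc.hom_surjective (Hc.hom f ≫ Hc.hom g)
  exact ⟨h, Hc.nonempty_compStruct_iff.2 hh.symm⟩

lemma mate_comp_counit {L : D ⟶ E} {R : E ⟶ D} (a : Adj L R) {X : D _⦋0⦌} {Y : E _⦋0⦌}
    {η : Edge (obj L X) Y} {η' : Edge X (obj R Y)}
    (h : Nonempty (Edge.CompStruct (a.unit.app X) (η.map R) η')) :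
    (Hc.map L).map (Hc.hom η') ≫ (Hc.adj a).counit.app ⟨Y⟩ = Hc.hom η := by
  have h1 : (Hc.adj a).unit.app ⟨X⟩ ≫ (Hc.map R).map (Hc.hom η) = Hc.hom η' :=
    Hc.nonempty_compStruct_iff.1 h
  have h2 : Hc.hom η' = (Hc.adj a).homEquiv ⟨X⟩ ⟨Y⟩ (Hc.hom η) :=
    h1.symm.trans ((Hc.adj a).homEquiv_unit (X := ⟨X⟩) (Y := ⟨Y⟩) (f := Hc.hom η)).symm
  refine ((Hc.adj a).homEquiv_counit (X := ⟨X⟩) (Y := ⟨Y⟩) (g := Hc.hom η')).symm.trans ?_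
  rw [h2]
  exact ((Hc.adj a).homEquiv ⟨X⟩ ⟨Y⟩).symm_apply_apply (Hc.hom η)

/-- The components of a natural isomorphism. -/
def transIso {F G : D ⟶ E} (α : Trans F G) (h : α.IsIso) (x : D _⦋0⦌) :
    (⟨obj F x⟩ : Hc E) ≅ ⟨obj G x⟩ :=
  @asIso _ _ _ _ _ (Hc.isIso_mapTrans_app α h ⟨x⟩)

/-- A functor with fully faithful right adjoint carries the fiber of the mate of a map to the
fiber of the map. -/
lemma nonempty_iso_of_mate {L : D ⟶ E} {R : E ⟶ D} (a : Adj L R) (hD : IsStable D)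
    (hE : IsStable E) (ha : a.counit.IsIso) {W X : D _⦋0⦌} {S Y : E _⦋0⦌} {w : Edge W X}
    {η' : Edge X (obj R Y)} (h' : IsFiberSeq w η') {ε : Edge S (obj L X)} {η : Edge (obj L X) Y}
    (h : IsFiberSeq ε η) (hη : Nonempty (Edge.CompStruct (a.unit.app X) (η.map R) η')) :
    Nonempty ((⟨obj L W⟩ : Hc E) ≅ ⟨S⟩) := by
  obtain ⟨Z, l, z, hZ, s⟩ := h'.bicart hD
  obtain ⟨Z', l', z', hZ', s'⟩ := h.bicart hE
  have hLZ : Limits.IsZero ((Hc.map L).obj Z) := (hZ.map_leftAdj a hE).hc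
  -- The counit identifies L R Y with Y and carries L η' to η by the mate relation, so the two fiber
  -- squares have isomorphic cospans.
  obtain ⟨e, -⟩ := (s.map_leftAdj a hE).exists_iso_first hE s'
    (transIso a.counit ha Y) (Iso.refl _) (hLZ.iso hZ'.hc)
    ((mate_comp_counit a hη).trans (Category.id_comp _).symm) (hLZ.eq_of_src _ _)
  exact ⟨e⟩

end

/-! ### Transport of t-structures -/

namespace TStructure

variable {D : SSet.{u}} [Quasicategory D] (t : InftyCat.TStructure D)

lemma ge_of_iso {X Y : Hc D} (e : X ≅ Y) (h : t.ge X.pt) : t.ge Y.pt :=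
  t.ge_of_equivalent _ _ (Hc.equivalent_iff.2 ⟨e⟩) h

lemma lt_of_iso {X Y : Hc D} (e : X ≅ Y) (h : t.lt X.pt) : t.lt Y.pt :=
  t.lt_of_equivalent _ _ (Hc.equivalent_iff.2 ⟨e⟩) h

lemma subsingleton_hom {X Y : Hc D} (hX : t.ge X.pt) (hY : t.lt Y.pt) : Subsingleton (X ⟶ Y) :=
  ⟨fun f g => by
    obtain ⟨f, rfl⟩ := Hc.hom_surjective f
    obtain ⟨g, rfl⟩ := Hc.hom_surjective g
    exact Hc.hom_eq_iff.2 (t.orthogonal _ _ hX hY f g)⟩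

end TStructure

section

variable {D E : SSet.{u}} [Quasicategory D] [Quasicategory E]

lemma IsSuspension.map_leftAdj {L : D ⟶ E} {R : E ⟶ D} (a : Adj L R) (hE : IsStable E)
    {X Y : D _⦋0⦌} (h : IsSuspension X Y) : IsSuspension (obj L X) (obj L Y) := by
  obtain ⟨σ, hσ, h1, h2, rfl, rfl⟩ := h
  exact ⟨σ ≫ L, hσ.comp_leftAdj a hE, h1.map_leftAdj a hE, h2.map_leftAdj a hE, rfl, rfl⟩

lemma IsSuspension.map_rightAdj {L : D ⟶ E} {R : E ⟶ D} (a : Adj L R) (hD : IsStable D)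
    (hE : IsStable E) {X Y : E _⦋0⦌} (h : IsSuspension X Y) :
    IsSuspension (obj R X) (obj R Y) := by
  obtain ⟨σ, hσ, h1, h2, rfl, rfl⟩ := h
  exact ⟨σ ≫ R, hσ.comp_rightAdj a hD hE, h1.map_rightAdj a hD, h2.map_rightAdj a hD, rfl, rfl⟩

end

/-! ### Recollements -/

namespace Recollement

variable {D₀ D D₁ : SSet.{u}} [Quasicategory D₀] [Quasicategory D] [Quasicategory D₁]
  (r : Recollement D₀ D D₁)

lemma isZero_q_i (Y : D₀ _⦋0⦌) : IsZero (obj r.q (obj r.i Y)) :=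
  (r.image_eq_kernel _).1 ⟨Y, Hc.equivalent_iff.2 ⟨Iso.refl _⟩⟩

/-- By the two adjunctions, endomorphisms of i_L q_L Y are maps from Y to q i i_L q_L Y, which is
zero. -/
lemma isZero_iL_qL (hD₀ : IsStable D₀) (Y : D₁ _⦋0⦌) : IsZero (obj r.iL (obj r.qL Y)) :=
  hD₀.isZero_of_subsingleton ⟨fun _ _ =>
    ((Hc.adj r.adj_iL).homEquiv ⟨obj r.qL Y⟩ ⟨obj r.iL (obj r.qL Y)⟩).injective
      (((Hc.adj r.adj_qL).homEquiv ⟨Y⟩ ⟨obj r.i (obj r.iL (obj r.qL Y))⟩).injective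
        ((r.isZero_q_i _).hc.eq_of_tgt _ _))⟩

lemma isZero_iR_qR (hD₀ : IsStable D₀) (Y : D₁ _⦋0⦌) : IsZero (obj r.iR (obj r.qR Y)) :=
  hD₀.isZero_of_subsingleton ⟨fun _ _ =>
    ((Hc.adj r.adj_iR).homEquiv ⟨obj r.iR (obj r.qR Y)⟩ ⟨obj r.qR Y⟩).symm.injective
      (((Hc.adj r.adj_qR).homEquiv ⟨obj r.i (obj r.iR (obj r.qR Y))⟩ ⟨Y⟩).symm.injective
        ((r.isZero_q_i _).hc.eq_of_src _ _))⟩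

lemma isIso_q_counit (X : Hc D) :
    IsIso ((Hc.map r.q).map ((Hc.adj r.adj_qL).counit.app X)) := by
  have h := (Hc.adj r.adj_qL).right_triangle_components X
  have : IsIso ((Hc.adj r.adj_qL).unit.app ((Hc.map r.q).obj X)) :=
    Hc.isIso_mapTrans_app r.adj_qL.unit r.qL_unit ((Hc.map r.q).obj X)
  rw [IsIso.eq_inv_of_hom_inv_id h]
  infer_instance

variable (t₀ : InftyCat.TStructure D₀) (t₁ : InftyCat.TStructure D₁)

/-- The cofiber of q_L q X → X comes from D₀, so maps out of X are controlled by two Hom sets, one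
computed in D₁ and one in D₀, each trivial by orthogonality there. -/
lemma subsingleton_hom (hD₀ : IsStable D₀) (hD : IsStable D) (hD₁ : IsStable D₁) {X Y : Hc D}
    (hX₁ : t₁.ge (obj r.q X.pt)) (hX₀ : t₀.ge (obj r.iL X.pt)) (hY₁ : t₁.lt (obj r.q Y.pt))
    (hY₀ : t₀.lt (obj r.iR Y.pt)) : Subsingleton (X ⟶ Y) := by
  obtain ⟨C, Z, l, p, z, hZ, s⟩ := hD.exists_cofiber ((Hc.adj r.adj_qL).counit.app X)
  -- The functor q inverts the counit and preserves the cofiber square, so qC is the image of the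
  -- zero corner.
  have hqC : IsZero (obj r.q C.pt) := by
    have := r.isIso_q_counit X
    have h2 : IsIso ((Hc.map r.q).map z) := (s.map_leftAdj r.adj_qR hD₁).isIso_bottom hD₁
    exact (hZ.map_leftAdj r.adj_qR hD₁).of_iso (@asIso _ _ _ _ _ h2).symm
  obtain ⟨Y', hY'⟩ := (r.image_eq_kernel C.pt).2 hqC
  obtain ⟨e⟩ := Hc.equivalent_iff.1 hY'
  -- Because i_L q_L = 0, the map i_L X → i_L C is invertible; with C ≅ i Y' this gives i_L X ≅ Y'.
  have hge : t₀.ge Y' := by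
    have h1 : IsIso ((Hc.map r.iL).map l) :=
      isIso_of_isZero (r.isZero_iL_qL hD₀ (obj r.q X.pt)).hc (hZ.map_leftAdj r.adj_iL hD₀).hc _
    have h2 : IsIso ((Hc.map r.iL).map p) := (s.map_leftAdj r.adj_iL hD₀).flip.isIso_bottom hD₀
    exact t₀.ge_of_iso (asIso ((Hc.map r.iL).map p) ≪≫ (Hc.map r.iL).mapIso e.symm ≪≫
      transIso r.adj_iL.counit r.iL_counit Y') hX₀
  have hs : Subsingleton ((⟨Y'⟩ : Hc D₀) ⟶ (Hc.map r.iR).obj Y) := t₀.subsingleton_hom hge hY₀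
  have hsC : ∀ f g : C ⟶ Y, f = g := fun f g => by
    rw [← cancel_epi e.hom]
    exact ((Hc.adj r.adj_iR).homEquiv ⟨Y'⟩ Y).injective (Subsingleton.elim _ _)
  have hsq : Subsingleton ((Hc.map r.q).obj X ⟶ (Hc.map r.q).obj Y) :=
    t₁.subsingleton_hom hX₁ hY₁
  -- The restriction of f to q_L q X and the map through zero both lie in Hom(q_L q X, Y), which is
  -- Hom(qX, qY) and has at most one element. Hence f factors through the cofiber.
  have key : ∀ f : X ⟶ Y, ∃ d, p ≫ d = f := fun f => by
    obtain ⟨d, hd, -⟩ := s.exists_desc hD f (hZ.hc.to_ Y)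
      (((Hc.adj r.adj_qL).homEquiv ((Hc.map r.q).obj X) Y).injective (Subsingleton.elim _ _))
    exact ⟨d, hd⟩
  refine ⟨fun f g => ?_⟩
  obtain ⟨d, rfl⟩ := key f
  obtain ⟨d', rfl⟩ := key g
  rw [hsC d d']

end Recollement

/-! ### The glued t-structure -/

section

variable {D₀ D D₁ : SSet.{u}} [Quasicategory D₀] [Quasicategory D] [Quasicategory D₁]
  (r : Recollement D₀ D D₁) (t₀ : InftyCat.TStructure D₀) (t₁ : InftyCat.TStructure D₁)

lemma nonempty_gluingDiagram (hD : IsStable D) (X : D _⦋0⦌) :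
    Nonempty (GluingDiagram r t₀ t₁ X) := by
  obtain ⟨S₁, R₁, ε, η, hS₁, hR₁, h₁⟩ := t₁.exists_fiberSeq (obj r.q X)
  obtain ⟨η', hη'⟩ := exists_comp (r.adj_qR.unit.app X) (η.map r.qR)
  obtain ⟨W, w, hw⟩ := hD.exists_fiberSeq η'
  obtain ⟨S₀, R₀, σ, θ, hS₀, hR₀, h₀⟩ := t₀.exists_fiberSeq (obj r.iL W)
  obtain ⟨θ', hθ'⟩ := exists_comp (r.adj_iL.unit.app W) (θ.map r.i)
  obtain ⟨S, s, hs⟩ := hD.exists_fiberSeq θ'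
  obtain ⟨R, ρ, b, sq, hsq, k1, k2, k3, k4⟩ := hD.exists_pushout_of_edges w θ'
  exact ⟨⟨S₁, R₁, ε, η, hS₁, hR₁, h₁, η', hη', W, w, hw, S₀, R₀, σ, θ, hS₀, hR₀, h₀, θ', hθ', S,
    s, hs, R, ρ, sq, hsq, k1, k2, k3⟩⟩

namespace GluingDiagram

variable {r t₀ t₁} {X : D _⦋0⦌} (d : GluingDiagram r t₀ t₁ X)

lemma exists_bicart : ∃ b : (⟨obj r.i d.R₀⟩ : Hc D) ⟶ ⟨d.R⟩,
    Bicart (Hc.hom d.w) (Hc.hom d.θ') (Hc.hom d.ρ) b := by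
  have h0 : corner d.square 0 1 = obj r.i d.R₀ := by
    rw [← d.θ'.tgt_eq, ← d.square_left]; exact (vEdge d.square 0).tgt_eq.symm
  have h1 : corner d.square 1 1 = d.R := by
    rw [← d.ρ.tgt_eq, ← d.square_right]; exact (vEdge d.square 1).tgt_eq.symm
  exact ⟨_, d.isPushout.bicart_of_edges (b := Edge.mk (horizontal d.square 1)
    ((hEdge d.square 1).src_eq.trans h0) ((hEdge d.square 1).tgt_eq.trans h1)) d.square_top
    d.square_right d.square_left rfl⟩

lemma nonempty_iso_q_W (hD : IsStable D) (hD₁ : IsStable D₁) :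
    Nonempty ((⟨obj r.q d.W⟩ : Hc D₁) ≅ ⟨d.S₁⟩) :=
  nonempty_iso_of_mate r.adj_qR hD hD₁ r.qR_counit d.fiberSeq_W d.fiberSeq₁ d.η'_mate

lemma nonempty_iso_iL_S (hD : IsStable D) (hD₀ : IsStable D₀) :
    Nonempty ((⟨obj r.iL d.S⟩ : Hc D₀) ≅ ⟨d.S₀⟩) :=
  nonempty_iso_of_mate r.adj_iL hD hD₀ r.iL_counit d.fiberSeq_S d.fiberSeq₀ d.θ'_mate

/-- As q i = 0, the lower edge of the fiber square of θ' becomes a map between zero objects under q,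
so the parallel edge q s is invertible. -/
lemma isIso_q_s (hD : IsStable D) (hD₁ : IsStable D₁) :
    IsIso ((Hc.map r.q).map (Hc.hom d.s)) := by
  obtain ⟨Z, l, z, hZ, s⟩ := d.fiberSeq_S.bicart hD
  have : IsIso ((Hc.map r.q).map z) :=
    isIso_of_isZero (hZ.map_leftAdj r.adj_qR hD₁).hc (r.isZero_q_i _).hc _
  exact (s.map_leftAdj r.adj_qR hD₁).isIso_top hD₁

/-- Here i_R q_R = 0 plays the same role for the fiber square of η'. -/
lemma isIso_iR_w (hD : IsStable D) (hD₀ : IsStable D₀) :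
    IsIso ((Hc.map r.iR).map (Hc.hom d.w)) := by
  obtain ⟨Z, l, z, hZ, s⟩ := d.fiberSeq_W.bicart hD
  have : IsIso ((Hc.map r.iR).map z) :=
    isIso_of_isZero (hZ.map_rightAdj r.adj_iR hD₀).hc (r.isZero_iR_qR hD₀ _).hc _
  exact (s.map_rightAdj r.adj_iR hD₀ hD).isIso_top hD₀

lemma ge_S (hD₀ : IsStable D₀) (hD : IsStable D) (hD₁ : IsStable D₁) :
    t₁.ge (obj r.q d.S) ∧ t₀.ge (obj r.iL d.S) := by
  obtain ⟨e₁⟩ := d.nonempty_iso_q_W hD hD₁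
  obtain ⟨e₀⟩ := d.nonempty_iso_iL_S hD hD₀
  have e : (⟨obj r.q d.S⟩ : Hc D₁) ≅ ⟨obj r.q d.W⟩ := @asIso _ _ _ _ _ (d.isIso_q_s hD hD₁)
  exact ⟨t₁.ge_of_iso (e ≪≫ e₁).symm d.ge_S₁, t₀.ge_of_iso e₀.symm d.ge_S₀⟩

lemma lt_R (hD₀ : IsStable D₀) (hD : IsStable D) (hD₁ : IsStable D₁) :
    t₁.lt (obj r.q d.R) ∧ t₀.lt (obj r.iR d.R) := by
  obtain ⟨b, s⟩ := d.exists_bicart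
  constructor
  · obtain ⟨Z, l, z, hZ, s'⟩ := d.fiberSeq_W.bicart hD
    have h1 := (r.isZero_q_i d.R₀).hc
    have h2 := (hZ.map_leftAdj r.adj_qR hD₁).hc
    -- Since q i R₀ = 0, both qR and q q_R R₁ are cofibers of qW → qX.
    obtain ⟨e, -⟩ := (s.map_leftAdj r.adj_qR hD₁).exists_iso_last
      (s'.map_leftAdj r.adj_qR hD₁) (Iso.refl _) (Iso.refl _) (h1.iso h2)
      ((Category.comp_id _).trans (Category.id_comp _).symm) (h2.eq_of_tgt _ _)
    exact t₁.lt_of_iso (e ≪≫ transIso r.adj_qR.counit r.qR_counit d.R₁).symm d.lt_R₁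
  · have := d.isIso_iR_w hD hD₀
    -- The top edge i_R w of the image square is invertible, hence so is i_R i R₀ → i_R R.
    have h1 := (s.map_rightAdj r.adj_iR hD₀ hD).isIso_bottom hD₀
    exact t₀.lt_of_iso (transIso r.adj_iR.unit r.iR_unit d.R₀ ≪≫ @asIso _ _ _ _ _ h1) d.lt_R₀

end GluingDiagram

end

/-! ### Rectangles -/

/-- The shape of two adjacent squares. -/
abbrev Rect : SSet.{u} := Δ[2] ⊗ Δ[1]

/-- The three squares in a rectangle: the right one, the outer one and the left one. -/
def sqAt (i : Fin 3) : Sq.{u} ⟶ Rect.{u} := stdSimplex.δ i ▷ Δ[1]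

/-- The two squares together with the top row of a rectangle. -/
def rectBase : Rect.{u}.Subcomplex := (Λ[2, 1]).unionProd (stdSimplex.face {0})

/-- The left column together with the top row of a rectangle. -/
def rectSpan : Rect.{u}.Subcomplex := (stdSimplex.face {0}).unionProd (stdSimplex.face {0})

lemma mem_face_iff_vx {n : ℕ} (j : Fin (n + 1)) {U} (z : (Δ[n] : SSet.{u}).obj U) :
    z ∈ (stdSimplex.face {j} : (Δ[n] : SSet.{u}).Subcomplex).obj U ↔ ∀ t, vx z t = j := by
  rw [stdSimplex.mem_face_iff]
  simp only [Finset.mem_singleton]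
  rfl

lemma mem_rectBase_iff {U} (x : (Δ[2] : SSet.{u}).obj U) (y : (Δ[1] : SSet.{u}).obj U) :
    (show Rect.{u}.obj U from (x, y)) ∈ rectBase.obj U ↔
      (∀ t, vx y t = 0) ∨ ∃ j, j ≠ 1 ∧ ∀ t, vx x t ≠ j := by
  refine (Subcomplex.mem_unionProd_iff _ _ _).trans ?_
  exact or_congr (mem_face_iff_vx 0 y) (mem_horn_iff_vx x)

lemma mem_rectSpan_iff {U} (x : (Δ[2] : SSet.{u}).obj U) (y : (Δ[1] : SSet.{u}).obj U) :
    (show Rect.{u}.obj U from (x, y)) ∈ rectSpan.obj U ↔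
      (∀ t, vx y t = 0) ∨ ∀ t, vx x t = 0 := by
  refine (Subcomplex.mem_unionProd_iff _ _ _).trans ?_
  exact or_congr (mem_face_iff_vx 0 y) (mem_face_iff_vx 0 x)

/-- The two squares in the base of the rectangle. -/
def baseSq (i : Fin 3) (hi : i ≠ 1) : Sq.{u} ⟶ (rectBase.{u} : SSet.{u}) :=
  Subcomplex.lift (sqAt i) (by
    rintro U _ ⟨⟨x, y⟩, rfl⟩
    exact (mem_rectBase_iff _ y).2 (Or.inr ⟨i, hi, fun t => Fin.succAbove_ne i (vx x t)⟩))

/-- The top row of the rectangle. -/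
def topRect : Δ[2] ⟶ Rect.{u} := lift (𝟙 _) (SSet.const (pt1 0))

/-- The top row in the base of the rectangle. -/
def baseTop : Δ[2] ⟶ (rectBase.{u} : SSet.{u}) :=
  Subcomplex.lift topRect (by
    rintro U _ ⟨x, rfl⟩
    exact (mem_rectBase_iff x _).2 (Or.inl fun t => rfl))

/-- The top row of a square. -/
def row : Δ[1] ⟶ Sq.{u} := lift (𝟙 _) (SSet.const (pt1 0))

lemma exists_base {U} (z : (rectBase.{u} : SSet.{u}).obj U) :
    (∃ a, (baseSq 2 (by decide)).app U a = z) ∨ (∃ a, (baseSq 0 (by decide)).app U a = z) ∨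
      ∃ a, baseTop.app U a = z := by
  obtain ⟨⟨x, y⟩, h⟩ := z
  obtain h | ⟨j, hj, h⟩ := (mem_rectBase_iff x y).1 h
  · exact Or.inr (Or.inr ⟨x, Subtype.ext (Prod.ext rfl (vx_ext fun t => (h t).symm))⟩)
  · obtain rfl | rfl : j = 0 ∨ j = 2 := by
      have : ∀ j : Fin 3, j ≠ 1 → j = 0 ∨ j = 2 := by decide
      exact this j hj
    · refine Or.inr (Or.inl ⟨((stdSimplex.σ 0).app U x, y),
        Subtype.ext (Prod.ext (vx_ext fun t => ?_) rfl)⟩)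
      have h1 : ∀ a : Fin 3, a ≠ 0 → Fin.succAbove 0 (Fin.predAbove (0 : Fin 2) a) = a := by decide
      exact h1 _ (h t)
    · refine Or.inl ⟨((stdSimplex.σ 1).app U x, y),
        Subtype.ext (Prod.ext (vx_ext fun t => ?_) rfl)⟩
      have h1 : ∀ a : Fin 3, a ≠ 2 → Fin.succAbove 2 (Fin.predAbove (1 : Fin 2) a) = a := by decide
      exact h1 _ (h t)

/-- The base is two squares sharing a column together with a triangle on their top row. The
parameter K is a simplex when filling spheres and a point when building a single rectangle. -/
lemma exists_rectBase_hom {K E : SSet.{u}} (l r : Sq.{u} ⊗ K ⟶ E) (t : Δ[2] ⊗ K ⟶ E)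
    (hlr : col 1 ▷ K ≫ l = col 0 ▷ K ≫ r) (hl : row ▷ K ≫ l = stdSimplex.δ 2 ▷ K ≫ t)
    (hr : row ▷ K ≫ r = stdSimplex.δ 0 ▷ K ≫ t) :
    ∃ m : (rectBase.{u} : SSet.{u}) ⊗ K ⟶ E, baseSq 2 (by decide) ▷ K ≫ m = l ∧
      baseSq 0 (by decide) ▷ K ≫ m = r ∧ baseTop ▷ K ≫ m = t := by
  have c01 : ∀ U y y', (baseSq 2 (by decide) ▷ K).app U y = (baseSq 0 (by decide) ▷ K).app U y' →
      l.app U y = r.app U y' := by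
    rintro U ⟨⟨x, y⟩, k⟩ ⟨⟨x', y'⟩, k'⟩ h
    have h1 : ∀ t, Fin.succAbove (2 : Fin 3) (vx x t) = Fin.succAbove 0 (vx x' t) := fun t =>
      congrArg (fun z : ((rectBase.{u} : SSet.{u}) ⊗ K).obj U => vx z.1.1.1 t) h
    have h2 : y = y' := congrArg (fun z : ((rectBase.{u} : SSet.{u}) ⊗ K).obj U => z.1.1.2) h
    have h3 : k = k' := congrArg (fun z : ((rectBase.{u} : SSet.{u}) ⊗ K).obj U => z.2) h
    subst h2 h3
    have key : ∀ a b : Fin 2, Fin.succAbove (2 : Fin 3) a = Fin.succAbove 0 b → a = 1 ∧ b = 0 := by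
      decide
    obtain rfl : (SSet.const (pt1 1) : Δ[1] ⟶ Δ[1]).app U y = x :=
      vx_ext fun t => (key _ _ (h1 t)).1.symm
    obtain rfl : (SSet.const (pt1 0) : Δ[1] ⟶ Δ[1]).app U y = x' :=
      vx_ext fun t => (key _ _ (h1 t)).2.symm
    exact app_congr hlr (y, k)
  have ctop : ∀ (i : Fin 3) (hi : i ≠ 1) (f : Sq.{u} ⊗ K ⟶ E),
      row ▷ K ≫ f = stdSimplex.δ i ▷ K ≫ t → ∀ U y y',
      (baseSq i hi ▷ K).app U y = (baseTop ▷ K).app U y' → f.app U y = t.app U y' := by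
    rintro i hi f hf U ⟨⟨x, y⟩, k⟩ ⟨x', k'⟩ h
    have h1 : (stdSimplex.δ i).app U x = x' :=
      congrArg (fun z : ((rectBase.{u} : SSet.{u}) ⊗ K).obj U => z.1.1.1) h
    have h2 : y = (SSet.const (pt1 0) : Δ[2] ⟶ Δ[1]).app U x' :=
      congrArg (fun z : ((rectBase.{u} : SSet.{u}) ⊗ K).obj U => z.1.1.2) h
    have h3 : k = k' := congrArg (fun z : ((rectBase.{u} : SSet.{u}) ⊗ K).obj U => z.2) h
    subst h1 h2 h3
    exact app_congr hf (x, k)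
  have inj : ∀ (i : Fin 3) (hi : i ≠ 1) U (y y' : (Sq.{u} ⊗ K).obj U),
      (baseSq i hi ▷ K).app U y = (baseSq i hi ▷ K).app U y' → y = y' := by
    rintro i hi U ⟨⟨x, y⟩, k⟩ ⟨⟨x', y'⟩, k'⟩ h
    have h1 : ∀ t, Fin.succAbove i (vx x t) = Fin.succAbove i (vx x' t) := fun t =>
      congrArg (fun z : ((rectBase.{u} : SSet.{u}) ⊗ K).obj U => vx z.1.1.1 t) h
    have h2 : y = y' := congrArg (fun z : ((rectBase.{u} : SSet.{u}) ⊗ K).obj U => z.1.1.2) h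
    have h3 : k = k' := congrArg (fun z : ((rectBase.{u} : SSet.{u}) ⊗ K).obj U => z.2) h
    subst h2 h3
    obtain rfl : x = x' := vx_ext fun t => Fin.succAbove_right_injective (h1 t)
    rfl
  have injt : ∀ U (y y' : ((Δ[2] : SSet.{u}) ⊗ K).obj U),
      (baseTop ▷ K).app U y = (baseTop ▷ K).app U y' → y = y' := by
    rintro U ⟨x, k⟩ ⟨x', k'⟩ h
    exact Prod.ext (congrArg (fun z : ((rectBase.{u} : SSet.{u}) ⊗ K).obj U => z.1.1.1) h)
      (congrArg (fun z : ((rectBase.{u} : SSet.{u}) ⊗ K).obj U => z.2) h)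
  let Y : Fin 3 → SSet.{u} := fun i => match i with
    | 0 => Sq ⊗ K
    | 1 => Sq ⊗ K
    | 2 => Δ[2] ⊗ K
  let a : ∀ i, Y i ⟶ (rectBase.{u} : SSet.{u}) ⊗ K := fun i => match i with
    | 0 => baseSq 2 (by decide) ▷ K
    | 1 => baseSq 0 (by decide) ▷ K
    | 2 => baseTop ▷ K
  let f : ∀ i, Y i ⟶ E := fun i => match i with
    | 0 => l
    | 1 => r
    | 2 => t
  obtain ⟨m, hm⟩ := exists_glue a f (fun U z => by
    obtain ⟨p, hp⟩ | ⟨p, hp⟩ | ⟨p, hp⟩ := exists_base z.1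
    · exact ⟨0, (p, z.2), Prod.ext hp rfl⟩
    · exact ⟨1, (p, z.2), Prod.ext hp rfl⟩
    · exact ⟨2, (p, z.2), Prod.ext hp rfl⟩) (fun U i j y y' h => by
    match i, j, y, y', h with
    | 0, 0, y, y', h => exact congrArg (l.app U) (inj _ _ U _ _ h)
    | 0, 1, y, y', h => exact c01 U _ _ h
    | 0, 2, y, y', h => exact ctop 2 _ l hl U _ _ h
    | 1, 0, y, y', h => exact (c01 U _ _ h.symm).symm
    | 1, 1, y, y', h => exact congrArg (r.app U) (inj _ _ U _ _ h)
    | 1, 2, y, y', h => exact ctop 0 _ r hr U _ _ h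
    | 2, 0, y, y', h => exact (ctop 2 _ l hl U _ _ h.symm).symm
    | 2, 1, y, y', h => exact (ctop 0 _ r hr U _ _ h.symm).symm
    | 2, 2, y, y', h => exact congrArg (t.app U) (injt U _ _ h))
  exact ⟨m, hm 0, hm 1, hm 2⟩

lemma rectBase_hom_ext {K E : SSet.{u}} {f g : (rectBase.{u} : SSet.{u}) ⊗ K ⟶ E}
    (h2 : baseSq 2 (by decide) ▷ K ≫ f = baseSq 2 (by decide) ▷ K ≫ g)
    (h0 : baseSq 0 (by decide) ▷ K ≫ f = baseSq 0 (by decide) ▷ K ≫ g)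
    (ht : baseTop ▷ K ≫ f = baseTop ▷ K ≫ g) : f = g := by
  ext U ⟨z, k⟩
  obtain ⟨p, rfl⟩ | ⟨p, rfl⟩ | ⟨p, rfl⟩ := exists_base z
  · exact app_congr h2 (p, k)
  · exact app_congr h0 (p, k)
  · exact app_congr ht (p, k)

lemma corr_whiskerRight_hom_ext {K E : SSet.{u}} {j : Fin 2}
    {f g : (corr.{u} j : SSet.{u}) ⊗ K ⟶ E}
    (h1 : corrH j ▷ K ≫ f = corrH j ▷ K ≫ g) (h2 : corrV j ▷ K ≫ f = corrV j ▷ K ≫ g) :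
    f = g := by
  ext U ⟨z, k⟩
  obtain ⟨a, rfl⟩ | ⟨b, rfl⟩ := exists_corrH_or_corrV j z
  · exact app_congr h1 (a, k)
  · exact app_congr h2 (b, k)

/-! ### Pasting of pushout squares -/

lemma isLeftKan_of_fill {C D : SSet.{u}} (S : C.Subcomplex) {σ : C ⟶ D}
    (h : ∀ (n : ℕ) (u : C ⊗ (∂Δ[n + 1] : SSet.{u}) ⟶ D) (v : (S : SSet.{u}) ⊗ Δ[n + 1] ⟶ D),
      S.ι ▷ (∂Δ[n + 1] : SSet.{u}) ≫ u = (S : SSet.{u}) ◁ (∂Δ[n + 1]).ι ≫ v →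
      atVertex C (bdVertex n 0) ≫ u = σ →
      ∃ w : C ⊗ Δ[n + 1] ⟶ D, C ◁ (∂Δ[n + 1]).ι ≫ w = u ∧ S.ι ▷ Δ[n + 1] ≫ w = v) :
    IsLeftKan S σ := by
  intro n u v huv hu
  rw [comp_pre_eq_iff] at huv
  rw [app_eq_asVertex] at hu
  obtain ⟨w, hw1, hw2⟩ := h n _ _ huv (asVertex_injective hu)
  refine ⟨MonoidalClosed.curry w, ?_, ?_⟩
  · rw [← MonoidalClosed.curry_natural_left, hw1, MonoidalClosed.curry_uncurry]
  · apply MonoidalClosed.uncurry_injective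
    rw [MonoidalClosed.uncurry_pre_app, MonoidalClosed.uncurry_curry]
    exact hw2

/-- The top row in the span of the rectangle. -/
def rectSpanTop : Δ[2] ⟶ (rectSpan.{u} : SSet.{u}) :=
  Subcomplex.lift topRect (by
    rintro U _ ⟨x, rfl⟩
    exact (mem_rectSpan_iff x _).2 (Or.inl fun t => rfl))

/-- The left column in the span of the rectangle. -/
def rectSpanCol : Δ[1] ⟶ (rectSpan.{u} : SSet.{u}) :=
  Subcomplex.lift (lift (SSet.const (stdSimplex.obj₀Equiv.symm 0)) (𝟙 _)) (by
    rintro U _ ⟨x, rfl⟩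
    exact (mem_rectSpan_iff _ x).2 (Or.inr fun t => rfl))

/-- The spans of the outer square and of the left square. -/
def rectSpanSq (i : Fin 3) (hi : i ≠ 0) : (span.{u} : SSet.{u}) ⟶ (rectSpan.{u} : SSet.{u}) :=
  Subcomplex.lift (span.ι ≫ sqAt i) (by
    rintro U _ ⟨⟨⟨x, y⟩, h⟩, rfl⟩
    have key : ∀ i : Fin 3, i ≠ 0 → ∀ a : Fin 2, a = 0 → Fin.succAbove i a = 0 := by decide
    exact (mem_rectSpan_iff _ y).2 (((mem_corr_iff 0 x y).1 h).imp id fun hx t =>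
      key i hi _ (hx t)))

lemma exists_rectSpan {U} (z : (rectSpan.{u} : SSet.{u}).obj U) :
    (∃ a, rectSpanTop.app U a = z) ∨ ∃ a, rectSpanCol.app U a = z := by
  obtain ⟨⟨x, y⟩, h⟩ := z
  obtain h | h := (mem_rectSpan_iff x y).1 h
  · exact Or.inl ⟨x, Subtype.ext (Prod.ext rfl (vx_ext fun t => (h t).symm))⟩
  · exact Or.inr ⟨y, Subtype.ext (Prod.ext (vx_ext fun t => (h t).symm) rfl)⟩

lemma rectSpan_hom_ext {K E : SSet.{u}} {f g : (rectSpan.{u} : SSet.{u}) ⊗ K ⟶ E}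
    (h1 : rectSpanTop ▷ K ≫ f = rectSpanTop ▷ K ≫ g)
    (h2 : rectSpanCol ▷ K ≫ f = rectSpanCol ▷ K ≫ g) : f = g := by
  ext U ⟨z, k⟩
  obtain ⟨a, rfl⟩ | ⟨a, rfl⟩ := exists_rectSpan z
  · exact app_congr h1 (a, k)
  · exact app_congr h2 (a, k)

lemma const_zero_eq (i : Fin 3) (hi : i ≠ 0) {U} (y : (Δ[1] : SSet.{u}).obj U) :
    (stdSimplex.δ i).app U ((SSet.const (pt1 0) : Δ[1] ⟶ Δ[1]).app U y) =
      (SSet.const (stdSimplex.obj₀Equiv.symm 0) : Δ[1] ⟶ (Δ[2] : SSet.{u})).app U y := by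
  have key : ∀ i : Fin 3, i ≠ 0 → Fin.succAbove i (0 : Fin 2) = 0 := by decide
  exact vx_ext fun t => key i hi

lemma col_corrV (i : Fin 3) (hi : i ≠ 0) : corrV 0 ≫ rectSpanSq.{u} i hi = rectSpanCol := by
  ext U y
  exact Subtype.ext (Prod.ext (const_zero_eq i hi y) rfl)

section

variable {A B C P K L S E : SSet.{u}}

lemma whiskerRight_comp_eq (K : SSet.{u}) {f : A ⟶ B} {g : B ⟶ P} {f' : A ⟶ C} {g' : C ⟶ P}
    (e : f ≫ g = f' ≫ g') (u : P ⊗ K ⟶ E) : f ▷ K ≫ g ▷ K ≫ u = f' ▷ K ≫ g' ▷ K ≫ u := by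
  rw [← comp_whiskerRight_assoc, e, comp_whiskerRight_assoc]

lemma whiskerRight_comp_compat {i : S ⟶ P} {f : A ⟶ B} {g : B ⟶ P} {s : A ⟶ S}
    (e : f ≫ g = s ≫ i) {j : K ⟶ L} {u : P ⊗ K ⟶ E} {v : S ⊗ L ⟶ E}
    (h : i ▷ K ≫ u = S ◁ j ≫ v) : f ▷ K ≫ g ▷ K ≫ u = A ◁ j ≫ s ▷ L ≫ v := by
  rw [whiskerRight_comp_eq K e, h, whisker_exchange_assoc]

lemma atVertex_comp_eq {k : K _⦋0⦌} {u : P ⊗ K ⟶ E} {π : P ⟶ E} (h : atVertex P k ≫ u = π)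
    (f : A ⟶ P) : atVertex A k ≫ f ▷ K ≫ u = f ≫ π := by
  rw [← Category.assoc, atVertex_whiskerRight, Category.assoc, h]

end

lemma span_ι_sqAt (i : Fin 3) (hi : i ≠ 0) :
    span.ι ≫ sqAt.{u} i = rectSpanSq i hi ≫ rectSpan.ι := rfl

lemma col_sqAt : col 1 ≫ sqAt.{u} 2 = corrV 0 ≫ span.ι ≫ sqAt 0 := by
  have key : ∀ a b : Fin 2, a = 1 → b = 0 → Fin.succAbove (2 : Fin 3) a = Fin.succAbove 0 b := by
    decide
  ext U y
  · exact vx_ext fun t => key _ _ rfl rfl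
  · rfl

variable {D : SSet.{u}}

/-- Once the left square is filled, its right column and the prescribed second half of the top row
form the span on which the right square is to be filled. -/
lemma exists_span_of_left_filler {n : ℕ} {v : (rectSpan.{u} : SSet.{u}) ⊗ Δ[n + 1] ⟶ D}
    {w : Sq.{u} ⊗ Δ[n + 1] ⟶ D}
    (hw : span.ι ▷ Δ[n + 1] ≫ w = rectSpanSq 2 (by decide) ▷ Δ[n + 1] ≫ v) :
    ∃ v' : (span.{u} : SSet.{u}) ⊗ Δ[n + 1] ⟶ D,
      corrH 0 ▷ Δ[n + 1] ≫ v' = stdSimplex.δ 0 ▷ Δ[n + 1] ≫ rectSpanTop ▷ Δ[n + 1] ≫ v ∧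
      corrV 0 ▷ Δ[n + 1] ≫ v' = col 1 ▷ Δ[n + 1] ≫ w := by
  refine exists_glue₂ (corrH.{u} 0 ▷ Δ[n + 1]) (corrV 0 ▷ Δ[n + 1]) _ _ (fun U ⟨z, k⟩ => ?_)
    (fun U a b hab => ?_)
  · obtain ⟨a, rfl⟩ | ⟨b, rfl⟩ := exists_corrH_or_corrV 0 z
    · exact Or.inl ⟨(a, k), rfl⟩
    · exact Or.inr ⟨(b, k), rfl⟩
  · obtain ⟨a, k⟩ := a
    obtain ⟨b, k'⟩ := b
    have e1 : k = k' :=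
      congrArg (fun z : ((corr.{u} 0 : SSet.{u}) ⊗ Δ[n + 1]).obj U => z.2) hab
    have e2 : a = (SSet.const (pt1 0) : Δ[1] ⟶ Δ[1]).app U b :=
      congrArg (fun z : ((corr.{u} 0 : SSet.{u}) ⊗ Δ[n + 1]).obj U => z.1.1.1) hab
    have e3 : (SSet.const (pt1 0) : Δ[1] ⟶ Δ[1]).app U a = b :=
      congrArg (fun z : ((corr.{u} 0 : SSet.{u}) ⊗ Δ[n + 1]).obj U => z.1.1.2) hab
    subst e1 e3
    have e4 : (col 1).app U ((SSet.const (pt1 0) : Δ[1] ⟶ Δ[1]).app U a) =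
        ((corrH 0).app U ((SSet.const (pt1 1) : Δ[1] ⟶ Δ[1]).app U a)).1 :=
      Prod.ext (vx_ext fun t => rfl) (vx_ext fun t => rfl)
    refine Eq.trans ?_ ((app_congr hw (U := U)
      ((corrH 0).app U ((SSet.const (pt1 1) : Δ[1] ⟶ Δ[1]).app U a), k)).symm.trans
        (congrArg (fun z => w.app U (z, k)) e4.symm))
    refine congrArg (fun z => v.app U (z, k)) (Subtype.ext (Prod.ext (vx_ext fun t => ?_)
      (vx_ext fun t => rfl)))
    have e5 : vx a t = 0 := congrArg (fun z => vx z t) e2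
    have e6 : ∀ p : Fin 2, p = 0 → Fin.succAbove (0 : Fin 3) p = Fin.succAbove 2 (1 : Fin 2) := by
      decide
    exact e6 _ e5

/-- The left pushout fills the left square, its filler supplies the span for the right one, and the
right pushout fills that; both are then glued with the prescribed top triangle. -/
theorem IsPushout.exists_rect_base_filler {π : Rect.{u} ⟶ D} (hl : IsPushout (sqAt 2 ≫ π))
    (hr : IsPushout (sqAt 0 ≫ π)) (n : ℕ) (u : Rect.{u} ⊗ (∂Δ[n + 1] : SSet.{u}) ⟶ D)
    (v : (rectSpan.{u} : SSet.{u}) ⊗ Δ[n + 1] ⟶ D)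
    (huv : rectSpan.ι ▷ (∂Δ[n + 1] : SSet.{u}) ≫ u =
      (rectSpan.{u} : SSet.{u}) ◁ (∂Δ[n + 1]).ι ≫ v)
    (hu : atVertex Rect (bdVertex n 0) ≫ u = π) :
    ∃ m : (rectBase.{u} : SSet.{u}) ⊗ Δ[n + 1] ⟶ D,
      rectBase.ι ▷ (∂Δ[n + 1] : SSet.{u}) ≫ u =
        (rectBase.{u} : SSet.{u}) ◁ (∂Δ[n + 1]).ι ≫ m ∧
      rectSpanSq 2 (by decide) ▷ Δ[n + 1] ≫ v =
        span.ι ▷ _ ≫ baseSq 2 (by decide) ▷ Δ[n + 1] ≫ m ∧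
      rectSpanTop ▷ Δ[n + 1] ≫ v = baseTop ▷ Δ[n + 1] ≫ m := by
  obtain ⟨wl, wl1, wl2⟩ := hl n (sqAt 2 ▷ _ ≫ u) (rectSpanSq 2 (by decide) ▷ _ ≫ v)
    (whiskerRight_comp_compat (span_ι_sqAt 2 (by decide)) huv) (atVertex_comp_eq hu _)
  obtain ⟨vr, vr1, vr2⟩ := exists_span_of_left_filler wl2
  obtain ⟨wr, wr1, wr2⟩ := hr n (sqAt 0 ▷ _ ≫ u) vr (corr_whiskerRight_hom_ext (by
      ext U ⟨a, k⟩
      exact (app_congr huv (rectSpanTop.app U ((stdSimplex.δ 0).app U a), k)).trans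
        (app_congr vr1 (a, k.1)).symm) (by
      ext U ⟨b, k⟩
      refine Eq.trans ?_ ((app_congr wl1 ((col 1).app U b, k)).symm.trans
        (app_congr vr2 (b, k.1)).symm)
      exact congrArg (fun z => u.app U (z, k)) (app_congr col_sqAt.{u} b).symm))
    (atVertex_comp_eq hu _)
  obtain ⟨m, ml, mr, mt⟩ := exists_rectBase_hom wl wr (rectSpanTop ▷ _ ≫ v)
    (by
      ext U ⟨b, k⟩
      exact (app_congr vr2 (b, k)).symm.trans (app_congr wr2 ((corrV 0).app U b, k)).symm)
    (by
      ext U ⟨a, k⟩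
      exact app_congr wl2 ((corrH 0).app U a, k))
    (by
      ext U ⟨a, k⟩
      exact (app_congr wr2 ((corrH 0).app U a, k)).trans (app_congr vr1 (a, k)))
  refine ⟨m, rectBase_hom_ext ?_ ?_ ?_, ?_, mt.symm⟩
  · ext U ⟨a, k⟩
    exact (app_congr wl1 (a, k)).symm.trans (app_congr ml (a, k.1)).symm
  · ext U ⟨a, k⟩
    exact (app_congr wr1 (a, k)).symm.trans (app_congr mr (a, k.1)).symm
  · ext U ⟨a, k⟩
    exact (app_congr huv (rectSpanTop.app U a, k)).trans (app_congr mt (a, k.1)).symm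
  · rw [ml, wl2]

lemma innerAnodyne_rectBase : innerAnodyneExtensions rectBase.{u}.ι :=
  innerAnodyneExtensions_unionProd_ι' _ _
    (innerAnodyneExtensions.horn_ι (n := 2) (i := 1) (by decide) (by decide))

/-- After filling over the two squares and the top row, only an extension along the pushout-product
of an inner anodyne map with a boundary inclusion remains, and this exists in any quasicategory. -/
theorem IsPushout.isLeftKan_rectSpan [Quasicategory D] {π : Rect.{u} ⟶ D}
    (hl : IsPushout (sqAt 2 ≫ π)) (hr : IsPushout (sqAt 0 ≫ π)) : IsLeftKan rectSpan π := by
  refine isLeftKan_of_fill _ fun n u v huv hu => ?_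
  obtain ⟨m, hm, hm2, hmt⟩ := exists_rect_base_filler hl hr n u v huv hu
  obtain ⟨w, hw⟩ := exists_extension_of_innerAnodyne _
    (innerAnodyneExtensions_unionProd_ι' rectBase.{u} ∂Δ[n + 1] innerAnodyne_rectBase)
    ((Subcomplex.unionProd.isPushout rectBase ∂Δ[n + 1]).desc _ _ hm)
  have h1 : Rect.{u} ◁ ∂Δ[n + 1].ι ≫ w = u := by
    rw [← Subcomplex.unionProd.ι₁_ι rectBase, Category.assoc, hw]
    exact (Subcomplex.unionProd.isPushout rectBase ∂Δ[n + 1]).inl_desc _ _ _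
  have h2 : rectBase.ι ▷ Δ[n + 1] ≫ w = m := by
    rw [← Subcomplex.unionProd.ι₂_ι rectBase ∂Δ[n + 1], Category.assoc, hw]
    exact (Subcomplex.unionProd.isPushout rectBase ∂Δ[n + 1]).inr_desc _ _ _
  refine ⟨w, h1, rectSpan_hom_ext ?_ ?_⟩
  · rw [hmt, ← h2]
    exact whiskerRight_comp_eq _ (f := rectSpanTop) (g := rectSpan.ι) (f' := baseTop)
      (g' := rectBase.ι) rfl w
  · ext U ⟨b, k⟩
    have e1 := app_congr hm2 (U := U) ((corrV 0).app U b, k)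
    have e2 : (rectSpanSq 2 (by decide)).app U ((corrV 0).app U b) = rectSpanCol.app U b :=
      app_congr (col_corrV.{u} 2 (by decide)) b
    have e3 := app_congr h2 (U := U) ((baseSq 2 (by decide)).app U ((col 0).app U b), k)
    have e4 : w.app U ((rectSpanCol.app U b).1, k) = v.app U (rectSpanCol.app U b, k) := by
      rw [← e2]
      exact e3.trans e1.symm
    exact e4

/-! ### The outer square of a rectangle -/

/-- The collapse of the right square of a rectangle. -/
def rectRetract : Rect.{u} ⟶ Sq.{u} := stdSimplex.σ 1 ▷ Δ[1]

lemma sqAt_rectRetract : sqAt.{u} 1 ≫ rectRetract = 𝟙 _ := by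
  have key : ∀ a : Fin 2, Fin.predAbove (1 : Fin 2) (Fin.succAbove (1 : Fin 3) a) = a := by decide
  ext U ⟨x, y⟩
  · exact vx_ext fun t => key _
  · rfl

/-- The collapse of the second edge of the triangle to its last vertex. -/
def collapse : (Δ[2] : SSet.{u}) ⊗ Δ[1] ⟶ Δ[2] :=
  vmap (fun a t => if t = 0 then a else if a = 0 then 0 else 2) (by decide)

lemma collapse_spec : ∀ (a : Fin 3), (if (0 : Fin 2) = 0 then a else if a = 0 then 0 else 2) = a ∧
    (if (1 : Fin 2) = 0 then a else if a = 0 then 0 else 2) =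
      Fin.succAbove (1 : Fin 3) (Fin.predAbove (1 : Fin 2) a) := by decide

/-- The homotopy that collapses the right square of a rectangle. -/
def rectHom : Trans (𝟙 Rect.{u}) (rectRetract ≫ sqAt 1) where
  hom := lift (lift (fst _ _ ≫ fst _ _) (snd _ _) ≫ collapse) (fst _ _ ≫ snd _ _)
  source := by
    ext U ⟨x, y⟩
    · exact vx_ext fun t => (collapse_spec _).1
    · rfl
  target := by
    ext U ⟨x, y⟩
    · exact vx_ext fun t => (collapse_spec _).2
    · rfl

lemma sqAt_rectHom : sqAt.{u} 1 ▷ _ ≫ rectHom.hom = fst _ _ ≫ sqAt 1 := by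
  have key : ∀ (a t : Fin 2), (if t = 0 then Fin.succAbove (1 : Fin 3) a else
    if Fin.succAbove (1 : Fin 3) a = 0 then 0 else 2) = Fin.succAbove (1 : Fin 3) a := by decide
  ext U ⟨⟨x, y⟩, s⟩
  · exact vx_ext fun t => key _ _
  · rfl

lemma rectHom_rectRetract : rectHom.{u}.hom ≫ rectRetract = fst _ _ ≫ rectRetract := by
  have key : ∀ (a : Fin 3) (t : Fin 2), Fin.predAbove (1 : Fin 2) (if t = 0 then a else
    if a = 0 then 0 else 2) = Fin.predAbove (1 : Fin 2) a := by decide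
  ext U ⟨⟨x, y⟩, s⟩
  · exact vx_ext fun t => key _ _
  · rfl

/-- The restriction of the collapse to spans. -/
def rectSpanRetract : (rectSpan.{u} : SSet.{u}) ⟶ (span.{u} : SSet.{u}) :=
  Subcomplex.lift (rectSpan.ι ≫ rectRetract) (by
    rintro U _ ⟨⟨⟨x, y⟩, h⟩, rfl⟩
    have key : ∀ a : Fin 3, a = 0 → Fin.predAbove (1 : Fin 2) a = 0 := by decide
    exact (mem_corr_iff 0 _ y).2 (((mem_rectSpan_iff x y).1 h).imp id fun hx t => key _ (hx t)))

lemma rectSpanSq_retract : rectSpanSq.{u} 1 (by decide) ≫ rectSpanRetract = 𝟙 _ := by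
  ext U z
  exact Subtype.ext (app_congr sqAt_rectRetract.{u} z.1)

/-- The restriction of the homotopy to spans. -/
def rectSpanHom : Trans (𝟙 (rectSpan.{u} : SSet.{u}))
    (rectSpanRetract ≫ rectSpanSq 1 (by decide)) where
  hom := Subcomplex.lift (rectSpan.ι ▷ _ ≫ rectHom.hom) (by
    rintro U _ ⟨⟨⟨⟨x, y⟩, h⟩, s⟩, rfl⟩
    have key : ∀ (a : Fin 3) (t : Fin 2), a = 0 →
      (if t = 0 then a else if a = 0 then 0 else 2) = 0 := by decide
    exact (mem_rectSpan_iff _ y).2 (((mem_rectSpan_iff x y).1 h).imp id fun hx t =>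
      key _ _ (hx t)))
  source := by
    ext U z
    exact Subtype.ext (app_congr rectHom.{u}.source z.1)
  target := by
    ext U z
    exact Subtype.ext (app_congr rectHom.{u}.target z.1)

lemma rectSpanSq_rectSpanHom :
    rectSpanSq.{u} 1 (by decide) ▷ _ ≫ rectSpanHom.hom = fst _ _ ≫ rectSpanSq 1 (by decide) := by
  ext U ⟨z, s⟩
  exact Subtype.ext (app_congr sqAt_rectHom.{u} (z.1, s))

lemma rectSpanHom_retract :
    rectSpanHom.{u}.hom ≫ rectSpanRetract = fst _ _ ≫ rectSpanRetract := by
  ext U ⟨z, s⟩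
  exact Subtype.ext (app_congr rectHom_rectRetract.{u} (z.1, s))

section

variable {D : SSet.{u}} [Quasicategory D]

/-- The outer square is a reflective subshape: the middle column moves to the last one. Maps into a
rectangle pulled back along this collapse are determined on the outer square. -/
lemma bijective_pre_sqAt (π : Rect.{u} ⟶ D) (ρ : Sq.{u} ⟶ D) :
    Function.Bijective fun f : (⟨π⟩ : FunHo Rect D) ⟶ ⟨rectRetract ≫ ρ⟩ =>
      (FunHo.pre (sqAt 1) D).map f :=
  FunHo.bijective_pre_of_unit sqAt_rectRetract rectHom sqAt_rectHom π
    (isIso_hom_of_eq _ (by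
      have h := congrArg (· ≫ ρ) rectHom_rectRetract.{u}
      exact h))

lemma bijective_pre_rectSpanSq (π : (rectSpan.{u} : SSet.{u}) ⟶ D)
    (ρ : (span.{u} : SSet.{u}) ⟶ D) :
    Function.Bijective fun f : (⟨π⟩ : FunHo (rectSpan.{u} : SSet.{u}) D) ⟶
      ⟨rectSpanRetract ≫ ρ⟩ => (FunHo.pre (rectSpanSq 1 (by decide)) D).map f :=
  FunHo.bijective_pre_of_unit rectSpanSq_retract rectSpanHom rectSpanSq_rectSpanHom π
    (isIso_hom_of_eq _ (by
      have h := congrArg (· ≫ ρ) rectSpanHom_retract.{u}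
      exact h))

/-- The outer square of two adjacent pushout squares is a pushout square. -/
theorem IsStable.isPushout_outer (hD : IsStable D) {π : Rect.{u} ⟶ D}
    (hl : IsPushout (sqAt 2 ≫ π)) (hr : IsPushout (sqAt 0 ≫ π)) : IsPushout (sqAt 1 ≫ π) := by
  refine hD.isPushout_of_hInitial ?_
  rintro ⟨ρ⟩
  -- The target ρ is extended to a rectangle whose right square is degenerate in the horizontal
  -- direction, so maps from π to ρ' correspond to maps from the outer square to ρ.
  obtain ⟨ρ', rfl, hρ'⟩ : ∃ ρ' : Rect.{u} ⟶ D, sqAt 1 ≫ ρ' = ρ ∧ ρ' = rectRetract ≫ ρ :=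
    ⟨rectRetract ≫ ρ, by rw [← Category.assoc, sqAt_rectRetract, Category.id_comp], rfl⟩
  have h1 : Function.Bijective fun f : (⟨π⟩ : FunHo Rect D) ⟶ ⟨ρ'⟩ =>
      (FunHo.pre (sqAt 1) D).map f := by
    rw [hρ']
    exact bijective_pre_sqAt π _
  have h2 := (hl.isLeftKan_rectSpan hr).hInitial ⟨ρ'⟩
  have h3 : Function.Bijective fun f : (⟨rectSpan.ι ≫ π⟩ : FunHo (rectSpan.{u} : SSet.{u}) D) ⟶
      ⟨rectSpan.ι ≫ ρ'⟩ => (FunHo.pre (rectSpanSq 1 (by decide)) D).map f := by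
    have e : rectSpan.ι ≫ ρ' = rectSpanRetract ≫ span.ι ≫ sqAt 1 ≫ ρ' := by
      conv_lhs => rw [hρ']
      rfl
    rw [e]
    exact bijective_pre_rectSpanSq _ _
  -- Restriction from the rectangle to the outer span is bijective, first through its top row and
  -- left column. It also factors through the outer square, where the first factor is h1; cancelling
  -- h1 leaves the claim.
  have h4 := h3.comp h2
  refine (Function.Bijective.of_comp_iff _ h1).1 ?_
  have h5 : ∀ f : (⟨π⟩ : FunHo Rect D) ⟶ ⟨ρ'⟩,
      (FunHo.pre span.ι D).map ((FunHo.pre (sqAt 1) D).map f) =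
      (FunHo.pre (rectSpanSq 1 (by decide)) D).map ((FunHo.pre rectSpan.ι D).map f) := fun f =>
    (FunHo.pre_pre span.ι (sqAt 1) f).trans
      (FunHo.pre_pre (rectSpanSq 1 (by decide)) rectSpan.ι f).symm
  exact Eq.mpr (congrArg Function.Bijective (funext h5)) h4

end

/-! ### Composites of fiber sequences -/

section

variable {D : SSet.{u}} [Quasicategory D]

/-- The triangle t is prescribed as well as the squares, so that the top edge of the outer square is
a given composite on the nose. -/
lemma exists_rect (l r : Sq.{u} ⟶ D) (t : Δ[2] ⟶ D) (hlr : col 1 ≫ l = col 0 ≫ r)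
    (hl : row ≫ l = stdSimplex.δ 2 ≫ t) (hr : row ≫ r = stdSimplex.δ 0 ≫ t) :
    ∃ π : Rect.{u} ⟶ D, sqAt 2 ≫ π = l ∧ sqAt 0 ≫ π = r ∧ topRect ≫ π = t := by
  have key : ∀ {A B C : SSet.{u}} {f : A ⟶ B} {f' : A ⟶ C} {g : B ⟶ D} {g' : C ⟶ D},
      f ≫ g = f' ≫ g' → f ▷ Δ[0] ≫ fst _ _ ≫ g = f' ▷ Δ[0] ≫ fst _ _ ≫ g' := by
    intro A B C f f' g g' h
    rw [whiskerRight_fst_assoc, whiskerRight_fst_assoc, h]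
  obtain ⟨m, ml, mr, mt⟩ := exists_rectBase_hom (K := Δ[0]) (fst _ _ ≫ l) (fst _ _ ≫ r)
    (fst _ _ ≫ t) (key hlr) (key hl) (key hr)
  let pt : (Δ[0] : SSet.{u}) _⦋0⦌ := stdSimplex.obj₀Equiv.symm 0
  obtain ⟨π, hπ⟩ := exists_extension_of_innerAnodyne _ innerAnodyne_rectBase
    (atVertex (rectBase.{u} : SSet.{u}) pt ≫ m)
  have key' : ∀ {A : SSet.{u}} (b : A ⟶ (rectBase.{u} : SSet.{u})) (f : A ⟶ D),
      b ▷ Δ[0] ≫ m = fst _ _ ≫ f → b ≫ rectBase.ι ≫ π = f := by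
    intro A b f h
    rw [hπ, ← Category.assoc, ← atVertex_whiskerRight, Category.assoc, h, ← Category.assoc,
      atVertex_fst, Category.id_comp]
  exact ⟨π, key' _ _ ml, key' _ _ mr, key' _ _ mt⟩

lemma corner_sqAt (π : Rect.{u} ⟶ D) (b : Fin 2) :
    corner (sqAt 1 ≫ π) 0 b = corner (sqAt 2 ≫ π) 0 b := by
  have key : Fin.succAbove (1 : Fin 3) (0 : Fin 2) = Fin.succAbove 2 0 := by decide
  exact congrArg (π.app (op ⦋0⦌)) (Prod.ext (vx_ext fun t => key) rfl)

lemma vertical_sqAt (π : Rect.{u} ⟶ D) :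
    vertical (sqAt 1 ≫ π) 1 = vertical (sqAt 0 ≫ π) 1 := by
  have key : Fin.succAbove (1 : Fin 3) (1 : Fin 2) = Fin.succAbove 0 1 := by decide
  exact congrArg (π.app (op ⦋1⦌)) (Prod.ext (vx_ext fun t => key) rfl)

lemma horizontal_sqAt (π : Rect.{u} ⟶ D) :
    SSet.yonedaEquiv.symm (horizontal (sqAt 1 ≫ π) 0) = stdSimplex.δ 1 ≫ topRect ≫ π := by
  rw [← horizontal_eq_app]
  rfl

/-- A fiber sequence can be pushed out. -/
lemma IsFiberSeq.comp (hD : IsStable D) {S W X Y R : D _⦋0⦌} {s : Edge S W} {w : Edge W X}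
    {c : Edge S X} {θ : Edge W Y} {ρ : Edge X R} (h : IsFiberSeq s θ) {σ : Sq.{u} ⟶ D}
    (hσ : IsPushout σ) (ht : horizontal σ 0 = w.edge) (hl : vertical σ 0 = θ.edge)
    (hr : vertical σ 1 = ρ.edge) (hc : Nonempty (Edge.CompStruct s w c)) : IsFiberSeq c ρ := by
  obtain ⟨τ, hτ, hZ, h1, h2⟩ := h
  obtain ⟨hc⟩ := hc
  -- The triangle witnessing c as a composite of s and w is the top row, so the outer square has top
  -- edge c, right edge ρ and the zero object of τ in its lower left corner.
  obtain ⟨π, rfl, rfl, hπ⟩ := exists_rect τ σ (SSet.yonedaEquiv.symm hc.simplex)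
    ((vertical_eq_app τ 1).trans ((congrArg SSet.yonedaEquiv.symm (h2.trans hl.symm)).trans
      (vertical_eq_app σ 0).symm))
    ((horizontal_eq_app τ 0).trans ((congrArg SSet.yonedaEquiv.symm (h1.trans hc.d₂.symm)).trans
      (yonedaEquiv_symm_δ hc.simplex 2).symm))
    ((horizontal_eq_app σ 0).trans ((congrArg SSet.yonedaEquiv.symm (ht.trans hc.d₀.symm)).trans
      (yonedaEquiv_symm_δ hc.simplex 0).symm))
  refine ⟨sqAt 1 ≫ π, (hD.pullback_iff_pushout _).2
    (hD.isPushout_outer ((hD.pullback_iff_pushout _).1 hτ) hσ), ?_, ?_,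
    (vertical_sqAt π).trans hr⟩
  · rw [corner_sqAt]
    exact hZ
  · refine SSet.yonedaEquiv.symm.injective ((horizontal_sqAt π).trans ?_)
    rw [hπ]
    exact (yonedaEquiv_symm_δ hc.simplex 1).trans (congrArg SSet.yonedaEquiv.symm hc.d₁)

end

/-! ### Assembly of the glued t-structure -/

section

variable {D₀ D D₁ : SSet.{u}} [Quasicategory D₀] [Quasicategory D] [Quasicategory D₁]
  (r : Recollement D₀ D D₁) (t₀ : InftyCat.TStructure D₀) (t₁ : InftyCat.TStructure D₁)

lemma GluingDiagram.isFiberSeq (hD : IsStable D) {r : Recollement D₀ D D₁}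
    {t₀ : InftyCat.TStructure D₀} {t₁ : InftyCat.TStructure D₁} {X : D _⦋0⦌}
    (d : GluingDiagram r t₀ t₁ X) (c : Edge d.S X) (hc : Nonempty (Edge.CompStruct d.s d.w c)) :
    IsFiberSeq c d.ρ :=
  d.fiberSeq_S.comp hD d.isPushout d.square_top d.square_left d.square_right hc

/-- The t-structure glued along a recollement. -/
def gluedTStructure (hD₀ : IsStable D₀) (hD : IsStable D) (hD₁ : IsStable D₁) :
    InftyCat.TStructure D where
  ge X := t₁.ge (obj r.q X) ∧ t₀.ge (obj r.iL X)
  lt X := t₁.lt (obj r.q X) ∧ t₀.lt (obj r.iR X)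
  ge_of_equivalent X Y h hX := by
    obtain ⟨e⟩ := Hc.equivalent_iff.1 h
    exact ⟨t₁.ge_of_iso ((Hc.map r.q).mapIso e) hX.1, t₀.ge_of_iso ((Hc.map r.iL).mapIso e) hX.2⟩
  lt_of_equivalent X Y h hX := by
    obtain ⟨e⟩ := Hc.equivalent_iff.1 h
    exact ⟨t₁.lt_of_iso ((Hc.map r.q).mapIso e) hX.1, t₀.lt_of_iso ((Hc.map r.iR).mapIso e) hX.2⟩
  orthogonal X Y hX hY f g := by
    have := r.subsingleton_hom t₀ t₁ hD₀ hD hD₁ (X := ⟨X⟩) (Y := ⟨Y⟩) hX.1 hX.2 hY.1 hY.2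
    exact Hc.hom_eq_iff.1 (Subsingleton.elim _ _)
  ge_shift X Y h hX := ⟨t₁.ge_shift _ _ (h.map_leftAdj r.adj_qR hD₁) hX.1,
    t₀.ge_shift _ _ (h.map_leftAdj r.adj_iL hD₀) hX.2⟩
  lt_shift X Y h hY := ⟨t₁.lt_shift _ _ (h.map_leftAdj r.adj_qR hD₁) hY.1,
    t₀.lt_shift _ _ (h.map_rightAdj r.adj_iR hD₀ hD) hY.2⟩
  exists_fiberSeq X := by
    obtain ⟨d⟩ := nonempty_gluingDiagram r t₀ t₁ hD X
    obtain ⟨c, hc⟩ := exists_comp d.s d.w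
    exact ⟨d.S, d.R, c, d.ρ, d.ge_S hD₀ hD hD₁, d.lt_R hD₀ hD hD₁, d.isFiberSeq hD c hc⟩

end

end InftyCat

end

open InftyCat in
theorem theorem2 {D₀ D D₁ : SSet.{u}}
    [SSet.Quasicategory D₀] [SSet.Quasicategory D] [SSet.Quasicategory D₁]
    (hD₀ : IsStable D₀) (hD : IsStable D) (hD₁ : IsStable D₁)
    (r : Recollement D₀ D D₁) (t₀ : InftyCat.TStructure D₀) (t₁ : InftyCat.TStructure D₁) :
    ∃ t : InftyCat.TStructure D,
      (∀ X : D _⦋0⦌, t.ge X ↔ t₁.ge (obj r.q X) ∧ t₀.ge (obj r.iL X)) ∧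
      (∀ X : D _⦋0⦌, t.lt X ↔ t₁.lt (obj r.q X) ∧ t₀.lt (obj r.iR X)) ∧
      (∀ X : D _⦋0⦌, Nonempty (GluingDiagram r t₀ t₁ X)) ∧
      (∀ (X : D _⦋0⦌) (d : GluingDiagram r t₀ t₁ X),
        t.ge d.S ∧ t.lt d.R ∧
        ∀ c : SSet.Edge d.S X, Nonempty (SSet.Edge.CompStruct d.s d.w c) →
          IsFiberSeq c d.ρ) :=
  ⟨gluedTStructure r t₀ t₁ hD₀ hD hD₁, fun _ => Iff.rfl, fun _ => Iff.rfl,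
    fun X => nonempty_gluingDiagram r t₀ t₁ hD X,
    fun _ d => ⟨d.ge_S hD₀ hD hD₁, d.lt_R hD₀ hD hD₁, fun c hc => d.isFiberSeq hD c hc⟩⟩
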